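/- **Conventions.** Let $(\mathcal C,J)$ be a site ($\mathcal C$ small relative to the universe in which the sheaves take values). For an abelian sheaf $A$ put $H^i(A)=\mathrm{Ext}^i(\mathbb Z,A)$, computed in abelian sheaves. $A\otimes B$ is the sheaf tensor product over $\mathbb Z$. Torsors are right torsors: locally non-empty sheaves on whose sections the group acts simply transitively. The class $[P]\in H^1(A)$ of an $A$-torsor $P$ is the class of the extension $0\to A\to E\to\mathbb Z\to0$ whose sections over $1$ form the torsor $P$. An (abelian) gerbe with band $A$ is a stack in groupoids, locally non-empty and locally connected, with isomorphisms $A(U)\cong\mathrm{Aut}(x)$ for all objects $x$ over $U$, compatible with morphisms and restriction. Its class in $H^2(A)$ is normalized as follows: the gerbe of lifts of a $Q$-torsor $T$ along an extension of abelian sheaves $0\to A\to I\to Q\to 0$ (objects over $U$: an $I$-torsor $R$ on $\mathcal C/U$ with an equivariant map $R\to T$) has the image of $[T]$ under the connecting map $H^1(Q)\to H^2(A)$ as its class; every gerbe with band $A$ and class $x$ is, by definition, equivalent to such a gerbe of lifts with $x=\partial[T]$. The cup product $\gamma\cup\delta\in H^2(A\otimes B)$ of $\gamma\in H^1(A)$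 and $\delta\in H^1(B)$ is the Yoneda product of $\delta\in\mathrm{Ext}^1(\mathbb Z,B)$ with $\gamma\otimes B\in\mathrm{Ext}^1(B,A\otimes B)$, the class of $0\to A\otimes B\to E\otimes B\to B\to 0$ where $0\to A\to E\to\mathbb Z\to 0$ has class $\gamma$ (on Čech cocycles: $(a_{ij}\otimes b_{jk})$). **Theorem.** Let $A,B$ be abelian sheaves on $(\mathcal C,J)$. 1. Let $H_{A,B}$ be the sheaf of triples $(a,b,t)$ of sections of $A$, $B$, $A\otimes B$ with the group law $(a,b,t)(a',b',t')=(a+a',\,b+b',\,t+t'+a\otimes b')$. It is a sheaf of groups, $t\mapsto(0,0,t)$ and $(a,b,t)\mapsto(a,b)$ form an exact sequence $0\to A\otimes B\to H_{A,B}\to A\times B\to0$, and $A\otimes B$ is central in $H_{A,B}$. Homomorphisms $A\to A'$, $B\to B'$ induce $H_{A,B}\to H_{A',B'}$, $(a,b,t)\mapsto(f(a),g(b),(f\otimes g)(t))$; this is a functor of $(A,B)$ and the exact sequence is natural. 2. Every $A$-torsor has exactly one class, and $P\mapsto[P]$ is a bijection from isomorphism classes of $A$-torsors to $H^1(A)$.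 The boundary map $\partial:H^1(A)\times H^1(B)=H^1(A\times B)\to H^2(A\otimes B)$ of the extension in (1), which sends an $A\times B$-torsor $T\cong P\times Q$ with $[P]=\gamma$, $[Q]=\delta$ to the class of the gerbe of lifts of $T$ to an $H_{A,B}$-torsor, is well defined and $\partial(\gamma,\delta)=\gamma\cup\delta$. 3. Let $P$ be an $A$-torsor and $Q$ a $B$-torsor. Let $\mathcal G_{P,Q}$ have as objects over $U$ the pairs of an $H_{A,B}$-torsor $R$ on $\mathcal C/U$ and an equivariant map $R\to (P\times Q)|_U$, and as morphisms the equivariant maps over $P\times Q$. Then $\mathcal G_{P,Q}$ is a gerbe with band $A\otimes B$ (the section $t$ acts by $r\mapsto r\cdot(0,0,t)$) and it has exactly one class, namely $[P]\cup[Q]\in H^2(A\otimes B)$. 4. $\mathcal G_{P,Q}$ is covariant in $A,B$ and contravariant in the site. Precisely, let $F:(\mathcal C,J)\to(\mathcal D,K)$ be a continuous functor all of whose induced functors $\mathcal C/U\to\mathcal D/F(U)$ are flat (for example the functor defining a morphism of sites $\mathcal D\to\mathcal C$, or the forgetful functor $\mathcal C=\mathcal D/X\to\mathcal D$, or the identity).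 Let $(A,B,P,Q)$ be as above on $\mathcal C$ and $(A',B',P',Q')$ on $\mathcal D$, and let $f$ consist of homomorphisms $A\to F_*A'$, $B\to F_*B'$ and equivariant maps $P\to F_*P'$, $Q\to F_*Q'$. Then there is a morphism of stacks $\mathcal G_{P,Q}\to F_*\mathcal G_{P',Q'}$ inducing $A\otimes B\to F_*(A'\otimes B')$ on bands, together with maps $R\to F_*R'$ from each lift $R$ to its image $R'$, equivariant under $H_{A,B}\to F_*H_{A',B'}$ and over $P\times Q\to F_*(P'\times Q')$, natural in $R$ and compatible with restriction. Any such map $R\to F_*R'$ over $f$, for lifts $R$ over $U$ and $R'$ over $F(U)$, is universal: any other such map $R\to F_*R''$ factors through it by a unique morphism $R'\to R''$. Consequently these morphisms of gerbes are compatible with identities and composition of the data $f$, up to unique isomorphisms compatible with the maps $R\to F_*R'$. 5. If $P$ or $Q$ is trivial, then $\mathcal G_{P,Q}$ is equivalent, as a gerbe with band $A\otimes B$, to the stack of $A\otimes B$-torsors. -/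

import Mathlib

open CategoryTheory Opposite
open scoped TensorProduct Bicategory

universe v u

namespace HeisenbergGerbe

/-- The tensor product over `ℤ` of two morphisms of abelian groups. -/
def tensorHom {X X' Y Y' : AddCommGrpCat.{u}} (f : X ⟶ X') (g : Y ⟶ Y') :
    AddCommGrpCat.of (X ⊗[ℤ] Y) ⟶ AddCommGrpCat.of (X' ⊗[ℤ] Y') :=
  AddCommGrpCat.ofHom
    (TensorProduct.map f.hom.toIntLinearMap g.hom.toIntLinearMap).toAddMonoidHom

theorem tensorHom_tmul {X X' Y Y' : AddCommGrpCat.{u}} (f : X ⟶ X') (g : Y ⟶ Y') (x : X) (y : Y) :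
    tensorHom f g (x ⊗ₜ[ℤ] y : X ⊗[ℤ] Y) = (f x ⊗ₜ[ℤ] g y : X' ⊗[ℤ] Y') := rfl

theorem tensorHom_ext {X Y : AddCommGrpCat.{u}} {Z : AddCommGrpCat.{u}}
    {f g : AddCommGrpCat.of (X ⊗[ℤ] Y) ⟶ Z}
    (h : ∀ (x : X) (y : Y), f (x ⊗ₜ[ℤ] y : X ⊗[ℤ] Y) = g (x ⊗ₜ[ℤ] y : X ⊗[ℤ] Y)) : f = g := by
  ext t
  induction t using TensorProduct.induction_on with
  | zero => exact (map_zero f.hom).trans (map_zero g.hom).symm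
  | tmul x y => exact h x y
  | add a b ha hb => exact (map_add f.hom a b).trans ((congrArg₂ (· + ·) ha hb).trans
      (map_add g.hom a b).symm)

theorem tensorHom_id (X Y : AddCommGrpCat.{u}) : tensorHom (𝟙 X) (𝟙 Y) = 𝟙 _ :=
  tensorHom_ext fun _ _ => rfl

theorem tensorHom_comp {X X' X'' Y Y' Y'' : AddCommGrpCat.{u}} (f : X ⟶ X') (f' : X' ⟶ X'')
    (g : Y ⟶ Y') (g' : Y' ⟶ Y'') :
    tensorHom (f ≫ f') (g ≫ g') = tensorHom f g ≫ tensorHom f' g' :=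
  tensorHom_ext fun _ _ => rfl

section Tensor

variable {C : Type u} [Category.{v} C]

/-- The presheaf `U ↦ A(U) ⊗ B(U)` (tensor product over `ℤ`). -/
def presheafTensor (A B : Cᵒᵖ ⥤ AddCommGrpCat.{max u v}) : Cᵒᵖ ⥤ AddCommGrpCat.{max u v} where
  obj U := AddCommGrpCat.of (A.obj U ⊗[ℤ] B.obj U)
  map f := tensorHom (A.map f) (B.map f)
  map_id U := by rw [A.map_id, B.map_id, tensorHom_id]
  map_comp f g := by rw [A.map_comp, B.map_comp, tensorHom_comp]

/-- The morphism `f ⊗ g` of presheaf tensor products. -/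
def presheafTensorMap {A A' B B' : Cᵒᵖ ⥤ AddCommGrpCat.{max u v}} (f : A ⟶ A') (g : B ⟶ B') :
    presheafTensor A B ⟶ presheafTensor A' B' where
  app U := tensorHom (f.app U) (g.app U)
  naturality U V h := by
    change tensorHom (A.map h) (B.map h) ≫ _ = _ ≫ tensorHom (A'.map h) (B'.map h)
    rw [← tensorHom_comp, ← tensorHom_comp, f.naturality, g.naturality]

theorem presheafTensorMap_id (A B : Cᵒᵖ ⥤ AddCommGrpCat.{max u v}) :
    presheafTensorMap (𝟙 A) (𝟙 B) = 𝟙 _ := by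
  ext1; funext U; exact tensorHom_id _ _

theorem presheafTensorMap_comp {A A' A'' B B' B'' : Cᵒᵖ ⥤ AddCommGrpCat.{max u v}}
    (f : A ⟶ A') (f' : A' ⟶ A'') (g : B ⟶ B') (g' : B' ⟶ B'') :
    presheafTensorMap (f ≫ f') (g ≫ g') = presheafTensorMap f g ≫ presheafTensorMap f' g' := by
  ext1; funext U; exact tensorHom_comp _ _ _ _

variable {J : GrothendieckTopology C}

instance isGrothendieckAbelian_sheaf :
    IsGrothendieckAbelian.{max u v} (Sheaf J AddCommGrpCat.{max u v}) where

/-- The tensor product `A ⊗ B` of abelian sheaves: the sheaf associated with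
`U ↦ A(U) ⊗ B(U)`. -/
noncomputable def tensor (A B : Sheaf J AddCommGrpCat.{max u v}) :
    Sheaf J AddCommGrpCat.{max u v} :=
  (presheafToSheaf J AddCommGrpCat.{max u v}).obj (presheafTensor A.obj B.obj)

/-- The homomorphism `f ⊗ g` of tensor products of abelian sheaves. -/
noncomputable def tensorMap {A A' B B' : Sheaf J AddCommGrpCat.{max u v}}
    (f : A ⟶ A') (g : B ⟶ B') : tensor A B ⟶ tensor A' B' :=
  (presheafToSheaf J AddCommGrpCat.{max u v}).map (presheafTensorMap f.hom g.hom)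

theorem tensorMap_id (A B : Sheaf J AddCommGrpCat.{max u v}) :
    tensorMap (𝟙 A) (𝟙 B) = 𝟙 _ :=
  (congrArg _ (presheafTensorMap_id A.obj B.obj)).trans (CategoryTheory.Functor.map_id _ _)

theorem tensorMap_comp {A A' A'' B B' B'' : Sheaf J AddCommGrpCat.{max u v}}
    (f : A ⟶ A') (f' : A' ⟶ A'') (g : B ⟶ B') (g' : B' ⟶ B'') :
    tensorMap (f ≫ f') (g ≫ g') = tensorMap f g ≫ tensorMap f' g' :=
  (congrArg _ (presheafTensorMap_comp f.hom f'.hom g.hom g'.hom)).trans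
    (CategoryTheory.Functor.map_comp _ _ _)

/-- The canonical map from the presheaf tensor product to the sheaf tensor product. -/
noncomputable def toTensor (A B : Sheaf J AddCommGrpCat.{max u v}) :
    presheafTensor A.obj B.obj ⟶ (tensor A B).obj :=
  toSheafify J (presheafTensor A.obj B.obj)

/-- The section `a ⊗ b` of `A ⊗ B`, for sections `a` of `A` and `b` of `B`. -/
noncomputable def tmul {A B : Sheaf J AddCommGrpCat.{max u v}} {U : Cᵒᵖ} (a : A.obj.obj U)
    (b : B.obj.obj U) : (tensor A B).obj.obj U :=
  (toTensor A B).app U (a ⊗ₜ[ℤ] b : A.obj.obj U ⊗[ℤ] B.obj.obj U)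

theorem add_tmul {A B : Sheaf J AddCommGrpCat.{max u v}} {U : Cᵒᵖ} (a a' : A.obj.obj U)
    (b : B.obj.obj U) : tmul (a + a') b = tmul a b + tmul a' b :=
  (congrArg ((toTensor A B).app U).hom (TensorProduct.add_tmul a a' b)).trans
    (map_add ((toTensor A B).app U).hom _ _)

theorem tmul_add {A B : Sheaf J AddCommGrpCat.{max u v}} {U : Cᵒᵖ} (a : A.obj.obj U)
    (b b' : B.obj.obj U) : tmul a (b + b') = tmul a b + tmul a b' :=
  (congrArg ((toTensor A B).app U).hom (TensorProduct.tmul_add a b b')).trans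
    (map_add ((toTensor A B).app U).hom _ _)

theorem map_tmul {A B : Sheaf J AddCommGrpCat.{max u v}} {U V : Cᵒᵖ} (f : U ⟶ V)
    (a : A.obj.obj U) (b : B.obj.obj U) :
    (tensor A B).obj.map f (tmul a b) = tmul (A.obj.map f a) (B.obj.map f b) :=
  (NatTrans.naturality_apply (toTensor A B) f (a ⊗ₜ[ℤ] b : A.obj.obj U ⊗[ℤ] B.obj.obj U)).symm

theorem tensorMap_tmul {A A' B B' : Sheaf J AddCommGrpCat.{max u v}}
    (f : A ⟶ A') (g : B ⟶ B') {U : Cᵒᵖ} (a : A.obj.obj U) (b : B.obj.obj U) :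
    (tensorMap f g).hom.app U (tmul a b) = tmul (f.hom.app U a) (g.hom.app U b) :=
  (ConcreteCategory.congr_hom (congr_app (toSheafify_naturality J
    (presheafTensorMap f.hom g.hom)) U) (a ⊗ₜ[ℤ] b : A.obj.obj U ⊗[ℤ] B.obj.obj U)).symm

end Tensor

section Over
variable {C : Type u} [Category.{v} C] {J : GrothendieckTopology C}
  {D : Type u} [Category.{v} D] {K : GrothendieckTopology D}

/-- For a continuous functor `F : C ⥤ D` and morphisms `α : A ⟶ F_* A'`, `β : B ⟶ F_* B'`, the induced
morphism `A ⊗ B ⟶ F_* (A' ⊗ B')`. -/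
noncomputable def tensorMapOver (F : C ⥤ D) [F.IsContinuous J K]
    {A B : Sheaf J AddCommGrpCat.{max u v}} {A' B' : Sheaf K AddCommGrpCat.{max u v}}
    (α : A.obj ⟶ F.op ⋙ A'.obj) (β : B.obj ⟶ F.op ⋙ B'.obj) :
    (tensor A B).obj ⟶ F.op ⋙ (tensor A' B').obj :=
  sheafifyLift J
    (presheafTensorMap α β ≫ Functor.whiskerLeft F.op (toTensor A' B') :
      presheafTensor A.obj B.obj ⟶ F.op ⋙ (tensor A' B').obj)
    ((F.sheafPushforwardContinuous AddCommGrpCat.{max u v} J K).obj (tensor A' B')).property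

theorem tensorMapOver_tmul (F : C ⥤ D) [F.IsContinuous J K]
    {A B : Sheaf J AddCommGrpCat.{max u v}} {A' B' : Sheaf K AddCommGrpCat.{max u v}}
    (α : A.obj ⟶ F.op ⋙ A'.obj) (β : B.obj ⟶ F.op ⋙ B'.obj) {U : Cᵒᵖ} (a : A.obj.obj U) (b : B.obj.obj U) :
    (tensorMapOver F α β).app U (tmul a b) =
      tmul (A := A') (B := B') (U := F.op.obj U) (α.app U a) (β.app U b) :=
  (ConcreteCategory.congr_hom (congr_app (toSheafify_sheafifyLift J
    (presheafTensorMap α β ≫ Functor.whiskerLeft F.op (toTensor A' B') :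
      presheafTensor A.obj B.obj ⟶ F.op ⋙ (tensor A' B').obj)
    ((F.sheafPushforwardContinuous AddCommGrpCat.{max u v} J K).obj (tensor A' B')).property) U)
      (a ⊗ₜ[ℤ] b : A.obj.obj U ⊗[ℤ] B.obj.obj U))
end Over
section Exact
variable {C : Type u} [Category.{v} C] {J : GrothendieckTopology C}

/-- Tensoring with an abelian group preserves exactness of a short exact sequence of abelian groups
whose last term is torsion-free. -/
theorem tensorHom_injective {X Y Z : AddCommGrpCat.{u}} (f : X ⟶ Y) (g : Y ⟶ Z)
    (hf : Function.Injective f) (hg : Function.Surjective g)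
    (hfg : Function.Exact f g) (hZ : ∀ (n : ℤ) (z : Z), n ≠ 0 → n • z = 0 → z = 0)
    (B : AddCommGrpCat.{u}) :
    Function.Injective (tensorHom f (𝟙 B)) := by
  have : Module.IsTorsionFree ℤ Z := by
    refine ⟨fun n hn x y h => ?_⟩
    have h' : n • (x - y) = 0 := by
      rw [smul_sub, sub_eq_zero]; exact h
    exact sub_eq_zero.1 (hZ n _ hn.ne_zero h')
  have h1 : Function.Injective (LinearMap.rTensor B f.hom.toIntLinearMap) := by
    have := LinearMap.lTensor_injective_of_exact_of_flat g.hom.toIntLinearMap hg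
      f.hom.toIntLinearMap hf hfg B
    rwa [LinearMap.lTensor_inj_iff_rTensor_inj] at this
  exact h1

theorem tensorHom_surjective {X Y : AddCommGrpCat.{u}} (f : X ⟶ Y)
    (hf : Function.Surjective f) (B : AddCommGrpCat.{u}) :
    Function.Surjective (tensorHom f (𝟙 B)) :=
  LinearMap.rTensor_surjective B (g := f.hom.toIntLinearMap) hf

theorem tensorHom_exact {X Y Z : AddCommGrpCat.{u}} (f : X ⟶ Y) (g : Y ⟶ Z)
    (hg : Function.Surjective g) (hfg : Function.Exact f g) (B : AddCommGrpCat.{u}) :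
    Function.Exact (tensorHom f (𝟙 B)) (tensorHom g (𝟙 B)) :=
  rTensor_exact (f := f.hom.toIntLinearMap) (g := g.hom.toIntLinearMap) B hfg hg

/-- A sequence of abelian presheaves that is short exact on all sections is short exact. -/
theorem presheaf_shortExact (S : ShortComplex (Cᵒᵖ ⥤ AddCommGrpCat.{max u v}))
    (hf : ∀ U, Function.Injective (S.f.app U)) (hg : ∀ U, Function.Surjective (S.g.app U))
    (hfg : ∀ U, Function.Exact (S.f.app U) (S.g.app U)) : S.ShortExact := by
  have h1 : ∀ U, Mono (S.f.app U) := fun U => (AddCommGrpCat.mono_iff_injective _).2 (hf U)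
  have h2 : ∀ U, Epi (S.g.app U) := fun U => (AddCommGrpCat.epi_iff_surjective _).2 (hg U)
  have : Mono S.f := NatTrans.mono_of_mono_app _
  have : Epi S.g := NatTrans.epi_of_epi_app _
  refine ⟨?_⟩
  rw [ShortComplex.exact_iff_isZero_homology, Functor.isZero_iff]
  intro U
  have h3 : (S.map ((evaluation _ _).obj U)).Exact := by
    rw [ShortComplex.ab_exact_iff_function_exact]
    exact hfg U
  rw [ShortComplex.exact_iff_isZero_homology] at h3
  exact h3.of_iso (S.mapHomologyIso ((evaluation _ _).obj U)).symm

/-- If `f : M ⟶ N` is locally surjective, then so is `M ⊗ B ⟶ N ⊗ B`. -/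
theorem isLocallySurjective_tensor {M N : Cᵒᵖ ⥤ AddCommGrpCat.{max u v}} (f : M ⟶ N)
    [Presheaf.IsLocallySurjective J f] (B : Cᵒᵖ ⥤ AddCommGrpCat.{max u v}) :
    Presheaf.IsLocallySurjective J (presheafTensorMap f (𝟙 B)) where
  imageSieve_mem {U} s := by
    induction s using TensorProduct.induction_on with
    | zero =>
      refine J.superset_covering ?_ (J.top_mem _)
      intro V i _
      exact ⟨0, (map_zero ((presheafTensorMap f (𝟙 B)).app (op V)).hom).trans
        (map_zero ((presheafTensor N B).map i.op).hom).symm⟩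
    | tmul n b =>
      refine J.superset_covering ?_ (Presheaf.imageSieve_mem J f n)
      rintro V i ⟨m, hm⟩
      refine ⟨(m ⊗ₜ[ℤ] (B.map i.op b) : M.obj (op V) ⊗[ℤ] B.obj (op V)), ?_⟩
      change (f.app (op V) m ⊗ₜ[ℤ] (B.map i.op b) : N.obj (op V) ⊗[ℤ] B.obj (op V)) = _
      rw [hm]; rfl
    | add x y hx hy =>
      refine J.superset_covering ?_ (J.intersection_covering hx hy)
      rintro V i ⟨⟨t, ht⟩, ⟨t', ht'⟩⟩
      exact ⟨t + t', (map_add ((presheafTensorMap f (𝟙 B)).app (op V)).hom t t').trans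
        ((congrArg₂ (· + ·) ht ht').trans (map_add ((presheafTensor N B).map i.op).hom x y).symm)⟩

/-- An element of the kernel of `M ⊗ B ⟶ N ⊗ B`, for a subgroup `M` of `N`, dies as soon as finitely many
elements of `N` are moved into the subgroup. -/
theorem exists_fg_tensor {M N B : Type u} [AddCommGroup M] [AddCommGroup N] [AddCommGroup B]
    (g : M →ₗ[ℤ] N) (z : M ⊗[ℤ] B) (hz : g.rTensor B z = 0) :
    ∃ P : Submodule ℤ N, P.FG ∧ ∀ (N' M' : Type u) [AddCommGroup N'] [AddCommGroup M']
      (r : N →ₗ[ℤ] N') (s : M →ₗ[ℤ] M') (g' : M' →ₗ[ℤ] N'), Function.Injective g' →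
      g' ∘ₗ s = r ∘ₗ g → (∀ p ∈ P, ∃ m, g' m = r p) → s.rTensor B z = 0 := by
  obtain ⟨Q, hQ, w, rfl⟩ := Submodule.exists_fg_le_eq_rTensor_subtype z
  have h1 : (Q.map g).subtype.rTensor B
      ((g.restrict (fun q hq => Submodule.mem_map_of_mem hq) : Q →ₗ[ℤ] Q.map g).rTensor B w) =
        0 := by
    rw [← hz, ← LinearMap.comp_apply, ← LinearMap.comp_apply, ← LinearMap.rTensor_comp,
      ← LinearMap.rTensor_comp]
    rfl
  obtain ⟨P, hPQ, hP, h2⟩ := TensorProduct.eq_zero_of_fg_of_subtype_eq_zero (hQ.map g) h1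
  refine ⟨P, hP, ?_⟩
  intro N' M' _ _ r s g' hg' hc hr
  choose l hl using fun p : P => hr p p.2
  let L : P →ₗ[ℤ] M' :=
    { toFun := l
      map_add' := fun x y => hg' (by rw [map_add, hl, hl, hl]; exact map_add r _ _)
      map_smul' := fun x y => hg' (by rw [map_smul, hl, hl]; exact map_smul r _ _) }
  have h3 := congrArg (L.rTensor B) h2
  rw [map_zero, ← LinearMap.comp_apply, ← LinearMap.comp_apply, ← LinearMap.rTensor_comp,
    ← LinearMap.rTensor_comp] at h3
  rw [← h3, ← LinearMap.comp_apply, ← LinearMap.rTensor_comp]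
  congr 2
  ext q
  apply hg'
  exact (LinearMap.congr_fun hc q).trans (hl ⟨g q, hPQ ⟨q, q.2, rfl⟩⟩).symm

/-- If `f : M ⟶ N` is injective on sections and locally surjective, then `M ⊗ B ⟶ N ⊗ B` is locally
injective. -/
theorem isLocallyInjective_tensor {M N : Cᵒᵖ ⥤ AddCommGrpCat.{max u v}} (f : M ⟶ N)
    (hf : ∀ U, Function.Injective (f.app U))
    [Presheaf.IsLocallySurjective J f] (B : Cᵒᵖ ⥤ AddCommGrpCat.{max u v}) :
    Presheaf.IsLocallyInjective J (presheafTensorMap f (𝟙 B)) where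
  equalizerSieve_mem {U} x y hxy := by
    let z : M.obj U ⊗[ℤ] B.obj U :=
      (show M.obj U ⊗[ℤ] B.obj U from x) - (show M.obj U ⊗[ℤ] B.obj U from y)
    have hz : (f.app U).hom.toIntLinearMap.rTensor (B.obj U) z = 0 := by
      rw [map_sub, sub_eq_zero]; exact hxy
    obtain ⟨P, ⟨S, rfl⟩, hP⟩ := exists_fg_tensor _ z hz
    have hcov : ∀ T : Finset (N.obj U), ∃ R ∈ J U.unop, ∀ ⦃V : C⦄ (i : V ⟶ U.unop), R i →
        ∀ n ∈ T, ∃ m, f.app (op V) m = N.map i.op n := by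
      classical
      intro T
      induction T using Finset.induction_on with
      | empty => exact ⟨⊤, J.top_mem _, fun V i _ n hn => by simp at hn⟩
      | insert a T ha ih =>
        obtain ⟨R, hR, hR'⟩ := ih
        refine ⟨_, J.intersection_covering (Presheaf.imageSieve_mem J f a) hR, ?_⟩
        rintro V i ⟨hi, hi'⟩ n hn
        rcases Finset.mem_insert.1 hn with rfl | hn
        · exact hi
        · exact hR' i hi' n hn
    obtain ⟨R, hR, hR'⟩ := hcov S
    refine J.superset_covering ?_ hR
    intro V i hi
    have h0 := hP (N.obj (op V)) (M.obj (op V)) (N.map i.op).hom.toIntLinearMap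
      (M.map i.op).hom.toIntLinearMap (f.app (op V)).hom.toIntLinearMap (hf _)
      (LinearMap.ext fun m => NatTrans.naturality_apply f i.op m) (by
        intro p hp
        have : p ∈ (LinearMap.range (f.app (op V)).hom.toIntLinearMap).comap
            (N.map i.op).hom.toIntLinearMap :=
          Submodule.span_le.2 (fun n hn => hR' i hi n hn) hp
        exact this)
    have h1 : (presheafTensor M B).map i.op x = (presheafTensor M B).map i.op y := by
      have h2 := congrArg (LinearMap.lTensor (M.obj (op V)) (B.map i.op).hom.toIntLinearMap) h0
      rw [map_zero, ← LinearMap.comp_apply, LinearMap.lTensor_comp_rTensor, map_sub,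
        sub_eq_zero] at h2
      exact h2
    exact h1

/-- The functor of sections over `U` on abelian sheaves. -/
noncomputable abbrev sectionsFunctor (J : GrothendieckTopology C) (U : Cᵒᵖ) :
    Sheaf J AddCommGrpCat.{max u v} ⥤ AddCommGrpCat.{max u v} :=
  sheafToPresheaf J AddCommGrpCat.{max u v} ⋙ (evaluation _ _).obj U

theorem injective_of_shortExact {S : ShortComplex (Sheaf J AddCommGrpCat.{max u v})}
    (hS : S.ShortExact) (U : Cᵒᵖ) : Function.Injective (S.f.hom.app U) := by
  have := hS.mono_f
  have h : Mono ((sectionsFunctor J U).map S.f) := inferInstance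
  exact (AddCommGrpCat.mono_iff_injective _).1 h

theorem exact_of_shortExact {S : ShortComplex (Sheaf J AddCommGrpCat.{max u v})}
    (hS : S.ShortExact) (U : Cᵒᵖ) :
    Function.Exact (S.f.hom.app U) (S.g.hom.app U) := by
  have := hS.mono_f
  have h := hS.exact.map_of_mono_of_preservesKernel (sectionsFunctor J U) inferInstance
    inferInstance
  rw [ShortComplex.ab_exact_iff_function_exact] at h
  exact h

theorem locallySurjective_of_shortExact {S : ShortComplex (Sheaf J AddCommGrpCat.{max u v})}
    (hS : S.ShortExact) : Presheaf.IsLocallySurjective J S.g.hom := by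
  have := hS.epi_g
  exact (Sheaf.isLocallySurjective_iff_epi' AddCommGrpCat.{max u v} S.g).2 inferInstance

/-- The presheaf of those sections that lift along `p`. -/
def rangePresheaf {E Z : Cᵒᵖ ⥤ AddCommGrpCat.{max u v}} (p : E ⟶ Z) :
    Cᵒᵖ ⥤ AddCommGrpCat.{max u v} where
  obj U := AddCommGrpCat.of (p.app U).hom.range
  map {U V} i := AddCommGrpCat.ofHom
    (((Z.map i).hom.comp (p.app U).hom.range.subtype).codRestrict (p.app V).hom.range (by
      rintro ⟨_, e, rfl⟩
      exact ⟨E.map i e, NatTrans.naturality_apply p i e⟩))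
  map_id U := by ext x; exact ConcreteCategory.congr_hom (Z.map_id U) x.1
  map_comp i j := by ext x; exact ConcreteCategory.congr_hom (Z.map_comp i j) x.1

/-- The inclusion of the presheaf of sections that lift along `p`. -/
def rangeSubtype {E Z : Cᵒᵖ ⥤ AddCommGrpCat.{max u v}} (p : E ⟶ Z) : rangePresheaf p ⟶ Z where
  app U := AddCommGrpCat.ofHom (p.app U).hom.range.subtype
  naturality _ _ _ := rfl

/-- The morphism `p`, with values in the presheaf of sections that lift along `p`. -/
def toRange {E Z : Cᵒᵖ ⥤ AddCommGrpCat.{max u v}} (p : E ⟶ Z) : E ⟶ rangePresheaf p where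
  app U := AddCommGrpCat.ofHom (p.app U).hom.rangeRestrict
  naturality U V i := by ext x; exact Subtype.ext (NatTrans.naturality_apply p i x)

theorem toRange_subtype {E Z : Cᵒᵖ ⥤ AddCommGrpCat.{max u v}} (p : E ⟶ Z) :
    toRange p ≫ rangeSubtype p = p := rfl

instance rangeSubtype_locallySurjective {E Z : Cᵒᵖ ⥤ AddCommGrpCat.{max u v}} (p : E ⟶ Z)
    [Presheaf.IsLocallySurjective J p] : Presheaf.IsLocallySurjective J (rangeSubtype p) where
  imageSieve_mem {U} s := by
    refine J.superset_covering ?_ (Presheaf.imageSieve_mem J p s)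
    rintro V i ⟨e, he⟩
    exact ⟨⟨_, e, rfl⟩, he⟩

theorem presheafTensorMap_zero_left {A A' B B' : Cᵒᵖ ⥤ AddCommGrpCat.{max u v}} (g : B ⟶ B') :
    presheafTensorMap (0 : A ⟶ A') g = 0 := by
  ext1; funext U
  exact tensorHom_ext fun x y => TensorProduct.zero_tmul _ (g.app U y)

/-- The sequence `S ⊗ B`. -/
noncomputable def tensorShortComplex (S : ShortComplex (Sheaf J AddCommGrpCat.{max u v}))
    (B : Sheaf J AddCommGrpCat.{max u v}) : ShortComplex (Sheaf J AddCommGrpCat.{max u v}) :=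
  ShortComplex.mk (tensorMap S.f (𝟙 B)) (tensorMap S.g (𝟙 B)) (by
    rw [← tensorMap_comp, S.zero]
    exact (congrArg _ (presheafTensorMap_zero_left _)).trans
      ((presheafToSheaf J AddCommGrpCat.{max u v}).map_zero _ _))

/-- Tensoring with an abelian sheaf preserves the exactness of short exact sequences whose last
term is torsion-free. -/
theorem tensorShortComplex_shortExact {S : ShortComplex (Sheaf J AddCommGrpCat.{max u v})}
    (hS : S.ShortExact)
    (hZ : ∀ (U : Cᵒᵖ) (n : ℤ) (z : S.X₃.obj.obj U), n ≠ 0 → n • z = 0 → z = 0)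
    (B : Sheaf J AddCommGrpCat.{max u v}) : (tensorShortComplex S B).ShortExact := by
  have := locallySurjective_of_shortExact hS
  have hz : S.f.hom ≫ toRange S.g.hom = 0 := by
    ext1; funext U; ext x
    exact Subtype.ext ((exact_of_shortExact hS U).apply_apply_eq_zero x)
  let T : ShortComplex (Cᵒᵖ ⥤ AddCommGrpCat.{max u v}) :=
    ShortComplex.mk (presheafTensorMap S.f.hom (𝟙 B.obj))
      (presheafTensorMap (toRange S.g.hom) (𝟙 B.obj)) (by
        rw [← presheafTensorMap_comp, hz, presheafTensorMap_zero_left])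
  have hex : ∀ U, Function.Exact (S.f.hom.app U) ((toRange S.g.hom).app U) := fun U x =>
    Subtype.ext_iff.trans (exact_of_shortExact hS U x)
  have hsurj : ∀ U, Function.Surjective ((toRange S.g.hom).app U) := fun U =>
    (S.g.hom.app U).hom.rangeRestrict_surjective
  have hT : T.ShortExact := presheaf_shortExact T
    (fun U => tensorHom_injective (S.f.hom.app U) ((toRange S.g.hom).app U)
      (injective_of_shortExact hS U) (hsurj U) (hex U)
      (fun n z hn h => Subtype.ext (hZ U n z.1 hn (congrArg Subtype.val h))) (B.obj.obj U))
    (fun U => tensorHom_surjective _ (hsurj U) (B.obj.obj U))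
    (fun U => tensorHom_exact (S.f.hom.app U) ((toRange S.g.hom).app U) (hsurj U) (hex U)
      (B.obj.obj U))
  have hT' := hT.map_of_exact (presheafToSheaf J AddCommGrpCat.{max u v})
  have := isLocallySurjective_tensor (J := J) (rangeSubtype S.g.hom) B.obj
  have := isLocallyInjective_tensor (J := J) (rangeSubtype S.g.hom)
    (fun U => Subtype.val_injective) B.obj
  have hW := J.W_of_isLocallyBijective (presheafTensorMap (rangeSubtype S.g.hom) (𝟙 B.obj))
  rw [J.W_iff] at hW
  let e := asIso ((presheafToSheaf J AddCommGrpCat.{max u v}).map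
    (presheafTensorMap (rangeSubtype S.g.hom) (𝟙 B.obj)))
  refine ShortComplex.shortExact_of_iso (ShortComplex.isoMk
    (S₁ := T.map (presheafToSheaf J AddCommGrpCat.{max u v})) (S₂ := tensorShortComplex S B)
    (Iso.refl _) (Iso.refl _) e ?_ ?_) hT'
  · exact (Category.id_comp _).trans (Category.comp_id _).symm
  · refine (Category.id_comp _).trans ?_
    refine Eq.trans ?_ ((presheafToSheaf J AddCommGrpCat.{max u v}).map_comp _ _)
    have h := (presheafTensorMap_comp (toRange S.g.hom) (rangeSubtype S.g.hom)
      (𝟙 B.obj) (𝟙 B.obj))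
    rw [toRange_subtype, Category.comp_id] at h
    exact congrArg _ h

end Exact

section Cup
variable {C : Type u} [Category.{v} C] {J : GrothendieckTopology C}

/-- The constant abelian sheaf `ℤ`. The group `H n` of an abelian sheaf is `Ext n` out of it. -/
noncomputable abbrev constZ (J : GrothendieckTopology C) : Sheaf J AddCommGrpCat.{max u v} :=
  (constantSheaf J AddCommGrpCat.{max u v}).obj (AddCommGrpCat.of (ULift.{max u v} ℤ))

/-- The section `1` of the constant sheaf `ℤ`. -/
noncomputable def oneSection (J : GrothendieckTopology C) (U : Cᵒᵖ) : (constZ J).obj.obj U :=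
  (toSheafify J ((Functor.const Cᵒᵖ).obj (AddCommGrpCat.of (ULift.{max u v} ℤ)))).app U
    (ULift.up (1 : ℤ) : ULift.{max u v} ℤ)

theorem map_oneSection {U V : Cᵒᵖ} (i : U ⟶ V) :
    (constZ J).obj.map i (oneSection J U) = oneSection J V :=
  (NatTrans.naturality_apply (toSheafify J ((Functor.const Cᵒᵖ).obj
    (AddCommGrpCat.of (ULift.{max u v} ℤ)))) i (ULift.up (1 : ℤ) : ULift.{max u v} ℤ)).symm

theorem constZ_torsionFree (U : Cᵒᵖ) (n : ℤ) (z : (constZ J).obj.obj U) (hn : n ≠ 0)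
    (h : n • z = 0) : z = 0 := by
  let P : Cᵒᵖ ⥤ AddCommGrpCat.{max u v} :=
    (Functor.const Cᵒᵖ).obj (AddCommGrpCat.of (ULift.{max u v} ℤ))
  have h1 : Mono (n • 𝟙 P) := by
    have : ∀ U, Mono ((n • 𝟙 P : P ⟶ P).app U) := fun U => by
      refine (AddCommGrpCat.mono_iff_injective _).2 fun x y hxy => ?_
      have h2 : n • x.down = n • y.down := congrArg ULift.down hxy
      exact ULift.ext _ _ (by simpa [hn] using h2)
    exact NatTrans.mono_of_mono_app _
  have h2 : Mono (n • 𝟙 (constZ J)) := by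
    have h3 : Mono ((presheafToSheaf J AddCommGrpCat.{max u v}).map (n • 𝟙 P)) := inferInstance
    rw [Functor.map_zsmul, CategoryTheory.Functor.map_id] at h3
    exact h3
  have h3 : Mono ((sectionsFunctor J U).map (n • 𝟙 (constZ J))) := inferInstance
  have h4 := (AddCommGrpCat.mono_iff_injective _).1 h3
  have h5 : ∀ x, (sectionsFunctor J U).map (n • 𝟙 (constZ J)) x = n • x := fun x => by
    rw [Functor.map_zsmul, CategoryTheory.Functor.map_id]; rfl
  exact h4 ((h5 z).trans (h.trans (((h5 0).trans (smul_zero n)).symm)))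

/-- The data of an extension `0 ⟶ A ⟶ E ⟶ ℤ ⟶ 0`. -/
structure ZExtension (A : Sheaf J AddCommGrpCat.{max u v}) where
  E : Sheaf J AddCommGrpCat.{max u v}
  i : A ⟶ E
  p : E ⟶ constZ J
  zero : i ≫ p = 0
  shortExact : (ShortComplex.mk i p zero).ShortExact

namespace ZExtension

variable {A : Sheaf J AddCommGrpCat.{max u v}}

/-- The class in `H¹(A) = Ext¹(ℤ, A)` of an extension. -/
noncomputable def cls (S : ZExtension A) : A.H 1 := S.shortExact.extClass

theorem injShortExact (A : Sheaf J AddCommGrpCat.{max u v}) :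
    (ShortComplex.mk (Injective.ι A) (Limits.cokernel.π (Injective.ι A))
      (Limits.cokernel.condition _)).ShortExact where
  exact := ShortComplex.exact_cokernel _

/-- Every element of `H¹(A)` is the class of an extension of `ℤ` by `A`. -/
theorem exists_cls_eq (γ : A.H 1) : ∃ S : ZExtension A, S.cls = γ := by
  obtain ⟨f, hf⟩ : ∃ f : constZ J ⟶ Limits.cokernel (Injective.ι A),
      (Abelian.Ext.mk₀ f).comp (injShortExact A).extClass (zero_add 1) = γ := by
    obtain ⟨x, hx⟩ := Abelian.Ext.covariant_sequence_exact₁ (constZ J) (injShortExact A) γ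
      (Abelian.Ext.eq_zero_of_injective _) (zero_add 1)
    obtain ⟨f, rfl⟩ := (Abelian.Ext.mk₀_bijective _ _).2 x
    exact ⟨f, hx⟩
  let q := Limits.cokernel.π (Injective.ι A)
  have hz : Injective.ι A ≫ q = 0 := Limits.cokernel.condition _
  let l : A ⟶ Limits.pullback q f := Limits.pullback.lift (Injective.ι A) 0 (by simp [hz])
  have hl : l ≫ Limits.pullback.snd q f = 0 := Limits.pullback.lift_snd _ _ _
  have hl' : l ≫ Limits.pullback.fst q f = Injective.ι A := Limits.pullback.lift_fst _ _ _
  have hS : (ShortComplex.mk l (Limits.pullback.snd q f) hl).ShortExact := by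
    have hm : Mono l := by
      have : Mono (l ≫ Limits.pullback.fst q f) := by rw [hl']; infer_instance
      exact mono_of_mono l (Limits.pullback.fst q f)
    refine ⟨ShortComplex.exact_of_f_is_kernel _ (Limits.KernelFork.IsLimit.ofι _ _
      (fun {W} k hk => (injShortExact A).exact.lift (k ≫ Limits.pullback.fst q f) ?_) ?_ ?_)⟩
    · change (k ≫ Limits.pullback.fst q f) ≫ q = 0
      change k ≫ Limits.pullback.snd q f = 0 at hk
      rw [Category.assoc, Limits.pullback.condition, reassoc_of% hk, Limits.zero_comp]
    · intro W k hk
      apply Limits.pullback.hom_ext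
      · rw [Category.assoc]
        exact (congrArg _ hl').trans ((injShortExact A).exact.lift_f _ _)
      · rw [Category.assoc]
        exact (congrArg _ hl).trans (Limits.comp_zero.trans hk.symm)
    · intro W k hk m hm'
      refine (cancel_mono l).1 (hm'.trans (Eq.symm ?_))
      apply Limits.pullback.hom_ext
      · rw [Category.assoc]
        exact (congrArg _ hl').trans ((injShortExact A).exact.lift_f _ _)
      · rw [Category.assoc]
        exact (congrArg _ hl).trans (Limits.comp_zero.trans hk.symm)
  refine ⟨⟨_, l, Limits.pullback.snd q f, hl, hS⟩, ?_⟩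
  have h := hS.extClass_naturality (injShortExact A)
    (ShortComplex.homMk (𝟙 A) (Limits.pullback.fst q f) f
      ((Category.id_comp _).trans hl'.symm) Limits.pullback.condition)
  exact (Abelian.Ext.comp_mk₀_id _).symm.trans (h.trans hf)

end ZExtension
end Cup

section Groups
variable {C : Type u} [Category.{v} C] {J : GrothendieckTopology C}

/-- A presheaf of sets that is the product of two sheaves is a sheaf. -/
theorem isSheaf_of_prod {F F₁ F₂ : Cᵒᵖ ⥤ Type (max u v)} (p₁ : F ⟶ F₁) (p₂ : F ⟶ F₂)
    (h : ∀ U, Function.Bijective fun x : F.obj U => (p₁.app U x, p₂.app U x))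
    (h₁ : Presheaf.IsSheaf J F₁) (h₂ : Presheaf.IsSheaf J F₂) : Presheaf.IsSheaf J F := by
  rw [isSheaf_iff_isSheaf_of_type] at h₁ h₂ ⊢
  intro X S hS x hx
  have hx₁ := hx.map p₁
  have hx₂ := hx.map p₂
  obtain ⟨t₁, ht₁, hu₁⟩ := h₁ S hS _ hx₁
  obtain ⟨t₂, ht₂, hu₂⟩ := h₂ S hS _ hx₂
  obtain ⟨t, ht⟩ := (h (op X)).2 (t₁, t₂)
  have hta : p₁.app _ t = t₁ := congrArg Prod.fst ht
  have htb : p₂.app _ t = t₂ := congrArg Prod.snd ht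
  refine ⟨t, ?_, ?_⟩
  · intro Y f hf
    apply (h (op Y)).1
    have e₁ := ht₁ f hf
    have e₂ := ht₂ f hf
    rw [← hta] at e₁
    rw [← htb] at e₂
    exact Prod.ext ((NatTrans.naturality_apply p₁ f.op t).trans e₁)
      ((NatTrans.naturality_apply p₂ f.op t).trans e₂)
  · intro s hs
    apply (h (op X)).1
    refine Eq.trans (Prod.ext ?_ ?_) ht.symm
    · refine hu₁ _ fun Y f hf => ?_
      exact (NatTrans.naturality_apply p₁ f.op s).symm.trans (congrArg _ (hs f hf))
    · refine hu₂ _ fun Y f hf => ?_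
      exact (NatTrans.naturality_apply p₂ f.op s).symm.trans (congrArg _ (hs f hf))

/-- A presheaf of groups is a sheaf if its underlying presheaf of sets is. -/
theorem isSheaf_group (G : Cᵒᵖ ⥤ GrpCat.{max u v}) (h : Presheaf.IsSheaf J (G ⋙ forget GrpCat.{max u v})) :
    Presheaf.IsSheaf J G :=
  (Presheaf.isSheaf_iff_isSheaf_forget J G (forget GrpCat.{max u v})).2 h

theorem isSheaf_underlying_group (G : Sheaf J GrpCat.{max u v}) :
    Presheaf.IsSheaf J (G.obj ⋙ forget GrpCat.{max u v}) :=
  (Presheaf.isSheaf_iff_isSheaf_forget J G.obj (forget GrpCat.{max u v})).1 G.property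

theorem isSheaf_underlying_ab (A : Sheaf J AddCommGrpCat.{max u v}) :
    Presheaf.IsSheaf J (A.obj ⋙ forget AddCommGrpCat.{max u v}) :=
  (Presheaf.isSheaf_iff_isSheaf_forget J A.obj (forget AddCommGrpCat.{max u v})).1 A.property

/-- An abelian sheaf, viewed as a sheaf of (multiplicatively written) groups. -/
def toGrp (A : Sheaf J AddCommGrpCat.{max u v}) : Sheaf J GrpCat.{max u v} where
  obj :=
    { obj := fun U => GrpCat.of (Multiplicative (A.obj.obj U))
      map := fun i => GrpCat.ofHom (A.obj.map i).hom.toMultiplicative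
      map_id := fun U => by
        ext1; ext1 x; exact ConcreteCategory.congr_hom (A.obj.map_id U) x.toAdd
      map_comp := fun i j => by
        ext1; ext1 x; exact ConcreteCategory.congr_hom (A.obj.map_comp i j) x.toAdd }
  property := isSheaf_group _ (isSheaf_underlying_ab A)

/-- A homomorphism of abelian sheaves, viewed as a homomorphism of sheaves of groups. -/
def toGrpMap {A B : Sheaf J AddCommGrpCat.{max u v}} (f : A ⟶ B) : toGrp A ⟶ toGrp B where
  hom :=
    { app := fun U => GrpCat.ofHom (f.hom.app U).hom.toMultiplicative
      naturality := fun U V i => by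
        ext1; ext1 x; exact NatTrans.naturality_apply f.hom i x.toAdd }

/-- The product of two sheaves of groups. -/
def prodGrp (G₁ G₂ : Sheaf J GrpCat.{max u v}) : Sheaf J GrpCat.{max u v} where
  obj :=
    { obj := fun U => GrpCat.of (G₁.obj.obj U × G₂.obj.obj U)
      map := fun i => GrpCat.ofHom ((G₁.obj.map i).hom.prodMap (G₂.obj.map i).hom)
      map_id := fun U => by
        ext1; ext1 x
        exact Prod.ext (ConcreteCategory.congr_hom (G₁.obj.map_id U) x.1)
          (ConcreteCategory.congr_hom (G₂.obj.map_id U) x.2)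
      map_comp := fun i j => by
        ext1; ext1 x
        exact Prod.ext (ConcreteCategory.congr_hom (G₁.obj.map_comp i j) x.1)
          (ConcreteCategory.congr_hom (G₂.obj.map_comp i j) x.2) }
  property := isSheaf_group _ (isSheaf_of_prod
    (F₁ := G₁.obj ⋙ forget GrpCat.{max u v}) (F₂ := G₂.obj ⋙ forget GrpCat.{max u v})
    { app := fun U => ↾(fun x : G₁.obj.obj U × G₂.obj.obj U => x.1) }
    { app := fun U => ↾(fun x : G₁.obj.obj U × G₂.obj.obj U => x.2) }
    (fun U => Function.bijective_id) (isSheaf_underlying_group G₁) (isSheaf_underlying_group G₂))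

/-- The product of two homomorphisms. -/
def prodGrpMap {G₁ G₂ G₁' G₂' : Sheaf J GrpCat.{max u v}} (f₁ : G₁ ⟶ G₁') (f₂ : G₂ ⟶ G₂') :
    prodGrp G₁ G₂ ⟶ prodGrp G₁' G₂' where
  hom :=
    { app := fun U => GrpCat.ofHom ((f₁.hom.app U).hom.prodMap (f₂.hom.app U).hom)
      naturality := fun U V i => by
        ext1; ext1 x
        exact Prod.ext (NatTrans.naturality_apply f₁.hom i x.1)
          (NatTrans.naturality_apply f₂.hom i x.2) }

/-- The sections over `U` of the Heisenberg sheaf: triples `(a, b, t)` of sections of `A`, `B` and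
`A ⊗ B`. -/
@[ext]
structure Heis (A B : Sheaf J AddCommGrpCat.{max u v}) (U : Cᵒᵖ) where
  a : A.obj.obj U
  b : B.obj.obj U
  t : (tensor A B).obj.obj U

namespace Heis

variable {A B : Sheaf J AddCommGrpCat.{max u v}} {U : Cᵒᵖ}

/-- The group law `(a, b, t) (a', b', t') = (a + a', b + b', t + t' + a ⊗ b')`. -/
noncomputable instance : Mul (Heis A B U) :=
  ⟨fun x y => ⟨x.a + y.a, x.b + y.b, x.t + y.t + tmul x.a y.b⟩⟩

noncomputable instance : One (Heis A B U) := ⟨⟨0, 0, 0⟩⟩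

noncomputable instance : Inv (Heis A B U) := ⟨fun x => ⟨-x.a, -x.b, -x.t + tmul x.a x.b⟩⟩

theorem mul_def (x y : Heis A B U) :
    x * y = ⟨x.a + y.a, x.b + y.b, x.t + y.t + tmul x.a y.b⟩ := rfl

theorem zero_tmul (b : B.obj.obj U) : tmul (0 : A.obj.obj U) b = 0 := by
  have h := add_tmul (0 : A.obj.obj U) 0 b
  rw [add_zero] at h
  exact left_eq_add.1 h

theorem tmul_zero (a : A.obj.obj U) : tmul a (0 : B.obj.obj U) = 0 := by
  have h := tmul_add a (0 : B.obj.obj U) 0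
  rw [add_zero] at h
  exact left_eq_add.1 h

theorem neg_tmul (a : A.obj.obj U) (b : B.obj.obj U) : tmul (-a) b = -tmul a b :=
  eq_neg_of_add_eq_zero_left (by rw [← add_tmul, neg_add_cancel, zero_tmul])

noncomputable instance : Group (Heis A B U) where
  mul_assoc x y z := by
    simp only [mul_def, add_tmul, tmul_add, Heis.mk.injEq]
    refine ⟨add_assoc _ _ _, add_assoc _ _ _, ?_⟩
    abel
  one_mul x := Heis.ext (zero_add _) (zero_add _) (by
    change 0 + x.t + tmul 0 x.b = x.t
    rw [zero_tmul, zero_add, add_zero])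
  mul_one x := Heis.ext (add_zero _) (add_zero _) (by
    change x.t + 0 + tmul x.a 0 = x.t
    rw [tmul_zero, add_zero, add_zero])
  inv_mul_cancel x := Heis.ext (neg_add_cancel _) (neg_add_cancel _) (by
    change -x.t + tmul x.a x.b + x.t + tmul (-x.a) x.b = 0
    rw [neg_tmul]
    abel)

/-- Given `α : A ⟶ A'`, `β : B ⟶ B'` and `τ : A ⊗ B ⟶ A' ⊗ B'` on sections, with
`τ (a ⊗ b) = α a ⊗ β b`, the induced map of Heisenberg groups. -/
noncomputable def map {C' : Type u} [Category.{v} C'] {J' : GrothendieckTopology C'}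
    {A' B' : Sheaf J' AddCommGrpCat.{max u v}} {V : C'ᵒᵖ}
    (α : A.obj.obj U →+ A'.obj.obj V) (β : B.obj.obj U →+ B'.obj.obj V)
    (τ : (tensor A B).obj.obj U →+ (tensor A' B').obj.obj V)
    (h : ∀ a b, τ (tmul a b) = tmul (α a) (β b)) : Heis A B U →* Heis A' B' V where
  toFun x := ⟨α x.a, β x.b, τ x.t⟩
  map_one' := Heis.ext (map_zero α) (map_zero β) (map_zero τ)
  map_mul' x y := Heis.ext (map_add α _ _) (map_add β _ _) (by
    change τ (x.t + y.t + tmul x.a y.b) = τ x.t + τ y.t + tmul (α x.a) (β y.b)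
    rw [map_add, map_add, h])

end Heis

/-- The underlying presheaf of groups of the Heisenberg sheaf. -/
noncomputable def heisPresheaf (A B : Sheaf J AddCommGrpCat.{max u v}) :
    Cᵒᵖ ⥤ GrpCat.{max u v} where
  obj U := GrpCat.of (Heis A B U)
  map i := GrpCat.ofHom (Heis.map (A.obj.map i).hom (B.obj.map i).hom ((tensor A B).obj.map i).hom
    (map_tmul i))
  map_id U := by
    ext1; ext1 x
    exact Heis.ext (ConcreteCategory.congr_hom (A.obj.map_id U) x.a)
      (ConcreteCategory.congr_hom (B.obj.map_id U) x.b)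
      (ConcreteCategory.congr_hom ((tensor A B).obj.map_id U) x.t)
  map_comp i j := by
    ext1; ext1 x
    exact Heis.ext (ConcreteCategory.congr_hom (A.obj.map_comp i j) x.a)
      (ConcreteCategory.congr_hom (B.obj.map_comp i j) x.b)
      (ConcreteCategory.congr_hom ((tensor A B).obj.map_comp i j) x.t)

theorem isSheaf_heisPresheaf (A B : Sheaf J AddCommGrpCat.{max u v}) :
    Presheaf.IsSheaf J (heisPresheaf A B) :=
  isSheaf_group _ (isSheaf_of_prod
    (F₁ := (prodGrp (toGrp A) (toGrp B)).obj ⋙ forget GrpCat.{max u v})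
    (F₂ := (tensor A B).obj ⋙ forget AddCommGrpCat.{max u v})
    { app := fun U => ↾(fun x : Heis A B U => ((x.a, x.b) : A.obj.obj U × B.obj.obj U)) }
    { app := fun U => ↾(fun x : Heis A B U => x.t) }
    (fun U => ⟨fun x y h => Heis.ext (congrArg (fun z => z.1.1) h) (congrArg (fun z => z.1.2) h)
      (congrArg (fun z => z.2) h), fun y => ⟨⟨y.1.1, y.1.2, y.2⟩, rfl⟩⟩)
    (isSheaf_underlying_group _) (isSheaf_underlying_ab _))

/-- The Heisenberg sheaf `H_{A,B}`. -/
noncomputable def heisSheaf (A B : Sheaf J AddCommGrpCat.{max u v}) :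
    Sheaf J GrpCat.{max u v} where
  obj := heisPresheaf A B
  property := isSheaf_heisPresheaf A B

/-- The homomorphism `H_{A,B} ⟶ H_{A',B'}` induced by `f : A ⟶ A'` and `g : B ⟶ B'`. -/
noncomputable def heisMap {A A' B B' : Sheaf J AddCommGrpCat.{max u v}} (f : A ⟶ A')
    (g : B ⟶ B') : heisSheaf A B ⟶ heisSheaf A' B' where
  hom :=
    { app := fun U => GrpCat.ofHom (Heis.map (f.hom.app U).hom (g.hom.app U).hom
        ((tensorMap f g).hom.app U).hom (tensorMap_tmul f g))
      naturality := fun U V i => by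
        ext1; ext1 x
        exact Heis.ext (NatTrans.naturality_apply f.hom i x.a)
          (NatTrans.naturality_apply g.hom i x.b)
          (NatTrans.naturality_apply (tensorMap f g).hom i x.t) }

theorem heisMap_id (A B : Sheaf J AddCommGrpCat.{max u v}) :
    heisMap (𝟙 A) (𝟙 B) = 𝟙 (heisSheaf A B) := by
  ext1; ext1; funext U; ext1; ext1 x
  exact Heis.ext rfl rfl (congrArg (fun φ : tensor A B ⟶ tensor A B => φ.hom.app U x.t)
    (tensorMap_id A B))

theorem heisMap_comp {A A' A'' B B' B'' : Sheaf J AddCommGrpCat.{max u v}}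
    (f : A ⟶ A') (f' : A' ⟶ A'') (g : B ⟶ B') (g' : B' ⟶ B'') :
    heisMap (f ≫ f') (g ≫ g') = heisMap f g ≫ heisMap f' g' := by
  ext1; ext1; funext U; ext1; ext1 x
  exact Heis.ext rfl rfl (congrArg (fun φ : tensor A B ⟶ tensor A'' B'' => φ.hom.app U x.t)
    (tensorMap_comp f f' g g'))

/-- The Heisenberg sheaf as a functor of the pair `(A, B)`. -/
noncomputable def heisenbergFunctor (J : GrothendieckTopology C) :
    Sheaf J AddCommGrpCat.{max u v} × Sheaf J AddCommGrpCat.{max u v} ⥤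
      Sheaf J GrpCat.{max u v} where
  obj X := heisSheaf X.1 X.2
  map φ := heisMap φ.1 φ.2
  map_id X := heisMap_id X.1 X.2
  map_comp φ ψ := heisMap_comp φ.1 ψ.1 φ.2 ψ.2

/-- A central extension `1 ⟶ A ⟶ E ⟶ G ⟶ 1` of sheaves of groups, `A` abelian. -/
structure CentralExtension (A : Sheaf J AddCommGrpCat.{max u v})
    (G : Sheaf J GrpCat.{max u v}) where
  E : Sheaf J GrpCat.{max u v}
  ι : toGrp A ⟶ E
  π : E ⟶ G
  injective : ∀ U, Function.Injective (ι.hom.app U)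
  exact : ∀ (U : Cᵒᵖ) (x : E.obj.obj U), π.hom.app U x = 1 ↔ ∃ a, ι.hom.app U a = x
  surjective : Presheaf.IsLocallySurjective J π.hom
  central : ∀ (U : Cᵒᵖ) (a : (toGrp A).obj.obj U) (x : E.obj.obj U),
    ι.hom.app U a * x = x * ι.hom.app U a

/-- The homomorphism `A ⊗ B ⟶ H_{A,B}`, `t ↦ (0, 0, t)`. -/
noncomputable def heisInl (A B : Sheaf J AddCommGrpCat.{max u v}) :
    toGrp (tensor A B) ⟶ heisSheaf A B where
  hom :=
    { app := fun U => GrpCat.ofHom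
        { toFun := fun t : Multiplicative ((tensor A B).obj.obj U) =>
            (⟨0, 0, t.toAdd⟩ : Heis A B U)
          map_one' := rfl
          map_mul' := fun x y => Heis.ext (add_zero _).symm (add_zero _).symm (by
            change x.toAdd + y.toAdd = x.toAdd + y.toAdd + tmul 0 0
            rw [Heis.zero_tmul, add_zero]) }
      naturality := fun U V i => by
        ext1; ext1 t
        exact Heis.ext (map_zero (A.obj.map i).hom).symm (map_zero (B.obj.map i).hom).symm rfl }

/-- The homomorphism `H_{A,B} ⟶ A × B`, `(a, b, t) ↦ (a, b)`. -/
noncomputable def heisProj (A B : Sheaf J AddCommGrpCat.{max u v}) :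
    heisSheaf A B ⟶ prodGrp (toGrp A) (toGrp B) where
  hom :=
    { app := fun U => GrpCat.ofHom
        { toFun := fun x : Heis A B U =>
            ((Multiplicative.ofAdd x.a, Multiplicative.ofAdd x.b) :
              Multiplicative (A.obj.obj U) × Multiplicative (B.obj.obj U))
          map_one' := rfl
          map_mul' := fun _ _ => rfl }
      naturality := fun _ _ _ => rfl }

/-- The Heisenberg central extension of `A × B` by `A ⊗ B`. -/
noncomputable def heisenberg (A B : Sheaf J AddCommGrpCat.{max u v}) :
    CentralExtension (tensor A B) (prodGrp (toGrp A) (toGrp B)) where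
  E := heisSheaf A B
  ι := heisInl A B
  π := heisProj A B
  injective U x y h := congrArg (fun z : Heis A B U => z.t) h
  exact U x := by
    constructor
    · intro h
      have h1 : (x : Heis A B U).a = 0 := congrArg Prod.fst h
      have h2 : (x : Heis A B U).b = 0 := congrArg Prod.snd h
      exact ⟨(x : Heis A B U).t, Heis.ext h1.symm h2.symm rfl⟩
    · rintro ⟨t, rfl⟩
      rfl
  surjective := ⟨fun {U} s => J.superset_covering (fun V i _ =>
    ⟨(⟨A.obj.map i.op s.1.toAdd, B.obj.map i.op s.2.toAdd, 0⟩ : Heis A B (op V)), rfl⟩)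
    (J.top_mem _)⟩
  central U t x := Heis.ext (add_comm (0 : A.obj.obj U) _) (add_comm (0 : B.obj.obj U) _) (by
    change Multiplicative.toAdd (show Multiplicative ((tensor A B).obj.obj U) from t) +
      (x : Heis A B U).t + tmul 0 (x : Heis A B U).b =
      (x : Heis A B U).t + Multiplicative.toAdd (show Multiplicative ((tensor A B).obj.obj U) from t) +
      tmul (x : Heis A B U).a 0
    rw [Heis.zero_tmul, Heis.tmul_zero, add_zero, add_zero, add_comm])

/-- A short exact sequence `0 ⟶ A ⟶ I ⟶ Q ⟶ 0` of abelian sheaves, viewed as a central extension. -/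
noncomputable def CentralExtension.ofShortExact
    (S : ShortComplex (Sheaf J AddCommGrpCat.{max u v}))
    (hS : S.ShortExact) : CentralExtension S.X₁ (toGrp S.X₃) where
  E := toGrp S.X₂
  ι := toGrpMap S.f
  π := toGrpMap S.g
  injective U := injective_of_shortExact hS U
  exact U x := exact_of_shortExact hS U (Multiplicative.toAdd x)
  surjective := ⟨fun s => (locallySurjective_of_shortExact hS).imageSieve_mem s.toAdd⟩
  central U _ _ := add_comm (G := S.X₂.obj.obj U) _ _

end Groups

section Torsors
universe w v₁ u₁ v₂ u₂
variable {D : Type u₁} [Category.{v₁} D] {K : GrothendieckTopology D}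
  {D' : Type u₂} [Category.{v₂} D'] {K' : GrothendieckTopology D'}

/-- A sheaf of sets with a right action of a presheaf of groups `G`. -/
structure GSheaf (K : GrothendieckTopology D) (G : Dᵒᵖ ⥤ GrpCat.{w}) where
  carrier : Sheaf K (Type w)
  act : ∀ {U : Dᵒᵖ}, carrier.obj.obj U → G.obj U → carrier.obj.obj U
  act_one : ∀ {U : Dᵒᵖ} (x : carrier.obj.obj U), act x 1 = x
  act_mul : ∀ {U : Dᵒᵖ} (x : carrier.obj.obj U) (g h : G.obj U),
    act x (g * h) = act (act x g) h
  map_act : ∀ {U V : Dᵒᵖ} (i : U ⟶ V) (x : carrier.obj.obj U) (g : G.obj U),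
    carrier.obj.map i (act x g) = act (carrier.obj.map i x) (G.map i g)

/-- A right `G`-torsor: a sheaf with a right action of `G` that locally has sections and on whose
sections `G` acts simply transitively. -/
structure GSheaf.IsTorsor {G : Dᵒᵖ ⥤ GrpCat.{w}} (P : GSheaf K G) : Prop where
  locally_nonempty : ∀ U : D, ∃ S ∈ K U, ∀ ⦃V : D⦄ (i : V ⟶ U), S i →
    Nonempty (P.carrier.obj.obj (op V))
  simply_transitive : ∀ {U : Dᵒᵖ} (x y : P.carrier.obj.obj U), ∃! g : G.obj U, P.act x g = y

/-- The pullback of a sheaf with `G`-action along a continuous functor. -/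
def GSheaf.comap (F : D ⥤ D') [F.IsContinuous K K'] {G : D'ᵒᵖ ⥤ GrpCat.{w}} (P : GSheaf K' G) :
    GSheaf K (F.op ⋙ G) where
  carrier := (F.sheafPushforwardContinuous (Type w) K K').obj P.carrier
  act {U} x g := P.act (U := op (F.obj U.unop)) x g
  act_one x := P.act_one x
  act_mul x g h := P.act_mul x g h
  map_act i x g := P.map_act (F.op.map i) x g

theorem GSheaf.IsTorsor.comap (F : D ⥤ D') [F.IsContinuous K K'] [F.IsCocontinuous K K']
    {G : D'ᵒᵖ ⥤ GrpCat.{w}} {P : GSheaf K' G} (h : P.IsTorsor) : (P.comap (K := K) F).IsTorsor where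
  locally_nonempty U := by
    obtain ⟨S, hS, h'⟩ := h.locally_nonempty (F.obj U)
    exact ⟨S.functorPullback F, F.cover_lift K K' hS, fun V i hi => h' (F.map i) hi⟩
  simply_transitive x y := h.simply_transitive x y

/-- The sheaf with `G`-action deduced from a sheaf with `G'`-action and a homomorphism `G ⟶ G'`. -/
def GSheaf.res {G G' : Dᵒᵖ ⥤ GrpCat.{w}} (φ : G ⟶ G') (P : GSheaf K G') : GSheaf K G where
  carrier := P.carrier
  act {U} x g := P.act x (φ.app U g)
  act_one {U} x := (congrArg (P.act x) (map_one (φ.app U).hom)).trans (P.act_one x)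
  act_mul {U} x g h := (congrArg (P.act x) (map_mul (φ.app U).hom g h)).trans (P.act_mul x _ _)
  map_act i x g := (P.map_act i x _).trans
    (congrArg (P.act (P.carrier.obj.map i x)) (NatTrans.naturality_apply φ i g).symm)

/-- Equivariant maps. -/
@[ext]
structure GSheafHom {G : Dᵒᵖ ⥤ GrpCat.{w}} (P Q : GSheaf K G) where
  hom : P.carrier.obj ⟶ Q.carrier.obj
  map_act : ∀ {U : Dᵒᵖ} (x : P.carrier.obj.obj U) (g : G.obj U),
    hom.app U (P.act x g) = Q.act (hom.app U x) g

namespace GSheafHom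
variable {G : Dᵒᵖ ⥤ GrpCat.{w}} {P Q R : GSheaf K G}

/-- The identity. -/
def id (P : GSheaf K G) : GSheafHom P P := ⟨𝟙 _, fun _ _ => rfl⟩

/-- Composition of equivariant maps. -/
def comp (φ : GSheafHom P Q) (ψ : GSheafHom Q R) : GSheafHom P R :=
  ⟨φ.hom ≫ ψ.hom, fun {U} x g => (congrArg (ψ.hom.app U) (φ.map_act x g)).trans (ψ.map_act _ _)⟩

/-- The pullback of an equivariant map along a continuous functor. -/
def comap (F : D ⥤ D') [F.IsContinuous K K'] {G : D'ᵒᵖ ⥤ GrpCat.{w}} {P Q : GSheaf K' G}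
    (φ : GSheafHom P Q) : GSheafHom (P.comap (K := K) F) (Q.comap (K := K) F) :=
  ⟨Functor.whiskerLeft F.op φ.hom, fun x g => φ.map_act x g⟩

end GSheafHom

/-- The trivial torsor: `G` acting on itself by right multiplication. -/
def GSheaf.trivial {G : Dᵒᵖ ⥤ GrpCat.{w}} (hG : Presheaf.IsSheaf K (G ⋙ forget GrpCat.{w})) :
    GSheaf K G where
  carrier := ⟨G ⋙ forget GrpCat.{w}, hG⟩
  act {U} (x : G.obj U) g := (x * g : G.obj U)
  act_one {U} (x : G.obj U) := mul_one x
  act_mul {U} (x : G.obj U) g h := (mul_assoc x g h).symm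
  map_act {U _} i (x : G.obj U) g := map_mul (G.map i).hom x g

/-- The one-point sheaf with the trivial action of `G`. -/
def GSheaf.point (K : GrothendieckTopology D) (G : Dᵒᵖ ⥤ GrpCat.{w}) : GSheaf K G where
  carrier := ⟨(Functor.const _).obj PUnit.{w + 1}, by
    rw [isSheaf_iff_isSheaf_of_type]
    intro X S _ x _
    exact ⟨PUnit.unit, fun _ _ _ => rfl, fun _ _ => rfl⟩⟩
  act _ _ := PUnit.unit
  act_one _ := rfl
  act_mul _ _ _ := rfl
  map_act _ _ _ := rfl

end Torsors

section Lifts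
variable {C : Type u} [Category.{v} C] {J : GrothendieckTopology C}

/-- The product of torsors (or of sheaves with action) for `G₁` and `G₂`, with its action of
`G₁ × G₂`. -/
def GSheaf.prod {G₁ G₂ : Sheaf J GrpCat.{max u v}} (P : GSheaf J G₁.obj) (Q : GSheaf J G₂.obj) :
    GSheaf J (prodGrp G₁ G₂).obj where
  carrier := ⟨
    { obj := fun U => P.carrier.obj.obj U × Q.carrier.obj.obj U
      map := fun i => ↾(Prod.map (P.carrier.obj.map i) (Q.carrier.obj.map i))
      map_id := fun U => by
        refine ConcreteCategory.hom_ext _ _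
          fun (x : P.carrier.obj.obj _ × Q.carrier.obj.obj _) => ?_
        have h₁ := ConcreteCategory.congr_hom (P.carrier.obj.map_id U) x.1
        have h₂ := ConcreteCategory.congr_hom (Q.carrier.obj.map_id U) x.2
        exact Prod.ext h₁ h₂
      map_comp := fun i j => by
        refine ConcreteCategory.hom_ext _ _
          fun (x : P.carrier.obj.obj _ × Q.carrier.obj.obj _) => ?_
        have h₁ := ConcreteCategory.congr_hom (P.carrier.obj.map_comp i j) x.1
        have h₂ := ConcreteCategory.congr_hom (Q.carrier.obj.map_comp i j) x.2
        exact Prod.ext h₁ h₂ },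
    isSheaf_of_prod (F₁ := P.carrier.obj) (F₂ := Q.carrier.obj)
      { app := fun U => ↾(fun x : P.carrier.obj.obj U × Q.carrier.obj.obj U => x.1) }
      { app := fun U => ↾(fun x : P.carrier.obj.obj U × Q.carrier.obj.obj U => x.2) }
      (fun U => Function.bijective_id) P.carrier.property Q.carrier.property⟩
  act x g := (P.act x.1 g.1, Q.act x.2 g.2)
  act_one x := Prod.ext (P.act_one x.1) (Q.act_one x.2)
  act_mul x g h := Prod.ext (P.act_mul x.1 g.1 h.1) (Q.act_mul x.2 g.2 h.2)
  map_act i x g := Prod.ext (P.map_act i x.1 g.1) (Q.map_act i x.2 g.2)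

variable {E : Sheaf J GrpCat.{max u v}}

/-- The restriction of a sheaf with action to the slice site `C / U`. -/
abbrev GSheaf.over (T : GSheaf J E.obj) (U : C) :
    GSheaf (J.over U) ((Over.forget U).op ⋙ E.obj) :=
  T.comap (Over.forget U)

/-- The restriction from the slice over `U` to the slice over `V`, for `f : V ⟶ U`. -/
abbrev GSheaf.restrict {U V : C} (f : V ⟶ U)
    (R : GSheaf (J.over U) ((Over.forget U).op ⋙ E.obj)) :
    GSheaf (J.over V) ((Over.forget V).op ⋙ E.obj) :=
  R.comap (K := J.over V) (Over.map f)

/-- For a sheaf `T` with action of `E`, an object over `U`: an `E`-torsor `R` on `C / U` with an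
equivariant map `R ⟶ T`. -/
structure LiftObj (T : GSheaf J E.obj) (U : C) where
  R : GSheaf (J.over U) ((Over.forget U).op ⋙ E.obj)
  isTorsor : R.IsTorsor
  lam : GSheafHom R (T.over U)

namespace LiftObj
variable {T : GSheaf J E.obj} {U V : C}

/-- Morphisms: equivariant maps compatible with the maps to `T`. -/
@[ext]
structure Hom (x y : LiftObj T U) where
  toHom : GSheafHom x.R y.R
  comm : toHom.hom ≫ y.lam.hom = x.lam.hom

instance : Category (LiftObj T U) where
  Hom x y := Hom x y
  id x := ⟨GSheafHom.id x.R, Category.id_comp _⟩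
  comp φ ψ := ⟨φ.toHom.comp ψ.toHom, (Category.assoc _ _ _).trans
    ((congrArg _ ψ.comm).trans φ.comm)⟩

/-- The effect of a morphism on sections. -/
def Hom.ap {x y : LiftObj T U} (φ : x ⟶ y) {X : (Over U)ᵒᵖ} (r : x.R.carrier.obj.obj X) :
    y.R.carrier.obj.obj X := (φ : Hom x y).toHom.hom.app X r

theorem hom_ext {x y : LiftObj T U} {φ ψ : x ⟶ y}
    (h : ∀ (X : (Over U)ᵒᵖ) (r : x.R.carrier.obj.obj X), Hom.ap φ r = Hom.ap ψ r) : φ = ψ :=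
  Hom.ext (GSheafHom.ext (by ext X r; exact h X r))

/-- The restriction of lifts along `f : V ⟶ U`. -/
def pull (f : V ⟶ U) : LiftObj T U ⥤ LiftObj T V where
  obj x := ⟨x.R.restrict f, x.isTorsor.comap (Over.map f), x.lam.comap (Over.map f)⟩
  map φ := ⟨φ.toHom.comap (Over.map f),
    congrArg (Functor.whiskerLeft (Over.map f).op) φ.comm⟩

/-- Isomorphisms of lifts given by restriction along isomorphisms in slices. -/
def isoOfMap {x y : LiftObj T U} (e : x.R.carrier.obj ≅ y.R.carrier.obj)
    (h : ∀ {X : (Over U)ᵒᵖ} (r : x.R.carrier.obj.obj X) (g : E.obj.obj (op X.unop.left)),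
      e.hom.app X (x.R.act r g) = y.R.act (e.hom.app X r) g)
    (h' : e.hom ≫ y.lam.hom = x.lam.hom) : x ≅ y where
  hom := ⟨⟨e.hom, h⟩, h'⟩
  inv := ⟨⟨e.inv, fun {X} r g => by
    have e1 : ∀ s, e.inv.app X (e.hom.app X s) = s := fun s =>
      ConcreteCategory.congr_hom (congr_app e.hom_inv_id X) s
    have e2 : ∀ s, e.hom.app X (e.inv.app X s) = s := fun s =>
      ConcreteCategory.congr_hom (congr_app e.inv_hom_id X) s
    have h1 := h (e.inv.app X r) g
    rw [e2] at h1
    exact (congrArg (e.inv.app X) h1).symm.trans (e1 _)⟩, by rw [← h', Iso.inv_hom_id_assoc]⟩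
  hom_inv_id := Hom.ext (GSheafHom.ext e.hom_inv_id)
  inv_hom_id := Hom.ext (GSheafHom.ext e.inv_hom_id)

theorem lam_map (x : LiftObj T U) {X Y : Over U} (i : X ⟶ Y) (r : x.R.carrier.obj.obj (op Y)) :
    x.lam.hom.app (op X) (x.R.carrier.obj.map i.op r) =
      T.carrier.obj.map i.left.op (x.lam.hom.app (op Y) r) :=
  NatTrans.naturality_apply x.lam.hom i.op r

theorem ap_map {x y : LiftObj T U} (φ : x ⟶ y) {X Y : Over U} (i : X ⟶ Y)
    (r : x.R.carrier.obj.obj (op Y)) :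
    Hom.ap φ (x.R.carrier.obj.map i.op r) = y.R.carrier.obj.map i.op (Hom.ap φ r) :=
  NatTrans.naturality_apply (Hom.toHom φ).hom i.op r

theorem map_id_apply {D : Type*} [Category* D] {W : Type*} [Category* W] {FF : W → W → Type*}
    {CC : W → Type*} [∀ X Y, FunLike (FF X Y) (CC X) (CC Y)] [ConcreteCategory W FF] (F : D ⥤ W)
    (X : D) (r : ToType (F.obj X)) : F.map (𝟙 X) r = r := by
  simp

/-- Restriction along the identity, on objects. -/
def pullIdApp (x : LiftObj T U) : (pull (𝟙 U)).obj x ≅ x :=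
  isoOfMap (Functor.isoWhiskerRight (NatIso.op (Over.mapId U)).symm x.R.carrier.obj)
    (fun {X} r g => (x.R.map_act ((Over.mapId U).inv.app X.unop).op r g).trans
      (congrArg (x.R.act _) (map_id_apply E.obj (op X.unop.left) g)))
    (by
      ext X r
      exact (lam_map x ((Over.mapId U).inv.app X.unop) r).trans (map_id_apply T.carrier.obj _ _))

/-- Restriction along the identity is isomorphic to the identity. -/
def pullId (T : GSheaf J E.obj) (U : C) : pull (T := T) (𝟙 U) ≅ 𝟭 _ :=
  NatIso.ofComponents pullIdApp (fun {x y} φ => hom_ext fun X r =>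
    (ap_map φ ((Over.mapId U).inv.app X.unop) r).symm)

/-- Restriction along a composition, on objects. -/
def pullCompApp {W : C} (f : W ⟶ V) (g : V ⟶ U) (x : LiftObj T U) :
    (pull (f ≫ g)).obj x ≅ (pull f).obj ((pull g).obj x) :=
  isoOfMap (Functor.isoWhiskerRight (NatIso.op (Over.mapComp f g)).symm x.R.carrier.obj)
    (fun {X} r k => (x.R.map_act ((Over.mapComp f g).inv.app X.unop).op r k).trans
      (congrArg (x.R.act _) (map_id_apply E.obj (op X.unop.left) k)))
    (by
      ext X r
      exact (lam_map x ((Over.mapComp f g).inv.app X.unop) r).trans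
        (map_id_apply T.carrier.obj _ _))

/-- Restriction along a composition is isomorphic to the composition of restrictions. -/
def pullComp (T : GSheaf J E.obj) {W : C} (f : W ⟶ V) (g : V ⟶ U) :
    pull (T := T) (f ≫ g) ≅ pull g ⋙ pull f :=
  NatIso.ofComponents (pullCompApp f g) (fun {x y} φ => hom_ext fun X r =>
    (ap_map φ ((Over.mapComp f g).inv.app X.unop) r).symm)

theorem ap_eqToHom {f f' : V ⟶ U} (h : f = f')
    (h' : (pull (T := T) f).toCatHom = (pull f').toCatHom)
    (x : LiftObj T U) (X : (Over V)ᵒᵖ) (r : ((pull f).obj x).R.carrier.obj.obj X) :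
    Hom.ap ((eqToHom h').toNatTrans.app x) r = x.R.carrier.obj.map
      (Over.homMk (𝟙 _) (by subst h; exact Category.id_comp _) :
        (Over.map f').obj X.unop ⟶ (Over.map f).obj X.unop).op r := by
  subst h
  refine (map_id_apply x.R.carrier.obj _ r).symm.trans ?_
  congr 2

theorem map_map (x : LiftObj T U) {X Y Z : (Over U)ᵒᵖ} (i : X ⟶ Y) (j : Y ⟶ Z)
    (r : x.R.carrier.obj.obj X) :
    x.R.carrier.obj.map j (x.R.carrier.obj.map i r) = x.R.carrier.obj.map (i ≫ j) r :=
  (ConcreteCategory.congr_hom (x.R.carrier.obj.map_comp i j) r).symm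

theorem map_congr (x : LiftObj T U) {X Y : (Over U)ᵒᵖ} (i j : X ⟶ Y)
    (h : i.unop.left = j.unop.left) (r : x.R.carrier.obj.obj X) :
    x.R.carrier.obj.map i r = x.R.carrier.obj.map j r := by
  obtain rfl : i = j := Quiver.Hom.unop_inj (Over.OverMorphism.ext h)
  rfl

/-- The pseudofunctor `U ↦ LiftObj T U`. -/
def pseudofunctor (T : GSheaf J E.obj) :
    LocallyDiscrete Cᵒᵖ ⥤ᵖ Cat.{max u v, (max u v) + 1} :=
  LocallyDiscrete.mkPseudofunctor (fun U => Cat.of (LiftObj T U.unop))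
    (fun f => (pull f.unop).toCatHom)
    (fun U => Cat.Hom.isoMk (pullId T U.unop))
    (fun f g => Cat.Hom.isoMk (pullComp T g.unop f.unop))
    (fun f g h => by
      ext1; ext1; ext1 x
      refine hom_ext fun X r => ?_
      refine Eq.trans ?_ (ap_eqToHom (by simp) _ x X r).symm
      change x.R.carrier.obj.map _ (x.R.carrier.obj.map _ (x.R.carrier.obj.map _
        (x.R.carrier.obj.map _ r))) = _
      refine (congrArg _ ((congrArg _ (map_map _ _ _ _)).trans (map_map _ _ _ _))).trans
        ((map_map _ _ _ _).trans ?_)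
      refine map_congr (x : LiftObj T _) _ _ ?_ r
      simp)
    (fun f => by
      ext1; ext1; ext1 x
      refine hom_ext fun X r => ?_
      refine Eq.trans ?_ (ap_eqToHom (by simp) _ x X r).symm
      change x.R.carrier.obj.map _ (x.R.carrier.obj.map _ r) = _
      refine (map_map _ _ _ _).trans ?_
      refine map_congr (x : LiftObj T _) _ _ ?_ r
      simp)
    (fun f => by
      ext1; ext1; ext1 x
      refine hom_ext fun X r => ?_
      refine Eq.trans ?_ (ap_eqToHom (by simp) _ x X r).symm
      change x.R.carrier.obj.map _ (x.R.carrier.obj.map _ r) = _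
      refine (map_map _ _ _ _).trans ?_
      refine map_congr (x : LiftObj T _) _ _ ?_ r
      simp)

end LiftObj
end Lifts

section Gerbes
variable {C : Type u} [Category.{v} C] {J : GrothendieckTopology C}

/-- A pseudofunctor together with, for every object `x` over `U`, a map `A(U) ⟶ End(x)`. -/
structure BandedPseudofunctor (A : Sheaf J AddCommGrpCat.{max u v}) where
  F : LocallyDiscrete Cᵒᵖ ⥤ᵖ Cat.{max u v, (max u v) + 1}
  band : ∀ {U : C} (x : F.obj ⟨op U⟩), A.obj.obj (op U) → (x ⟶ x)

/-- An abelian gerbe with band `A`: a stack in groupoids, locally non-empty and locally connected, with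
isomorphisms `A(U) ≅ Aut(x)` compatible with morphisms and with restriction. -/
structure BandedPseudofunctor.IsGerbe {A : Sheaf J AddCommGrpCat.{max u v}}
    (𝒢 : BandedPseudofunctor A) : Prop where
  isStack : 𝒢.F.IsStack J
  isIso : ∀ {U : C} {x y : 𝒢.F.obj ⟨op U⟩} (φ : x ⟶ y), IsIso φ
  locally_nonempty : ∀ U : C, ∃ S ∈ J U, ∀ ⦃V : C⦄ (i : V ⟶ U), S i →
    Nonempty (𝒢.F.obj ⟨op V⟩)
  locally_connected : ∀ {U : C} (x y : 𝒢.F.obj ⟨op U⟩), ∃ S ∈ J U, ∀ ⦃V : C⦄ (i : V ⟶ U), S i →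
    Nonempty ((𝒢.F.map i.op.toLoc).toFunctor.obj x ⟶ (𝒢.F.map i.op.toLoc).toFunctor.obj y)
  band_bijective : ∀ {U : C} (x : 𝒢.F.obj ⟨op U⟩), Function.Bijective (𝒢.band x)
  band_add : ∀ {U : C} (x : 𝒢.F.obj ⟨op U⟩) (a b : A.obj.obj (op U)),
    𝒢.band x (a + b) = 𝒢.band x a ≫ 𝒢.band x b
  band_naturality : ∀ {U : C} {x y : 𝒢.F.obj ⟨op U⟩} (φ : x ⟶ y) (a : A.obj.obj (op U)),
    φ ≫ 𝒢.band y a = 𝒢.band x a ≫ φ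
  map_band : ∀ {U V : C} (i : V ⟶ U) (x : 𝒢.F.obj ⟨op U⟩) (a : A.obj.obj (op U)),
    (𝒢.F.map i.op.toLoc).toFunctor.map (𝒢.band x a) =
      𝒢.band ((𝒢.F.map i.op.toLoc).toFunctor.obj x) (A.obj.map i.op a)

/-- An equivalence of gerbes with band `A` (inducing the identity of `A` on the bands). -/
structure BandedEquiv {A : Sheaf J AddCommGrpCat.{max u v}} (𝒢 ℋ : BandedPseudofunctor A) where
  trans : Pseudofunctor.StrongTrans 𝒢.F ℋ.F
  isEquivalence : ∀ U : C, (trans.app ⟨op U⟩).toFunctor.IsEquivalence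
  map_band : ∀ {U : C} (x : 𝒢.F.obj ⟨op U⟩) (a : A.obj.obj (op U)),
    (trans.app ⟨op U⟩).toFunctor.map (𝒢.band x a) =
      ℋ.band ((trans.app ⟨op U⟩).toFunctor.obj x) a

/-- The pseudofunctor of lifts, for a sheaf `T` with action of `E`, with the action of a sheaf of abelian groups
mapping to the center of `E` and acting trivially on `T`: the section `a` acts as `r ↦ r · a`. -/
def bandedLifts {A : Sheaf J AddCommGrpCat.{max u v}} {E : Sheaf J GrpCat.{max u v}}
    (T : GSheaf J E.obj) (ι : toGrp A ⟶ E)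
    (central : ∀ (U : Cᵒᵖ) (a : (toGrp A).obj.obj U) (x : E.obj.obj U),
      ι.hom.app U a * x = x * ι.hom.app U a)
    (triv : ∀ (U : Cᵒᵖ) (a : (toGrp A).obj.obj U) (t : T.carrier.obj.obj U),
      T.act t (ι.hom.app U a) = t) : BandedPseudofunctor A where
  F := LiftObj.pseudofunctor T
  band {U} x a :=
    let a' (X : (Over U)ᵒᵖ) : E.obj.obj (op X.unop.left) := ι.hom.app (op X.unop.left)
      (Multiplicative.ofAdd (A.obj.map X.unop.hom.op a))
    let x' : LiftObj T U := x
    (⟨⟨{ app := fun X => ↾(fun r => x'.R.act r (a' X))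
         naturality := fun X Y i => by
          refine ConcreteCategory.hom_ext _ _ fun (r : x'.R.carrier.obj.obj X) => ?_
          refine Eq.symm ((x'.R.map_act i r (a' X)).trans
            (congrArg (x'.R.act (x'.R.carrier.obj.map i r)) ?_))
          refine (NatTrans.naturality_apply ι.hom i.unop.left.op _).symm.trans
            (congrArg (ι.hom.app (op Y.unop.left)) (congrArg Multiplicative.ofAdd ?_))
          refine (ConcreteCategory.congr_hom (A.obj.map_comp _ _) a).symm.trans ?_
          exact congrArg (fun k => A.obj.map k a) (Quiver.Hom.unop_inj (Over.w i.unop)) },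
        fun {X} r g => (x'.R.act_mul r g (a' X)).symm.trans
          ((congrArg (x'.R.act r) (central _ _ _).symm).trans (x'.R.act_mul r (a' X) g))⟩, by
        ext X r
        exact (x'.lam.map_act r (a' X)).trans (triv _ _ _)⟩ : LiftObj.Hom x' x')

/-- The gerbe of lifts of a `G`-torsor `T` along a central extension of `G` by `A`: its objects over
`U` are pairs of an `E`-torsor `R` on `C / U` and an equivariant map `R ⟶ T`. -/
def CentralExtension.lifts {A : Sheaf J AddCommGrpCat.{max u v}} {G : Sheaf J GrpCat.{max u v}}
    (𝓔 : CentralExtension A G) (T : GSheaf J G.obj) : BandedPseudofunctor A :=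
  bandedLifts (T.res 𝓔.π.hom) 𝓔.ι 𝓔.central
    (fun U a t => (congrArg (T.act t) ((𝓔.exact U _).2 ⟨a, rfl⟩)).trans (T.act_one t))

/-- The stack of `A`-torsors (described as torsors with a map to the point). -/
def torsorStack (A : Sheaf J AddCommGrpCat.{max u v}) : BandedPseudofunctor A :=
  bandedLifts (GSheaf.point J (toGrp A).obj) (𝟙 _)
    (fun U a x => add_comm (G := A.obj.obj U) _ _) (fun _ _ _ => rfl)

/-- `γ ∈ H¹(A)` is the class of the `A`-torsor `P`: there is an extension `0 ⟶ A ⟶ E ⟶ ℤ ⟶ 0` of class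
`γ` whose torsor of sections of `E` over `1` is `P`. -/
def GSheaf.HasClass {A : Sheaf J AddCommGrpCat.{max u v}} (P : GSheaf J (toGrp A).obj)
    (γ : A.H 1) : Prop :=
  ∃ (S : ZExtension A) (φ : P.carrier.obj ⟶ S.E.obj ⋙ forget AddCommGrpCat.{max u v}),
    S.cls = γ ∧
    (∀ (U : Cᵒᵖ) (x : P.carrier.obj.obj U) (a : A.obj.obj U),
      (show S.E.obj.obj U from φ.app U (P.act x (Multiplicative.ofAdd a))) =
        (show S.E.obj.obj U from φ.app U x) + S.i.hom.app U a) ∧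
    ∀ (U : Cᵒᵖ) (x : P.carrier.obj.obj U),
      S.p.hom.app U (show S.E.obj.obj U from φ.app U x) = oneSection J U

/-- `x ∈ H²(A)` is the class of the gerbe `𝒢` with band `A`: there are a short exact sequence
`0 ⟶ A ⟶ I ⟶ Q ⟶ 0` of abelian sheaves and a `Q`-torsor `T` such that `𝒢` is equivalent to the
gerbe of lifts of `T` to an `I`-torsor, and `x` is the image of the class of `T` under the connecting
map `H¹(Q) ⟶ H²(A)`. -/
def BandedPseudofunctor.HasClass {A : Sheaf J AddCommGrpCat.{max u v}}
    (𝒢 : BandedPseudofunctor A) (x : A.H 2) : Prop :=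
  ∃ (I Q : Sheaf J AddCommGrpCat.{max u v}) (f : A ⟶ I) (g : I ⟶ Q) (zero : f ≫ g = 0)
    (hS : (ShortComplex.mk f g zero).ShortExact) (T : GSheaf J (toGrp Q).obj) (t : Q.H 1),
    T.IsTorsor ∧ T.HasClass t ∧
      Nonempty (BandedEquiv 𝒢 ((CentralExtension.ofShortExact _ hS).lifts T)) ∧
      x = Abelian.Ext.comp t hS.extClass rfl

/-- Isomorphic sheaves with action. -/
def GSheaf.Isomorphic {G : Cᵒᵖ ⥤ GrpCat.{max u v}} (P Q : GSheaf J G) : Prop :=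
  ∃ φ : GSheafHom P Q, IsIso φ.hom

/-- A torsor is trivial if it is isomorphic to the group acting on itself by translations. -/
def GSheaf.IsTrivial {A : Sheaf J AddCommGrpCat.{max u v}} (P : GSheaf J (toGrp A).obj) : Prop :=
  GSheaf.Isomorphic (GSheaf.trivial (isSheaf_underlying_group (toGrp A))) P

/-- The gerbe `𝒢_{P,Q}` of local lifts of the `A × B`-torsor `P × Q` to a torsor under the Heisenberg
sheaf. -/
noncomputable def heisenbergGerbe {A B : Sheaf J AddCommGrpCat.{max u v}}
    (P : GSheaf J (toGrp A).obj) (Q : GSheaf J (toGrp B).obj) :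
    BandedPseudofunctor (tensor A B) :=
  (heisenberg A B).lifts (P.prod Q)

/-- The boundary map `∂ : H¹(A) × H¹(B) = H¹(A × B) ⟶ H²(A ⊗ B)` of the Heisenberg extension, as a
relation: `x = ∂ (γ, δ)` if `x` is the class of the gerbe of lifts of an `A × B`-torsor `T` which
corresponds to `(γ, δ)`. -/
def IsHeisenbergBoundary {A B : Sheaf J AddCommGrpCat.{max u v}} (γ : A.H 1) (δ : B.H 1)
    (x : (tensor A B).H 2) : Prop :=
  ∃ (T : GSheaf J (prodGrp (toGrp A) (toGrp B)).obj) (P : GSheaf J (toGrp A).obj)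
    (Q : GSheaf J (toGrp B).obj), P.IsTorsor ∧ P.HasClass γ ∧ Q.IsTorsor ∧ Q.HasClass δ ∧
      T.Isomorphic (P.prod Q) ∧ ((heisenberg A B).lifts T).HasClass x

/-- The homomorphism `B ⟶ ℤ ⊗ B`, `b ↦ 1 ⊗ b`. -/
noncomputable def oneTmul (B : Sheaf J AddCommGrpCat.{max u v}) : B ⟶ tensor (constZ J) B where
  hom :=
    { app := fun U => AddCommGrpCat.ofHom
        (AddMonoidHom.mk' (fun b => tmul (oneSection J U) b) (tmul_add _))
      naturality := fun U V i => by
        ext b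
        exact ((map_tmul i (oneSection J U) b).trans
          (congrArg (fun s => tmul s (B.obj.map i b)) (map_oneSection i))).symm }

/-- The extension `S ⊗ B` of `ℤ ⊗ B` by `A ⊗ B`, for an extension `S` of `ℤ` by `A`, is exact. -/
theorem ZExtension.tensor_shortExact {A : Sheaf J AddCommGrpCat.{max u v}} (S : ZExtension A)
    (B : Sheaf J AddCommGrpCat.{max u v}) :
    (tensorShortComplex (ShortComplex.mk S.i S.p S.zero) B).ShortExact :=
  tensorShortComplex_shortExact S.shortExact (constZ_torsionFree (J := J)) B

/-- The cup product `H¹(A) × H¹(B) ⟶ H²(A ⊗ B)`, as a Yoneda product: `γ ∪ δ` is the product of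
`δ ∈ Ext¹(ℤ, B)` with `γ ⊗ B ∈ Ext¹(B, A ⊗ B)`, the class of the extension
`0 ⟶ A ⊗ B ⟶ E ⊗ B ⟶ ℤ ⊗ B = B ⟶ 0` deduced from an extension `0 ⟶ A ⟶ E ⟶ ℤ ⟶ 0` of class `γ`. -/
noncomputable def cup {A B : Sheaf J AddCommGrpCat.{max u v}} (γ : A.H 1) (δ : B.H 1) :
    (tensor A B).H 2 :=
  Abelian.Ext.comp δ (Abelian.Ext.comp (Abelian.Ext.mk₀ (oneTmul B))
    ((ZExtension.exists_cls_eq γ).choose.tensor_shortExact B).extClass (zero_add 1)) rfl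

end Gerbes

section Functoriality

/-- Two abelian sheaves with a torsor for each. -/
structure TorsorPair {C : Type u} [Category.{v} C] (J : GrothendieckTopology C) where
  A : Sheaf J AddCommGrpCat.{max u v}
  B : Sheaf J AddCommGrpCat.{max u v}
  P : GSheaf J (toGrp A).obj
  Q : GSheaf J (toGrp B).obj
  hP : P.IsTorsor
  hQ : Q.IsTorsor

variable {C : Type u} [Category.{v} C] {J : GrothendieckTopology C}
  {D : Type u} [Category.{v} D] {K : GrothendieckTopology D}
  {D' : Type u} [Category.{v} D'] {K' : GrothendieckTopology D'}

/-- A morphism of torsor pairs over a functor `F : C ⥤ D`: homomorphisms `α : A ⟶ F_* A'`,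
`β : B ⟶ F_* B'` and equivariant maps `p : P ⟶ F_* P'`, `q : Q ⟶ F_* Q'`. -/
structure TorsorPairHom (F : C ⥤ D) (X : TorsorPair J) (Y : TorsorPair K) where
  α : X.A.obj ⟶ F.op ⋙ Y.A.obj
  β : X.B.obj ⟶ F.op ⋙ Y.B.obj
  p : X.P.carrier.obj ⟶ F.op ⋙ Y.P.carrier.obj
  q : X.Q.carrier.obj ⟶ F.op ⋙ Y.Q.carrier.obj
  p_act : ∀ (U : C) (x : X.P.carrier.obj.obj (op U)) (a : X.A.obj.obj (op U)),
    p.app (op U) (X.P.act x (Multiplicative.ofAdd a)) =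
      Y.P.act (U := op (F.obj U)) (p.app (op U) x) (Multiplicative.ofAdd (α.app (op U) a))
  q_act : ∀ (U : C) (x : X.Q.carrier.obj.obj (op U)) (b : X.B.obj.obj (op U)),
    q.app (op U) (X.Q.act x (Multiplicative.ofAdd b)) =
      Y.Q.act (U := op (F.obj U)) (q.app (op U) x) (Multiplicative.ofAdd (β.app (op U) b))

namespace TorsorPair

/-- The `A × B`-torsor `P × Q`. -/
def prod (X : TorsorPair J) : GSheaf J (prodGrp (toGrp X.A) (toGrp X.B)).obj := X.P.prod X.Q

/-- Local lifts of `P × Q` over `U` to a torsor under the Heisenberg sheaf. -/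
abbrev Lift (X : TorsorPair J) (U : C) :=
  LiftObj (X.prod.res (heisenberg X.A X.B).π.hom) U

/-- The gerbe `𝒢_{P,Q}`; its fibre over `U` is `X.Lift U`. -/
noncomputable abbrev gerbe (X : TorsorPair J) : BandedPseudofunctor (tensor X.A X.B) :=
  heisenbergGerbe X.P X.Q

end TorsorPair

namespace TorsorPairHom

/-- The identity. -/
def id (X : TorsorPair J) : TorsorPairHom (𝟭 C) X X where
  α := 𝟙 X.A.obj
  β := 𝟙 X.B.obj
  p := 𝟙 X.P.carrier.obj
  q := 𝟙 X.Q.carrier.obj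
  p_act _ _ _ := rfl
  q_act _ _ _ := rfl

variable {F : C ⥤ D} {G : D ⥤ D'} {X : TorsorPair J} {Y : TorsorPair K} {Z : TorsorPair K'}

/-- Composition. -/
def comp (f : TorsorPairHom F X Y) (g : TorsorPairHom G Y Z) : TorsorPairHom (F ⋙ G) X Z where
  α := f.α ≫ Functor.whiskerLeft F.op g.α
  β := f.β ≫ Functor.whiskerLeft F.op g.β
  p := f.p ≫ Functor.whiskerLeft F.op g.p
  q := f.q ≫ Functor.whiskerLeft F.op g.q
  p_act U x a := (congrArg (g.p.app (op (F.obj U))) (f.p_act U x a)).trans (g.p_act _ _ _)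
  q_act U x a := (congrArg (g.q.app (op (F.obj U))) (f.q_act U x a)).trans (g.q_act _ _ _)

/-- The homomorphism `A ⊗ B ⟶ F_* (A' ⊗ B')` on sections. -/
noncomputable def tensor (f : TorsorPairHom F X Y) [F.IsContinuous J K] (U : C) :
    (HeisenbergGerbe.tensor X.A X.B).obj.obj (op U) →+
      (HeisenbergGerbe.tensor Y.A Y.B).obj.obj (op (F.obj U)) :=
  ((tensorMapOver F f.α f.β).app (op U)).hom

/-- The homomorphism `H_{A,B} ⟶ F_* H_{A',B'}` on sections. -/
noncomputable def heis (f : TorsorPairHom F X Y) [F.IsContinuous J K] (U : C) :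
    Heis X.A X.B (op U) →* Heis Y.A Y.B (op (F.obj U)) :=
  Heis.map (f.α.app (op U)).hom (f.β.app (op U)).hom (f.tensor U)
    (tensorMapOver_tmul F f.α f.β)

theorem heis_id (X : TorsorPair J) (U : C) (h : Heis X.A X.B (op U)) :
    (TorsorPairHom.id X).heis (K := J) U h = h := by
  have e : tensorMapOver (J := J) (K := J) (𝟭 C) (𝟙 X.A.obj) (𝟙 X.B.obj) =
      𝟙 (HeisenbergGerbe.tensor X.A X.B).obj :=
    sheafify_hom_ext J _ _ (HeisenbergGerbe.tensor X.A X.B).property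
      ((toSheafify_sheafifyLift J _ _).trans
      ((congrArg (fun k => k ≫ toTensor X.A X.B) (presheafTensorMap_id X.A.obj X.B.obj)).trans
        ((Category.id_comp _).trans (Category.comp_id _).symm)))
  exact Heis.ext rfl rfl (ConcreteCategory.congr_hom (congr_app e (op U)) h.t)

theorem heis_comp [F.IsContinuous J K] [G.IsContinuous K K'] [(F ⋙ G).IsContinuous J K']
    (f : TorsorPairHom F X Y) (g : TorsorPairHom G Y Z) (U : C) (h : Heis X.A X.B (op U)) :
    (f.comp g).heis U h = g.heis (F.obj U) (f.heis U h) := by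
  have hs : Presheaf.IsSheaf J ((F ⋙ G).op ⋙ (HeisenbergGerbe.tensor Z.A Z.B).obj) :=
    (((F ⋙ G).sheafPushforwardContinuous AddCommGrpCat.{max u v} J K').obj
      (HeisenbergGerbe.tensor Z.A Z.B)).property
  have e : tensorMapOver (J := J) (K := K') (F ⋙ G) (f.comp g).α (f.comp g).β =
      (tensorMapOver F f.α f.β ≫ Functor.whiskerLeft F.op (tensorMapOver G g.α g.β) :
        (HeisenbergGerbe.tensor X.A X.B).obj ⟶
          (F ⋙ G).op ⋙ (HeisenbergGerbe.tensor Z.A Z.B).obj) := by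
    refine sheafify_hom_ext J _ _ hs ?_
    ext1
    funext V
    refine tensorHom_ext fun a b => ?_
    refine (tensorMapOver_tmul (J := J) (K := K') (F ⋙ G) (f.comp g).α (f.comp g).β a b).trans ?_
    refine Eq.symm ((congrArg ((tensorMapOver G g.α g.β).app (F.op.obj V))
      (tensorMapOver_tmul F f.α f.β a b)).trans ?_)
    exact tensorMapOver_tmul G g.α g.β _ _
  exact Heis.ext rfl rfl (ConcreteCategory.congr_hom (congr_app e (op U)) h.t)

end TorsorPairHom

/-- The canonical comparison between the two ways of mapping `C / V` to `D / F U`. -/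
def postMap (F : C ⥤ D) {U V : C} (i : V ⟶ U) :
    Over.post (X := V) F ⋙ Over.map (F.map i) ⟶ Over.map i ⋙ Over.post (X := U) F where
  app W := Over.homMk (𝟙 (F.obj W.left))
    ((Category.id_comp _).trans (F.map_comp W.hom i))
  naturality W W' j := by
    ext
    exact (Category.comp_id _).trans (Category.id_comp _).symm

variable {F : C ⥤ D} [F.IsContinuous J K] {G : D ⥤ D'} [G.IsContinuous K K']
  {X : TorsorPair J} {Y : TorsorPair K} {Z : TorsorPair K'}

/-- A map over `f` from a lift `x` over `U` to a lift `y` over `F U`: a map of sheaves `R ⟶ F_* R'`,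
equivariant for `H_{A,B} ⟶ F_* H_{A',B'}` and compatible with `P × Q ⟶ F_* (P' × Q')`. -/
@[ext]
structure LiftMap (f : TorsorPairHom F X Y) {U : C} (x : X.Lift U) (y : Y.Lift (F.obj U)) where
  hom : x.R.carrier.obj ⟶ (Over.post (X := U) F).op ⋙ y.R.carrier.obj
  map_act : ∀ (V : Over U) (r : x.R.carrier.obj.obj (op V)) (h : Heis X.A X.B (op V.left)),
    hom.app (op V) (x.R.act r h) =
      y.R.act (U := op ((Over.post F).obj V)) (hom.app (op V) r) (f.heis V.left h)
  comm : ∀ (V : Over U) (r : x.R.carrier.obj.obj (op V)),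
    (y.lam.hom.app (op ((Over.post F).obj V)) (hom.app (op V) r) :
      Y.P.carrier.obj.obj (op (F.obj V.left)) × Y.Q.carrier.obj.obj (op (F.obj V.left))) =
    (f.p.app (op V.left) (x.lam.hom.app (op V) r : X.P.carrier.obj.obj (op V.left) ×
        X.Q.carrier.obj.obj (op V.left)).1,
      f.q.app (op V.left) (x.lam.hom.app (op V) r : X.P.carrier.obj.obj (op V.left) ×
        X.Q.carrier.obj.obj (op V.left)).2)

namespace LiftMap

variable {f : TorsorPairHom F X Y} {g : TorsorPairHom G Y Z} {U : C}

/-- Composition with a morphism of lifts on the right. -/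
def post {x : X.Lift U} {y y' : Y.Lift (F.obj U)} (c : LiftMap f x y) (φ : y ⟶ y') :
    LiftMap f x y' where
  hom := c.hom ≫ Functor.whiskerLeft (Over.post F).op (LiftObj.Hom.toHom φ).hom
  map_act V r h := (congrArg ((LiftObj.Hom.toHom φ).hom.app (op ((Over.post F).obj V)))
    (c.map_act V r h)).trans ((LiftObj.Hom.toHom φ).map_act _ _)
  comm V r := (ConcreteCategory.congr_hom (congr_app (LiftObj.Hom.comm φ)
    (op ((Over.post F).obj V))) (c.hom.app (op V) r)).trans (c.comm V r)

/-- Composition with a morphism of lifts on the left. -/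
def pre {x x' : X.Lift U} {y : Y.Lift (F.obj U)} (φ : x ⟶ x') (c : LiftMap f x' y) :
    LiftMap f x y where
  hom := (LiftObj.Hom.toHom φ).hom ≫ c.hom
  map_act V r h := (congrArg (c.hom.app (op V)) ((LiftObj.Hom.toHom φ).map_act r h)).trans
    (c.map_act V _ h)
  comm V r := by
    have e := ConcreteCategory.congr_hom (congr_app (LiftObj.Hom.comm φ) (op V)) r
    refine (c.comm V _).trans ?_
    rw [← e]
    rfl

/-- The identity map. -/
def id (x : X.Lift U) : LiftMap (F := 𝟭 C) (K := J) (TorsorPairHom.id X) (U := U) x x where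
  hom := 𝟙 x.R.carrier.obj
  map_act V r h := congrArg (x.R.act r) (TorsorPairHom.heis_id X V.left h).symm
  comm _ _ := rfl

/-- The composition of a map over `f` and a map over `g`. -/
def comp [(F ⋙ G).IsContinuous J K'] {x : X.Lift U} {y : Y.Lift (F.obj U)} {z : Z.Lift (G.obj (F.obj U))}
    (c : LiftMap f x y) (d : LiftMap g y z) : LiftMap (F := F ⋙ G) (f.comp g) (U := U) x z where
  hom := c.hom ≫ Functor.whiskerLeft (Over.post F).op d.hom
  map_act V r h := (congrArg (d.hom.app (op ((Over.post F).obj V))) (c.map_act V r h)).trans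
    ((d.map_act ((Over.post F).obj V) _ _).trans
      (congrArg (z.R.act (U := op ((Over.post G).obj ((Over.post F).obj V))) _)
        (TorsorPairHom.heis_comp f g V.left h).symm))
  comm V r := by
    refine (d.comm ((Over.post F).obj V) (c.hom.app (op V) r)).trans ?_
    have h := c.comm V r
    exact congrArg (fun t : Y.P.carrier.obj.obj (op (F.obj V.left)) ×
      Y.Q.carrier.obj.obj (op (F.obj V.left)) =>
        (g.p.app (op (F.obj V.left)) t.1, g.q.app (op (F.obj V.left)) t.2)) h

/-- The restriction along `i : V ⟶ U`. -/
noncomputable def pull {V : C} (i : V ⟶ U) {x : X.Lift U} {y : Y.Lift (F.obj U)} (c : LiftMap f x y) :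
    LiftMap f ((LiftObj.pull i).obj x) ((LiftObj.pull (F.map i)).obj y) where
  hom := Functor.whiskerLeft (Over.map i).op c.hom ≫
    Functor.whiskerRight (NatTrans.op (postMap F i)) y.R.carrier.obj
  map_act W r h := (congrArg (y.R.carrier.obj.map ((postMap F i).app W).op)
      (c.map_act ((Over.map i).obj W) r h)).trans
    ((y.R.map_act ((postMap F i).app W).op _ _).trans
      (congrArg (y.R.act _) (LiftObj.map_id_apply (heisSheaf Y.A Y.B).obj (op (F.obj W.left)) _)))
  comm W r := by
    refine Eq.trans ?_ (c.comm ((Over.map i).obj W) r)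
    exact (LiftObj.lam_map y ((postMap F i).app W) (c.hom.app (op ((Over.map i).obj W)) r)).trans
      (LiftObj.map_id_apply Y.prod.carrier.obj (op (F.obj W.left)) _)

end LiftMap

/-- A morphism of gerbes `𝒢_{P,Q} ⟶ F_* 𝒢_{P',Q'}` induced by `f`: a morphism of stacks inducing
`A ⊗ B ⟶ F_* (A' ⊗ B')` on bands, which sends a lift `R` to a lift `R'` that comes with a map
`R ⟶ F_* R'` over `f`, natural in `R` and compatible with restriction. -/
structure GerbeHom (f : TorsorPairHom F X Y) where
  trans : Pseudofunctor.StrongTrans X.gerbe.F (F.op.toPseudofunctor.comp Y.gerbe.F)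
  unit : ∀ {U : C} (x : X.Lift U), LiftMap f x ((trans.app ⟨op U⟩).toFunctor.obj x : Y.Lift (F.obj U))
  unit_naturality : ∀ {U : C} {x y : X.Lift U} (φ : x ⟶ y),
    (unit y).pre φ = (unit x).post ((trans.app ⟨op U⟩).toFunctor.map φ)
  unit_pull : ∀ {U V : C} (i : V ⟶ U) (x : X.Lift U),
    (unit ((LiftObj.pull i).obj x)).post ((trans.naturality i.op.toLoc).hom.toNatTrans.app x) =
      (unit x).pull i
  map_band : ∀ {U : C} (x : X.Lift U) (t : (tensor X.A X.B).obj.obj (op U)),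
    (trans.app ⟨op U⟩).toFunctor.map (X.gerbe.band x t) =
      Y.gerbe.band ((trans.app ⟨op U⟩).toFunctor.obj x : Y.Lift (F.obj U)) (f.tensor U t)

/-- The functor on fibres over `U`. -/
noncomputable def GerbeHom.functor {f : TorsorPairHom F X Y} (Φ : GerbeHom f) (U : C) :
    X.Lift U ⥤ Y.Lift (F.obj U) := (Φ.trans.app ⟨op U⟩).toFunctor

end Functoriality

end HeisenbergGerbe

/-!
# Heisenberg gerbes and cup products

The central extension `0 ⟶ A ⊗ B ⟶ H ⟶ A × B ⟶ 0` attaches to a pair of torsors `(P, Q)` the gerbe of lifts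
of `P × Q` to an `H`-torsor. Three ideas carry the proof.

**Torsors as cocycles.** A torsor is handled through the differences of its sections, that is, through a
cocycle indexed by a presheaf of sets that locally has sections. A cocycle has a torsor, and a
trivialization of a cocycle on a torsor is universal (`Cocycle.Map.existsUnique`). Descent for lifts, hence
the stack property (`LiftObj.isStack`), amounts to the cocycle of a descent datum. Push-forward along a
functor with flat slices amounts to a cocycle whose indices come from the source site
(`IndexedCocycle`); flatness makes its value independent of the refinement used to compute it.

**Twists.** The morphisms of gerbes of lifts come from crossed homomorphisms (`Twist`). The maps
of torsors over a twist are universal, and each torsor has one (`TwistMap.existsUnique`,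
`exists_twistMap`); from such a correspondence one gets a morphism of pseudofunctors whose coherence is
automatic by uniqueness (`Correspondence.trans`). This gives the functoriality of the gerbe. If the two
groups are extensions by the same abelian sheaf, on which the crossed homomorphism is the identity, one
gets an equivalence of banded gerbes (`Twist.nonempty_bandedEquiv`). Given an equivariant map
`φ` from `P` to an abelian sheaf `M` with a homomorphism from `A`, the map `(a, b, t) ↦ t + φ ⊗ b` is a crossed
homomorphism from `H` to `M ⊗ B`. With `M = A` it trivializes the gerbe for trivial `P`; with `M` an extension
of `ℤ` by `A` that has the class of `P` it exhibits the cup product as a class of the gerbe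
(`hasClass_lifts_cup`).

**Classes.** An additive cocycle on a presheaf of sets `S` is a homomorphism on the kernel of the augmentation
`ℤ[S] ⟶ ℤ`, so it has a class in `Ext¹(ℤ, A)`; the class of a torsor is that of its differences
(`GSheaf.hasClass_iff`). For the uniqueness of the class of a gerbe, two equivalences with
gerbes of lifts along abelian extensions are compared inside an injective sheaf: evaluated on trivial torsors
they differ by a cocycle with values in that sheaf, whose class vanishes (`comp_extClass_eq`).
-/

namespace HeisenbergGerbe

/-! ### Gluing sections and morphisms of sheaves of sets -/

section Gluing
universe w v₁ u₁
variable {D : Type u₁} [Category.{v₁} D] {K : GrothendieckTopology D}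

theorem sections_ext {N : Dᵒᵖ ⥤ Type w} (hN : Presheaf.IsSheaf K N) {X : D} {S : Sieve X}
    (hS : S ∈ K X) {x y : N.obj (op X)}
    (h : ∀ ⦃Y : D⦄ (f : Y ⟶ X), S f → N.map f.op x = N.map f.op y) : x = y :=
  (((isSheaf_iff_isSheaf_of_type _ _).1 hN).isSeparated S hS).ext h

theorem exists_glue {N : Dᵒᵖ ⥤ Type w} (hN : Presheaf.IsSheaf K N) {X : D} {S : Sieve X}
    (hS : S ∈ K X) (x : ∀ ⦃Y : D⦄ (f : Y ⟶ X), S f → N.obj (op Y))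
    (hx : ∀ ⦃Y Z : D⦄ (f : Y ⟶ X) (g : Z ⟶ Y) (hf : S f),
      x (g ≫ f) (S.downward_closed hf g) = N.map g.op (x f hf)) :
    ∃ s : N.obj (op X), ∀ ⦃Y : D⦄ (f : Y ⟶ X) (hf : S f), N.map f.op s = x f hf := by
  obtain ⟨s, hs, -⟩ := (isSheaf_iff_isSheaf_of_type _ _).1 hN S hS x
    ((Presieve.compatible_iff_sieveCompatible _).2 hx)
  exact ⟨s, hs⟩

/-- A property `p` of local sections that is stable under restriction, has at most one solution
over each object, and has a solution locally, determines a unique global section. This replaces an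
explicit gluing in most constructions below. -/
theorem existsUnique_of_local {N : Dᵒᵖ ⥤ Type w} (hN : Presheaf.IsSheaf K N) {X : D}
    (p : ∀ ⦃Y : D⦄, (Y ⟶ X) → N.obj (op Y) → Prop)
    (res : ∀ ⦃Y Z : D⦄ (f : Y ⟶ X) (g : Z ⟶ Y) (n : N.obj (op Y)), p f n →
      p (g ≫ f) (N.map g.op n))
    (uniq : ∀ ⦃Y : D⦄ (f : Y ⟶ X) (n n' : N.obj (op Y)), p f n → p f n' → n = n')
    (ex : ∃ S ∈ K X, ∀ ⦃Y : D⦄ (f : Y ⟶ X), S f → ∃ n, p f n) :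
    ∃! s : N.obj (op X), ∀ ⦃Y : D⦄ (f : Y ⟶ X) (n : N.obj (op Y)), p f n → N.map f.op s = n := by
  obtain ⟨S, hS, hex⟩ := ex
  choose n hn using hex
  obtain ⟨s, hs⟩ := exists_glue hN hS n (fun Y Z f g hf =>
    uniq _ _ _ (hn _ _) (res f g _ (hn f hf)))
  refine ⟨s, fun Y f m hm => ?_, fun t ht => sections_ext hN hS fun Y f hf => ?_⟩
  · refine sections_ext hN (K.pullback_stable f hS) fun Z g hg => ?_
    rw [← Functor.map_comp_apply, ← op_comp, hs _ hg]
    exact uniq _ _ _ (hn _ _) (res f g _ hm)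
  · rw [hs f hf, ht f _ (hn f hf)]

/-- A morphism from a presheaf to a sheaf can be constructed locally on sections: it is enough to
give a relation `p` with at most one value, stable under restriction, and with a value locally. -/
theorem exists_hom_of_local {M N : Dᵒᵖ ⥤ Type w} (hN : Presheaf.IsSheaf K N)
    (p : ∀ ⦃X : D⦄, M.obj (op X) → N.obj (op X) → Prop)
    (res : ∀ ⦃X Y : D⦄ (f : Y ⟶ X) (m : M.obj (op X)) (n : N.obj (op X)), p m n →
      p (M.map f.op m) (N.map f.op n))
    (uniq : ∀ ⦃X : D⦄ (m : M.obj (op X)) (n n' : N.obj (op X)), p m n → p m n' → n = n')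
    (ex : ∀ ⦃X : D⦄ (m : M.obj (op X)), ∃ S ∈ K X, ∀ ⦃Y : D⦄ (f : Y ⟶ X), S f →
      ∃ n, p (M.map f.op m) n) :
    ∃ h : M ⟶ N, ∀ ⦃X : D⦄ (m : M.obj (op X)) (n : N.obj (op X)), p m n → h.app (op X) m = n := by
  have key := fun (X : D) (m : M.obj (op X)) => existsUnique_of_local hN
    (fun Y f n => p (M.map f.op m) n)
    (fun Y Z f g n hn => by
      have := res g _ _ hn
      rwa [← Functor.map_comp_apply, ← op_comp] at this)
    (fun Y f n n' => uniq _ n n') (ex m)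
  choose h hh hu using key
  refine ⟨⟨fun X => ↾(h X.unop), fun X Y f => ?_⟩, fun X m n hn => ?_⟩
  · refine ConcreteCategory.hom_ext _ _ fun m => ?_
    refine (hu Y.unop _ (N.map f (h X.unop m)) fun Z g n hn => ?_).symm
    have e := hh X.unop m (g ≫ f.unop) n (by
      rw [op_comp, Functor.map_comp_apply]; exact hn)
    rw [op_comp, Functor.map_comp_apply] at e
    exact e
  · have e := hh X m (𝟙 X) n (by rw [op_id, Functor.map_id_apply]; exact hn)
    rw [op_id, Functor.map_id_apply] at e
    exact e

/-- A morphism of presheaves of sets which is a bijection on all sections is an isomorphism. -/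
theorem isIso_of_bijective {M N : Dᵒᵖ ⥤ Type w} (h : M ⟶ N)
    (hb : ∀ X, Function.Bijective (h.app X)) : IsIso h :=
  (NatTrans.isIso_iff_isIso_app h).2 fun X => (isIso_iff_bijective _).2 (hb X)

end Gluing

/-! ### Torsors -/

section Torsor
universe w v₁ u₁
variable {D : Type u₁} [Category.{v₁} D] {K : GrothendieckTopology D} {G : Dᵒᵖ ⥤ GrpCat.{w}}

namespace GSheaf
variable (P : GSheaf K G)

theorem act_act_inv {U : Dᵒᵖ} (x : P.carrier.obj.obj U) (g : G.obj U) :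
    P.act (P.act x g) g⁻¹ = x := by
  rw [← P.act_mul, mul_inv_cancel, P.act_one]

theorem act_right_injective {P : GSheaf K G} (hP : P.IsTorsor) {U : Dᵒᵖ}
    (x : P.carrier.obj.obj U) {g h : G.obj U} (e : P.act x g = P.act x h) : g = h :=
  (hP.simply_transitive x (P.act x h)).unique e rfl

/-- The difference of two sections of a torsor: `x · (x \ y) = y`. -/
noncomputable def diff {P : GSheaf K G} (hP : P.IsTorsor) {U : Dᵒᵖ}
    (x y : P.carrier.obj.obj U) : G.obj U := (hP.simply_transitive x y).choose

theorem act_diff {P : GSheaf K G} (hP : P.IsTorsor) {U : Dᵒᵖ}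
    (x y : P.carrier.obj.obj U) : P.act x (diff hP x y) = y :=
  (hP.simply_transitive x y).choose_spec.1

theorem diff_eq {P : GSheaf K G} (hP : P.IsTorsor) {U : Dᵒᵖ}
    {x y : P.carrier.obj.obj U} {g : G.obj U} (h : P.act x g = y) : diff hP x y = g :=
  act_right_injective hP x ((act_diff hP x y).trans h.symm)

theorem diff_mul {P : GSheaf K G} (hP : P.IsTorsor) {U : Dᵒᵖ}
    (x y z : P.carrier.obj.obj U) : diff hP x y * diff hP y z = diff hP x z :=
  (diff_eq hP (by rw [P.act_mul, act_diff, act_diff])).symm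

theorem map_diff {P : GSheaf K G} (hP : P.IsTorsor) {U V : Dᵒᵖ} (i : U ⟶ V)
    (x y : P.carrier.obj.obj U) :
    G.map i (diff hP x y) = diff hP (P.carrier.obj.map i x) (P.carrier.obj.map i y) :=
  (diff_eq hP (by rw [← P.map_act, act_diff])).symm

end GSheaf

/-- An equivariant map of torsors is bijective on sections, even where there are no sections:
injectivity is simple transitivity, and preimages exist and are unique locally, so they glue. -/
theorem GSheafHom.bijective {P P' : GSheaf K G} (hP : P.IsTorsor) (hP' : P'.IsTorsor)
    (φ : GSheafHom P P') (U : Dᵒᵖ) : Function.Bijective (φ.hom.app U) := by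
  have inj : ∀ V : Dᵒᵖ, Function.Injective (φ.hom.app V) := fun V x y h => by
    have e : P'.act (φ.hom.app V x) (GSheaf.diff hP x y) = P'.act (φ.hom.app V x) 1 := by
      rw [← φ.map_act, GSheaf.act_diff, P'.act_one, h]
    have e' := GSheaf.act_diff hP x y
    rw [GSheaf.act_right_injective hP' _ e, P.act_one] at e'
    exact e'
  refine ⟨inj U, fun y => ?_⟩
  obtain ⟨s, hs, -⟩ := existsUnique_of_local P.carrier.property (X := U.unop)
    (fun Y f x => φ.hom.app (op Y) x = P'.carrier.obj.map f.op y)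
    (fun Y Z f g x hx => by
      rw [NatTrans.naturality_apply, hx, op_comp, Functor.map_comp_apply])
    (fun Y f x x' h h' => inj _ (h.trans h'.symm))
    (by
      obtain ⟨S, hS, h⟩ := hP.locally_nonempty U.unop
      refine ⟨S, hS, fun Y f hf => ?_⟩
      obtain ⟨x⟩ := h f hf
      exact ⟨P.act x (GSheaf.diff hP' (φ.hom.app _ x) (P'.carrier.obj.map f.op y)), by
        rw [φ.map_act, GSheaf.act_diff]⟩)
  refine ⟨s, ?_⟩
  obtain ⟨S, hS, h⟩ := hP.locally_nonempty U.unop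
  refine sections_ext P'.carrier.property hS fun Y f hf => ?_
  obtain ⟨x⟩ := h f hf
  have e := hs f (P.act x (GSheaf.diff hP' (φ.hom.app _ x) (P'.carrier.obj.map f.op y))) (by
        rw [φ.map_act, GSheaf.act_diff])
  refine (NatTrans.naturality_apply φ.hom f.op s).symm.trans ?_
  rw [e, φ.map_act, GSheaf.act_diff]

theorem GSheafHom.isIso {P P' : GSheaf K G} (hP : P.IsTorsor) (hP' : P'.IsTorsor)
    (φ : GSheafHom P P') : IsIso φ.hom :=
  isIso_of_bijective _ (φ.bijective hP hP')

end Torsor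

/-! ### The torsor of a cocycle -/

section Cocycle
universe v₁ u₁
variable {D : Type u₁} [Category.{v₁} D] {K : GrothendieckTopology D}
  {G : Dᵒᵖ ⥤ GrpCat.{max u₁ v₁}}

/-- A cocycle with values in a presheaf of groups `G`: a locally non-empty presheaf of sets `Q`
and a function `d` of two sections of `Q` with `d x y * d y z = d x z`. Indexing by a presheaf,
rather than by a covering, avoids choices. -/
structure Cocycle (K : GrothendieckTopology D) (G : Dᵒᵖ ⥤ GrpCat.{max u₁ v₁}) where
  Q : Dᵒᵖ ⥤ Type (max u₁ v₁)
  d : ∀ {U : Dᵒᵖ}, Q.obj U → Q.obj U → G.obj U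
  map_d : ∀ {U V : Dᵒᵖ} (i : U ⟶ V) (x y : Q.obj U), G.map i (d x y) = d (Q.map i x) (Q.map i y)
  d_mul : ∀ {U : Dᵒᵖ} (x y z : Q.obj U), d x y * d y z = d x z
  locally_nonempty : ∀ U : D, ∃ S ∈ K U, ∀ ⦃V : D⦄ (i : V ⟶ U), S i → Nonempty (Q.obj (op V))

namespace Cocycle
variable (c : Cocycle K G)

/-- A map from the index presheaf of a cocycle to a sheaf with `G`-action which trivializes the
cocycle: `hom y = hom x · d x y`. -/
structure Map (R : GSheaf K G) where
  hom : c.Q ⟶ R.carrier.obj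
  hom_d : ∀ {U : Dᵒᵖ} (x y : c.Q.obj U), hom.app U y = R.act (hom.app U x) (c.d x y)

variable {c} in
/-- A trivialization of a cocycle on a torsor is universal among all trivializations, also those
on sheaves with action that are not torsors. -/
theorem Map.existsUnique {R R' : GSheaf K G} (hR : R.IsTorsor) (k : c.Map R) (k' : c.Map R') :
    ∃! φ : GSheafHom R R', k.hom ≫ φ.hom = k'.hom := by
  obtain ⟨h, hh⟩ := exists_hom_of_local (M := R.carrier.obj) (N := R'.carrier.obj)
    R'.carrier.property
    (fun X r r' => ∃ (q : c.Q.obj (op X)) (g : G.obj (op X)), r = R.act (k.hom.app _ q) g ∧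
      r' = R'.act (k'.hom.app _ q) g)
    (by
      rintro X Y f _ _ ⟨q, g, rfl, rfl⟩
      refine ⟨c.Q.map f.op q, G.map f.op g, ?_, ?_⟩
      · rw [R.map_act, NatTrans.naturality_apply]
      · rw [R'.map_act, NatTrans.naturality_apply])
    (by
      rintro X _ _ _ ⟨q, g, rfl, rfl⟩ ⟨q', g', h, rfl⟩
      rw [k.hom_d q q', ← R.act_mul] at h
      rw [k'.hom_d q q', ← R'.act_mul, GSheaf.act_right_injective hR _ h])
    (by
      intro X r
      obtain ⟨S, hS, h⟩ := c.locally_nonempty X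
      refine ⟨S, hS, fun Y f hf => ?_⟩
      obtain ⟨q⟩ := h f hf
      exact ⟨_, q, GSheaf.diff hR (k.hom.app _ q) (R.carrier.obj.map f.op r),
        (GSheaf.act_diff hR _ _).symm, rfl⟩)
  have hk : k.hom ≫ h = k'.hom := by
    ext U q
    exact hh _ _ ⟨q, 1, (R.act_one _).symm, (R'.act_one _).symm⟩
  refine ⟨⟨h, fun {U} x g => ?_⟩, hk, fun ψ hψ => ?_⟩
  · obtain ⟨S, hS, hq⟩ := c.locally_nonempty U.unop
    refine sections_ext R'.carrier.property hS fun Y f hf => ?_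
    obtain ⟨q⟩ := hq f hf
    have e := GSheaf.act_diff hR (k.hom.app _ q) (R.carrier.obj.map f.op x)
    have e₁ := hh _ _ ⟨q, _, e.symm, rfl⟩
    have e₂ := hh (R.carrier.obj.map f.op (R.act x g)) _
      ⟨q, GSheaf.diff hR (k.hom.app _ q) (R.carrier.obj.map f.op x) * G.map f.op g,
        by rw [R.act_mul, e, ← R.map_act], rfl⟩
    refine (NatTrans.naturality_apply h f.op _).symm.trans (e₂.trans ?_)
    rw [R'.act_mul, ← e₁, R'.map_act, NatTrans.naturality_apply]
  · apply GSheafHom.ext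
    ext U x
    obtain ⟨S, hS, hq⟩ := c.locally_nonempty U.unop
    refine sections_ext R'.carrier.property hS fun Y f hf => ?_
    obtain ⟨q⟩ := hq f hf
    have e := GSheaf.act_diff hR (k.hom.app _ q) (R.carrier.obj.map f.op x)
    refine (NatTrans.naturality_apply ψ.hom f.op _).symm.trans (Eq.trans ?_
      (NatTrans.naturality_apply h f.op _))
    rw [hh _ _ ⟨q, _, e.symm, rfl⟩]
    conv_lhs => rw [← e]
    rw [ψ.map_act, ← hψ]
    rfl

/-- The sections over `U` of the torsor of a cocycle: the functions `f` on the sections of `Q` over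
objects over `U`, compatible with restriction, with `f q = d q q' * f q'`. -/
@[ext]
structure TorsorSection (U : Dᵒᵖ) where
  val : ∀ ⦃Y : D⦄ (_ : Y ⟶ U.unop) (_ : c.Q.obj (op Y)), G.obj (op Y)
  map_val : ∀ ⦃Y Z : D⦄ (g : Y ⟶ U.unop) (h : Z ⟶ Y) (q : c.Q.obj (op Y)),
    G.map h.op (val g q) = val (h ≫ g) (c.Q.map h.op q)
  d_val : ∀ ⦃Y : D⦄ (g : Y ⟶ U.unop) (q q' : c.Q.obj (op Y)), val g q = c.d q q' * val g q'

/-- The underlying presheaf of the torsor of a cocycle. -/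
def torsorPresheaf : Dᵒᵖ ⥤ Type (max u₁ v₁) where
  obj U := c.TorsorSection U
  map {U V} i := ↾fun f =>
    { val := fun Y g q => f.val (g ≫ i.unop) q
      map_val := fun Y Z g h q => by rw [f.map_val, Category.assoc]
      d_val := fun Y g q q' => f.d_val _ q q' }
  map_id U := by
    refine ConcreteCategory.hom_ext _ _ fun f => TorsorSection.ext ?_
    funext Y g q
    exact congrArg (fun k => f.val k q) (Category.comp_id g)
  map_comp i j := by
    refine ConcreteCategory.hom_ext _ _ fun f => TorsorSection.ext ?_
    funext Y g q
    exact congrArg (fun k => f.val k q) (Category.assoc g _ _).symm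

theorem torsorPresheaf_map_val {U V : Dᵒᵖ} (i : U ⟶ V) (f : c.torsorPresheaf.obj U) {Y : D}
    (g : Y ⟶ V.unop) (q : c.Q.obj (op Y)) :
    (c.torsorPresheaf.map i f).val g q = f.val (g ≫ i.unop) q := rfl

theorem isSheaf_torsorPresheaf (hG : Presheaf.IsSheaf K (G ⋙ forget GrpCat.{max u₁ v₁})) :
    Presheaf.IsSheaf K c.torsorPresheaf := by
  rw [isSheaf_iff_isSheaf_of_type]
  intro X S hS x hx
  rw [Presieve.compatible_iff_sieveCompatible] at hx
  have key := fun (Y : D) (g : Y ⟶ X) (q : c.Q.obj (op Y)) =>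
    exists_glue hG (K.pullback_stable g hS)
      (fun Z h hh => (x (h ≫ g) hh).val (𝟙 Z) (c.Q.map h.op q))
      (fun Z W h k hh => by
        have e := congrArg (fun s : c.TorsorSection (op W) => s.val (𝟙 W) (c.Q.map (k ≫ h).op q))
          (hx (h ≫ g) k hh)
        refine Eq.trans ?_ (e.trans ?_)
        · congr 2; exact Category.assoc _ _ _
        · refine (torsorPresheaf_map_val c k.op _ _ _).trans (Eq.symm ?_)
          refine ((x (h ≫ g) hh).map_val (𝟙 Z) k _).trans ?_
          rw [op_comp, Functor.map_comp_apply]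
          congr 1
          exact (Category.comp_id _).trans (Category.id_comp _).symm)
  choose s hs using key
  have hs' : ∀ (Y : D) (g : Y ⟶ X) (q : c.Q.obj (op Y)) (Z : D) (h : Z ⟶ Y) (hh : S (h ≫ g)),
      G.map h.op (s Y g q) = (x (h ≫ g) hh).val (𝟙 Z) (c.Q.map h.op q) :=
    fun Y g q Z h hh => hs Y g q h hh
  refine ⟨⟨s, fun Y Z g h q => ?_, fun Y g q q' => ?_⟩, fun Y f hf => ?_, fun t ht => ?_⟩
  · refine sections_ext hG (K.pullback_stable (h ≫ g) hS) fun W k hk => ?_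
    refine (Functor.map_comp_apply G h.op k.op _).symm.trans ((hs' Y g q W (k ≫ h) (by
      rw [Category.assoc]; exact hk)).trans (Eq.symm ((hs' Z (h ≫ g) _ W k hk).trans ?_)))
    rw [op_comp, Functor.map_comp_apply]
    congr 2
    exact (Category.assoc _ _ _).symm
  · refine sections_ext hG (K.pullback_stable g hS) fun W k hk => ?_
    refine (hs' Y g q W k hk).trans (Eq.symm ((map_mul (G.map k.op).hom _ _).trans ?_))
    refine (congrArg₂ (· * ·) (c.map_d k.op q q') (hs' Y g q' W k hk)).trans ?_
    exact ((x (k ≫ g) hk).d_val (𝟙 W) _ _).symm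
  · refine TorsorSection.ext ?_
    funext Z g q
    refine (torsorPresheaf_map_val c f.op _ _ _).trans ?_
    refine sections_ext hG (K.top_mem Z) fun W k _ => ?_
    have hk : S (g ≫ f) := S.downward_closed hf g
    refine (hs' Z (g ≫ f) q W k (S.downward_closed hk k)).trans ?_
    refine Eq.trans ?_ ((x f hf).map_val g k q).symm
    have e := congrArg (fun s : c.TorsorSection (op W) => s.val (𝟙 W) (c.Q.map k.op q))
          (hx f (k ≫ g) hf)
    refine Eq.trans ?_ (e.trans ?_)
    · congr 2; exact (Category.assoc _ _ _).symm
    · refine (torsorPresheaf_map_val c (k ≫ g).op _ _ _).trans ?_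
      congr 1
      exact Category.id_comp _
  · refine TorsorSection.ext ?_
    funext Y g q
    refine sections_ext hG (K.pullback_stable g hS) fun W k hk => ?_
    refine Eq.trans ?_ (hs' Y g q W k hk).symm
    refine (t.map_val g k q).trans ?_
    have e := congrArg (fun s : c.TorsorSection (op W) => s.val (𝟙 W) (c.Q.map k.op q))
      (ht (k ≫ g) hk)
    refine Eq.trans ?_ e
    refine Eq.trans ?_ (torsorPresheaf_map_val c (k ≫ g).op t _ _).symm
    congr 1
    exact (Category.id_comp _).symm

/-- The torsor of a cocycle. -/
def torsor (hG : Presheaf.IsSheaf K (G ⋙ forget GrpCat.{max u₁ v₁})) : GSheaf K G where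
  carrier := ⟨c.torsorPresheaf, c.isSheaf_torsorPresheaf hG⟩
  act {U} f e :=
    { val := fun Y g q => f.val g q * G.map g.op e
      map_val := fun Y Z g h q => (map_mul (G.map h.op).hom _ _).trans (congrArg₂ (· * ·)
        (f.map_val g h q) (Functor.map_comp_apply G g.op h.op e).symm)
      d_val := fun Y g q q' => by rw [f.d_val g q q', mul_assoc] }
  act_one {U} f := TorsorSection.ext (by
    funext Y g q
    exact (congrArg (f.val g q * ·) (map_one (G.map g.op).hom)).trans (mul_one _))
  act_mul {U} f e e' := TorsorSection.ext (by
    funext Y g q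
    exact (congrArg (f.val g q * ·) (map_mul (G.map g.op).hom e e')).trans (mul_assoc _ _ _).symm)
  map_act {U V} i f e := TorsorSection.ext (by
    funext Y g q
    exact congrArg (f.val (g ≫ i.unop) q * ·) (Functor.map_comp_apply G i g.op e))

theorem torsor_act_val (hG : Presheaf.IsSheaf K (G ⋙ forget GrpCat.{max u₁ v₁})) {U : Dᵒᵖ}
    (f : (c.torsor hG).carrier.obj.obj U) (e : G.obj U) {Y : D} (g : Y ⟶ U.unop)
    (q : c.Q.obj (op Y)) :
    TorsorSection.val ((c.torsor hG).act f e) g q = TorsorSection.val f g q * G.map g.op e := rfl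

/-- The canonical map to the torsor of a cocycle: the section `x` of `Q` goes to the
function `q ↦ d q x`. -/
def torsorMap (hG : Presheaf.IsSheaf K (G ⋙ forget GrpCat.{max u₁ v₁})) : c.Map (c.torsor hG) where
  hom :=
    { app := fun U => ↾fun x =>
        { val := fun Y g q => c.d q (c.Q.map g.op x)
          map_val := fun Y Z g h q => by rw [c.map_d, op_comp, Functor.map_comp_apply]
          d_val := fun Y g q q' => (c.d_mul _ _ _).symm }
      naturality := fun U V i => by
        refine ConcreteCategory.hom_ext _ _ fun x => TorsorSection.ext ?_
        funext Y g q
        change c.d q (c.Q.map g.op (c.Q.map i x)) = c.d q (c.Q.map (i ≫ g.op) x)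
        rw [Functor.map_comp_apply] }
  hom_d {U} x y := TorsorSection.ext (by
    funext Y g q
    change c.d q (c.Q.map g.op y) = c.d q (c.Q.map g.op x) * G.map g.op (c.d x y)
    rw [c.map_d, c.d_mul])

theorem isTorsor_torsor (hG : Presheaf.IsSheaf K (G ⋙ forget GrpCat.{max u₁ v₁})) :
    (c.torsor hG).IsTorsor where
  locally_nonempty U := by
    obtain ⟨S, hS, h⟩ := c.locally_nonempty U
    exact ⟨S, hS, fun V i hi => (h i hi).map fun q => (c.torsorMap hG).hom.app _ q⟩
  simply_transitive {U} f f' := by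
    obtain ⟨S, hS, hq⟩ := c.locally_nonempty U.unop
    obtain ⟨e, he, hu⟩ := existsUnique_of_local hG (X := U.unop)
      (fun Y g e => ∃ q, TorsorSection.val f g q * e = TorsorSection.val f' g q)
      (by
        rintro Y Z g h e ⟨q, hq⟩
        refine ⟨c.Q.map h.op q, ?_⟩
        rw [← f.map_val, ← f'.map_val, ← hq]
        exact (map_mul (G.map h.op).hom _ _).symm)
      (by
        rintro Y g e e' ⟨q, h⟩ ⟨q', h'⟩
        rw [f.d_val g q q', f'.d_val g q q', mul_assoc, mul_right_inj, ← h', mul_right_inj] at h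
        exact h)
      ⟨S, hS, fun Y g hg => by
        obtain ⟨q⟩ := hq g hg
        exact ⟨(TorsorSection.val f g q : G.obj (op Y))⁻¹ * TorsorSection.val f' g q, q,
          mul_inv_cancel_left _ _⟩⟩
    refine ⟨e, TorsorSection.ext ?_, fun e' h => hu e' fun Y g n ⟨q, hn⟩ => ?_⟩
    · funext Y g q
      have h := he g _ ⟨q, mul_inv_cancel_left (TorsorSection.val f g q) _⟩
      refine (c.torsor_act_val hG f e g q).trans ((congrArg (TorsorSection.val f g q * ·) h).trans ?_)
      exact mul_inv_cancel_left _ _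
    · have h1 := (c.torsor_act_val hG f e' g q).symm.trans
        (congrArg (fun s : c.TorsorSection U => s.val g q) h)
      exact mul_left_cancel (h1.trans hn.symm)

end Cocycle
end Cocycle

/-! ### Sections of lifts over arrows -/

section SliceSections
variable {C : Type u} [Category.{v} C] {J : GrothendieckTopology C}
  {E : Sheaf J GrpCat.{max u v}} {T : GSheaf J E.obj}

theorem isSheaf_over_group (E : Sheaf J GrpCat.{max u v}) (U : C) :
    Presheaf.IsSheaf (J.over U) (((Over.forget U).op ⋙ E.obj) ⋙ forget GrpCat.{max u v}) :=
  (Over.forget U).op_comp_isSheaf (J.over U) J ⟨_, isSheaf_underlying_group E⟩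

theorem over_symm_mem {U : C} {X : Over U} {S : Sieve X.left} (hS : S ∈ J X.left) :
    (Sieve.overEquiv X).symm S ∈ J.over U X := by
  rw [GrothendieckTopology.mem_over_iff, OrderIso.apply_symm_apply]
  exact hS

namespace LiftObj

/-- The sections of (the torsor of) a lift over an arrow `b : Y ⟶ U`. Arrows rather than objects
of the slice category serve as index, so that a composite `k ≫ b` can be rewritten. -/
abbrev Sec {U : C} (x : LiftObj T U) {Y : C} (b : Y ⟶ U) : Type (max u v) :=
  x.R.carrier.obj.obj (op (Over.mk b))

variable {U : C} (x : LiftObj T U)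

/-- The restriction of sections of a lift along `k`. The target `b'` is only propositionally equal
to `k ≫ b`, which keeps casts out of the computations with descent data. -/
def res {Y Z : C} {b : Y ⟶ U} {b' : Z ⟶ U} (k : Z ⟶ Y) (h : k ≫ b = b') (r : x.Sec b) : x.Sec b' :=
  x.R.carrier.obj.map (Over.homMk k h : Over.mk b' ⟶ Over.mk b).op r

/-- The action on the sections of a lift. -/
def sact {Y : C} {b : Y ⟶ U} (r : x.Sec b) (g : E.obj.obj (op Y)) : x.Sec b := x.R.act r g

/-- The image in `T` of a section of a lift. -/
def slam {Y : C} {b : Y ⟶ U} (r : x.Sec b) : T.carrier.obj.obj (op Y) :=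
  x.lam.hom.app (op (Over.mk b)) r

@[simp] theorem res_res {Y Z W : C} {b : Y ⟶ U} {b' : Z ⟶ U} {b'' : W ⟶ U} (k : Z ⟶ Y)
    (h : k ≫ b = b') (l : W ⟶ Z) (h' : l ≫ b' = b'') (r : x.Sec b) :
    x.res l h' (x.res k h r) = x.res (l ≫ k) (by rw [Category.assoc, h, h']) r :=
  map_map x _ _ r

@[simp] theorem res_id {Y : C} {b : Y ⟶ U} (h : 𝟙 Y ≫ b = b) (r : x.Sec b) :
    x.res (𝟙 Y) h r = r :=
  (map_congr x _ (𝟙 _) rfl r).trans (Functor.map_id_apply _ _ _)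

theorem res_sact {Y Z : C} {b : Y ⟶ U} {b' : Z ⟶ U} (k : Z ⟶ Y) (h : k ≫ b = b') (r : x.Sec b)
    (g : E.obj.obj (op Y)) : x.res k h (x.sact r g) = x.sact (x.res k h r) (E.obj.map k.op g) :=
  x.R.map_act _ r g

theorem slam_res {Y Z : C} {b : Y ⟶ U} {b' : Z ⟶ U} (k : Z ⟶ Y) (h : k ≫ b = b') (r : x.Sec b) :
    x.slam (x.res k h r) = T.carrier.obj.map k.op (x.slam r) :=
  lam_map x _ r

theorem slam_sact {Y : C} {b : Y ⟶ U} (r : x.Sec b) (g : E.obj.obj (op Y)) :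
    x.slam (x.sact r g) = T.act (x.slam r) g :=
  x.lam.map_act r g

theorem sact_mul {Y : C} {b : Y ⟶ U} (r : x.Sec b) (g h : E.obj.obj (op Y)) :
    x.sact r (g * h) = x.sact (x.sact r g) h := x.R.act_mul r g h

theorem sact_one {Y : C} {b : Y ⟶ U} (r : x.Sec b) : x.sact r 1 = r := x.R.act_one r

/-- The difference of two sections of a lift. -/
noncomputable def sdiff {Y : C} {b : Y ⟶ U} (r s : x.Sec b) : E.obj.obj (op Y) :=
  GSheaf.diff x.isTorsor r s

theorem sact_sdiff {Y : C} {b : Y ⟶ U} (r s : x.Sec b) : x.sact r (x.sdiff r s) = s :=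
  GSheaf.act_diff x.isTorsor r s

theorem sdiff_eq {Y : C} {b : Y ⟶ U} {r s : x.Sec b} {g : E.obj.obj (op Y)} (h : x.sact r g = s) :
    x.sdiff r s = g := GSheaf.diff_eq x.isTorsor h

theorem sact_injective {Y : C} {b : Y ⟶ U} (r : x.Sec b) {g h : E.obj.obj (op Y)}
    (e : x.sact r g = x.sact r h) : g = h := GSheaf.act_right_injective x.isTorsor r e

theorem sec_ext {Y : C} {b : Y ⟶ U} {S : Sieve Y} (hS : S ∈ J Y) {r s : x.Sec b}
    (h : ∀ ⦃Z : C⦄ (k : Z ⟶ Y), S k → x.res k rfl r = x.res k rfl s) : r = s := by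
  refine sections_ext x.R.carrier.property (over_symm_mem (X := Over.mk b) hS) fun Z f hf => ?_
  have hh := h f.left hf
  have e := congrArg (x.res (b' := Z.hom) (𝟙 _) (by rw [Category.id_comp]; exact Over.w f)) hh
  rw [res_res, res_res] at e
  refine Eq.trans ?_ (e.trans ?_) <;>
  exact map_congr x _ _ (by simp) _

theorem exists_sec {Y : C} (b : Y ⟶ U) : ∃ S ∈ J Y, ∀ ⦃Z : C⦄ (k : Z ⟶ Y), S k →
    Nonempty (x.Sec (k ≫ b)) := by
  obtain ⟨S, hS, h⟩ := x.isTorsor.locally_nonempty (Over.mk b)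
  refine ⟨Sieve.overEquiv _ S, hS, fun Z k hk => ?_⟩
  rw [Sieve.overEquiv_iff] at hk
  exact h _ hk

/-- Morphisms of lifts are determined by their effect on sections over arrows. -/
theorem hom_ext_sec {x y : LiftObj T U} {φ ψ : x ⟶ y}
    (h : ∀ ⦃Y : C⦄ (b : Y ⟶ U) (r : x.Sec b), Hom.ap φ r = Hom.ap ψ r) : φ = ψ :=
  hom_ext fun X r => h X.unop.hom r

variable {x} {y : LiftObj T U}

theorem ap_sact (φ : x ⟶ y) {Y : C} {b : Y ⟶ U} (r : x.Sec b) (g : E.obj.obj (op Y)) :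
    (Hom.ap φ (x.sact r g) : y.Sec b) = y.sact (Hom.ap φ r) g :=
  (φ : Hom x y).toHom.map_act r g

theorem ap_res (φ : x ⟶ y) {Y Z : C} {b : Y ⟶ U} {b' : Z ⟶ U} (k : Z ⟶ Y) (h : k ≫ b = b')
    (r : x.Sec b) : (Hom.ap φ (x.res k h r) : y.Sec b') = y.res k h (Hom.ap φ r) :=
  ap_map φ _ r

theorem slam_ap (φ : x ⟶ y) {Y : C} {b : Y ⟶ U} (r : x.Sec b) :
    y.slam (b := b) (Hom.ap φ r) = x.slam r :=
  ConcreteCategory.congr_hom (congr_app (Hom.comm φ) (op (Over.mk b))) r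

theorem ap_comp {z : LiftObj T U} (φ : x ⟶ y) (ψ : y ⟶ z) {X : (Over U)ᵒᵖ}
    (r : x.R.carrier.obj.obj X) : Hom.ap (φ ≫ ψ) r = Hom.ap ψ (Hom.ap φ r) := rfl

/-- All morphisms of lifts are isomorphisms, as equivariant maps of torsors are. -/
theorem isIso_hom (φ : x ⟶ y) : IsIso φ := by
  have := GSheafHom.isIso x.isTorsor y.isTorsor (φ : Hom x y).toHom
  have e : φ = (isoOfMap (asIso (φ : Hom x y).toHom.hom)
    (fun r g => (φ : Hom x y).toHom.map_act r g) (φ : Hom x y).comm).hom := rfl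
  rw [e]
  infer_instance

end LiftObj
end SliceSections

/-! ### Sections of a descent datum -/

section Descent
variable {C : Type u} [Category.{v} C] {J : GrothendieckTopology C}
  {E : Sheaf J GrpCat.{max u v}} {T : GSheaf J E.obj}

namespace LiftObj

/-- The coherence isomorphisms of the stack of lifts are identities on sections, up to the
identification of a composite of arrows. -/
theorem ap_mapComp'_hom {U V W : C} (f : V ⟶ U) (g : W ⟶ V) (k : W ⟶ U)
    (h : f.op.toLoc ≫ g.op.toLoc = k.op.toLoc) (x : LiftObj T U) {Y : C} (b : Y ⟶ W)
    (r : x.Sec (b ≫ k)) (h' : g ≫ f = k) :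
    Hom.ap (T := T) (U := W) (x := (pull k).obj x) (y := (pull g).obj ((pull f).obj x))
      (((pseudofunctor T).mapComp' f.op.toLoc g.op.toLoc k.op.toLoc h).hom.toNatTrans.app x)
      (X := op (Over.mk b)) r =
      x.res (b' := (b ≫ g) ≫ f) (𝟙 Y) (by rw [← h']; simp) r := by
  subst h'
  have e : (pseudofunctor T).mapComp' f.op.toLoc g.op.toLoc (g ≫ f).op.toLoc h =
    (pseudofunctor T).mapComp f.op.toLoc g.op.toLoc := Pseudofunctor.mapComp'_eq_mapComp _ _ _
  rw [e]
  rfl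

theorem ap_mapComp'_inv {U V W : C} (f : V ⟶ U) (g : W ⟶ V) (k : W ⟶ U)
    (h : f.op.toLoc ≫ g.op.toLoc = k.op.toLoc) (x : LiftObj T U) {Y : C} (b : Y ⟶ W)
    (r : x.Sec ((b ≫ g) ≫ f)) (h' : g ≫ f = k) :
    Hom.ap (T := T) (U := W) (y := (pull k).obj x) (x := (pull g).obj ((pull f).obj x))
      (((pseudofunctor T).mapComp' f.op.toLoc g.op.toLoc k.op.toLoc h).inv.toNatTrans.app x)
      (X := op (Over.mk b)) r =
      x.res (b' := b ≫ k) (𝟙 Y) (by rw [← h']; simp) r := by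
  subst h'
  have e : (pseudofunctor T).mapComp' f.op.toLoc g.op.toLoc (g ≫ f).op.toLoc h =
    (pseudofunctor T).mapComp f.op.toLoc g.op.toLoc := Pseudofunctor.mapComp'_eq_mapComp _ _ _
  rw [e]
  rfl

/-- The effect on sections over `Z` of a morphism between restrictions to `Y` of lifts over `S₁`
and `S₂`, where the arrows from `Z` to `S₁` and `S₂` are only propositionally the composites
through `Y`. -/
def transport {S₁ S₂ Y Z : C} {M : LiftObj T S₁} {N : LiftObj T S₂} {a : Y ⟶ S₁} {b : Y ⟶ S₂}
    (φ : (pull a).obj M ⟶ (pull b).obj N) (z : Z ⟶ Y) {p : Z ⟶ S₁} {q : Z ⟶ S₂}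
    (hp : z ≫ a = p) (hq : z ≫ b = q) (r : M.Sec p) : N.Sec q :=
  N.res (b := z ≫ b) (𝟙 Z) (by rw [← hq]; simp)
    (Hom.ap φ (X := op (Over.mk z)) (M.res (b' := z ≫ a) (𝟙 Z) (by rw [← hp]; simp) r))

section
variable {S₁ S₂ S₃ Y Z : C} {M : LiftObj T S₁} {N : LiftObj T S₂} {L : LiftObj T S₃}
  {a : Y ⟶ S₁} {b : Y ⟶ S₂} {c : Y ⟶ S₃}

theorem transport_rfl (φ : (pull a).obj M ⟶ (pull b).obj N) (z : Z ⟶ Y) (r : M.Sec (z ≫ a)) :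
    transport φ z rfl rfl r = Hom.ap φ (X := op (Over.mk z)) r := by
  unfold transport
  exact (res_id N _ _).trans (congrArg (Hom.ap φ (X := op (Over.mk z))) (res_id M _ r))

theorem transport_sact (φ : (pull a).obj M ⟶ (pull b).obj N) (z : Z ⟶ Y) {p : Z ⟶ S₁} {q : Z ⟶ S₂}
    (hp : z ≫ a = p) (hq : z ≫ b = q) (r : M.Sec p) (g : E.obj.obj (op Z)) :
    transport φ z hp hq (M.sact r g) = N.sact (transport φ z hp hq r) g := by
  subst hp hq
  simp only [transport_rfl]
  exact ap_sact φ (b := z) r g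

theorem slam_transport (φ : (pull a).obj M ⟶ (pull b).obj N) (z : Z ⟶ Y) {p : Z ⟶ S₁} {q : Z ⟶ S₂}
    (hp : z ≫ a = p) (hq : z ≫ b = q) (r : M.Sec p) :
    N.slam (transport φ z hp hq r) = M.slam r := by
  subst hp hq
  simp only [transport_rfl]
  exact slam_ap φ (b := z) r

theorem res_transport (φ : (pull a).obj M ⟶ (pull b).obj N) (z : Z ⟶ Y) {p : Z ⟶ S₁} {q : Z ⟶ S₂}
    (hp : z ≫ a = p) (hq : z ≫ b = q) (r : M.Sec p) {W : C} (k : W ⟶ Z) {p' : W ⟶ S₁} {q' : W ⟶ S₂}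
    (hp' : k ≫ p = p') (hq' : k ≫ q = q') :
    N.res k hq' (transport φ z hp hq r) =
      transport φ (k ≫ z) (by rw [Category.assoc, hp, hp']) (by rw [Category.assoc, hq, hq'])
        (M.res k hp' r) := by
  subst hp hq
  rw [transport_rfl]
  unfold transport
  rw [res_res]
  have e := ap_res φ (b := z) (b' := k ≫ z) k rfl r
  have e' : M.res (b' := (k ≫ z) ≫ a) (𝟙 W ≫ k) (by simp) r =
    ((pull a).obj M).res (b := z) (b' := k ≫ z) k rfl r := map_congr M _ _ (by simp) r
  rw [e', e]
  refine Eq.symm ((map_map N _ _ _).trans ?_)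
  exact map_congr N _ _ (by simp) _

theorem transport_comp (φ : (pull a).obj M ⟶ (pull b).obj N) (ψ : (pull b).obj N ⟶ (pull c).obj L)
    (z : Z ⟶ Y) {p : Z ⟶ S₁} {q : Z ⟶ S₂} {s : Z ⟶ S₃}
    (hp : z ≫ a = p) (hq : z ≫ b = q) (hs : z ≫ c = s) (r : M.Sec p) :
    transport (φ ≫ ψ) z hp hs r = transport ψ z hq hs (transport φ z hp hq r) := by
  subst hp hq hs
  rw [transport_rfl, transport_rfl, transport_rfl]
  rfl

theorem transport_id (z : Z ⟶ Y) {p : Z ⟶ S₁} (hp : z ≫ a = p) (r : M.Sec p) :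
    transport (𝟙 ((pull a).obj M)) z hp hp r = r := by
  subst hp
  rw [transport_rfl]
  rfl

theorem transport_map {f : Y ⟶ S₁} {M' : LiftObj T S₁} (φ : M ⟶ M') (z : Z ⟶ Y) {p : Z ⟶ S₁}
    (hp : z ≫ f = p) (r : M.Sec p) :
    transport ((pull f).map φ) z hp hp r = Hom.ap φ r := by
  subst hp
  rw [transport_rfl]
  rfl

open Pseudofunctor.LocallyDiscreteOpToCat in
theorem transport_pullHom (φ : (pull a).obj M ⟶ (pull b).obj N) {W : C} (g : W ⟶ Y)
    {ga : W ⟶ S₁} {gb : W ⟶ S₂} (hga : g ≫ a = ga) (hgb : g ≫ b = gb) (z : Z ⟶ W)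
    {p : Z ⟶ S₁} {q : Z ⟶ S₂} (hp : z ≫ ga = p) (hq : z ≫ gb = q) (r : M.Sec p) :
    transport (M := M) (N := N) (a := ga) (b := gb)
      (pullHom (F := pseudofunctor T) (M₁ := M) (M₂ := N) φ g ga gb hga hgb) z hp hq r =
      transport φ (z ≫ g) (by rw [Category.assoc, hga, hp]) (by rw [Category.assoc, hgb, hq]) r := by
  subst hp hq hga hgb
  let α : (pull (g ≫ a)).obj M ⟶ (pull g).obj ((pull a).obj M) :=
    (((pseudofunctor T).mapComp' a.op.toLoc g.op.toLoc (g ≫ a).op.toLoc rfl).hom.toNatTrans.app M)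
  let γ : (pull g).obj ((pull b).obj N) ⟶ (pull (g ≫ b)).obj N :=
    (((pseudofunctor T).mapComp' b.op.toLoc g.op.toLoc (g ≫ b).op.toLoc rfl).inv.toNatTrans.app N)
  have e : pullHom (F := pseudofunctor T) (M₁ := M) (M₂ := N) φ g (g ≫ a) (g ≫ b) rfl rfl =
    α ≫ (pull g).map φ ≫ γ := rfl
  refine (congrArg (fun φ => transport (M := M) (N := N) (a := g ≫ a) (b := g ≫ b) φ z rfl rfl r)
    e).trans ?_
  refine (transport_rfl (M := M) (N := N) (a := g ≫ a) (b := g ≫ b) _ z r).trans ?_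
  have hA : Hom.ap α (X := op (Over.mk z)) r = _ := ap_mapComp'_hom a g (g ≫ a) rfl M z r rfl
  have hC : Hom.ap γ (X := op (Over.mk z)) _ = _ := ap_mapComp'_inv b g (g ≫ b) rfl N z
    (Hom.ap φ (X := op (Over.mk (z ≫ g)))
      (M.res (b' := (z ≫ g) ≫ a) (𝟙 Z) (by simp) r)) rfl
  refine Eq.trans ?_ hC
  exact congrArg (fun s => Hom.ap γ (X := op (Over.mk z)) (Hom.ap φ (X := op (Over.mk (z ≫ g))) s)) hA

end

end LiftObj

namespace LiftObj

variable {ι : Type (max u v)} {S : C} {X : ι → C} (f : ∀ i, X i ⟶ S)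

/-- The sections over `Y` of the members of a descent datum: a member `i`, an arrow from `Y` to
the object `X i` on which it lives, and a section. They generate the lift glued from the descent
datum. -/
structure DescentSection (D : (pseudofunctor T).DescentData f) (Y : (Over S)ᵒᵖ) where
  i : ι
  b : Y.unop.left ⟶ X i
  w : b ≫ f i = Y.unop.hom
  r : Sec (T := T) (D.obj i) b

variable {f} (D : (pseudofunctor T).DescentData f)

/-- A member of a descent datum, viewed as a lift. -/
abbrev member (i : ι) : LiftObj T (X i) := D.obj i

/-- The identification of the sections of two members of a descent datum over the same object. -/
def compareSec {i j : ι} {Y : C} {b : Y ⟶ X i} {b' : Y ⟶ X j} (h : b ≫ f i = b' ≫ f j)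
    (r : (member D i).Sec b) : (member D j).Sec b' :=
  transport (M := member D i) (N := member D j) (D.hom (b ≫ f i) b b' rfl h.symm) (𝟙 Y)
    (Category.id_comp b) (Category.id_comp b') r

theorem transport_hom {i j : ι} {Y Z : C} {q : Y ⟶ S} {b : Y ⟶ X i} {b' : Y ⟶ X j} (h : b ≫ f i = q)
    (h' : b' ≫ f j = q) (z : Z ⟶ Y) {p : Z ⟶ X i} {p' : Z ⟶ X j} (hp : z ≫ b = p) (hp' : z ≫ b' = p')
    (r : (member D i).Sec p) :
    transport (M := member D i) (N := member D j) (D.hom q b b' h h') z hp hp' r =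
      compareSec D (by rw [← hp, ← hp', Category.assoc, Category.assoc, h, h']) r := by
  subst hp hp'
  unfold compareSec
  have e := D.pullHom_hom z q ((z ≫ b) ≫ f i) (by rw [Category.assoc, h]) b b' h h' (z ≫ b) (z ≫ b')
    rfl rfl
  rw [← e]
  refine Eq.trans ?_ (transport_pullHom (M := member D i) (N := member D j) (D.hom q b b' h h') z
    rfl rfl (𝟙 Z) _ _ r).symm
  congr 1
  exact (Category.id_comp z).symm

theorem compareSec_self {i : ι} {Y : C} {b : Y ⟶ X i} (r : (member D i).Sec b) :
    compareSec D (rfl : b ≫ f i = b ≫ f i) r = r := by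
  unfold compareSec
  rw [D.hom_self _ b rfl]
  exact transport_id (M := member D i) (𝟙 Y) _ r

theorem compareSec_comp {i j k : ι} {Y : C} {b : Y ⟶ X i} {b' : Y ⟶ X j} {b'' : Y ⟶ X k}
    (h : b ≫ f i = b' ≫ f j) (h' : b' ≫ f j = b'' ≫ f k) (r : (member D i).Sec b) :
    compareSec D h' (compareSec D h r) = compareSec D (h.trans h') r := by
  have e := transport_hom D (q := b ≫ f i) h.symm (h.trans h').symm (𝟙 Y) (Category.id_comp b')
    (Category.id_comp b'') (compareSec D h r)
  refine e.symm.trans ?_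
  refine (transport_comp (M := member D i) (N := member D j) (L := member D k) _ _ (𝟙 Y) _ _ _ r).symm.trans ?_
  exact congrArg (fun φ => transport (M := member D i) (N := member D k) (a := b) (b := b'') φ (𝟙 Y)
    (Category.id_comp b) (Category.id_comp b'') r) (D.hom_comp (b ≫ f i) b b' b'' _ _ _)

theorem res_compareSec {i j : ι} {Y Z : C} {b : Y ⟶ X i} {b' : Y ⟶ X j} (h : b ≫ f i = b' ≫ f j)
    (r : (member D i).Sec b) (k : Z ⟶ Y) :
    (member D j).res k rfl (compareSec D h r) =
      compareSec D (by rw [Category.assoc, Category.assoc, h]) ((member D i).res k rfl r) := by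
  refine (res_transport (M := member D i) (N := member D j) _ _ _ _ r k rfl rfl).trans ?_
  exact transport_hom D _ _ _ _ _ _

theorem compareSec_sact {i j : ι} {Y : C} {b : Y ⟶ X i} {b' : Y ⟶ X j} (h : b ≫ f i = b' ≫ f j)
    (r : (member D i).Sec b) (g : E.obj.obj (op Y)) :
    compareSec D h ((member D i).sact r g) = (member D j).sact (compareSec D h r) g :=
  transport_sact (M := member D i) (N := member D j) _ _ _ _ r g

theorem slam_compareSec {i j : ι} {Y : C} {b : Y ⟶ X i} {b' : Y ⟶ X j} (h : b ≫ f i = b' ≫ f j)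
    (r : (member D i).Sec b) : (member D j).slam (compareSec D h r) = (member D i).slam r :=
  slam_transport (M := member D i) (N := member D j) _ _ _ _ r

end LiftObj
end Descent

/-! ### The lifts of a torsor form a stack -/

section Covers
universe v₁ u₁
variable {D : Type u₁} [Category.{v₁} D] {K : GrothendieckTopology D}

/-- A property of arrows that holds locally on a covering holds on a covering. -/
theorem exists_cover_trans {X : D} {S : Sieve X} (hS : S ∈ K X)
    (p : ∀ ⦃Y : D⦄, (Y ⟶ X) → Prop)
    (h : ∀ ⦃Y : D⦄ (f : Y ⟶ X), S f → ∃ S' ∈ K Y, ∀ ⦃Z : D⦄ (g : Z ⟶ Y), S' g → p (g ≫ f)) :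
    ∃ R ∈ K X, ∀ ⦃Y : D⦄ (f : Y ⟶ X), R f → p f := by
  choose S' hS' h' using h
  refine ⟨Sieve.bind S.arrows fun Y f hf => S' f hf, K.bind_covering hS fun Y f hf => hS' f hf, ?_⟩
  rintro Y f ⟨Z, g, k, hk, hg, rfl⟩
  exact h' k hk g hg

end Covers

section Cocycle
universe v₁ u₁
variable {D : Type u₁} [Category.{v₁} D] {K : GrothendieckTopology D}
  {G : Dᵒᵖ ⥤ GrpCat.{max u₁ v₁}} {c : Cocycle K G} {R : GSheaf K G}

theorem Cocycle.Map.map_hom (m : c.Map R) {U V : Dᵒᵖ} (k : U ⟶ V) (s : c.Q.obj U) :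
    R.carrier.obj.map k (m.hom.app U s) = m.hom.app V (c.Q.map k s) :=
  (NatTrans.naturality_apply m.hom k s).symm

end Cocycle

section Stack
variable {C : Type u} [Category.{v} C] {J : GrothendieckTopology C}
  {E : Sheaf J GrpCat.{max u v}} {T : GSheaf J E.obj}

namespace LiftObj

variable {ι : Type (max u v)} {S : C} {X : ι → C} {f : ∀ i, X i ⟶ S}

theorem exists_cover_family (hf : Sieve.ofArrows X f ∈ J S) {Y : C} (q : Y ⟶ S) :
    ∃ R ∈ J Y, ∀ ⦃Z : C⦄ (k : Z ⟶ Y), R k → ∃ (i : ι) (b : Z ⟶ X i), b ≫ f i = k ≫ q := by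
  refine ⟨_, J.pullback_stable q hf, fun Z k hk => ?_⟩
  obtain ⟨_, g, _, ⟨i⟩, h⟩ := hk
  exact ⟨i, g, h⟩

/-- The descent datum of the restrictions of a lift `M` identifies the sections of its members
with the sections of `M`. -/
theorem transport_ofObj (M : LiftObj T S) {i j : ι} {Y Z : C} {q : Y ⟶ S} {b : Y ⟶ X i}
    {b' : Y ⟶ X j} (h : b ≫ f i = q) (h' : b' ≫ f j = q) (z : Z ⟶ Y)
    (r : M.Sec ((z ≫ b) ≫ f i)) :
    Hom.ap (T := T) (U := Y) (x := (pull b).obj ((pull (f i)).obj M))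
      (y := (pull b').obj ((pull (f j)).obj M))
      ((Pseudofunctor.DescentData.ofObj (F := pseudofunctor T) (f := f) M).hom q b b' h h')
      (X := op (Over.mk z)) r =
      M.res (b' := (z ≫ b') ≫ f j) (𝟙 Z) (by simp [h, h']) r := by
  let α : (pull b).obj ((pull (f i)).obj M) ⟶ (pull q).obj M :=
    (((pseudofunctor T).mapComp' (f i).op.toLoc b.op.toLoc q.op.toLoc
      (by rw [← h]; rfl)).inv.toNatTrans.app M)
  let γ : (pull q).obj M ⟶ (pull b').obj ((pull (f j)).obj M) :=
    (((pseudofunctor T).mapComp' (f j).op.toLoc b'.op.toLoc q.op.toLoc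
      (by rw [← h']; rfl)).hom.toNatTrans.app M)
  have e : Hom.ap (α ≫ γ) (X := op (Over.mk z)) r =
      Hom.ap γ (X := op (Over.mk z)) (Hom.ap α (X := op (Over.mk z)) r) := rfl
  have hα : Hom.ap α (X := op (Over.mk z)) r = _ := ap_mapComp'_inv (f i) b q _ M z r h
  have hγ := ap_mapComp'_hom (f j) b' q (by rw [← h']; rfl) M z
    (M.res (b := (z ≫ b) ≫ f i) (b' := z ≫ q) (𝟙 Z) (by simp [h]) r) h'
  refine (e.trans (congrArg (Hom.ap γ (X := op (Over.mk z))) hα)).trans (Eq.trans hγ ?_)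
  refine (res_res M _ _ _ _ r).trans ?_
  exact map_congr M _ _ (Category.comp_id _) r

theorem transport_ofObj' (M : LiftObj T S) {i j : ι} {Y Z : C} {q : Y ⟶ S} {b : Y ⟶ X i}
    {b' : Y ⟶ X j} (h : b ≫ f i = q) (h' : b' ≫ f j = q) (z : Z ⟶ Y) {p : Z ⟶ X i} {p' : Z ⟶ X j}
    (hp : z ≫ b = p) (hp' : z ≫ b' = p') (r : M.Sec (p ≫ f i)) :
    transport (M := (pull (f i)).obj M) (N := (pull (f j)).obj M) (a := b) (b := b')
      ((Pseudofunctor.DescentData.ofObj (F := pseudofunctor T) (f := f) M).hom q b b' h h')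
      z hp hp' r =
      M.res (b' := p' ≫ f j) (𝟙 Z) (by simp [← hp, ← hp', h, h']) r := by
  subst hp hp'
  refine (transport_rfl (M := (pull (f i)).obj M) (N := (pull (f j)).obj M) (a := b) (b := b')
    _ z r).trans ?_
  exact transport_ofObj M h h' z r

/-- The compatibility of a family of morphisms with descent data, in terms of sections over the
base. -/
theorem transport_eq_of_comm {M N : LiftObj T S} {i j : ι} {Y : C} {q : Y ⟶ S} {b : Y ⟶ X i}
    {b' : Y ⟶ X j} (h : b ≫ f i = q) (h' : b' ≫ f j = q)
    (φ : (pull (f i)).obj M ⟶ (pull (f i)).obj N) (ψ : (pull (f j)).obj M ⟶ (pull (f j)).obj N)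
    (e : (show (pull b).obj ((pull (f i)).obj M) ⟶ (pull b').obj ((pull (f j)).obj N) from
      (pull b).map φ ≫
        (Pseudofunctor.DescentData.ofObj (F := pseudofunctor T) (f := f) N).hom q b b' h h') =
      (show (pull b).obj ((pull (f i)).obj M) ⟶ (pull b').obj ((pull (f j)).obj N) from
      (Pseudofunctor.DescentData.ofObj (F := pseudofunctor T) (f := f) M).hom q b b' h h' ≫
        (pull b').map ψ)) (r : M.Sec q) :
    transport φ b h h r = transport ψ b' h' h' r := by
  let r₁ := M.res (b := q) (b' := b ≫ f i) (𝟙 Y) (by rw [Category.id_comp, h]) r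
  have e₁ := congrArg (fun χ => transport (M := (pull (f i)).obj M) (N := (pull (f j)).obj N)
    (a := b) (b := b') χ (𝟙 Y) (Category.id_comp b) (Category.id_comp b') r₁) e
  have hL := transport_comp (M := (pull (f i)).obj M) (N := (pull (f i)).obj N)
    (L := (pull (f j)).obj N) ((pull b).map φ)
    ((Pseudofunctor.DescentData.ofObj (F := pseudofunctor T) (f := f) N).hom q b b' h h')
    (𝟙 Y) (Category.id_comp b) (Category.id_comp b) (Category.id_comp b') r₁
  have hR := transport_comp (M := (pull (f i)).obj M) (N := (pull (f j)).obj M)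
    (L := (pull (f j)).obj N)
    ((Pseudofunctor.DescentData.ofObj (F := pseudofunctor T) (f := f) M).hom q b b' h h')
    ((pull b').map ψ)
    (𝟙 Y) (Category.id_comp b) (Category.id_comp b') (Category.id_comp b') r₁
  have hL₁ := (transport_ofObj' N h h' (𝟙 Y) (Category.id_comp b) (Category.id_comp b')
    (transport (M := (pull (f i)).obj M) (N := (pull (f i)).obj N) ((pull b).map φ) (𝟙 Y)
    (Category.id_comp b) (Category.id_comp b) r₁)).trans (congrArg (N.res (𝟙 Y) _)
      (transport_map (M := (pull (f i)).obj M) (M' := (pull (f i)).obj N) φ (𝟙 Y)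
        (Category.id_comp b) r₁))
  have hR₁ := (congrArg (transport (M := (pull (f j)).obj M) (N := (pull (f j)).obj N)
    ((pull b').map ψ) (𝟙 Y) (Category.id_comp b') (Category.id_comp b'))
    (transport_ofObj' M h h' (𝟙 Y) (Category.id_comp b) (Category.id_comp b') r₁)).trans
      (transport_map (M := (pull (f j)).obj M) (M' := (pull (f j)).obj N) ψ (𝟙 Y)
        (Category.id_comp b') _)
  have key := hL₁.symm.trans (hL.symm.trans (e₁.trans (hR.trans hR₁)))
  unfold transport
  refine Eq.trans ?_ (((congrArg (N.res (b := b' ≫ f j) (b' := q) (𝟙 Y) (by simp [h'])) key)).trans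
    ?_)
  · refine Eq.symm ((res_res N _ _ _ _ _).trans ?_)
    exact map_congr N _ _ (Category.comp_id _) _
  · refine congrArg (fun r => N.res (𝟙 Y) _ (Hom.ap ψ (X := op (Over.mk b')) r)) ?_
    refine (res_res M _ _ _ _ _).trans ?_
    exact map_congr M _ _ (Category.comp_id _) _

/-- A morphism of lifts is determined by its restrictions to a covering family. -/
theorem hom_ext_of_cover (hf : Sieve.ofArrows X f ∈ J S) {M N : LiftObj T S} {φ ψ : M ⟶ N}
    (h : ∀ i, (pull (f i)).map φ = (pull (f i)).map ψ) : φ = ψ := by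
  refine hom_ext_sec fun Y b r => ?_
  obtain ⟨R, hR, hb⟩ := exists_cover_family hf b
  refine sec_ext (b := b) N hR fun Z k hk => ?_
  obtain ⟨i, b', hb'⟩ := hb k hk
  rw [← ap_res, ← ap_res, ← transport_map φ b' hb', ← transport_map ψ b' hb', h]

/-- A compatible family of morphisms on the restrictions of lifts to a covering family is
given by a morphism of lifts. -/
theorem exists_hom_of_cover (hf : Sieve.ofArrows X f ∈ J S) {M N : LiftObj T S}
    (φ : ∀ i, (pull (f i)).obj M ⟶ (pull (f i)).obj N)
    (hφ : ∀ {i j : ι} {Y : C} {q : Y ⟶ S} (b : Y ⟶ X i) (b' : Y ⟶ X j) (h : b ≫ f i = q)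
      (h' : b' ≫ f j = q) (r : M.Sec q),
      transport (φ i) b h h r = transport (φ j) b' h' h' r) :
    ∃ ψ : M ⟶ N, ∀ i, (pull (f i)).map ψ = φ i := by
  obtain ⟨h, hh⟩ := exists_hom_of_local (K := J.over S) (M := M.R.carrier.obj)
    (N := N.R.carrier.obj) N.R.carrier.property
    (fun Y m n => ∃ (i : ι) (b : Y.left ⟶ X i) (hb : b ≫ f i = Y.hom),
      n = transport (φ i) b hb hb m)
    (by
      rintro Y Z k m _ ⟨i, b, hb, rfl⟩
      exact ⟨i, k.left ≫ b, by rw [Category.assoc, hb, Over.w],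
        res_transport (φ i) b hb hb m k.left (Over.w k) (Over.w k)⟩)
    (by
      rintro Y m _ _ ⟨i, b, hb, rfl⟩ ⟨j, b', hb', rfl⟩
      exact hφ b b' hb hb' m)
    (by
      intro Y m
      obtain ⟨R, hR, hb⟩ := exists_cover_family hf Y.hom
      refine ⟨_, over_symm_mem hR, fun Z k hk => ?_⟩
      obtain ⟨i, b, hb⟩ := hb k.left hk
      exact ⟨_, i, b, hb.trans (Over.w k), rfl⟩)
  have hloc : ∀ {Y : Over S} (m : M.R.carrier.obj.obj (op Y)), ∃ R ∈ J.over S Y,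
      ∀ ⦃Z : Over S⦄ (k : Z ⟶ Y), R k → ∃ (i : ι) (b : Z.left ⟶ X i) (hb : b ≫ f i = Z.hom),
        ∀ m : M.R.carrier.obj.obj (op Z), h.app _ m = transport (φ i) b hb hb m := by
    intro Y m
    obtain ⟨R, hR, hb⟩ := exists_cover_family hf Y.hom
    refine ⟨_, over_symm_mem hR, fun Z k hk => ?_⟩
    obtain ⟨i, b, hb⟩ := hb k.left hk
    exact ⟨i, b, hb.trans (Over.w k), fun m => hh _ _ ⟨i, b, hb.trans (Over.w k), rfl⟩⟩
  refine ⟨⟨⟨h, fun {Y} m g => ?_⟩, ?_⟩, fun i => hom_ext fun Y m => ?_⟩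
  · obtain ⟨R, hR, hb⟩ := hloc m
    refine sections_ext N.R.carrier.property hR fun Z k hk => ?_
    obtain ⟨i, b, hb, hm⟩ := hb k hk
    refine (NatTrans.naturality_apply h k.op _).symm.trans (Eq.symm ((N.R.map_act k.op _ _).trans
      ((congrArg (fun n => N.R.act n _) (NatTrans.naturality_apply h k.op _).symm).trans ?_)))
    rw [hm, M.R.map_act, hm]
    exact (transport_sact (φ i) b hb hb _ _).symm
  · ext Y m
    obtain ⟨R, hR, hb⟩ := hloc m
    refine sections_ext (T.over S).carrier.property hR fun Z k hk => ?_
    obtain ⟨i, b, hb, hm⟩ := hb k hk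
    refine (NatTrans.naturality_apply (h ≫ N.lam.hom) k.op _).symm.trans (Eq.trans ?_
      (NatTrans.naturality_apply M.lam.hom k.op _))
    refine (congrArg (N.lam.hom.app _) (hm _)).trans ?_
    exact slam_transport (φ i) b hb hb _
  · exact (hh _ _ ⟨i, Y.unop.hom, rfl, rfl⟩).trans (transport_rfl (φ i) Y.unop.hom m)

section Glue
variable (hf : Sieve.ofArrows X f ∈ J S) (D : (pseudofunctor T).DescentData f)

theorem DescentSection.ext' {Y : (Over S)ᵒᵖ} {s s' : DescentSection f D Y} (i : s.i = s'.i)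
    (b : s.b ≍ s'.b) (r : s.r ≍ s'.r) : s = s' := by
  obtain ⟨_, _, _, _⟩ := s
  obtain ⟨_, _, _, _⟩ := s'
  obtain rfl := i
  obtain rfl := eq_of_heq b
  obtain rfl := eq_of_heq r
  rfl

theorem res_heq {U : C} (x : LiftObj T U) {Y Z : C} {b : Y ⟶ U} {b₁ b₂ : Z ⟶ U} (k₁ k₂ : Z ⟶ Y)
    (h₁ : k₁ ≫ b = b₁) (h₂ : k₂ ≫ b = b₂) (hk : k₁ = k₂) (r : x.Sec b) :
    x.res k₁ h₁ r ≍ x.res k₂ h₂ r := by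
  subst hk h₁ h₂
  rfl

theorem res_eq_heq {U : C} (x : LiftObj T U) {Y : C} {b b' : Y ⟶ U} (k : Y ⟶ Y)
    (h : k ≫ b = b') (hk : k = 𝟙 Y) (r : x.Sec b) : x.res k h r ≍ r := by
  subst hk
  obtain rfl : b = b' := (Category.id_comp b).symm.trans h
  exact heq_of_eq (res_id x _ r)

/-- The presheaf of sections of the members of a descent datum. -/
def descentPresheaf : (Over S)ᵒᵖ ⥤ Type (max u v) where
  obj Y := DescentSection f D Y
  map {Y Z} k := ↾fun s =>
    { i := s.i
      b := k.unop.left ≫ s.b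
      w := by rw [Category.assoc, s.w]; exact Over.w k.unop
      r := (member D s.i).res k.unop.left rfl s.r }
  map_id Y := by
    refine ConcreteCategory.hom_ext _ _ fun s => ?_
    refine DescentSection.ext' D ?_ (heq_of_eq (Category.id_comp s.b)) ?_
    · rfl
    exact res_eq_heq (member D s.i) _ _ rfl s.r
  map_comp {Y Z W} k l := by
    refine ConcreteCategory.hom_ext _ _ fun s => ?_
    refine DescentSection.ext' D ?_ (heq_of_eq (Category.assoc l.unop.left k.unop.left s.b)) ?_
    · rfl
    refine HEq.trans ?_ (heq_of_eq (res_res (member D s.i) k.unop.left rfl l.unop.left rfl s.r).symm)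
    exact res_heq (member D s.i) _ _ _ _ rfl s.r

theorem compareSec_res {i j : ι} {Y Z : C} {b : Y ⟶ X i} {b' : Y ⟶ X j} (h : b ≫ f i = b' ≫ f j)
    (r : (member D i).Sec b) (k : Z ⟶ Y) (h' : (k ≫ b) ≫ f i = (k ≫ b') ≫ f j) :
    compareSec D h' ((member D i).res k rfl r) = (member D j).res k rfl (compareSec D h r) :=
  (res_compareSec D h r k).symm

include hf in
theorem descentPresheaf_locally_nonempty (Y : Over S) : ∃ R ∈ J.over S Y,
    ∀ ⦃Z : Over S⦄ (k : Z ⟶ Y), R k → Nonempty ((descentPresheaf D).obj (op Z)) := by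
  obtain ⟨R, hR, h⟩ := exists_cover_family hf Y.hom
  obtain ⟨R', hR', h'⟩ := exists_cover_trans hR (fun Z k => ∃ (i : ι) (b : Z ⟶ X i),
    b ≫ f i = k ≫ Y.hom ∧ Nonempty ((member D i).Sec b)) (fun Z k hk => by
      obtain ⟨i, b, hb⟩ := h k hk
      obtain ⟨R', hR', h'⟩ := (member D i).exists_sec b
      exact ⟨R', hR', fun W l hl => ⟨i, l ≫ b, by rw [Category.assoc, hb, Category.assoc],
        h' l hl⟩⟩)
  refine ⟨_, over_symm_mem hR', fun Z k hk => ?_⟩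
  obtain ⟨i, b, hb, ⟨r⟩⟩ := h' k.left hk
  exact ⟨⟨i, b, hb.trans (Over.w k), r⟩⟩

/-- The cocycle of a descent datum: the difference of two sections of members, once compared over
a common object. Its torsor is the glued lift. -/
noncomputable def descentCocycle : Cocycle (J.over S) ((Over.forget S).op ⋙ E.obj) where
  Q := descentPresheaf D
  d {Y} s s' := (member D s'.i).sdiff (compareSec D (s.w.trans s'.w.symm) s.r) s'.r
  map_d {Y Z} k s s' := by
    refine (sdiff_eq (member D s'.i) ?_).symm
    refine Eq.trans (congrArg (fun r => (member D s'.i).sact r _)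
      (compareSec_res D (s.w.trans s'.w.symm) s.r k.unop.left _)) ?_
    refine (res_sact (member D s'.i) k.unop.left rfl _ _).symm.trans ?_
    exact congrArg ((member D s'.i).res k.unop.left rfl) (sact_sdiff (member D s'.i) _ _)
  d_mul {Y} s s' s'' := by
    refine (sdiff_eq (member D s''.i) ?_).symm
    refine (sact_mul (member D s''.i) _ _ _).trans ?_
    refine Eq.trans (congrArg (fun r => (member D s''.i).sact r _) ?_)
      (sact_sdiff (member D s''.i) _ _)
    refine (congrArg (fun r => (member D s''.i).sact r _) (compareSec_comp D
      (s.w.trans s'.w.symm) (s'.w.trans s''.w.symm) s.r).symm).trans ?_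
    refine (compareSec_sact D (s'.w.trans s''.w.symm) _ _).symm.trans ?_
    exact congrArg (compareSec D (s'.w.trans s''.w.symm)) (sact_sdiff (member D s'.i) _ _)
  locally_nonempty Y := descentPresheaf_locally_nonempty hf D Y

/-- The map from the sections of the members of a descent datum to `T`; it trivializes the
cocycle, hence extends to the glued torsor. -/
def descentLam : (descentCocycle hf D).Map (T.over S) where
  hom :=
    { app := fun Y => ↾fun s : DescentSection f D Y => (member D s.i).slam s.r
      naturality := fun Y Z k => ConcreteCategory.hom_ext _ _ fun s : DescentSection f D Y =>
        slam_res (member D s.i) k.unop.left rfl s.r }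
  hom_d {Y} s s' := by
    refine Eq.trans ?_ ((slam_sact (member D s'.i) (compareSec D (s.w.trans s'.w.symm) s.r) _).trans
      (congrArg (fun t => T.act t _) (slam_compareSec D (s.w.trans s'.w.symm) s.r)))
    exact congrArg (member D s'.i).slam (sact_sdiff (member D s'.i) _ _).symm

theorem exists_descentLam : ∃ lam : GSheafHom ((descentCocycle hf D).torsor
      (isSheaf_over_group E S)) (T.over S),
    ((descentCocycle hf D).torsorMap (isSheaf_over_group E S)).hom ≫ lam.hom =
      (descentLam hf D).hom :=
  (Cocycle.Map.existsUnique ((descentCocycle hf D).isTorsor_torsor (isSheaf_over_group E S))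
    ((descentCocycle hf D).torsorMap (isSheaf_over_group E S)) (descentLam hf D)).exists

/-- The lift glued from a descent datum. -/
noncomputable def glue : LiftObj T S where
  R := (descentCocycle hf D).torsor (isSheaf_over_group E S)
  isTorsor := (descentCocycle hf D).isTorsor_torsor (isSheaf_over_group E S)
  lam := (exists_descentLam hf D).choose

/-- The section of the glued lift given by a section of a member. -/
noncomputable def glueSec {Y : (Over S)ᵒᵖ} (s : DescentSection f D Y) :
    (glue hf D).R.carrier.obj.obj Y :=
  ((descentCocycle hf D).torsorMap (isSheaf_over_group E S)).hom.app Y s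

theorem lam_glueSec {Y : (Over S)ᵒᵖ} (s : DescentSection f D Y) :
    (glue hf D).lam.hom.app Y (glueSec hf D s) = (member D s.i).slam s.r :=
  ConcreteCategory.congr_hom (congr_app (exists_descentLam hf D).choose_spec Y) s

theorem map_glueSec {Y Z : (Over S)ᵒᵖ} (k : Y ⟶ Z) (s : DescentSection f D Y) :
    (glue hf D).R.carrier.obj.map k (glueSec hf D s) =
      glueSec hf D ((descentPresheaf D).map k s) :=
  ((descentCocycle hf D).torsorMap (isSheaf_over_group E S)).map_hom k s

theorem glueSec_act {Y : (Over S)ᵒᵖ} (s s' : DescentSection f D Y) (g : E.obj.obj (op Y.unop.left))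
    (h : (member D s'.i).sact (compareSec D (s.w.trans s'.w.symm) s.r) g = s'.r) :
    glueSec hf D s' = (glue hf D).R.act (glueSec hf D s) g := by
  refine (((descentCocycle hf D).torsorMap (isSheaf_over_group E S)).hom_d s s').trans ?_
  exact congrArg ((glue hf D).R.act (glueSec hf D s)) (sdiff_eq (member D s'.i) h)

/-- The isomorphism of a member of a descent datum with the restriction of the glued lift. -/
noncomputable def glueHom (i : ι) : member D i ⟶ (pull (f i)).obj (glue hf D) where
  toHom :=
    { hom :=
        { app := fun Y => ↾fun r : (member D i).R.carrier.obj.obj Y =>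
            glueSec hf D (Y := (Over.map (f i)).op.obj Y) ⟨i, Y.unop.hom, rfl, r⟩
          naturality := fun Y Z k => by
            refine ConcreteCategory.hom_ext _ _ fun r => Eq.symm ?_
            refine (map_glueSec hf D ((Over.map (f i)).op.map k) _).trans
              (congrArg (glueSec hf D) ?_)
            refine DescentSection.ext' D rfl (heq_of_eq (Over.w k.unop)) ?_
            exact res_heq (member D i) (b := Y.unop.hom) (b₂ := Z.unop.hom) k.unop.left k.unop.left
              rfl (Over.w k.unop) rfl r }
      map_act := fun {Y} r g => by
        refine glueSec_act hf D (Y := (Over.map (f i)).op.obj Y) ⟨i, Y.unop.hom, rfl, r⟩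
          ⟨i, Y.unop.hom, rfl, (member D i).R.act r g⟩ g ?_
        exact congrArg (fun r => (member D i).sact (b := Y.unop.hom) r g)
          (compareSec_self D (b := Y.unop.hom) r) }
  comm := by
    ext Y r
    exact lam_glueSec hf D (Y := (Over.map (f i)).op.obj Y) ⟨i, Y.unop.hom, rfl, r⟩

theorem compareSec_res_one {i j : ι} {Y : C} {b b₁ : Y ⟶ X i} {b' : Y ⟶ X j}
    (h : b ≫ f i = b' ≫ f j) (r : (member D i).Sec b) (hb : 𝟙 Y ≫ b = b₁)
    (h₁ : b₁ ≫ f i = b' ≫ f j) :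
    compareSec D h₁ ((member D i).res (𝟙 Y) hb r) = compareSec D h r := by
  obtain rfl : b = b₁ := (Category.id_comp b).symm.trans hb
  rw [res_id]

theorem transport_glueHom {i j : ι} {Y Z : C} {q : Y ⟶ S} {b : Y ⟶ X i} {b' : Y ⟶ X j}
    (h : b ≫ f i = q) (h' : b' ≫ f j = q) (z : Z ⟶ Y) (r : (member D i).Sec (z ≫ b)) :
    (glue hf D).res (b := (z ≫ b) ≫ f i) (b' := (z ≫ b') ≫ f j) (𝟙 Z) (by simp [h, h'])
        (glueSec hf D (Y := op (Over.mk ((z ≫ b) ≫ f i))) ⟨i, z ≫ b, rfl, r⟩) =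
      glueSec hf D (Y := op (Over.mk ((z ≫ b') ≫ f j))) ⟨j, z ≫ b', rfl,
        compareSec D (by rw [Category.assoc, Category.assoc, h, h']) r⟩ := by
  have hb : (z ≫ b) ≫ f i = (z ≫ b') ≫ f j := by rw [Category.assoc, Category.assoc, h, h']
  refine (map_glueSec hf D _ _).trans ?_
  refine (((glue hf D).R.act_one _).symm.trans (glueSec_act hf D _ _ 1 ?_).symm)
  refine (sact_one _ _).trans ?_
  exact compareSec_res_one D hb r rfl _

/-- The descent datum of the glued lift. -/
noncomputable def glueIso : D ≅ ((pseudofunctor T).toDescentData f).obj (glue hf D) :=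
  Pseudofunctor.DescentData.isoMk
    (fun i => @asIso (LiftObj T (X i)) _ _ _ (glueHom hf D i) (isIso_hom _))
    (fun Y q i j b b' h h' => by
      refine hom_ext_sec fun Z z r => ?_
      refine Eq.trans (transport_ofObj (f := f) (glue hf D) h h' z _) ?_
      refine (transport_glueHom hf D h h' z r).trans ?_
      refine congrArg (fun r => glueSec hf D (Y := op (Over.mk ((z ≫ b') ≫ f j)))
        ⟨j, z ≫ b', rfl, r⟩) ?_
      exact (transport_hom D h h' z rfl rfl r).symm.trans
        (transport_rfl (M := member D i) (N := member D j) (D.hom q b b' h h') z r))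

end Glue

/-- Descent is effective for the lifts to a torsor, for every covering family. -/
theorem isEquivalence_toDescentData (hf : Sieve.ofArrows X f ∈ J S) :
    ((pseudofunctor T).toDescentData f).IsEquivalence where
  faithful := ⟨fun {M N φ ψ} h => hom_ext_of_cover hf fun i =>
    congrArg (fun χ : _ ⟶ _ => Pseudofunctor.DescentData.Hom.hom χ i) h⟩
  full := ⟨fun {M N} Φ => by
    obtain ⟨ψ, hψ⟩ := exists_hom_of_cover hf (M := M) (N := N) Φ.hom (by
      intro i j Y q b b' h h' r
      exact transport_eq_of_comm h h' (Φ.hom i) (Φ.hom j) (Φ.comm q b b' h h') r)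
    exact ⟨ψ, Pseudofunctor.DescentData.hom_ext hψ⟩⟩
  essSurj := ⟨fun D => ⟨glue hf D, ⟨(glueIso hf D).symm⟩⟩⟩

theorem isStack (T : GSheaf J E.obj) : (pseudofunctor T).IsStack J :=
  Pseudofunctor.IsStack.of_isStackFor fun S R hR => by
    obtain ⟨ι, X, f, hf⟩ : ∃ (ι : Type (max u v)) (X : ι → C) (f : ∀ i, X i ⟶ S),
        R = Sieve.ofArrows X f :=
      ⟨Σ Y : C, { g : Y ⟶ S // R g }, fun i => i.1, fun i => i.2.1, by
        refine le_antisymm (fun Y g hg => ?_) ?_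
        · exact ⟨Y, 𝟙 Y, g, Presieve.ofArrows.mk (⟨Y, g, hg⟩ : Σ Y : C, { g : Y ⟶ S // R g }),
            Category.id_comp g⟩
        · rw [Sieve.ofArrows, Sieve.generate_le_iff]
          rintro _ _ ⟨i⟩
          exact i.2.2⟩
    subst hf
    rw [Sieve.ofArrows, Pseudofunctor.IsStackFor_generate_iff,
      Pseudofunctor.isStackFor_ofArrows_iff]
    exact isEquivalence_toDescentData hR

end LiftObj
end Stack

/-! ### The lifts of a torsor form a gerbe -/

section LiftGerbe
variable {C : Type u} [Category.{v} C] {J : GrothendieckTopology C}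
  {E : Sheaf J GrpCat.{max u v}} {T : GSheaf J E.obj} {A : Sheaf J AddCommGrpCat.{max u v}}

/-- A sheaf `T` with `E`-action is a torsor under the quotient of `E` by the image of the
injective homomorphism `ι : A ⟶ E`: it is locally non-empty, `E` acts locally transitively, and the
stabilizers are the image of `A`. -/
structure IsQuotientTorsor (ι : toGrp A ⟶ E) (T : GSheaf J E.obj) : Prop where
  injective : ∀ U, Function.Injective (ι.hom.app U)
  locally_nonempty : ∀ U : C, ∃ S ∈ J U, ∀ ⦃V : C⦄ (i : V ⟶ U), S i →
    Nonempty (T.carrier.obj.obj (op V))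
  locally_transitive : ∀ {U : C} (t t' : T.carrier.obj.obj (op U)), ∃ S ∈ J U,
    ∀ ⦃V : C⦄ (i : V ⟶ U), S i → ∃ g : E.obj.obj (op V),
      T.act (T.carrier.obj.map i.op t) g = T.carrier.obj.map i.op t'
  stabilizer : ∀ {U : Cᵒᵖ} (t : T.carrier.obj.obj U) (g : E.obj.obj U),
    T.act t g = t ↔ ∃ a, ι.hom.app U a = g

/-- A torsor under the quotient `G` of a central extension, with the action of the extension
through `G`. -/
theorem CentralExtension.isQuotientTorsor {G : Sheaf J GrpCat.{max u v}}
    (𝓔 : CentralExtension A G) {T : GSheaf J G.obj} (hT : T.IsTorsor) :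
    IsQuotientTorsor 𝓔.ι (T.res 𝓔.π.hom) where
  injective := 𝓔.injective
  locally_nonempty := hT.locally_nonempty
  locally_transitive {U} t t' := by
    refine ⟨_, 𝓔.surjective.imageSieve_mem (GSheaf.diff hT t t'), ?_⟩
    rintro V i ⟨g, hg⟩
    refine ⟨g, ?_⟩
    refine (congrArg (T.act _) hg).trans ?_
    exact (T.map_act i.op t _).symm.trans (congrArg (T.carrier.obj.map i.op)
      (GSheaf.act_diff hT t t'))
  stabilizer {U} t g := by
    rw [← 𝓔.exact]
    constructor
    · intro h
      exact GSheaf.act_right_injective hT t (h.trans (T.act_one t).symm)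
    · intro h
      exact (congrArg (T.act t) h).trans (T.act_one t)

namespace LiftObj
variable {U : C}

theorem res_congr (x : LiftObj T U) {Y Z : C} {b : Y ⟶ U} {b' : Z ⟶ U} {k k' : Z ⟶ Y}
    (hk : k = k') (h : k ≫ b = b') (h' : k' ≫ b = b') (r : x.Sec b) :
    x.res k h r = x.res k' h' r := by
  subst hk
  rfl

/-- The trivial torsor, with the map to `T` sending `1` to `t`. -/
def trivial (t : T.carrier.obj.obj (op U)) : LiftObj T U where
  R := GSheaf.trivial (isSheaf_over_group E U)
  isTorsor :=
    { locally_nonempty := fun X => ⟨⊤, (J.over U).top_mem X, fun Y _ _ =>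
        ⟨(1 : E.obj.obj (op Y.left))⟩⟩
      simply_transitive := fun {X} (x y : E.obj.obj (op X.unop.left)) =>
        ⟨x⁻¹ * y, mul_inv_cancel_left x y, fun g h => eq_inv_mul_of_mul_eq h⟩ }
  lam :=
    { hom :=
        { app := fun X => ↾fun g : E.obj.obj (op X.unop.left) =>
            T.act (T.carrier.obj.map X.unop.hom.op t) g
          naturality := fun X Y i => ConcreteCategory.hom_ext _ _ fun g => by
            refine Eq.symm ((T.map_act i.unop.left.op _ _).trans ?_)
            refine congrArg (fun s => T.act s _) ?_
            refine (Functor.map_comp_apply T.carrier.obj _ _ _).symm.trans ?_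
            rw [← op_comp, Over.w] }
      map_act := fun {X} g h => T.act_mul _ _ _ }

/-- The section `1` of the trivial lift. -/
def trivialSec (t : T.carrier.obj.obj (op U)) {Y : C} (b : Y ⟶ U) : (trivial t).Sec b :=
  (1 : E.obj.obj (op Y))

theorem slam_trivialSec (t : T.carrier.obj.obj (op U)) {Y : C} (b : Y ⟶ U) :
    (trivial t).slam (trivialSec t b) = T.carrier.obj.map b.op t :=
  T.act_one _

theorem res_trivialSec (t : T.carrier.obj.obj (op U)) {Y Z : C} (b : Y ⟶ U) (k : Z ⟶ Y)
    {b' : Z ⟶ U} (h : k ≫ b = b') :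
    (trivial t).res k h (trivialSec t b) = trivialSec t b' :=
  map_one (E.obj.map k.op).hom

/-- A section of a torsor over the final object of the slice trivializes the constant one-point
cocycle, so a morphism out of a torsor with a section is determined by the image of the section.
-/
theorem existsUnique_hom_of_sec {x y : LiftObj T U} (r : x.Sec (𝟙 U)) (s : y.Sec (𝟙 U))
    (h : x.slam r = y.slam s) :
    ∃! φ : x ⟶ y, (Hom.ap φ r : y.Sec (𝟙 U)) = s := by
  let c : Cocycle (J.over U) ((Over.forget U).op ⋙ E.obj) :=
    { Q := (Functor.const _).obj PUnit
      d := fun _ _ => 1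
      map_d := fun i _ _ => map_one (E.obj.map i.unop.left.op).hom
      d_mul := fun _ _ _ => one_mul _
      locally_nonempty := fun X => ⟨⊤, (J.over U).top_mem X, fun _ _ _ => ⟨⟨⟩⟩⟩ }
  let κ (z : LiftObj T U) (r : z.Sec (𝟙 U)) : c.Map z.R :=
    { hom :=
        { app := fun X => ↾fun _ => z.res (b' := X.unop.hom) X.unop.hom (Category.comp_id _) r
          naturality := fun X Y i => ConcreteCategory.hom_ext _ _ fun _ => by
            refine Eq.symm ((res_res z X.unop.hom (Category.comp_id _) i.unop.left (Over.w i.unop)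
              r).trans ?_)
            exact res_congr z (Over.w i.unop) _ _ r }
      hom_d := fun _ _ => (z.R.act_one _).symm }
  let κT (t : T.carrier.obj.obj (op U)) : c.Map (T.over U) :=
    { hom :=
        { app := fun X => ↾fun _ => T.carrier.obj.map X.unop.hom.op t
          naturality := fun X Y i => ConcreteCategory.hom_ext _ _ fun _ => by
            exact (Functor.map_comp_apply T.carrier.obj X.unop.hom.op i.unop.left.op t).symm.trans
              (congrArg (fun k : Y.unop.left ⟶ U => T.carrier.obj.map k.op t) (Over.w i.unop)) |>.symm }
      hom_d := fun _ _ => (T.act_one _).symm }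
  have hκ : ∀ (z : LiftObj T U) (r : z.Sec (𝟙 U)),
      (κ z r).hom ≫ z.lam.hom = (κT (z.slam r)).hom := fun z r => by
    ext X _
    exact slam_res z X.unop.hom (Category.comp_id _) r
  obtain ⟨φ, hφ, hu⟩ := Cocycle.Map.existsUnique x.isTorsor (κ x r) (κ y s)
  have hc : φ.comp y.lam = x.lam := by
    obtain ⟨ψ, -, hψ⟩ := Cocycle.Map.existsUnique x.isTorsor (κ x r) (κT (x.slam r))
    refine (hψ _ ?_).trans (hψ _ (hκ x r)).symm
    refine (Category.assoc _ _ _).symm.trans ?_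
    rw [hφ, hκ, h]
  refine ⟨⟨φ, congrArg GSheafHom.hom hc⟩, ?_, fun ψ hψ => ?_⟩
  · have e := ConcreteCategory.congr_hom (congr_app hφ (op (Over.mk (𝟙 U)))) ⟨⟩
    refine Eq.trans (congrArg (φ.hom.app (op (Over.mk (𝟙 U)))) ?_) (e.trans (res_id y _ s))
    exact (res_id x (Category.comp_id _) r).symm
  · refine Hom.ext (hu _ ?_)
    ext X a
    refine (ap_res ψ (b := 𝟙 U) (b' := X.unop.hom) X.unop.hom (Category.comp_id _) r).trans ?_
    rw [hψ]
    rfl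

end LiftObj

section Band
variable {ι : toGrp A ⟶ E}
  {central : ∀ (U : Cᵒᵖ) (a : (toGrp A).obj.obj U) (x : E.obj.obj U),
    ι.hom.app U a * x = x * ι.hom.app U a}
  {triv : ∀ (U : Cᵒᵖ) (a : (toGrp A).obj.obj U) (t : T.carrier.obj.obj U),
    T.act t (ι.hom.app U a) = t}

/-- The section of `E` given by a section of `A`. -/
abbrev bandSec (ι : toGrp A ⟶ E) {U : Cᵒᵖ} (a : A.obj.obj U) : E.obj.obj U :=
  ι.hom.app U (Multiplicative.ofAdd a)

theorem map_bandSec (ι : toGrp A ⟶ E) {U V : Cᵒᵖ} (i : U ⟶ V) (a : A.obj.obj U) :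
    E.obj.map i (bandSec ι a) = bandSec ι (A.obj.map i a) :=
  (NatTrans.naturality_apply ι.hom i (Multiplicative.ofAdd a)).symm

theorem ap_band {U Y : C} (x : LiftObj T U) (a : A.obj.obj (op U)) (b : Y ⟶ U) (r : x.Sec b) :
    (LiftObj.Hom.ap ((bandedLifts T ι central triv).band x a : x ⟶ x) r : x.Sec b) =
      x.sact r (bandSec ι (A.obj.map b.op a)) := rfl

include central triv in
/-- The automorphisms of a lift are the sections of `A`: locally an automorphism moves a section
by an element of the stabilizer, which is `A`, and this element is independent of the section
because `A` is central. -/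
theorem band_bijective (h : IsQuotientTorsor ι T) {U : C} (x : LiftObj T U) :
    Function.Bijective ((bandedLifts T ι central triv).band (U := U) x) := by
  have inj : ∀ {V : Cᵒᵖ} {a a' : A.obj.obj V}, bandSec ι a = bandSec ι a' → a = a' :=
    fun e => Multiplicative.ofAdd.injective (h.injective _ e)
  obtain ⟨S, hS, hr⟩ := x.exists_sec (𝟙 U)
  have hr' : ∀ ⦃Z : C⦄ (k : Z ⟶ U), S k → Nonempty (x.Sec k) := fun Z k hk => by
    have := hr k hk
    rwa [Category.comp_id] at this
  constructor
  · intro a a' e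
    refine sections_ext (isSheaf_underlying_ab A) hS fun Y f hf => inj ?_
    obtain ⟨r⟩ := hr' f hf
    have e' := congrArg (fun φ : x ⟶ x => (LiftObj.Hom.ap φ r : x.Sec f)) e
    exact x.sact_injective r e'
  · intro φ
    change x ⟶ x at φ
    obtain ⟨a, ha, -⟩ := existsUnique_of_local (isSheaf_underlying_ab A) (X := U)
      (fun Y f (a : A.obj.obj (op Y)) => ∃ r : x.Sec f,
        (LiftObj.Hom.ap φ r : x.Sec f) = x.sact r (bandSec ι a))
      (by
        rintro Y Z f g a ⟨r, hr⟩
        refine ⟨x.res g rfl r, ?_⟩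
        rw [LiftObj.ap_res φ (b := f) g rfl r, hr, LiftObj.res_sact, map_bandSec]
        rfl)
      (by
        rintro Y f a a' ⟨r, hr⟩ ⟨r', hr'⟩
        refine inj (x.sact_injective r' ?_)
        rw [← hr', ← x.sact_sdiff r r', LiftObj.ap_sact, hr, ← LiftObj.sact_mul,
          ← LiftObj.sact_mul]
        exact congrArg (x.sact r) (central _ _ _).symm)
      ⟨S, hS, fun Y f hf => by
        obtain ⟨r⟩ := hr' f hf
        have e := LiftObj.slam_sact x r (x.sdiff r (LiftObj.Hom.ap φ r))
        rw [x.sact_sdiff, LiftObj.slam_ap] at e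
        obtain ⟨a, ha⟩ := (h.stabilizer _ _).1 e.symm
        refine ⟨Multiplicative.toAdd a, r, ?_⟩
        refine (x.sact_sdiff r _).symm.trans (congrArg (x.sact r) ha.symm)⟩
    refine ⟨a, LiftObj.hom_ext_sec fun Y b r => ?_⟩
    refine (ap_band x a b r).trans ?_
    refine x.sec_ext (b := b) (J.pullback_stable b hS) fun Z k hk => ?_
    have e := LiftObj.slam_sact x r (x.sdiff r (LiftObj.Hom.ap φ r))
    rw [x.sact_sdiff, LiftObj.slam_ap] at e
    obtain ⟨a', ha'⟩ := (h.stabilizer _ _).1 e.symm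
    have e' : LiftObj.Hom.ap φ r = x.sact r (bandSec ι (Multiplicative.toAdd a')) :=
      (x.sact_sdiff r _).symm.trans (congrArg (x.sact r) ha'.symm)
    have := ha b (Multiplicative.toAdd a') ⟨r, e'⟩
    rw [e']
    exact congrArg (fun a => x.res k rfl (x.sact r (bandSec ι a))) this

/-- The lifts of a torsor under a quotient form a gerbe. -/
theorem isGerbe_bandedLifts (h : IsQuotientTorsor ι T) :
    (bandedLifts T ι central triv).IsGerbe where
  isStack := LiftObj.isStack T
  isIso φ := LiftObj.isIso_hom φ
  locally_nonempty U := by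
    obtain ⟨S, hS, ht⟩ := h.locally_nonempty U
    exact ⟨S, hS, fun V i hi => (ht i hi).map fun t => LiftObj.trivial t⟩
  locally_connected {U} x y := by
    change LiftObj T U at x y
    obtain ⟨S, hS, hr⟩ := x.exists_sec (𝟙 U)
    obtain ⟨S', hS', hr'⟩ := y.exists_sec (𝟙 U)
    refine exists_cover_trans (J.intersection_covering hS hS') (fun V i =>
      Nonempty ((LiftObj.pull i).obj x ⟶ (LiftObj.pull i).obj y)) ?_
    rintro V i ⟨hi, hi'⟩
    obtain ⟨r⟩ := hr i hi
    obtain ⟨r'⟩ := hr' i hi'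
    obtain ⟨R, hR, hg⟩ := h.locally_transitive (x.slam r) (y.slam r')
    refine ⟨R, hR, fun W j hj => ?_⟩
    obtain ⟨g, hg⟩ := hg j hj
    obtain ⟨φ, -⟩ := LiftObj.existsUnique_hom_of_sec
      (x := (LiftObj.pull (j ≫ i)).obj x) (y := (LiftObj.pull (j ≫ i)).obj y)
      (x.sact (x.res (b' := 𝟙 W ≫ j ≫ i) j (by simp) r) g)
      (y.res (b' := 𝟙 W ≫ j ≫ i) j (by simp) r')
      ((LiftObj.slam_sact x _ g).trans (by
        refine Eq.trans ?_ (LiftObj.slam_res y _ _ _).symm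
        rw [LiftObj.slam_res]
        exact hg))
    exact ⟨φ⟩
  band_bijective x := band_bijective h x
  band_add {U} x a b := LiftObj.hom_ext_sec (x := x) (y := x) fun Y f r => by
    change LiftObj T U at x
    refine (ap_band x (a + b) f r).trans ?_
    refine Eq.trans ?_ (x.sact_mul r _ _)
    refine congrArg (x.sact r) ?_
    refine (congrArg (bandSec ι) (map_add (A.obj.map f.op).hom a b)).trans ?_
    exact map_mul (ι.hom.app (op Y)).hom _ _
  band_naturality {U x y} φ a := LiftObj.hom_ext_sec (x := x) (y := y) fun Y f r =>
    (LiftObj.ap_sact (x := x) (y := y) φ r (bandSec ι (A.obj.map f.op a))).symm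
  map_band {U V} i x a := LiftObj.hom_ext_sec (T := T) (x := (LiftObj.pull i).obj x)
    (y := (LiftObj.pull i).obj x) fun Y f r => by
      change LiftObj T U at x
      refine congrArg (fun a => x.sact (b := f ≫ i) r (bandSec ι a)) ?_
      exact Functor.map_comp_apply A.obj i.op f.op a

end Band

theorem CentralExtension.isGerbe_lifts {G : Sheaf J GrpCat.{max u v}}
    (𝓔 : CentralExtension A G) {T : GSheaf J G.obj} (hT : T.IsTorsor) : (𝓔.lifts T).IsGerbe :=
  isGerbe_bandedLifts (𝓔.isQuotientTorsor hT)

end LiftGerbe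

/-! ### Torsors induced along flat functors -/

section Flat
universe v₁ u₁ v₂ u₂
variable {𝒞 : Type u₁} [Category.{v₁} 𝒞] {𝒟 : Type u₂} [Category.{v₂} 𝒟]
  (Φ : 𝒞 ⥤ 𝒟) [RepresentablyFlat Φ]

/-- A flat functor `Φ` is one for which the categories of arrows `Z ⟶ Φ V` are cofiltered; here
this gives spans. -/
theorem exists_span_of_flat {Z : 𝒟} {V V' : 𝒞} (z : Z ⟶ Φ.obj V) (z' : Z ⟶ Φ.obj V') :
    ∃ (W : 𝒞) (w : Z ⟶ Φ.obj W) (a : W ⟶ V) (a' : W ⟶ V'), w ≫ Φ.map a = z ∧ w ≫ Φ.map a' = z' :=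
  ⟨_, _, (IsCofiltered.minToLeft (StructuredArrow.mk z) (StructuredArrow.mk z')).right,
    (IsCofiltered.minToRight (StructuredArrow.mk z) (StructuredArrow.mk z')).right,
    StructuredArrow.w (IsCofiltered.minToLeft (StructuredArrow.mk z) (StructuredArrow.mk z')),
    StructuredArrow.w (IsCofiltered.minToRight (StructuredArrow.mk z) (StructuredArrow.mk z'))⟩

theorem exists_equalize_of_flat {Z : 𝒟} {W V : 𝒞} (w : Z ⟶ Φ.obj W) (a a' : W ⟶ V)
    (h : w ≫ Φ.map a = w ≫ Φ.map a') :
    ∃ (W' : 𝒞) (w' : Z ⟶ Φ.obj W') (c : W' ⟶ W), w' ≫ Φ.map c = w ∧ c ≫ a = c ≫ a' := by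
  let f : StructuredArrow.mk w ⟶ StructuredArrow.mk (w ≫ Φ.map a) := StructuredArrow.homMk a rfl
  let f' : StructuredArrow.mk w ⟶ StructuredArrow.mk (w ≫ Φ.map a) :=
    StructuredArrow.homMk a' h.symm
  exact ⟨_, _, (IsCofiltered.eqHom f f').right, StructuredArrow.w (IsCofiltered.eqHom f f'),
    congrArg CommaMorphism.right (IsCofiltered.eq_condition f f')⟩

/-- Two spans over the same pair of generalized objects have a common refinement. -/
theorem exists_bowtie_of_flat {Z : 𝒟} {W₁ W₂ V V' : 𝒞} (w₁ : Z ⟶ Φ.obj W₁) (w₂ : Z ⟶ Φ.obj W₂)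
    (a₁ : W₁ ⟶ V) (a₂ : W₂ ⟶ V) (b₁ : W₁ ⟶ V') (b₂ : W₂ ⟶ V')
    (ha : w₁ ≫ Φ.map a₁ = w₂ ≫ Φ.map a₂) (hb : w₁ ≫ Φ.map b₁ = w₂ ≫ Φ.map b₂) :
    ∃ (W : 𝒞) (w : Z ⟶ Φ.obj W) (c₁ : W ⟶ W₁) (c₂ : W ⟶ W₂), w ≫ Φ.map c₁ = w₁ ∧
      w ≫ Φ.map c₂ = w₂ ∧ c₁ ≫ a₁ = c₂ ≫ a₂ ∧ c₁ ≫ b₁ = c₂ ≫ b₂ := by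
  obtain ⟨W, w, c₁, c₂, rfl, rfl⟩ := exists_span_of_flat Φ w₁ w₂
  obtain ⟨W', w', c, rfl, hc⟩ := exists_equalize_of_flat Φ w (c₁ ≫ a₁) (c₂ ≫ a₂)
    (by simpa using ha)
  obtain ⟨W'', w'', c', rfl, hc'⟩ := exists_equalize_of_flat Φ w' (c ≫ c₁ ≫ b₁) (c ≫ c₂ ≫ b₂)
    (by simpa using hb)
  refine ⟨W'', w'', c' ≫ c ≫ c₁, c' ≫ c ≫ c₂, by simp, by simp, ?_, ?_⟩
  · simp [hc]
  · simpa using hc'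

end Flat

section IndexedCocycle
universe v₁ u₁
variable {𝒞 : Type u₁} [Category.{v₁} 𝒞] {𝒟 : Type u₁} [Category.{v₁} 𝒟]
  {K : GrothendieckTopology 𝒟} {Φ : 𝒞 ⥤ 𝒟} {G : 𝒟ᵒᵖ ⥤ GrpCat.{max u₁ v₁}}

/-- A cocycle with values in a presheaf `G` on `𝒟` whose index presheaf lives on `𝒞`: the data
from which a torsor on `𝒞` is pushed to `𝒟` along `Φ : 𝒞 ⥤ 𝒟`. -/
structure IndexedCocycle (K : GrothendieckTopology 𝒟) (Φ : 𝒞 ⥤ 𝒟)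
    (G : 𝒟ᵒᵖ ⥤ GrpCat.{max u₁ v₁}) where
  Q : 𝒞ᵒᵖ ⥤ Type (max u₁ v₁)
  d : ∀ {V : 𝒞}, Q.obj (op V) → Q.obj (op V) → G.obj (op (Φ.obj V))
  map_d : ∀ {V W : 𝒞} (i : W ⟶ V) (x y : Q.obj (op V)),
    G.map (Φ.map i).op (d x y) = d (Q.map i.op x) (Q.map i.op y)
  d_mul : ∀ {V : 𝒞} (x y z : Q.obj (op V)), d x y * d y z = d x z
  locally_nonempty : ∀ Z : 𝒟, ∃ S ∈ K Z, ∀ ⦃Z' : 𝒟⦄ (k : Z' ⟶ Z), S k →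
    ∃ (V : 𝒞) (_ : Z' ⟶ Φ.obj V), Nonempty (Q.obj (op V))

namespace IndexedCocycle
variable (c : IndexedCocycle K Φ G)

theorem d_self {V : 𝒞} (x : c.Q.obj (op V)) : c.d x x = 1 := mul_eq_left.1 (c.d_mul x x x)

/-- The sections over `Z` of the index presheaf on `𝒟`: a section over some `V` in `𝒞` and an
arrow `Z ⟶ Φ V`. No quotient is taken, since the cocycle takes care of identifications. -/
structure Index (Z : 𝒟ᵒᵖ) where
  V : 𝒞
  z : Z.unop ⟶ Φ.obj V
  q : c.Q.obj (op V)

/-- The index presheaf on `𝒟`. -/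
def indexPresheaf : 𝒟ᵒᵖ ⥤ Type (max u₁ v₁) where
  obj Z := c.Index Z
  map k := ↾fun s => ⟨s.V, k.unop ≫ s.z, s.q⟩
  map_id Z := ConcreteCategory.hom_ext _ _ fun s =>
    congrArg (fun z => (⟨s.V, z, s.q⟩ : c.Index Z)) (Category.id_comp s.z)
  map_comp {_ _ Z} k l := ConcreteCategory.hom_ext _ _ fun s =>
    congrArg (fun z => (⟨s.V, z, s.q⟩ : c.Index Z)) (Category.assoc l.unop k.unop s.z)

/-- `e` is the value of the cocycle on the pair `(s, s')`, computed on a common refinement. -/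
def IsValue {Z : 𝒟ᵒᵖ} (s s' : c.Index Z) (e : G.obj Z) : Prop :=
  ∃ (W : 𝒞) (w : Z.unop ⟶ Φ.obj W) (a : W ⟶ s.V) (a' : W ⟶ s'.V), w ≫ Φ.map a = s.z ∧
    w ≫ Φ.map a' = s'.z ∧ e = G.map w.op (c.d (c.Q.map a.op s.q) (c.Q.map a'.op s'.q))

/-- A map from the index presheaf on `𝒞` to a sheaf on `𝒟` which trivializes the cocycle. -/
structure Map (R : GSheaf K G) where
  hom : c.Q ⟶ Φ.op ⋙ R.carrier.obj
  hom_d : ∀ {V : 𝒞} (x y : c.Q.obj (op V)),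
    hom.app (op V) y = R.act (U := op (Φ.obj V)) (hom.app (op V) x) (c.d x y)

variable {c}

theorem IsValue.map {Z Z' : 𝒟ᵒᵖ} {s s' : c.Index Z} {e : G.obj Z} (h : c.IsValue s s' e)
    (k : Z ⟶ Z') :
    c.IsValue (c.indexPresheaf.map k s) (c.indexPresheaf.map k s') (G.map k e) := by
  obtain ⟨W, w, a, a', h, h', rfl⟩ := h
  refine ⟨W, k.unop ≫ w, a, a', (Category.assoc _ _ _).trans (congrArg (k.unop ≫ ·) h),
    (Category.assoc _ _ _).trans (congrArg (k.unop ≫ ·) h'), ?_⟩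
  exact (Functor.map_comp_apply G w.op k _).symm

variable [RepresentablyFlat Φ]

/-- The value does not depend on the common refinement, by flatness. -/
theorem IsValue.eq {Z : 𝒟ᵒᵖ} {s s' : c.Index Z} {e e' : G.obj Z} (h : c.IsValue s s' e)
    (h' : c.IsValue s s' e') : e = e' := by
  obtain ⟨W₁, w₁, a₁, b₁, ha₁, hb₁, rfl⟩ := h
  obtain ⟨W₂, w₂, a₂, b₂, ha₂, hb₂, rfl⟩ := h'
  obtain ⟨W, w, c₁, c₂, rfl, rfl, ha, hb⟩ := exists_bowtie_of_flat Φ w₁ w₂ a₁ a₂ b₁ b₂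
    (ha₁.trans ha₂.symm) (hb₁.trans hb₂.symm)
  rw [op_comp, op_comp, Functor.map_comp_apply, Functor.map_comp_apply, c.map_d, c.map_d,
    ← Functor.map_comp_apply c.Q, ← Functor.map_comp_apply c.Q, ← Functor.map_comp_apply c.Q,
    ← Functor.map_comp_apply c.Q, ← op_comp, ← op_comp, ← op_comp, ← op_comp, ha, hb]

variable (c) in
theorem exists_isValue {Z : 𝒟ᵒᵖ} (s s' : c.Index Z) : ∃ e, c.IsValue s s' e := by
  obtain ⟨W, w, a, a', h, h'⟩ := exists_span_of_flat Φ s.z s'.z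
  exact ⟨_, W, w, a, a', h, h', rfl⟩

theorem IsValue.mul {Z : 𝒟ᵒᵖ} {s s' s'' : c.Index Z} {e e' : G.obj Z} (h : c.IsValue s s' e)
    (h' : c.IsValue s' s'' e') : c.IsValue s s'' (e * e') := by
  obtain ⟨W₁, w₁, a₁, b₁, ha₁, hb₁, rfl⟩ := h
  obtain ⟨W₂, w₂, a₂, b₂, ha₂, hb₂, rfl⟩ := h'
  obtain ⟨W, w, c₁, c₂, rfl, rfl, h, -⟩ := exists_bowtie_of_flat Φ w₁ w₂ b₁ a₂ b₁ a₂
    (hb₁.trans ha₂.symm) (hb₁.trans ha₂.symm)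
  refine ⟨W, w, c₁ ≫ a₁, c₂ ≫ b₂, by rw [← ha₁, Φ.map_comp, Category.assoc],
    by rw [← hb₂, Φ.map_comp, Category.assoc], ?_⟩
  rw [op_comp, op_comp, Functor.map_comp_apply, Functor.map_comp_apply, c.map_d, c.map_d,
    ← Functor.map_comp_apply c.Q, ← Functor.map_comp_apply c.Q, ← Functor.map_comp_apply c.Q,
    ← Functor.map_comp_apply c.Q, ← op_comp, ← op_comp, ← op_comp, ← op_comp, h]
  exact (map_mul (G.map w.op).hom _ _).symm.trans (congrArg (G.map w.op) (c.d_mul _ _ _))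

variable (c)

/-- The cocycle on `𝒟` deduced from a cocycle indexed by `𝒞`: its value on a pair is computed on a
common refinement in `𝒞`. -/
noncomputable def toCocycle : Cocycle K G where
  Q := c.indexPresheaf
  d s s' := (c.exists_isValue s s').choose
  map_d k s s' := ((c.exists_isValue s s').choose_spec.map k).eq (c.exists_isValue _ _).choose_spec
  d_mul s s' s'' := ((c.exists_isValue s s').choose_spec.mul
    (c.exists_isValue s' s'').choose_spec).eq (c.exists_isValue s s'').choose_spec
  locally_nonempty Z := by
    obtain ⟨S, hS, h⟩ := c.locally_nonempty Z
    refine ⟨S, hS, fun Z' k hk => ?_⟩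
    obtain ⟨V, z, ⟨q⟩⟩ := h k hk
    exact ⟨⟨V, z, q⟩⟩

theorem toCocycle_d {Z : 𝒟ᵒᵖ} {s s' : c.Index Z} {e : G.obj Z} (h : c.IsValue s s' e) :
    c.toCocycle.d s s' = e :=
  (c.exists_isValue s s').choose_spec.eq h

variable {c}

/-- A trivialization of a cocycle indexed by `𝒞` trivializes the associated cocycle on `𝒟`. -/
noncomputable def Map.toMap {R : GSheaf K G} (k : c.Map R) : c.toCocycle.Map R where
  hom :=
    { app := fun Z => ↾fun s : c.Index Z => R.carrier.obj.map s.z.op (k.hom.app (op s.V) s.q)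
      naturality := fun Z Z' l => ConcreteCategory.hom_ext _ _ fun s : c.Index Z =>
        Functor.map_comp_apply R.carrier.obj s.z.op l _ }
  hom_d {Z} s s' := by
    change c.Index Z at s s'
    obtain ⟨e, h⟩ := c.exists_isValue s s'
    rw [c.toCocycle_d h]
    obtain ⟨W, w, a, a', h, h', rfl⟩ := h
    have key : ∀ {V : 𝒞} (b : W ⟶ V) (q : c.Q.obj (op V)),
        R.carrier.obj.map (w ≫ Φ.map b).op (k.hom.app (op V) q) =
          R.carrier.obj.map w.op (k.hom.app (op W) (c.Q.map b.op q)) := fun {V} b q => by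
      rw [op_comp, Functor.map_comp_apply, NatTrans.naturality_apply k.hom b.op q]
      rfl
    change R.carrier.obj.map s'.z.op (k.hom.app (op s'.V) s'.q) =
      R.act (R.carrier.obj.map s.z.op (k.hom.app (op s.V) s.q)) _
    rw [← h, ← h', key, key, k.hom_d (c.Q.map a.op s.q) (c.Q.map a'.op s'.q)]
    exact R.map_act w.op _ _

/-- The canonical trivialization on the torsor of the cocycle. -/
noncomputable def unit (hG : Presheaf.IsSheaf K (G ⋙ forget GrpCat.{max u₁ v₁})) :
    c.Map (c.toCocycle.torsor hG) where
  hom :=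
    { app := fun V => ↾fun q => (c.toCocycle.torsorMap hG).hom.app (op (Φ.obj V.unop))
        (⟨V.unop, 𝟙 _, q⟩ : c.Index (op (Φ.obj V.unop)))
      naturality := fun V W i => ConcreteCategory.hom_ext _ _ fun q => by
        refine Eq.symm (((c.toCocycle.torsorMap hG).map_hom (Φ.map i.unop).op
          (⟨V.unop, 𝟙 _, q⟩ : c.Index (op (Φ.obj V.unop)))).trans ?_)
        refine ((c.toCocycle.torsorMap hG).hom_d
          (⟨W.unop, 𝟙 _, c.Q.map i q⟩ : c.Index (op (Φ.obj W.unop))) _).trans ?_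
        refine (congrArg (GSheaf.act _ _) (c.toCocycle_d (e := 1)
          ⟨W.unop, 𝟙 _, 𝟙 _, i.unop, ?_, ?_, ?_⟩)).trans (GSheaf.act_one _ _)
        · exact (congrArg _ (Φ.map_id _)).trans (Category.comp_id _)
        · exact (Category.id_comp _).trans (Category.comp_id _).symm
        · refine Eq.trans ?_ (congrArg (G.map (𝟙 (Φ.obj W.unop)).op)
            ((congrArg₂ c.d (Functor.map_id_apply c.Q _ _) rfl).trans (c.d_self _))).symm
          exact (map_one (G.map (𝟙 (Φ.obj W.unop)).op).hom).symm }
  hom_d {V} x y := by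
    refine ((c.toCocycle.torsorMap hG).hom_d _ _).trans (congrArg (GSheaf.act _ _)
      (c.toCocycle_d ⟨V, 𝟙 _, 𝟙 _, 𝟙 _, ?_, ?_, ?_⟩))
    · exact (congrArg _ (Φ.map_id _)).trans (Category.comp_id _)
    · exact (congrArg _ (Φ.map_id _)).trans (Category.comp_id _)
    · refine Eq.symm ((Functor.map_id_apply G _ _).trans ?_)
      exact congrArg₂ c.d (Functor.map_id_apply c.Q _ _) (Functor.map_id_apply c.Q _ _)

/-- Trivializations indexed by `𝒞` correspond to trivializations of the cocycle on `𝒟`, so one on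
a torsor is universal. -/
theorem Map.existsUnique {R R' : GSheaf K G} (hR : R.IsTorsor) (k : c.Map R) (k' : c.Map R') :
    ∃! φ : GSheafHom R R', k.hom ≫ Functor.whiskerLeft Φ.op φ.hom = k'.hom := by
  have key : ∀ φ : GSheafHom R R', k.hom ≫ Functor.whiskerLeft Φ.op φ.hom = k'.hom ↔
      k.toMap.hom ≫ φ.hom = k'.toMap.hom := fun φ => by
    constructor
    · intro h
      ext Z s
      change c.Index Z at s
      refine (NatTrans.naturality_apply φ.hom s.z.op _).trans ?_
      exact congrArg (R'.carrier.obj.map s.z.op) (ConcreteCategory.congr_hom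
        (congr_app h (op s.V)) s.q)
    · intro h
      ext V q
      have e := ConcreteCategory.congr_hom (congr_app h (op (Φ.obj V.unop)))
        (⟨V.unop, 𝟙 _, q⟩ : c.Index (op (Φ.obj V.unop)))
      refine Eq.trans (congrArg (φ.hom.app (op (Φ.obj V.unop))) ?_) (e.trans ?_)
      · exact (Functor.map_id_apply R.carrier.obj _ _).symm
      · exact Functor.map_id_apply R'.carrier.obj _ _
  obtain ⟨φ, hφ, hu⟩ := Cocycle.Map.existsUnique hR k.toMap k'.toMap
  exact ⟨φ, (key φ).2 hφ, fun ψ hψ => hu ψ ((key ψ).1 hψ)⟩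

end IndexedCocycle
end IndexedCocycle

/-! ### Images of lifts under crossed homomorphisms -/

section Twist
variable {C : Type u} [Category.{v} C] {J : GrothendieckTopology C}
  {D : Type u} [Category.{v} D] {K : GrothendieckTopology D}
  {E : Sheaf J GrpCat.{max u v}} {E' : Sheaf K GrpCat.{max u v}}

/-- A map `τ : T ⟶ F_* T'` from a sheaf with action of `E` to the direct image of a sheaf with
action of `E'`, which is equivariant along a crossed homomorphism: `τ (t · g) = τ t · θ t g`,
where `θ t (g h) = θ t g · θ (t · g) h`. Homomorphisms of groups give twists with `θ` independent
of `t`; the dependence on `t` is what relates the non-abelian Heisenberg torsors to torsors under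
abelian sheaves. -/
structure Twist (F : C ⥤ D) (T : GSheaf J E.obj) (T' : GSheaf K E'.obj) where
  τ : T.carrier.obj ⟶ F.op ⋙ T'.carrier.obj
  θ : ∀ {U : C}, T.carrier.obj.obj (op U) → E.obj.obj (op U) → E'.obj.obj (op (F.obj U))
  map_θ : ∀ {U V : C} (i : V ⟶ U) (t : T.carrier.obj.obj (op U)) (g : E.obj.obj (op U)),
    E'.obj.map (F.map i).op (θ t g) = θ (T.carrier.obj.map i.op t) (E.obj.map i.op g)
  θ_mul : ∀ {U : C} (t : T.carrier.obj.obj (op U)) (g h : E.obj.obj (op U)),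
    θ t (g * h) = θ t g * θ (T.act t g) h
  τ_act : ∀ {U : C} (t : T.carrier.obj.obj (op U)) (g : E.obj.obj (op U)),
    τ.app (op U) (T.act t g) = T'.act (U := op (F.obj U)) (τ.app (op U) t) (θ t g)

variable {F : C ⥤ D} {T : GSheaf J E.obj} {T' : GSheaf K E'.obj} (w : Twist F T T')

theorem Twist.θ_one {U : C} (t : T.carrier.obj.obj (op U)) : w.θ t 1 = 1 := by
  have h := w.θ_mul t 1 1
  rw [mul_one, T.act_one] at h
  exact left_eq_mul.1 h

/-- A map over a twist from a lift `x` over `U` to a lift `y` over `F U`: it sends `r · g` to `hom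
r · θ (λ r) g`, where `λ` is the map to `T`. -/
@[ext]
structure TwistMap {U : C} (x : LiftObj T U) (y : LiftObj T' (F.obj U)) where
  hom : x.R.carrier.obj ⟶ (Over.post (X := U) F).op ⋙ y.R.carrier.obj
  map_act : ∀ {V : Over U} (r : x.R.carrier.obj.obj (op V)) (g : E.obj.obj (op V.left)),
    hom.app (op V) (x.R.act r g) = y.R.act (U := op ((Over.post F).obj V)) (hom.app (op V) r)
      (w.θ (U := V.left) (x.lam.hom.app (op V) r) g)
  comm : ∀ {V : Over U} (r : x.R.carrier.obj.obj (op V)),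
    y.lam.hom.app (op ((Over.post F).obj V)) (hom.app (op V) r) =
      w.τ.app (op V.left) (x.lam.hom.app (op V) r)

namespace TwistMap
variable {w} {U : C} {x : LiftObj T U} {y : LiftObj T' (F.obj U)}

/-- The effect of a map over a twist on sections over arrows. -/
def ap (c : TwistMap w x y) {Y : C} {b : Y ⟶ U} (r : x.Sec b) : y.Sec (F.map b) :=
  c.hom.app (op (Over.mk b)) r

theorem ext_ap {c c' : TwistMap w x y} (h : ∀ {Y : C} {b : Y ⟶ U} (r : x.Sec b), c.ap r = c'.ap r) :
    c = c' := by
  apply TwistMap.ext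
  ext V r
  exact h (b := V.unop.hom) r

theorem ap_res (c : TwistMap w x y) {Y Z : C} {b : Y ⟶ U} {b' : Z ⟶ U} (k : Z ⟶ Y)
    (h : k ≫ b = b') (r : x.Sec b) :
    c.ap (x.res k h r) = y.res (F.map k) (by rw [← F.map_comp, h]) (c.ap r) :=
  NatTrans.naturality_apply c.hom (Over.homMk k h : Over.mk b' ⟶ Over.mk b).op r

theorem ap_sact (c : TwistMap w x y) {Y : C} {b : Y ⟶ U} (r : x.Sec b) (g : E.obj.obj (op Y)) :
    c.ap (x.sact r g) = y.sact (c.ap r) (w.θ (x.slam r) g) := c.map_act _ _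

theorem slam_ap (c : TwistMap w x y) {Y : C} {b : Y ⟶ U} (r : x.Sec b) :
    y.slam (c.ap r) = w.τ.app (op Y) (x.slam r) := c.comm (V := Over.mk b) r

/-- Composition with a morphism of lifts on the right. -/
def post {y' : LiftObj T' (F.obj U)} (c : TwistMap w x y) (φ : y ⟶ y') : TwistMap w x y' where
  hom := c.hom ≫ Functor.whiskerLeft (Over.post F).op (LiftObj.Hom.toHom φ).hom
  map_act {V} r h := (congrArg ((LiftObj.Hom.toHom φ).hom.app (op ((Over.post F).obj V)))
    (c.map_act r h)).trans ((LiftObj.Hom.toHom φ).map_act _ _)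
  comm {V} r := (ConcreteCategory.congr_hom (congr_app (LiftObj.Hom.comm φ)
    (op ((Over.post F).obj V))) (c.hom.app (op V) r)).trans (c.comm r)

/-- Composition with a morphism of lifts on the left. -/
def pre {x' : LiftObj T U} (φ : x' ⟶ x) (c : TwistMap w x y) : TwistMap w x' y where
  hom := (LiftObj.Hom.toHom φ).hom ≫ c.hom
  map_act {V} r h := by
    refine (congrArg (c.hom.app (op V)) ((LiftObj.Hom.toHom φ).map_act r h)).trans
      ((c.map_act _ h).trans ?_)
    have e := ConcreteCategory.congr_hom (congr_app (LiftObj.Hom.comm φ) (op V)) r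
    exact congrArg (fun t => y.R.act (U := op ((Over.post F).obj V)) _ (w.θ (U := V.left) t h)) e
  comm {V} r := by
    have e := ConcreteCategory.congr_hom (congr_app (LiftObj.Hom.comm φ) (op V)) r
    exact (c.comm _).trans (congrArg (w.τ.app (op V.left)) e)

/-- The restriction along `i : V ⟶ U`. -/
def pull {V : C} (i : V ⟶ U) (c : TwistMap w x y) :
    TwistMap w ((LiftObj.pull i).obj x) ((LiftObj.pull (F.map i)).obj y) where
  hom := Functor.whiskerLeft (Over.map i).op c.hom ≫
    Functor.whiskerRight (NatTrans.op (postMap F i)) y.R.carrier.obj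
  map_act {W} r h := (congrArg (y.R.carrier.obj.map ((postMap F i).app W).op)
      (c.map_act (V := (Over.map i).obj W) r h)).trans
    ((y.R.map_act ((postMap F i).app W).op _ _).trans
      (congrArg (y.R.act _) (LiftObj.map_id_apply E'.obj (op (F.obj W.left)) _)))
  comm {W} r := by
    refine Eq.trans ?_ (c.comm (V := (Over.map i).obj W) r)
    exact (LiftObj.lam_map y ((postMap F i).app W) (c.hom.app (op ((Over.map i).obj W)) r)).trans
      (LiftObj.map_id_apply T'.carrier.obj (op (F.obj W.left)) _)

end TwistMap

section Universal
variable [F.IsContinuous J K] {U : C} (x : LiftObj T U)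

/-- The cocycle that describes the image of a lift under a twist: its index presheaf is the torsor
of the lift and its value is `θ` of the difference. The crossed homomorphism law is the cocycle
identity. -/
noncomputable def twistCocycle : IndexedCocycle (K.over (F.obj U)) (Over.post (X := U) F)
    ((Over.forget (F.obj U)).op ⋙ E'.obj) where
  Q := x.R.carrier.obj
  d {V} r r' := w.θ (U := V.left) (x.lam.hom.app (op V) r) (GSheaf.diff x.isTorsor r r')
  map_d {V W} i r r' := by
    refine (w.map_θ i.left _ _).trans ?_
    refine congrArg₂ (w.θ (U := W.left)) (LiftObj.lam_map x i r).symm ?_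
    exact GSheaf.map_diff x.isTorsor i.op r r'
  d_mul {V} r r' r'' := by
    refine Eq.symm ((congrArg (w.θ (U := V.left) _) (GSheaf.diff_mul x.isTorsor r r' r'').symm).trans
      ((w.θ_mul _ _ _).trans ?_))
    refine congrArg (fun t => _ * w.θ (U := V.left) t _) ?_
    exact (x.lam.map_act r _).symm.trans (congrArg (x.lam.hom.app (op V))
      (GSheaf.act_diff x.isTorsor r r'))
  locally_nonempty Z := by
    obtain ⟨S, hS, h⟩ := x.exists_sec (𝟙 U)
    have hS' := K.pullback_stable Z.hom
      ((CoverPreserving.of_isContinuous F J K).cover_preserve hS)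
    refine ⟨_, over_symm_mem hS', fun Z' k hk => ?_⟩
    obtain ⟨V, b, l, hb, hl⟩ := hk
    obtain ⟨r⟩ := h b hb
    refine ⟨Over.mk (b ≫ 𝟙 U), Over.homMk l ?_, ⟨r⟩⟩
    rw [← Over.w k, Category.comp_id]
    exact hl.symm

variable {w x}

theorem twistCocycle_d_act {V : Over U} (r : x.R.carrier.obj.obj (op V))
    (g : E.obj.obj (op V.left)) :
    (twistCocycle w x).d r (x.R.act r g) = w.θ (U := V.left) (x.lam.hom.app (op V) r) g :=
  congrArg (w.θ (U := V.left) _) (GSheaf.diff_eq x.isTorsor rfl)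

/-- A map over a twist trivializes the cocycle. -/
def TwistMap.toMap {y : LiftObj T' (F.obj U)} (c : TwistMap w x y) :
    (twistCocycle w x).Map y.R where
  hom := c.hom
  hom_d {V} r r' := by
    refine Eq.trans ?_ (c.map_act r _)
    exact congrArg (c.hom.app (op V)) (GSheaf.act_diff x.isTorsor r r').symm

variable (w x) in
/-- The map to `T'` trivializes the cocycle. -/
def twistLam : (twistCocycle w x).Map (T'.over (F.obj U)) where
  hom :=
    { app := fun V => ↾fun r => w.τ.app (op V.unop.left) (x.lam.hom.app V r)
      naturality := fun V W i => ConcreteCategory.hom_ext _ _ fun r =>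
        (congrArg (w.τ.app (op W.unop.left)) (LiftObj.lam_map x i.unop r)).trans
          (NatTrans.naturality_apply w.τ i.unop.left.op _) }
  hom_d {V} r r' := by
    refine Eq.trans (congrArg (w.τ.app (op V.left)) ?_) (w.τ_act (x.lam.hom.app (op V) r) _)
    exact (congrArg (x.lam.hom.app (op V)) (GSheaf.act_diff x.isTorsor r r')).symm.trans
      (x.lam.map_act r _)

theorem TwistMap.toMap_lam {y : LiftObj T' (F.obj U)} (c : TwistMap w x y) :
    c.toMap.hom ≫ Functor.whiskerLeft (Over.post F).op y.lam.hom = (twistLam w x).hom := by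
  ext V r
  exact c.comm r

variable [RepresentablyFlat (Over.post (X := U) F)]

/-- Every map over a twist is universal: it trivializes the cocycle of the twist on a torsor. -/
theorem TwistMap.existsUnique {y y' : LiftObj T' (F.obj U)} (c : TwistMap w x y)
    (c' : TwistMap w x y') : ∃! φ : y ⟶ y', c.post φ = c' := by
  obtain ⟨φ, hφ, hu⟩ := IndexedCocycle.Map.existsUnique y.isTorsor c.toMap c'.toMap
  -- The compatibility of `φ` with the maps to `T'` follows from the universality of `c` as well.
  obtain ⟨ψ, -, hψ⟩ := IndexedCocycle.Map.existsUnique y.isTorsor c.toMap (twistLam w x)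
  have hc : φ.comp y'.lam = y.lam := by
    refine (hψ _ ?_).trans (hψ _ c.toMap_lam).symm
    refine Eq.trans ?_ c'.toMap_lam
    rw [← hφ]
    rfl
  refine ⟨⟨φ, congrArg GSheafHom.hom hc⟩, TwistMap.ext hφ, fun χ hχ => ?_⟩
  exact LiftObj.Hom.ext (hu _ (congrArg TwistMap.hom hχ))

variable (w x) in
/-- Every lift has an image, namely the torsor of its cocycle. -/
theorem exists_twistMap : ∃ y : LiftObj T' (F.obj U), Nonempty (TwistMap w x y) := by
  obtain ⟨lam, hlam, -⟩ := IndexedCocycle.Map.existsUnique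
    ((twistCocycle w x).toCocycle.isTorsor_torsor (isSheaf_over_group E' (F.obj U)))
    ((twistCocycle w x).unit (isSheaf_over_group E' (F.obj U))) (twistLam w x)
  refine ⟨⟨_, (twistCocycle w x).toCocycle.isTorsor_torsor (isSheaf_over_group E' (F.obj U)), lam⟩,
    ⟨⟨((twistCocycle w x).unit (isSheaf_over_group E' (F.obj U))).hom, fun {V} r g => ?_,
      fun {V} r => ?_⟩⟩⟩
  · refine (((twistCocycle w x).unit (isSheaf_over_group E' (F.obj U))).hom_d r
      (x.R.act r g)).trans ?_
    exact congrArg (GSheaf.act _ _) (twistCocycle_d_act r g)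
  · exact ConcreteCategory.congr_hom (congr_app hlam (op V)) r

end Universal
end Twist

/-! ### Morphisms of stacks from universal correspondences -/

section Correspondence
universe w₁ w₂ v₁ u₁ t

variable {B : Type u₁} [Bicategory.{w₁, v₁} B] [Bicategory.IsLocallyDiscrete B]

/-- A correspondence between two pseudofunctors in categories: a set `M x y` of maps from an
object `x` of `𝒢` to an object `y` of `ℋ`, which can be composed with morphisms on both sides and
restricted. Every map is universal, and every `x` has a map to some `y`. Such data determine a
morphism `𝒢 ⟶ ℋ`, and universality makes all coherence conditions automatic. -/
structure Correspondence (𝒢 ℋ : B ⥤ᵖ Cat.{w₂, w₂ + 1}) where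
  M : ∀ {a : B}, 𝒢.obj a → ℋ.obj a → Type t
  post : ∀ {a : B} {x : 𝒢.obj a} {y y' : ℋ.obj a}, M x y → (y ⟶ y') → M x y'
  pre : ∀ {a : B} {x x' : 𝒢.obj a} {y : ℋ.obj a}, (x ⟶ x') → M x' y → M x y
  pull : ∀ {a b : B} (f : a ⟶ b) {x : 𝒢.obj a} {y : ℋ.obj a}, M x y →
    M ((𝒢.map f).toFunctor.obj x) ((ℋ.map f).toFunctor.obj y)
  post_id : ∀ {a : B} {x : 𝒢.obj a} {y : ℋ.obj a} (c : M x y), post c (𝟙 y) = c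
  post_comp : ∀ {a : B} {x : 𝒢.obj a} {y y' y'' : ℋ.obj a} (c : M x y) (φ : y ⟶ y')
    (ψ : y' ⟶ y''), post c (φ ≫ ψ) = post (post c φ) ψ
  pre_id : ∀ {a : B} {x : 𝒢.obj a} {y : ℋ.obj a} (c : M x y), pre (𝟙 x) c = c
  pre_comp : ∀ {a : B} {x x' x'' : 𝒢.obj a} {y : ℋ.obj a} (φ : x ⟶ x') (ψ : x' ⟶ x'')
    (c : M x'' y), pre (φ ≫ ψ) c = pre φ (pre ψ c)
  pre_post : ∀ {a : B} {x x' : 𝒢.obj a} {y y' : ℋ.obj a} (φ : x ⟶ x') (c : M x' y) (ψ : y ⟶ y'),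
    post (pre φ c) ψ = pre φ (post c ψ)
  pull_post : ∀ {a b : B} (f : a ⟶ b) {x : 𝒢.obj a} {y y' : ℋ.obj a} (c : M x y) (φ : y ⟶ y'),
    pull f (post c φ) = post (pull f c) ((ℋ.map f).toFunctor.map φ)
  pull_pre : ∀ {a b : B} (f : a ⟶ b) {x x' : 𝒢.obj a} {y : ℋ.obj a} (φ : x ⟶ x') (c : M x' y),
    pull f (pre φ c) = pre ((𝒢.map f).toFunctor.map φ) (pull f c)
  pull_id : ∀ {a : B} {x : 𝒢.obj a} {y : ℋ.obj a} (c : M x y),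
    post (pull (𝟙 a) c) ((ℋ.mapId a).hom.toNatTrans.app y) =
      pre ((𝒢.mapId a).hom.toNatTrans.app x) c
  pull_comp : ∀ {a b d : B} (f : a ⟶ b) (g : b ⟶ d) {x : 𝒢.obj a} {y : ℋ.obj a} (c : M x y),
    post (pull (f ≫ g) c) ((ℋ.mapComp f g).hom.toNatTrans.app y) =
      pre ((𝒢.mapComp f g).hom.toNatTrans.app x) (pull g (pull f c))
  existsUnique : ∀ {a : B} {x : 𝒢.obj a} {y y' : ℋ.obj a} (c : M x y) (c' : M x y'),
    ∃! φ : y ⟶ y', post c φ = c'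
  exists_map : ∀ {a : B} (x : 𝒢.obj a), ∃ y : ℋ.obj a, Nonempty (M x y)

namespace Correspondence
variable {𝒢 ℋ : B ⥤ᵖ Cat.{w₂, w₂ + 1}} (R : Correspondence.{w₁, w₂, v₁, u₁, t} 𝒢 ℋ)

/-- The morphism between the targets of two maps with the same source. -/
noncomputable def lift {a : B} {x : 𝒢.obj a} {y y' : ℋ.obj a} (c : R.M x y) (c' : R.M x y') :
    y ⟶ y' := (R.existsUnique c c').choose

theorem post_lift {a : B} {x : 𝒢.obj a} {y y' : ℋ.obj a} (c : R.M x y) (c' : R.M x y') :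
    R.post c (R.lift c c') = c' := (R.existsUnique c c').choose_spec.1

theorem post_injective {a : B} {x : 𝒢.obj a} {y y' : ℋ.obj a} (c : R.M x y) {φ ψ : y ⟶ y'}
    (h : R.post c φ = R.post c ψ) : φ = ψ :=
  (R.existsUnique c (R.post c ψ)).unique h rfl

/-- The isomorphism between the targets of two maps with the same source. -/
noncomputable def liftIso {a : B} {x : 𝒢.obj a} {y y' : ℋ.obj a} (c : R.M x y) (c' : R.M x y') :
    y ≅ y' where
  hom := R.lift c c'
  inv := R.lift c' c
  hom_inv_id := R.post_injective c (by rw [R.post_comp, post_lift, post_lift, R.post_id])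
  inv_hom_id := R.post_injective c' (by rw [R.post_comp, post_lift, post_lift, R.post_id])

/-- The target of a chosen map out of `x`. -/
noncomputable def obj {a : B} (x : 𝒢.obj a) : ℋ.obj a := (R.exists_map x).choose

/-- The chosen map out of `x`. -/
noncomputable def unit {a : B} (x : 𝒢.obj a) : R.M x (R.obj x) := (R.exists_map x).choose_spec.some

/-- The functor on fibres determined by a correspondence. -/
noncomputable def functor (a : B) : 𝒢.obj a ⥤ ℋ.obj a where
  obj := R.obj
  map φ := R.lift (R.unit _) (R.pre φ (R.unit _))
  map_id x := R.post_injective (R.unit x) (by rw [post_lift, R.pre_id, R.post_id])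
  map_comp φ ψ := R.post_injective (R.unit _) (by
    rw [post_lift, R.post_comp, post_lift, R.pre_post, post_lift, R.pre_comp])

theorem post_functor_map {a : B} {x x' : 𝒢.obj a} (φ : x ⟶ x') :
    R.post (R.unit x) ((R.functor a).map φ) = R.pre φ (R.unit x') := R.post_lift _ _

/-- The compatibility of the functors on fibres with restriction. -/
noncomputable def naturality {a b : B} (f : a ⟶ b) :
    (𝒢.map f).toFunctor ⋙ R.functor b ≅ R.functor a ⋙ (ℋ.map f).toFunctor :=
  NatIso.ofComponents (fun x => R.liftIso (R.unit _) (R.pull f (R.unit x))) fun {x x'} φ =>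
    R.post_injective (R.unit _) (by
      refine (R.post_comp _ _ _).trans (Eq.trans ?_ (R.post_comp _ _ _).symm)
      refine (congrArg (fun c => R.post c (R.lift _ _)) (R.post_functor_map _)).trans ?_
      refine (R.pre_post _ _ _).trans ((congrArg (R.pre _) (R.post_lift _ _)).trans ?_)
      refine Eq.symm ((congrArg (fun c => R.post c _) (R.post_lift _ _)).trans ?_)
      refine (R.pull_post f _ _).symm.trans ?_
      exact (congrArg (R.pull f) (R.post_functor_map φ)).trans (R.pull_pre f φ _))

theorem post_naturality {a b : B} (f : a ⟶ b) (x : 𝒢.obj a) :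
    R.post (R.unit _) ((R.naturality f).hom.app x) = R.pull f (R.unit x) := R.post_lift _ _

/-- The morphism of pseudofunctors determined by a correspondence. -/
noncomputable def trans : Pseudofunctor.StrongTrans 𝒢 ℋ where
  app a := (R.functor a).toCatHom
  naturality f := Cat.Hom.isoMk (R.naturality f)
  naturality_naturality {a b f g} η := by
    obtain rfl := obj_ext_of_isDiscrete η
    obtain rfl : η = 𝟙 _ := Subsingleton.elim _ _
    have key : ∀ (p : 𝒢.obj b ⟶ ℋ.obj b) (q : 𝒢.obj a ⟶ ℋ.obj a)
        (n : 𝒢.map f ≫ p ≅ q ≫ ℋ.map f),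
        𝒢.map₂ (𝟙 f) ▷ p ≫ n.hom = n.hom ≫ q ◁ ℋ.map₂ (𝟙 f) := fun p q n => by simp
    exact key _ _ _
  naturality_id a := by
    ext1; ext1; ext1 x
    refine R.post_injective (R.unit _) ?_
    change R.post _ ((R.naturality (𝟙 a)).hom.app x ≫ (ℋ.mapId a).hom.toNatTrans.app (R.obj x)) =
      R.post _ ((R.functor a).map ((𝒢.mapId a).hom.toNatTrans.app x) ≫ 𝟙 _ ≫ 𝟙 _)
    refine (R.post_comp _ _ _).trans ((congrArg (fun c => R.post c _)
      (R.post_naturality (𝟙 a) x)).trans ((R.pull_id (R.unit x)).trans ?_))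
    refine Eq.symm ((congrArg (R.post _) ?_).trans (R.post_functor_map _))
    exact (congrArg _ (Category.comp_id _)).trans (Category.comp_id _)
  naturality_comp {a b d} f g := by
    ext1; ext1; ext1 x
    refine R.post_injective (R.unit _) ?_
    change R.post _ ((R.naturality (f ≫ g)).hom.app x ≫
        (ℋ.mapComp f g).hom.toNatTrans.app (R.obj x)) =
      R.post _ ((R.functor d).map ((𝒢.mapComp f g).hom.toNatTrans.app x) ≫ 𝟙 _ ≫
        (R.naturality g).hom.app ((𝒢.map f).toFunctor.obj x) ≫ 𝟙 _ ≫
        (ℋ.map g).toFunctor.map ((R.naturality f).hom.app x) ≫ 𝟙 _)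
    refine (R.post_comp _ _ _).trans ((congrArg (fun c => R.post c _)
      (R.post_naturality (f ≫ g) x)).trans ((R.pull_comp f g (R.unit x)).trans ?_))
    refine Eq.symm ((congrArg (R.post _) (congrArg _ ((Category.id_comp _).trans (congrArg _
      ((Category.id_comp _).trans (Category.comp_id _)))))).trans ?_)
    refine (R.post_comp _ _ _).trans ((congrArg (fun c => R.post c _)
      (R.post_functor_map _)).trans ?_)
    refine (R.pre_post _ _ _).trans (congrArg (R.pre _) ?_)
    refine (R.post_comp _ _ _).trans ((congrArg (fun c => R.post c _)
      (R.post_naturality g _)).trans ?_)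
    exact (R.pull_post g _ _).symm.trans (congrArg (R.pull g) (R.post_naturality f x))

end Correspondence
end Correspondence

/-! ### The correspondence of a twist -/

section TwistCorrespondence
variable {C : Type u} [Category.{v} C] {J : GrothendieckTopology C}
  {D : Type u} [Category.{v} D] {K : GrothendieckTopology D}
  {E : Sheaf J GrpCat.{max u v}} {E' : Sheaf K GrpCat.{max u v}}
  {F : C ⥤ D} {T : GSheaf J E.obj} {T' : GSheaf K E'.obj}

/-- A composite of 2-morphisms in the bicategory of categories, evaluated at an object. -/
theorem cat_comp_app {𝒜 ℬ : Cat.{v, u}} {f g h : 𝒜 ⟶ ℬ} (γ : f ⟶ h) (α : f ⟶ g) (β : g ⟶ h)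
    (e : γ = α ≫ β) (x : 𝒜) : γ.toNatTrans.app x = α.toNatTrans.app x ≫ β.toNatTrans.app x := by
  subst e
  rfl

namespace LiftObj

theorem ap_mapId_hom {U : C} (x : LiftObj T U) {Y : C} (b : Y ⟶ U) (r : x.Sec (b ≫ 𝟙 U)) :
    Hom.ap (T := T) (x := (pull (𝟙 U)).obj x) (y := x)
      (((pseudofunctor T).mapId ⟨op U⟩).hom.toNatTrans.app x) (X := op (Over.mk b)) r =
      x.res (𝟙 Y) (by simp) r := rfl

theorem ap_mapComp_hom {U V W : C} (f : V ⟶ U) (g : W ⟶ V) (x : LiftObj T U) {Y : C} (b : Y ⟶ W)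
    (r : x.Sec (b ≫ g ≫ f)) :
    Hom.ap (T := T) (x := (pull (g ≫ f)).obj x) (y := (pull g).obj ((pull f).obj x))
      (((pseudofunctor T).mapComp f.op.toLoc g.op.toLoc).hom.toNatTrans.app x)
      (X := op (Over.mk b)) r =
      x.res (b' := (b ≫ g) ≫ f) (𝟙 Y) (by simp) r := rfl

theorem ap_map₂ {U V : C} {f f' : V ⟶ U} (h : f = f') (η : f.op.toLoc ⟶ f'.op.toLoc)
    (x : LiftObj T U) {Y : C} (b : Y ⟶ V) (r : x.Sec (b ≫ f)) :
    Hom.ap (T := T) (x := (pull f).obj x) (y := (pull f').obj x)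
      (((pseudofunctor T).map₂ η).toNatTrans.app x) (X := op (Over.mk b)) r =
      x.res (b' := b ≫ f') (𝟙 Y) (by simp [h]) r := by
  subst h
  obtain rfl : η = 𝟙 _ := Subsingleton.elim _ _
  exact (res_id x _ r).symm

theorem ap_comp_mapId_hom {U : C} (x : LiftObj T' (F.obj U)) {Y : D} (b : Y ⟶ F.obj U)
    (r : x.Sec (b ≫ F.map (𝟙 U))) :
    Hom.ap (T := T') (x := (pull (F.map (𝟙 U))).obj x) (y := x)
      (((F.op.toPseudofunctor.comp (pseudofunctor T')).mapId ⟨op U⟩).hom.toNatTrans.app x)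
      (X := op (Over.mk b)) r =
      x.res (𝟙 Y) (by simp) r := by
  let η : (F.map (𝟙 U)).op.toLoc ⟶ (𝟙 (F.obj U)).op.toLoc :=
    (F.op.toPseudofunctor.mapId ⟨op U⟩).hom
  let α : (pull (F.map (𝟙 U))).obj x ⟶ (pull (𝟙 (F.obj U))).obj x :=
    ((pseudofunctor T').map₂ η).toNatTrans.app x
  let β : (pull (𝟙 (F.obj U))).obj x ⟶ x :=
    ((pseudofunctor T').mapId ⟨op (F.obj U)⟩).hom.toNatTrans.app x
  have e : ((F.op.toPseudofunctor.comp (pseudofunctor T')).mapId ⟨op U⟩).hom.toNatTrans.app x =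
      α ≫ β := cat_comp_app (((F.op.toPseudofunctor.comp (pseudofunctor T')).mapId ⟨op U⟩).hom)
    ((pseudofunctor T').map₂ η) ((pseudofunctor T').mapId ⟨op (F.obj U)⟩).hom rfl x
  refine (congrArg (fun φ : (pull (F.map (𝟙 U))).obj x ⟶ x => Hom.ap φ (X := op (Over.mk b)) r)
    e).trans ?_
  have hα : Hom.ap α (X := op (Over.mk b)) r = _ := ap_map₂ (F.map_id U) η x b r
  refine (congrArg (Hom.ap β (X := op (Over.mk b))) hα).trans ?_
  refine (ap_mapId_hom x b _).trans ((res_res x _ _ _ _ r).trans ?_)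
  exact res_congr x (Category.id_comp _) _ _ r

theorem ap_comp_mapComp_hom {U V W : C} (f : V ⟶ U) (g : W ⟶ V) (x : LiftObj T' (F.obj U)) {Y : D}
    (b : Y ⟶ F.obj W) (r : x.Sec (b ≫ F.map (g ≫ f))) :
    Hom.ap (T := T') (x := (pull (F.map (g ≫ f))).obj x)
      (y := (pull (F.map g)).obj ((pull (F.map f)).obj x))
      (((F.op.toPseudofunctor.comp (pseudofunctor T')).mapComp f.op.toLoc
        g.op.toLoc).hom.toNatTrans.app x) (X := op (Over.mk b)) r =
      x.res (b' := (b ≫ F.map g) ≫ F.map f) (𝟙 Y) (by simp) r := by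
  let η : (F.map (g ≫ f)).op.toLoc ⟶ (F.map g ≫ F.map f).op.toLoc :=
    (F.op.toPseudofunctor.mapComp f.op.toLoc g.op.toLoc).hom
  let α : (pull (F.map (g ≫ f))).obj x ⟶ (pull (F.map g ≫ F.map f)).obj x :=
    ((pseudofunctor T').map₂ η).toNatTrans.app x
  let β : (pull (F.map g ≫ F.map f)).obj x ⟶ (pull (F.map g)).obj ((pull (F.map f)).obj x) :=
    ((pseudofunctor T').mapComp (F.map f).op.toLoc (F.map g).op.toLoc).hom.toNatTrans.app x
  have e : ((F.op.toPseudofunctor.comp (pseudofunctor T')).mapComp f.op.toLoc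
      g.op.toLoc).hom.toNatTrans.app x = α ≫ β :=
    cat_comp_app (((F.op.toPseudofunctor.comp (pseudofunctor T')).mapComp f.op.toLoc g.op.toLoc).hom)
      ((pseudofunctor T').map₂ η)
      ((pseudofunctor T').mapComp (F.map f).op.toLoc (F.map g).op.toLoc).hom rfl x
  refine (congrArg (fun φ : (pull (F.map (g ≫ f))).obj x ⟶
    (pull (F.map g)).obj ((pull (F.map f)).obj x) => Hom.ap φ (X := op (Over.mk b)) r) e).trans ?_
  have hα : Hom.ap α (X := op (Over.mk b)) r = _ := ap_map₂ (F.map_comp g f) η x b r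
  refine (congrArg (Hom.ap β (X := op (Over.mk b))) hα).trans ?_
  refine (ap_mapComp_hom (F.map f) (F.map g) x b _).trans ((res_res x _ _ _ _ r).trans ?_)
  exact res_congr x (Category.id_comp _) _ _ r

end LiftObj

namespace TwistMap
variable {w : Twist F T T'} {U : C} {x : LiftObj T U} {y : LiftObj T' (F.obj U)}

theorem pull_post {y' : LiftObj T' (F.obj U)} (c : TwistMap w x y) (φ : y ⟶ y') {V : C} (i : V ⟶ U) :
    (c.post φ).pull i = (c.pull i).post ((LiftObj.pull (F.map i)).map φ) := by
  refine TwistMap.ext_ap fun {Y k} r => ?_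
  exact (LiftObj.ap_res (x := y) (y := y') φ (b := F.map (k ≫ i)) (b' := F.map k ≫ F.map i) (𝟙 _)
    (by simp) (c.ap (b := k ≫ i) r)).symm

/-- The restriction of maps over a twist along an identity is compatible with all isomorphisms that
act on sections as the coherence isomorphisms do. -/
theorem post_pull_id (c : TwistMap w x y) (α : (LiftObj.pull (F.map (𝟙 U))).obj y ⟶ y)
    (β : (LiftObj.pull (𝟙 U)).obj x ⟶ x)
    (hα : ∀ {Y : D} (b : Y ⟶ F.obj U) (r : y.Sec (b ≫ F.map (𝟙 U))),
      LiftObj.Hom.ap α (X := op (Over.mk b)) r = y.res (𝟙 Y) (by simp) r)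
    (hβ : ∀ {Y : C} (b : Y ⟶ U) (r : x.Sec (b ≫ 𝟙 U)),
      LiftObj.Hom.ap β (X := op (Over.mk b)) r = x.res (𝟙 Y) (by simp) r) :
    (c.pull (𝟙 U)).post α = c.pre β := by
  refine TwistMap.ext_ap fun {Y k} r => ?_
  refine (hα (F.map k) _).trans ((LiftObj.res_res y (b := F.map (k ≫ 𝟙 U))
    (b' := F.map k ≫ F.map (𝟙 U)) (b'' := F.map k) (𝟙 _) (by simp) (𝟙 _) (by simp)
    (c.ap (b := k ≫ 𝟙 U) r)).trans (Eq.symm ?_))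
  refine (congrArg (fun r : x.Sec k => c.ap r) (hβ k r)).trans ((c.ap_res (𝟙 Y) (by simp) r).trans ?_)
  exact LiftObj.res_congr y (by simp) _ _ _

/-- The restriction of maps over a twist along a composite is compatible with all isomorphisms that
act on sections as the coherence isomorphisms do. -/
theorem post_pull_comp {V W : C} (f : V ⟶ U) (g : W ⟶ V) (c : TwistMap w x y)
    (α : (LiftObj.pull (F.map (g ≫ f))).obj y ⟶
      (LiftObj.pull (F.map g)).obj ((LiftObj.pull (F.map f)).obj y))
    (β : (LiftObj.pull (g ≫ f)).obj x ⟶ (LiftObj.pull g).obj ((LiftObj.pull f).obj x))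
    (hα : ∀ {Y : D} (b : Y ⟶ F.obj W) (r : y.Sec (b ≫ F.map (g ≫ f))),
      LiftObj.Hom.ap α (X := op (Over.mk b)) r =
        y.res (b' := (b ≫ F.map g) ≫ F.map f) (𝟙 Y) (by simp) r)
    (hβ : ∀ {Y : C} (b : Y ⟶ W) (r : x.Sec (b ≫ g ≫ f)),
      LiftObj.Hom.ap β (X := op (Over.mk b)) r = x.res (b' := (b ≫ g) ≫ f) (𝟙 Y) (by simp) r) :
    (c.pull (g ≫ f)).post α = ((c.pull f).pull g).pre β := by
  refine TwistMap.ext_ap fun {Y k} r => ?_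
  refine (hα (F.map k) _).trans ((LiftObj.res_res y (b := F.map (k ≫ g ≫ f))
    (b' := F.map k ≫ F.map (g ≫ f)) (b'' := (F.map k ≫ F.map g) ≫ F.map f) (𝟙 _) (by simp) (𝟙 _)
    (by simp) (c.ap (b := k ≫ g ≫ f) r)).trans (Eq.symm ?_))
  refine (congrArg (((c.pull f).pull g).ap (b := k)) (hβ k r)).trans ?_
  refine (LiftObj.res_res y (b := F.map ((k ≫ g) ≫ f)) (b' := F.map (k ≫ g) ≫ F.map f)
    (b'' := (F.map k ≫ F.map g) ≫ F.map f) (𝟙 _) (by simp) (𝟙 _) (by simp) (c.ap (b := (k ≫ g) ≫ f)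
      (x.res (𝟙 Y) (by simp) r))).trans ?_
  refine (congrArg (LiftObj.res y _ _) (c.ap_res (b' := (k ≫ g) ≫ f) (𝟙 Y) (by simp) r)).trans ?_
  refine (LiftObj.res_res y _ _ _ _ _).trans ?_
  exact LiftObj.res_congr y (by simp) _ _ _

end TwistMap

variable [F.IsContinuous J K] (w : Twist F T T')

/-- The maps over a twist form a correspondence between the lifts to `T` and the direct image of the
lifts to `T'`. -/
noncomputable def Twist.correspondence (hF : ∀ U : C, RepresentablyFlat (Over.post (X := U) F)) :
    Correspondence (LiftObj.pseudofunctor T)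
      (F.op.toPseudofunctor.comp (LiftObj.pseudofunctor T')) where
  M {a} x y := TwistMap w (U := a.as.unop) x y
  post {a} x y y' c φ := TwistMap.post (U := a.as.unop) (x := x) (y := y) (y' := y') c φ
  pre {a} x x' y φ c := TwistMap.pre (U := a.as.unop) (x' := x) (x := x') (y := y) φ c
  pull {a b} f x y c := TwistMap.pull (U := a.as.unop) (x := x) (y := y) f.as.unop c
  post_id _ := rfl
  post_comp _ _ _ := rfl
  pre_id _ := rfl
  pre_comp _ _ _ := rfl
  pre_post _ _ _ := rfl
  pull_post {a b} f x y y' c φ := TwistMap.pull_post (U := a.as.unop) (x := x) (y := y) (y' := y')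
    c φ f.as.unop
  pull_pre {a b} f x x' y φ c := rfl
  pull_id {a} x y c := TwistMap.post_pull_id (U := a.as.unop) (x := x) (y := y) c _ _
    (LiftObj.ap_comp_mapId_hom (F := F) (U := a.as.unop) y)
    (LiftObj.ap_mapId_hom (U := a.as.unop) x)
  pull_comp {a b d} f g x y c := TwistMap.post_pull_comp (U := a.as.unop) (x := x) (y := y)
    f.as.unop g.as.unop c _ _
    (LiftObj.ap_comp_mapComp_hom (F := F) (U := a.as.unop) f.as.unop g.as.unop y)
    (LiftObj.ap_mapComp_hom (U := a.as.unop) f.as.unop g.as.unop x)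
  existsUnique {a} x y y' c c' := by
    have := hF a.as.unop
    exact TwistMap.existsUnique (U := a.as.unop) (x := x) (y := y) (y' := y') c c'
  exists_map {a} x := by
    have := hF a.as.unop
    exact exists_twistMap (U := a.as.unop) w x

end TwistCorrespondence

section TwistId
variable {C : Type u} [Category.{v} C] {J : GrothendieckTopology C}
  {E E' : Sheaf J GrpCat.{max u v}} {T : GSheaf J E.obj} {T' : GSheaf J E'.obj}

theorem flat_post_id (U : C) : RepresentablyFlat (Over.post (X := U) (𝟭 C)) :=
  RepresentablyFlat.of_iso (NatIso.ofComponents (fun X => Over.isoMk (Iso.refl _) (Category.id_comp _))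
    (fun _ => by ext; exact (Category.comp_id _).trans (Category.id_comp _).symm) :
    𝟭 (Over U) ≅ Over.post (X := U) (𝟭 C))

/-- The maps over a twist over the identity form a correspondence between lifts. -/
noncomputable def Twist.correspondenceId (w : Twist (𝟭 C) T T') :
    Correspondence (LiftObj.pseudofunctor T) (LiftObj.pseudofunctor T') where
  M {a} x y := TwistMap w (F := 𝟭 C) (U := a.as.unop) x y
  post {a} x y y' c φ := TwistMap.post (F := 𝟭 C) (U := a.as.unop) (x := x) (y := y) (y' := y') c φ
  pre {a} x x' y φ c := TwistMap.pre (F := 𝟭 C) (U := a.as.unop) (x' := x) (x := x') (y := y) φ c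
  pull {a b} f x y c := TwistMap.pull (F := 𝟭 C) (U := a.as.unop) (x := x) (y := y) f.as.unop c
  post_id _ := rfl
  post_comp _ _ _ := rfl
  pre_id _ := rfl
  pre_comp _ _ _ := rfl
  pre_post _ _ _ := rfl
  pull_post {a b} f x y y' c φ := TwistMap.pull_post (F := 𝟭 C) (U := a.as.unop) (x := x) (y := y) (y' := y')
    c φ f.as.unop
  pull_pre {a b} f x x' y φ c := rfl
  pull_id {a} x y c := TwistMap.post_pull_id (F := 𝟭 C) (U := a.as.unop) (x := x) (y := y) c _ _
    (LiftObj.ap_mapId_hom (U := a.as.unop) y)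
    (LiftObj.ap_mapId_hom (U := a.as.unop) x)
  pull_comp {a b d} f g x y c := TwistMap.post_pull_comp (F := 𝟭 C) (U := a.as.unop) (x := x) (y := y)
    f.as.unop g.as.unop c _ _
    (LiftObj.ap_mapComp_hom (U := a.as.unop) f.as.unop g.as.unop y)
    (LiftObj.ap_mapComp_hom (U := a.as.unop) f.as.unop g.as.unop x)
  existsUnique {a} x y y' c c' := by
    have := flat_post_id a.as.unop
    exact TwistMap.existsUnique (F := 𝟭 C) (U := a.as.unop) (x := x) (y := y) (y' := y') c c'
  exists_map {a} x := by
    have := flat_post_id a.as.unop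
    exact exists_twistMap (U := a.as.unop) w x

end TwistId

/-! ### Functoriality of the Heisenberg gerbe -/

section GerbeHom
variable {C : Type u} [Category.{v} C] {J : GrothendieckTopology C}
  {D : Type u} [Category.{v} D] {K : GrothendieckTopology D}
  {D' : Type u} [Category.{v} D'] {K' : GrothendieckTopology D'}
  {F : C ⥤ D} [F.IsContinuous J K] {G : D ⥤ D'} [G.IsContinuous K K']
  {X : TorsorPair J} {Y : TorsorPair K} {Z : TorsorPair K'}

/-- The twist of Heisenberg torsors given by a morphism of torsor pairs. -/
noncomputable def TorsorPairHom.twist (f : TorsorPairHom F X Y) :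
    Twist F (X.prod.res (heisenberg X.A X.B).π.hom) (Y.prod.res (heisenberg Y.A Y.B).π.hom) where
  τ :=
    { app := fun U => ↾fun t : X.P.carrier.obj.obj U × X.Q.carrier.obj.obj U =>
        ((f.p.app U t.1, f.q.app U t.2) :
          Y.P.carrier.obj.obj (F.op.obj U) × Y.Q.carrier.obj.obj (F.op.obj U))
      naturality := fun U V i => by
        refine ConcreteCategory.hom_ext _ _ fun t => ?_
        change X.P.carrier.obj.obj U × X.Q.carrier.obj.obj U at t
        have h₁ := NatTrans.naturality_apply f.p i t.1
        have h₂ := NatTrans.naturality_apply f.q i t.2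
        exact Prod.ext h₁ h₂ }
  θ {U} _ h := f.heis U h
  map_θ {U V} i t h := Heis.ext (NatTrans.naturality_apply f.α i.op (h : Heis X.A X.B (op U)).a).symm
    (NatTrans.naturality_apply f.β i.op (h : Heis X.A X.B (op U)).b).symm
    (NatTrans.naturality_apply (tensorMapOver F f.α f.β) i.op (h : Heis X.A X.B (op U)).t).symm
  θ_mul {U} _ g h := map_mul (f.heis U) g h
  τ_act {U} t h := Prod.ext (f.p_act U t.1 (h : Heis X.A X.B (op U)).a)
    (f.q_act U t.2 (h : Heis X.A X.B (op U)).b)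

variable {f : TorsorPairHom F X Y} {U : C}

/-- A map of lifts over a morphism of torsor pairs, seen as a map over its twist. -/
def LiftMap.toTwistMap {x : X.Lift U} {y : Y.Lift (F.obj U)} (c : LiftMap f x y) :
    TwistMap f.twist x y := ⟨c.hom, fun {V} r h => c.map_act V r h, fun {V} r => c.comm V r⟩

/-- A map over the twist of a morphism of torsor pairs, seen as a map of lifts. -/
def TwistMap.toLiftMap {x : X.Lift U} {y : Y.Lift (F.obj U)} (c : TwistMap f.twist x y) :
    LiftMap f x y := ⟨c.hom, fun _ r h => c.map_act r h, fun _ r => c.comm r⟩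

/-- Every map of lifts over a morphism of torsor pairs is universal. -/
theorem LiftMap.existsUnique [RepresentablyFlat (Over.post (X := U) F)]
    {x : X.Lift U} {y y' : Y.Lift (F.obj U)} (c : LiftMap f x y) (c' : LiftMap f x y') :
    ∃! φ : y ⟶ y', c.post φ = c' := by
  obtain ⟨φ, hφ, hu⟩ := TwistMap.existsUnique c.toTwistMap c'.toTwistMap
  exact ⟨φ, LiftMap.ext (congrArg TwistMap.hom hφ), fun ψ hψ =>
    hu ψ (TwistMap.ext (congrArg LiftMap.hom hψ))⟩

theorem LiftMap.post_injective [RepresentablyFlat (Over.post (X := U) F)]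
    {x : X.Lift U} {y y' : Y.Lift (F.obj U)} (c : LiftMap f x y) {φ ψ : y ⟶ y'}
    (h : c.post φ = c.post ψ) : φ = ψ :=
  (LiftMap.existsUnique c (c.post ψ)).unique h rfl

/-- A map over a morphism of torsor pairs carries the action of the band of the source to that of the
band of the target. -/
theorem LiftMap.post_band {x : X.Lift U} {y : Y.Lift (F.obj U)} (c : LiftMap f x y)
    (t : (tensor X.A X.B).obj.obj (op U)) :
    c.post (Y.gerbe.band (U := F.obj U) y (f.tensor U t)) = c.pre (X.gerbe.band (U := U) x t) := by
  refine LiftMap.ext ?_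
  ext V r
  refine Eq.symm ((c.map_act V.unop r _).trans ?_)
  refine congrArg (y.R.act (U := op ((Over.post F).obj V.unop)) (c.hom.app V r)) ?_
  refine Heis.ext (map_zero (f.α.app _).hom) (map_zero (f.β.app _).hom) ?_
  exact NatTrans.naturality_apply (tensorMapOver F f.α f.β) V.unop.hom.op t

/-- The morphism of gerbes induced by a morphism of torsor pairs. -/
noncomputable def TorsorPairHom.gerbeHom (f : TorsorPairHom F X Y)
    (hF : ∀ U : C, RepresentablyFlat (Over.post (X := U) F)) : GerbeHom f where
  trans := (f.twist.correspondence hF).trans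
  unit {U} x := TwistMap.toLiftMap ((f.twist.correspondence hF).unit (a := ⟨op U⟩) x)
  unit_naturality {U x y} φ := LiftMap.ext (congrArg TwistMap.hom
    ((f.twist.correspondence hF).post_functor_map (a := ⟨op U⟩) φ).symm)
  unit_pull {U V} i x := LiftMap.ext (congrArg TwistMap.hom
    ((f.twist.correspondence hF).post_naturality (a := ⟨op U⟩) (b := ⟨op V⟩) i.op.toLoc x))
  map_band {U} x t := by
    have := hF U
    refine LiftMap.post_injective (f := f) (U := U) (x := x)
      (TwistMap.toLiftMap ((f.twist.correspondence hF).unit (a := ⟨op U⟩) x)) ?_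
    refine Eq.trans ?_ (LiftMap.post_band (f := f) (U := U) (x := x) _ t).symm
    exact LiftMap.ext (congrArg TwistMap.hom
      ((f.twist.correspondence hF).post_functor_map (a := ⟨op U⟩) (X.gerbe.band (U := U) x t)))

/-- Two functors that come with natural maps over `f` are isomorphic in a unique way. -/
theorem LiftMap.existsUnique_iso [RepresentablyFlat (Over.post (X := U) F)]
    (H H' : X.Lift U ⥤ Y.Lift (F.obj U)) (c : ∀ x, LiftMap f x (H.obj x))
    (c' : ∀ x, LiftMap f x (H'.obj x))
    (hc : ∀ {x y : X.Lift U} (φ : x ⟶ y), (c y).pre φ = (c x).post (H.map φ))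
    (hc' : ∀ {x y : X.Lift U} (φ : x ⟶ y), (c' y).pre φ = (c' x).post (H'.map φ)) :
    ∃! e : H ≅ H', ∀ x, (c x).post (e.hom.app x) = c' x := by
  choose h hh _ using fun x => LiftMap.existsUnique (c x) (c' x)
  choose k hk _ using fun x => LiftMap.existsUnique (c' x) (c x)
  have hhk : ∀ x, h x ≫ k x = 𝟙 _ := fun x => (c x).post_injective
    ((congrArg (fun d => LiftMap.post d (k x)) (hh x)).trans (hk x))
  have hkh : ∀ x, k x ≫ h x = 𝟙 _ := fun x => (c' x).post_injective
    ((congrArg (fun d => LiftMap.post d (h x)) (hk x)).trans (hh x))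
  refine ⟨NatIso.ofComponents (fun x => ⟨h x, k x, hhk x, hkh x⟩) fun {x y} φ =>
    (c x).post_injective ?_, hh, fun e he => ?_⟩
  · refine (congrArg (fun d => LiftMap.post d (h y)) (hc φ).symm).trans ?_
    refine (congrArg (LiftMap.pre φ) (hh y)).trans ((hc' φ).trans ?_)
    exact congrArg (fun d => LiftMap.post d (H'.map φ)) (hh x).symm
  · ext x
    exact (c x).post_injective ((he x).trans (hh x).symm)

theorem GerbeHom.existsUnique_iso_id {X : TorsorPair J}
    (Φ : GerbeHom (F := 𝟭 C) (K := J) (TorsorPairHom.id X)) (U : C) :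
    ∃! e : 𝟭 (X.Lift U) ≅ Φ.functor U,
        ∀ x : X.Lift U, (LiftMap.id x).post (e.hom.app x) = Φ.unit x :=
  have := flat_post_id U
  LiftMap.existsUnique_iso (f := TorsorPairHom.id X) (U := U) (𝟭 (X.Lift U)) (Φ.functor U)
    (fun x => LiftMap.id x) (fun x => Φ.unit x) (fun _ => rfl) (fun φ => Φ.unit_naturality φ)

theorem GerbeHom.existsUnique_iso_comp [(F ⋙ G).IsContinuous J K']
    (hF : ∀ U : C, RepresentablyFlat (Over.post (X := U) F))
    (hG : ∀ U : D, RepresentablyFlat (Over.post (X := U) G))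
    {f : TorsorPairHom F X Y} {g : TorsorPairHom G Y Z} (Φ : GerbeHom f) (Ψ : GerbeHom g)
    (Ξ : GerbeHom (f.comp g)) (U : C) :
    ∃! e : Φ.functor U ⋙ Ψ.functor (F.obj U) ≅ Ξ.functor U,
      ∀ x : X.Lift U, ((Φ.unit x).comp (Ψ.unit ((Φ.functor U).obj x))).post (e.hom.app x) =
        Ξ.unit x := by
  have := hF U
  have := hG (F.obj U)
  have : RepresentablyFlat (Over.post (X := U) (F ⋙ G)) :=
    RepresentablyFlat.comp (Over.post (X := U) F) (Over.post (X := F.obj U) G)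
  refine LiftMap.existsUnique_iso (F := F ⋙ G) (f := f.comp g) (U := U)
    (Φ.functor U ⋙ Ψ.functor (F.obj U)) (Ξ.functor U)
    (fun x => (Φ.unit x).comp (Ψ.unit ((Φ.functor U).obj x))) (fun x => Ξ.unit x)
    (fun {x y} φ => ?_) (fun φ => Ξ.unit_naturality φ)
  have h₁ := Φ.unit_naturality φ
  have h₂ := Ψ.unit_naturality ((Φ.functor U).map φ)
  refine (congrArg (fun d : LiftMap f x ((Φ.functor U).obj y) =>
    d.comp (Ψ.unit ((Φ.functor U).obj y))) h₁).trans ?_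
  exact congrArg (fun d => (Φ.unit x).comp d) h₂

end GerbeHom

/-! ### Twists that induce equivalences of gerbes -/

section Correspondence
universe w₁ w₂ v₁ u₁ t
variable {B : Type u₁} [Bicategory.{w₁, v₁} B] [Bicategory.IsLocallyDiscrete B]

/-- The functors on fibres of a correspondence are equivalences if the maps are also couniversal and
every object is the target of a map. -/
theorem Correspondence.isEquivalence_functor {𝒢 ℋ : B ⥤ᵖ Cat.{w₂, w₂ + 1}}
    (R : Correspondence.{w₁, w₂, v₁, u₁, t} 𝒢 ℋ) (a : B)
    (h₁ : ∀ {x x' : 𝒢.obj a} {y : ℋ.obj a} (c : R.M x y) (c' : R.M x' y),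
      ∃! φ : x ⟶ x', R.pre φ c' = c)
    (h₂ : ∀ y : ℋ.obj a, ∃ x : 𝒢.obj a, Nonempty (R.M x y)) : (R.functor a).IsEquivalence where
  faithful := ⟨fun {x x'} φ ψ h => by
    refine (h₁ (R.pre ψ (R.unit x')) (R.unit x')).unique ?_ rfl
    rw [← R.post_functor_map, ← R.post_functor_map, h]⟩
  full := ⟨fun {x x'} χ => by
    obtain ⟨φ, hφ, -⟩ := h₁ (R.post (R.unit x) χ) (R.unit x')
    exact ⟨φ, R.post_injective (R.unit x) ((R.post_functor_map φ).trans hφ)⟩⟩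
  essSurj := ⟨fun y => by
    obtain ⟨x, ⟨c⟩⟩ := h₂ y
    exact ⟨x, ⟨R.liftIso (R.unit x) c⟩⟩⟩

end Correspondence

section FibreProduct
universe w v₁ u₁
variable {D : Type u₁} [Category.{v₁} D] {K : GrothendieckTopology D} {N M P : Dᵒᵖ ⥤ Type w}

/-- The fibre product of two presheaves of sets over a third one. -/
def fibreProduct (f : N ⟶ P) (g : M ⟶ P) : Dᵒᵖ ⥤ Type w where
  obj U := {p : N.obj U × M.obj U // f.app U p.1 = g.app U p.2}
  map i := ↾fun p => ⟨(N.map i p.1.1, M.map i p.1.2), by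
    rw [NatTrans.naturality_apply, NatTrans.naturality_apply, p.2]⟩
  map_id U := ConcreteCategory.hom_ext _ _ fun p => Subtype.ext
    (Prod.ext (Functor.map_id_apply N _ p.1.1) (Functor.map_id_apply M _ p.1.2))
  map_comp i j := ConcreteCategory.hom_ext _ _ fun p => Subtype.ext
    (Prod.ext (Functor.map_comp_apply N i j p.1.1) (Functor.map_comp_apply M i j p.1.2))

theorem isSheaf_fibreProduct (f : N ⟶ P) (g : M ⟶ P) (hN : Presheaf.IsSheaf K N)
    (hM : Presheaf.IsSheaf K M) (hP : Presheaf.IsSheaf K P) :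
    Presheaf.IsSheaf K (fibreProduct f g) := by
  rw [isSheaf_iff_isSheaf_of_type]
  intro X S hS x hx
  rw [Presieve.compatible_iff_sieveCompatible] at hx
  obtain ⟨n, hn⟩ := exists_glue hN hS (fun Y k hk => (x k hk).1.1) fun Y Z k l hk =>
    congrArg (fun p => p.1.1) (hx k l hk)
  obtain ⟨m, hm⟩ := exists_glue hM hS (fun Y k hk => (x k hk).1.2) fun Y Z k l hk =>
    congrArg (fun p => p.1.2) (hx k l hk)
  refine ⟨⟨(n, m), sections_ext hP hS fun Y k hk => ?_⟩, fun Y k hk => ?_, fun p hp => ?_⟩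
  · rw [← NatTrans.naturality_apply, ← NatTrans.naturality_apply, hn k hk, hm k hk]
    exact (x k hk).2
  · exact Subtype.ext (Prod.ext (hn k hk) (hm k hk))
  · refine Subtype.ext (Prod.ext ?_ ?_)
    · exact sections_ext hN hS fun Y k hk =>
        (congrArg (fun p => p.1.1) (hp k hk)).trans (hn k hk).symm
    · exact sections_ext hM hS fun Y k hk =>
        (congrArg (fun p => p.1.2) (hp k hk)).trans (hm k hk).symm

end FibreProduct

section TwistEquivalence
variable {C : Type u} [Category.{v} C] {J : GrothendieckTopology C}
  {E E' : Sheaf J GrpCat.{max u v}} {T : GSheaf J E.obj} {T' : GSheaf J E'.obj}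
  {A : Sheaf J AddCommGrpCat.{max u v}} {ι : toGrp A ⟶ E} {ι' : toGrp A ⟶ E'}

namespace Twist
variable (w : Twist (𝟭 C) T T')

/-- The map of a twist over the identity, on sections. -/
def base {Y : Cᵒᵖ} (t : T.carrier.obj.obj Y) : T'.carrier.obj.obj Y := w.τ.app Y t

/-- The crossed homomorphism of a twist over the identity. -/
def cross {Y : C} (t : T.carrier.obj.obj (op Y)) (g : E.obj.obj (op Y)) : E'.obj.obj (op Y) := w.θ t g

theorem map_base {Y Z : Cᵒᵖ} (i : Y ⟶ Z) (t : T.carrier.obj.obj Y) :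
    T'.carrier.obj.map i (w.base t) = w.base (T.carrier.obj.map i t) :=
  (NatTrans.naturality_apply w.τ i t).symm

theorem map_cross {Y Z : C} (i : Z ⟶ Y) (t : T.carrier.obj.obj (op Y)) (g : E.obj.obj (op Y)) :
    E'.obj.map i.op (w.cross t g) = w.cross (T.carrier.obj.map i.op t) (E.obj.map i.op g) :=
  w.map_θ i t g

theorem cross_mul {Y : C} (t : T.carrier.obj.obj (op Y)) (g h : E.obj.obj (op Y)) :
    w.cross t (g * h) = w.cross t g * w.cross (T.act t g) h := w.θ_mul t g h

theorem cross_one {Y : C} (t : T.carrier.obj.obj (op Y)) : w.cross t 1 = 1 := w.θ_one t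

theorem base_act {Y : C} (t : T.carrier.obj.obj (op Y)) (g : E.obj.obj (op Y)) :
    w.base (T.act t g) = T'.act (w.base t) (w.cross t g) := w.τ_act t g

variable {w}

/-- The crossed homomorphism is compatible with the bands on the left as well, since `A` acts
trivially on `T`. -/
theorem cross_mul_bandSec (h : IsQuotientTorsor ι T)
    (hθ : ∀ {Y : C} (t : T.carrier.obj.obj (op Y)) (a : A.obj.obj (op Y)),
      w.cross t (bandSec ι a) = bandSec ι' a) {Y : C} (t : T.carrier.obj.obj (op Y))
      (g : E.obj.obj (op Y)) (a : A.obj.obj (op Y)) :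
    w.cross t (bandSec ι a * g) = bandSec ι' a * w.cross t g := by
  have e : T.act t (bandSec ι a) = t := (h.stabilizer t _).2 ⟨_, rfl⟩
  rw [cross_mul, hθ, e]

end Twist

namespace TwistMap
variable {w : Twist (𝟭 C) T T'} {U : C} {x : LiftObj T U} {y : LiftObj T' U}

/-- The effect on sections of a map over a twist over the identity. -/
def sec (c : TwistMap w (U := U) x y) {Y : C} {b : Y ⟶ U} (r : x.Sec b) : y.Sec b :=
  TwistMap.ap (F := 𝟭 C) (U := U) (y := y) c r

theorem sec_res (c : TwistMap w (U := U) x y) {Y Z : C} {b : Y ⟶ U} {b' : Z ⟶ U} (k : Z ⟶ Y)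
    (h : k ≫ b = b') (r : x.Sec b) : c.sec (x.res k h r) = y.res k h (c.sec r) :=
  TwistMap.ap_res (F := 𝟭 C) (U := U) (y := y) c k h r

theorem sec_sact (c : TwistMap w (U := U) x y) {Y : C} {b : Y ⟶ U} (r : x.Sec b)
    (g : E.obj.obj (op Y)) : c.sec (x.sact r g) = y.sact (c.sec r) (w.cross (x.slam r) g) :=
  TwistMap.ap_sact (F := 𝟭 C) (U := U) (y := y) c r g

theorem slam_sec (c : TwistMap w (U := U) x y) {Y : C} {b : Y ⟶ U} (r : x.Sec b) :
    y.slam (c.sec r) = w.base (x.slam r) :=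
  TwistMap.slam_ap (F := 𝟭 C) (U := U) (y := y) c r

/-- Maps over a twist between torsors under the quotients by the same abelian sheaf are
couniversal, provided that the crossed homomorphism is the identity on this sheaf: a section of
the source is determined by its images in `T` and in the target. -/
theorem existsUnique_pre (h : IsQuotientTorsor ι T) (h' : IsQuotientTorsor ι' T')
    (hθ : ∀ {Y : C} (t : T.carrier.obj.obj (op Y)) (a : A.obj.obj (op Y)),
      w.cross t (bandSec ι a) = bandSec ι' a)
    {x' : LiftObj T U} (c : TwistMap w (U := U) x y) (c' : TwistMap w (U := U) x' y) :
    ∃! φ : x ⟶ x', TwistMap.pre (F := 𝟭 C) (U := U) (y := y) φ c' = c := by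
  have inj : ∀ {Y : C} {b : Y ⟶ U} (s s' : x'.Sec b), x'.slam s = x'.slam s' → c'.sec s = c'.sec s' →
      s = s' := by
    intro Y b s s' e₁ e₂
    have e := x'.slam_sact s (x'.sdiff s s')
    rw [x'.sact_sdiff, ← e₁] at e
    obtain ⟨a, ha⟩ := (h.stabilizer _ _).1 e.symm
    have e₃ := c'.sec_sact s (bandSec ι (Multiplicative.toAdd a))
    rw [hθ] at e₃
    have e₄ : x'.sact s (bandSec ι (Multiplicative.toAdd a)) = s' :=
      (congrArg (x'.sact s) ha).trans (x'.sact_sdiff s s')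
    rw [e₄, ← e₂] at e₃
    have e₅ : bandSec ι' (Multiplicative.toAdd a) = 1 :=
      y.sact_injective _ (e₃.symm.trans (y.sact_one _).symm)
    have e₆ : a = 1 := h'.injective _ (e₅.trans (map_one (ι'.hom.app (op Y)).hom).symm)
    rw [← e₄, e₆]
    exact (x'.sact_one s).symm.trans (congrArg (x'.sact s) (map_one (ι.hom.app (op Y)).hom).symm)
  -- Locally a section of `x'` can be moved to have the right image in `T`; the discrepancy between
  -- the images in `y` is then a section of `A`, which acts trivially on `T`.
  have key : ∀ {Y : C} (b : Y ⟶ U) (r : x.Sec b), ∃ S ∈ J Y, ∀ ⦃V : C⦄ (k : V ⟶ Y), S k →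
      ∃ s : x'.Sec (k ≫ b), x'.slam s = x.slam (x.res k rfl r) ∧ c'.sec s = c.sec (x.res k rfl r) := by
    intro Y b r
    obtain ⟨S, hS, hs⟩ := x'.exists_sec b
    refine exists_cover_trans hS _ fun V k hk => ?_
    obtain ⟨s⟩ := hs k hk
    obtain ⟨R, hR, hg⟩ := h.locally_transitive (x'.slam s) (x.slam (x.res k rfl r))
    refine ⟨R, hR, fun W l hl => ?_⟩
    obtain ⟨g, hg⟩ := hg l hl
    let s₁ : x'.Sec ((l ≫ k) ≫ b) := x'.sact (x'.res l (by simp) s) g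
    have hs₁ : x'.slam s₁ = x.slam (x.res (l ≫ k) rfl r) := by
      refine (x'.slam_sact _ g).trans ?_
      rw [x'.slam_res, hg, ← x.slam_res (b' := (l ≫ k) ≫ b) l (by simp), x.res_res]
    have e := y.slam_sact (c'.sec s₁) (y.sdiff (c'.sec s₁) (c.sec (x.res (l ≫ k) rfl r)))
    rw [y.sact_sdiff, c.slam_sec, c'.slam_sec, ← hs₁] at e
    obtain ⟨a, ha⟩ := (h'.stabilizer _ _).1 e.symm
    refine ⟨x'.sact s₁ (bandSec ι (Multiplicative.toAdd a)), ?_, ?_⟩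
    · rw [x'.slam_sact, ← hs₁]
      exact (h.stabilizer _ _).2 ⟨_, rfl⟩
    · rw [c'.sec_sact, hθ]
      exact (congrArg (y.sact _) ha).trans (y.sact_sdiff _ _)
  obtain ⟨φ, hφ⟩ := exists_hom_of_local (M := x.R.carrier.obj) (N := x'.R.carrier.obj)
    x'.R.carrier.property
    (fun X r s => x'.slam (b := X.hom) s = x.slam (b := X.hom) r ∧
      c'.sec (b := X.hom) s = c.sec (b := X.hom) r)
    (fun X Y f r s hrs => by
      refine ⟨(x'.slam_res f.left (Over.w f) s).trans ?_,
        (c'.sec_res f.left (Over.w f) s).trans ?_⟩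
      · rw [hrs.1]
        exact (x.slam_res f.left (Over.w f) r).symm
      · rw [hrs.2]
        exact (c.sec_res f.left (Over.w f) r).symm)
    (fun X r s s' hs hs' => inj (b := X.hom) s s' (hs.1.trans hs'.1.symm) (hs.2.trans hs'.2.symm))
    (fun X r => by
      obtain ⟨S, hS, hs⟩ := key X.hom r
      refine ⟨_, over_symm_mem hS, fun Y f hf => ?_⟩
      obtain ⟨s, hs₁, hs₂⟩ := hs f.left hf
      have hw : f.left ≫ X.hom = Y.hom := Over.w f
      have hw' : 𝟙 _ ≫ f.left ≫ X.hom = Y.hom := (Category.id_comp _).trans hw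
      refine ⟨x'.res (b' := Y.hom) (𝟙 _) hw' s, ?_, ?_⟩
      · refine (x'.slam_res (b' := Y.hom) (𝟙 _) hw' s).trans ?_
        rw [hs₁, ← x.slam_res (b' := Y.hom) (𝟙 _) hw', x.res_res]
        exact congrArg (x.slam (b := Y.hom))
          (LiftObj.res_congr x (b := X.hom) (Category.id_comp _) _ hw r)
      · refine (c'.sec_res (b' := Y.hom) (𝟙 _) hw' s).trans ?_
        rw [hs₂, ← c.sec_res (b' := Y.hom) (𝟙 _) hw', x.res_res]
        exact congrArg (c.sec (b := Y.hom))
          (LiftObj.res_congr x (b := X.hom) (Category.id_comp _) _ hw r))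
  have hφs : ∀ {Y : C} {b : Y ⟶ U} (r : x.Sec b) (s : x'.Sec b), x'.slam s = x.slam r →
      c'.sec s = c.sec r → φ.app (op (Over.mk b)) r = s := fun {Y b} r s e₁ e₂ =>
    hφ (X := Over.mk b) r s ⟨e₁, e₂⟩
  have hφr : ∀ {Y Z : C} {b : Y ⟶ U} (k : Z ⟶ Y) (r : x.Sec b),
      x'.res k rfl (φ.app (op (Over.mk b)) r) = φ.app (op (Over.mk (k ≫ b))) (x.res k rfl r) :=
    fun {Y Z b} k r => (NatTrans.naturality_apply φ
      (Over.homMk k rfl : Over.mk (k ≫ b) ⟶ Over.mk b).op r).symm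
  have h₁ : ∀ {Y : C} {b : Y ⟶ U} (r : x.Sec b),
      x'.slam (b := b) (φ.app (op (Over.mk b)) r) = x.slam r := by
    intro Y b r
    obtain ⟨S, hS, hs⟩ := key b r
    refine sections_ext T.carrier.property hS fun Z k hk => ?_
    obtain ⟨s, hs₁, hs₂⟩ := hs k hk
    rw [← x'.slam_res (b' := k ≫ b) k rfl, ← x.slam_res (b' := k ≫ b) k rfl, hφr,
      hφs _ s hs₁ hs₂, hs₁]
  have h₂ : ∀ {Y : C} {b : Y ⟶ U} (r : x.Sec b),
      c'.sec (b := b) (φ.app (op (Over.mk b)) r) = c.sec r := by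
    intro Y b r
    obtain ⟨S, hS, hs⟩ := key b r
    refine y.sec_ext hS fun Z k hk => ?_
    obtain ⟨s, hs₁, hs₂⟩ := hs k hk
    rw [← c'.sec_res k rfl, ← c.sec_res k rfl, hφr, hφs _ s hs₁ hs₂, hs₂]
  have h₃ : ∀ {Y : C} {b : Y ⟶ U} (r : x.Sec b) (g : E.obj.obj (op Y)),
      φ.app (op (Over.mk b)) (x.sact r g) = x'.sact (b := b) (φ.app (op (Over.mk b)) r) g := by
    intro Y b r g
    refine inj _ _ ?_ ?_
    · rw [h₁, x.slam_sact, x'.slam_sact, h₁]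
    · rw [h₂, c.sec_sact, c'.sec_sact, h₁, h₂]
  refine ⟨⟨⟨φ, fun {X} r g => h₃ (b := X.unop.hom) r g⟩, ?_⟩, ?_, fun ψ hψ => ?_⟩
  · ext X r
    exact h₁ (b := X.unop.hom) r
  · exact TwistMap.ext_ap (F := 𝟭 C) (U := U) (y := y) fun {Y b} r => h₂ r
  · refine LiftObj.hom_ext_sec fun Y b r => inj _ _ ?_ ?_
    · exact (LiftObj.slam_ap ψ r).trans (h₁ r).symm
    · exact (congrArg (fun d => TwistMap.sec d r) hψ).trans (h₂ r).symm

end TwistMap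

/-- The sheaf with `E`-action deduced from a lift `y` to `T'`: its sections are the pairs of a
section of `T` and a section of `y` with the same image in `T'`, on which `E` acts by `(t, r) · g
= (t · g, r · θ t g)`. -/
def Twist.source (w : Twist (𝟭 C) T T') {U : C} (y : LiftObj T' U) :
    GSheaf (J.over U) ((Over.forget U).op ⋙ E.obj) where
  carrier := ⟨fibreProduct (N := (Over.forget U).op ⋙ T.carrier.obj) (M := y.R.carrier.obj)
    (Functor.whiskerLeft (Over.forget U).op w.τ) y.lam.hom, isSheaf_fibreProduct _ _
      (T.over U).carrier.property y.R.carrier.property (T'.over U).carrier.property⟩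
  act {X} p g := ⟨(T.act p.1.1 g, y.R.act p.1.2 (w.cross (Y := X.unop.left) p.1.1 g)), by
    refine (w.base_act (Y := X.unop.left) p.1.1 g).trans (Eq.symm ((y.lam.map_act _ _).trans ?_))
    exact congrArg (fun t => T'.act t (w.cross (Y := X.unop.left) p.1.1 g)) p.2.symm⟩
  act_one {X} p := Subtype.ext (Prod.ext (T.act_one _) ((congrArg (y.R.act p.1.2)
    (w.cross_one (Y := X.unop.left) _)).trans (y.R.act_one _)))
  act_mul {X} p g g' := Subtype.ext (Prod.ext (T.act_mul _ _ _) ((congrArg (y.R.act p.1.2)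
    (w.cross_mul (Y := X.unop.left) _ _ _)).trans (y.R.act_mul _ _ _)))
  map_act {X Y} i p g := Subtype.ext (Prod.ext (T.map_act _ _ _) ((y.R.map_act i _ _).trans
    (congrArg (y.R.act _) (w.map_cross i.unop.left p.1.1 g))))

section Source
variable {w : Twist (𝟭 C) T T'} (h : IsQuotientTorsor ι T) (h' : IsQuotientTorsor ι' T')
    (hθ : ∀ {Y : C} (t : T.carrier.obj.obj (op Y)) (a : A.obj.obj (op Y)),
      w.cross t (bandSec ι a) = bandSec ι' a)
include h h' hθ

/-- An element of `E` is determined by its action on a section of `T` and its value under the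
crossed homomorphism: two candidates differ by a section of `A`, which the crossed homomorphism
detects. -/
theorem Twist.eq_of_act_eq {Y : C} {t : T.carrier.obj.obj (op Y)} {g g' : E.obj.obj (op Y)}
    (e₁ : T.act t g = T.act t g') (e₂ : w.cross t g = w.cross t g') : g = g' := by
  have e : T.act t (g' * g⁻¹) = t := by rw [T.act_mul, ← e₁, T.act_act_inv]
  obtain ⟨a, ha⟩ := (h.stabilizer _ _).1 e
  have e₃ := Twist.cross_mul_bandSec h hθ t g (Multiplicative.toAdd a)
  have e₄ : bandSec ι (Multiplicative.toAdd a) * g = g' := by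
    rw [← inv_mul_cancel_right g' g, ← ha]
    rfl
  rw [e₄, ← e₂] at e₃
  have e₅ : bandSec ι' (Multiplicative.toAdd a) = 1 := right_eq_mul.1 e₃
  have e₆ : a = 1 := h'.injective _ (e₅.trans (map_one (ι'.hom.app (op Y)).hom).symm)
  rw [← e₄, e₆]
  exact ((congrArg (· * g) (map_one (ι.hom.app (op Y)).hom)).trans (one_mul g)).symm

/-- The pairs form a torsor: an element that moves the first component is found locally, and the
remaining discrepancy in the second one is a section of `A`. -/
theorem Twist.isTorsor_source {U : C} (y : LiftObj T' U) : (w.source y).IsTorsor where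
  locally_nonempty X := by
    obtain ⟨S, hS, hr⟩ := y.exists_sec X.hom
    obtain ⟨S', hS', ht⟩ := h.locally_nonempty X.left
    have key := exists_cover_trans (J.intersection_covering hS hS') (fun Z k =>
      ∃ (t : T.carrier.obj.obj (op Z)) (r : y.Sec (k ≫ X.hom)), w.base t = y.slam r) (by
        rintro V k ⟨hk, hk'⟩
        obtain ⟨r⟩ := hr k hk
        obtain ⟨t⟩ := ht k hk'
        obtain ⟨R, hR, hg⟩ := h'.locally_transitive (y.slam r) (w.base t)
        refine ⟨R, hR, fun W l hl => ?_⟩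
        obtain ⟨g, hg⟩ := hg l hl
        refine ⟨T.carrier.obj.map l.op t, y.sact (y.res l (by simp) r) g, ?_⟩
        rw [y.slam_sact, y.slam_res, hg, w.map_base])
    obtain ⟨R, hR, hp⟩ := key
    refine ⟨_, over_symm_mem hR, fun Y f hf => ?_⟩
    obtain ⟨t, r, e⟩ := hp f.left hf
    have hw : 𝟙 _ ≫ f.left ≫ X.hom = Y.hom := (Category.id_comp _).trans (Over.w f)
    refine ⟨⟨(t, y.res (b' := Y.hom) (𝟙 _) hw r), ?_⟩⟩
    refine e.trans (Eq.symm ((y.slam_res (b' := Y.hom) (𝟙 _) hw r).trans ?_))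
    exact Functor.map_id_apply T'.carrier.obj _ _
  simply_transitive {X} p p' := by
    obtain ⟨⟨t, r⟩, hp⟩ := p
    obtain ⟨⟨t', r'⟩, hp'⟩ := p'
    change y.Sec X.unop.hom at r r'
    change T.carrier.obj.obj (op X.unop.left) at t t'
    change w.base t = y.slam r at hp
    change w.base t' = y.slam r' at hp'
    obtain ⟨S, hS, hg⟩ := h.locally_transitive t t'
    have hex : ∀ ⦃Y : C⦄ (f : Y ⟶ X.unop.left), S f → ∃ g : E.obj.obj (op Y),
        T.act (T.carrier.obj.map f.op t) g = T.carrier.obj.map f.op t' ∧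
        y.sact (y.res (b' := f ≫ X.unop.hom) f rfl r) (w.cross (T.carrier.obj.map f.op t) g) =
          y.res (b' := f ≫ X.unop.hom) f rfl r' := by
      intro Y f hf
      obtain ⟨g, hg⟩ := hg f hf
      let r₁ := y.sact (y.res (b' := f ≫ X.unop.hom) f rfl r)
        (w.cross (T.carrier.obj.map f.op t) g)
      have e := y.slam_sact r₁ (y.sdiff r₁ (y.res (b' := f ≫ X.unop.hom) f rfl r'))
      have e' : y.slam r₁ = w.base (T.carrier.obj.map f.op t') := by
        refine (y.slam_sact _ _).trans ?_
        rw [y.slam_res, ← hp, w.map_base, ← w.base_act, hg]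
      rw [y.sact_sdiff, y.slam_res, ← hp', w.map_base, e'] at e
      obtain ⟨a, ha⟩ := (h'.stabilizer _ _).1 e.symm
      refine ⟨g * bandSec ι (Multiplicative.toAdd a), ?_, ?_⟩
      · refine (T.act_mul _ _ _).trans ((congrArg (fun t => T.act t _) hg).trans ?_)
        exact (h.stabilizer _ _).2 ⟨_, rfl⟩
      · rw [w.cross_mul, hθ, y.sact_mul]
        exact (congrArg (y.sact r₁) ha).trans (y.sact_sdiff _ _)
    obtain ⟨g, hgu, hu⟩ := existsUnique_of_local (isSheaf_underlying_group E) (X := X.unop.left)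
      (fun Y f (g : E.obj.obj (op Y)) =>
        T.act (T.carrier.obj.map f.op t) g = T.carrier.obj.map f.op t' ∧
        y.sact (y.res (b' := f ≫ X.unop.hom) f rfl r) (w.cross (T.carrier.obj.map f.op t) g) =
          y.res (b' := f ≫ X.unop.hom) f rfl r')
      (by
        rintro Y Z f k g ⟨hg₁, hg₂⟩
        refine ⟨?_, ?_⟩
        · rw [op_comp, Functor.map_comp_apply, Functor.map_comp_apply, ← hg₁]
          exact (T.map_act _ _ _).symm
        · have e := congrArg (y.res (b' := (k ≫ f) ≫ X.unop.hom) k (by simp)) hg₂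
          rw [y.res_sact, y.res_res, y.res_res, w.map_cross, ← Functor.map_comp_apply,
            ← op_comp] at e
          exact e)
      (by
        rintro Y f g g' ⟨hg₁, hg₂⟩ ⟨hg₁', hg₂'⟩
        exact Twist.eq_of_act_eq h h' hθ (hg₁.trans hg₁'.symm)
          (y.sact_injective _ (hg₂.trans hg₂'.symm)))
      ⟨S, hS, hex⟩
    refine ⟨g, Subtype.ext (Prod.ext ?_ ?_), fun g' hg' => hu g' fun Y f n hn => ?_⟩
    · refine sections_ext T.carrier.property hS fun Y f hf => ?_
      obtain ⟨n, hn⟩ := hex f hf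
      refine (T.map_act f.op t g).trans ((congrArg (T.act _) (hgu f n hn)).trans hn.1)
    · refine y.sec_ext (b := X.unop.hom) hS fun Y f hf => ?_
      obtain ⟨n, hn⟩ := hex f hf
      refine (y.res_sact (b := X.unop.hom) f rfl r (w.cross t g)).trans (Eq.trans ?_ hn.2)
      rw [w.map_cross]
      exact congrArg (fun n => y.sact _ (w.cross _ n)) (hgu f n hn)
    · have e₁ : T.act t g' = t' := congrArg (fun p => p.1.1) hg'
      have e₂ : y.sact (b := X.unop.hom) r (w.cross t g') = r' := congrArg (fun p => p.1.2) hg'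
      have e₃ := (T.map_act f.op t g').symm.trans (congrArg (T.carrier.obj.map f.op) e₁)
      have e₄ := congrArg (y.res (b' := f ≫ X.unop.hom) f rfl) e₂
      rw [y.res_sact] at e₄
      replace e₄ := (congrArg (y.sact _) (w.map_cross f t g').symm).trans e₄
      exact Twist.eq_of_act_eq h h' hθ (e₃.trans hn.1.symm)
        (y.sact_injective _ (e₄.trans hn.2.symm))

/-- Every lift to `T'` is, up to a map over the twist, the image of a lift to `T`. -/
theorem Twist.exists_source {U : C} (y : LiftObj T' U) :
    ∃ x : LiftObj T U, Nonempty (TwistMap w (U := U) x y) :=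
  ⟨⟨w.source y, Twist.isTorsor_source h h' hθ y,
    { hom :=
        { app := fun _ => ↾fun p => p.1.1
          naturality := fun _ _ _ => rfl }
      map_act := fun _ _ => rfl }⟩,
    ⟨{ hom :=
        { app := fun _ => ↾fun p => p.1.2
          naturality := fun _ _ _ => rfl }
       map_act := fun _ _ => rfl
       comm := fun p => p.2.symm }⟩⟩

end Source

theorem TwistMap.post_band {w : Twist (𝟭 C) T T'}
    {central : ∀ (U : Cᵒᵖ) (a : (toGrp A).obj.obj U) (x : E.obj.obj U),
      ι.hom.app U a * x = x * ι.hom.app U a}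
    {triv : ∀ (U : Cᵒᵖ) (a : (toGrp A).obj.obj U) (t : T.carrier.obj.obj U),
      T.act t (ι.hom.app U a) = t}
    {central' : ∀ (U : Cᵒᵖ) (a : (toGrp A).obj.obj U) (x : E'.obj.obj U),
      ι'.hom.app U a * x = x * ι'.hom.app U a}
    {triv' : ∀ (U : Cᵒᵖ) (a : (toGrp A).obj.obj U) (t : T'.carrier.obj.obj U),
      T'.act t (ι'.hom.app U a) = t}
    (hθ : ∀ {Y : C} (t : T.carrier.obj.obj (op Y)) (a : A.obj.obj (op Y)),
      w.cross t (bandSec ι a) = bandSec ι' a)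
    {U : C} {x : LiftObj T U} {y : LiftObj T' U} (c : TwistMap w (U := U) x y)
    (a : A.obj.obj (op U)) :
    TwistMap.post (F := 𝟭 C) (U := U) (y := y) (y' := y) c
      ((bandedLifts T' ι' central' triv').band (U := U) y a) =
    TwistMap.pre (F := 𝟭 C) (U := U) (y := y) ((bandedLifts T ι central triv).band (U := U) x a) c := by
  refine TwistMap.ext_ap (F := 𝟭 C) (U := U) (y := y) fun {Y b} r => ?_
  refine Eq.symm ((c.sec_sact r (bandSec ι (A.obj.map b.op a))).trans ?_)
  exact congrArg (y.sact (c.sec r)) (hθ _ _)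

/-- A twist between torsors under the quotients of two sheaves of groups by the same abelian sheaf, which
is the identity on this abelian sheaf, induces an equivalence between the gerbes of lifts. -/
theorem Twist.nonempty_bandedEquiv (w : Twist (𝟭 C) T T')
    (h : IsQuotientTorsor ι T) (h' : IsQuotientTorsor ι' T')
    (hθ : ∀ {Y : C} (t : T.carrier.obj.obj (op Y)) (a : A.obj.obj (op Y)),
      w.cross t (bandSec ι a) = bandSec ι' a)
    {central : ∀ (U : Cᵒᵖ) (a : (toGrp A).obj.obj U) (x : E.obj.obj U),
      ι.hom.app U a * x = x * ι.hom.app U a}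
    {triv : ∀ (U : Cᵒᵖ) (a : (toGrp A).obj.obj U) (t : T.carrier.obj.obj U),
      T.act t (ι.hom.app U a) = t}
    {central' : ∀ (U : Cᵒᵖ) (a : (toGrp A).obj.obj U) (x : E'.obj.obj U),
      ι'.hom.app U a * x = x * ι'.hom.app U a}
    {triv' : ∀ (U : Cᵒᵖ) (a : (toGrp A).obj.obj U) (t : T'.carrier.obj.obj U),
      T'.act t (ι'.hom.app U a) = t} :
    Nonempty (BandedEquiv (bandedLifts T ι central triv) (bandedLifts T' ι' central' triv')) :=
  ⟨{ trans := w.correspondenceId.trans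
     isEquivalence := fun U => w.correspondenceId.isEquivalence_functor ⟨op U⟩
      (fun {x x' y} c c' => TwistMap.existsUnique_pre (U := U) (x := x) (x' := x') (y := y)
        h h' hθ c c')
      (fun y => Twist.exists_source (U := U) h h' hθ y)
     map_band := fun {U} x a => by
      refine w.correspondenceId.post_injective (a := ⟨op U⟩) (x := x)
        (w.correspondenceId.unit (a := ⟨op U⟩) x) ?_
      refine (w.correspondenceId.post_functor_map (a := ⟨op U⟩) _).trans (Eq.symm ?_)
      exact TwistMap.post_band (U := U) hθ (w.correspondenceId.unit (a := ⟨op U⟩) x) a }⟩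

theorem Twist.nonempty_bandedEquiv_lifts {G : Sheaf J GrpCat.{max u v}} (𝓔 : CentralExtension A G)
    {T : GSheaf J G.obj} (hT : T.IsTorsor) (w : Twist (𝟭 C) (T.res 𝓔.π.hom) T')
    (h' : IsQuotientTorsor ι' T')
    (hθ : ∀ {Y : C} (t : T.carrier.obj.obj (op Y)) (a : A.obj.obj (op Y)),
      w.cross t (bandSec 𝓔.ι a) = bandSec ι' a)
    {central' : ∀ (U : Cᵒᵖ) (a : (toGrp A).obj.obj U) (x : E'.obj.obj U),
      ι'.hom.app U a * x = x * ι'.hom.app U a}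
    {triv' : ∀ (U : Cᵒᵖ) (a : (toGrp A).obj.obj U) (t : T'.carrier.obj.obj U),
      T'.act t (ι'.hom.app U a) = t} :
    Nonempty (BandedEquiv (𝓔.lifts T) (bandedLifts T' ι' central' triv')) :=
  Twist.nonempty_bandedEquiv w (𝓔.isQuotientTorsor hT) h' hθ

end TwistEquivalence

/-! ### Twists of Heisenberg torsors and trivial factors -/

section TensorTwist
variable {C : Type u} [Category.{v} C] {J : GrothendieckTopology C}
  {A B M : Sheaf J AddCommGrpCat.{max u v}}

/-- A twist from Heisenberg torsors to `M ⊗ B`-torsors: for a map `φ` to `M` that is equivariant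
for `i : A ⟶ M`, the crossed homomorphism `(a, b, t) ↦ i t + φ ⊗ b`. The term `a ⊗ b'` of the
Heisenberg group law is the change of `φ ⊗ b'` under `a`. -/
noncomputable def tensorTwist (T : GSheaf J (heisSheaf A B).obj) (i : A ⟶ M)
    (φ : T.carrier.obj ⟶ M.obj ⋙ forget AddCommGrpCat.{max u v})
    (hφ : ∀ {U : Cᵒᵖ} (t : T.carrier.obj.obj U) (h : Heis A B U),
      (show M.obj.obj U from φ.app U (T.act t h)) =
        (show M.obj.obj U from φ.app U t) + i.hom.app U h.a)
    (T' : GSheaf J (toGrp (tensor M B)).obj) (τ : T.carrier.obj ⟶ T'.carrier.obj)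
    (hτ : ∀ {U : Cᵒᵖ} (t : T.carrier.obj.obj U) (h : Heis A B U),
      τ.app U (T.act t h) = T'.act (τ.app U t) (Multiplicative.ofAdd
        ((tensorMap i (𝟙 B)).hom.app U h.t + tmul (show M.obj.obj U from φ.app U t) h.b))) :
    Twist (𝟭 C) T T' where
  τ := τ
  θ {U} t (h : Heis A B (op U)) := Multiplicative.ofAdd
    ((tensorMap i (𝟙 B)).hom.app (op U) h.t + tmul (show M.obj.obj (op U) from φ.app (op U) t) h.b)
  map_θ {U V} k t h := by
    refine congrArg Multiplicative.ofAdd ((map_add ((tensor M B).obj.map k.op).hom _ _).trans ?_)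
    refine congrArg₂ (· + ·) (NatTrans.naturality_apply (tensorMap i (𝟙 B)).hom k.op _).symm ?_
    refine (map_tmul k.op _ _).trans ?_
    exact congrArg (fun m : M.obj.obj (op V) => tmul m _) (NatTrans.naturality_apply φ k.op t).symm
  θ_mul {U} t g h := by
    change Heis A B (op U) at g h
    refine congrArg Multiplicative.ofAdd ?_
    change (tensorMap i (𝟙 B)).hom.app (op U) (g.t + h.t + tmul g.a h.b) +
      tmul (show M.obj.obj (op U) from φ.app (op U) t) (g.b + h.b) =
      ((tensorMap i (𝟙 B)).hom.app (op U) g.t + tmul (show M.obj.obj (op U) from φ.app (op U) t) g.b) +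
      ((tensorMap i (𝟙 B)).hom.app (op U) h.t +
        tmul (show M.obj.obj (op U) from φ.app (op U) (T.act t g)) h.b)
    rw [hφ, add_tmul, tmul_add, map_add, map_add, tensorMap_tmul]
    change _ + _ + tmul _ h.b + _ = _
    abel
  τ_act t h := hτ t h

theorem tensorTwist_cross {T : GSheaf J (heisSheaf A B).obj} {i : A ⟶ M}
    {φ : T.carrier.obj ⟶ M.obj ⋙ forget AddCommGrpCat.{max u v}}
    (hφ : ∀ {U : Cᵒᵖ} (t : T.carrier.obj.obj U) (h : Heis A B U),
      (show M.obj.obj U from φ.app U (T.act t h)) =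
        (show M.obj.obj U from φ.app U t) + i.hom.app U h.a)
    {T' : GSheaf J (toGrp (tensor M B)).obj} {τ : T.carrier.obj ⟶ T'.carrier.obj}
    (hτ : ∀ {U : Cᵒᵖ} (t : T.carrier.obj.obj U) (h : Heis A B U),
      τ.app U (T.act t h) = T'.act (τ.app U t) (Multiplicative.ofAdd
        ((tensorMap i (𝟙 B)).hom.app U h.t + tmul (show M.obj.obj U from φ.app U t) h.b)))
    {Y : C} (t : T.carrier.obj.obj (op Y)) (a : (tensor A B).obj.obj (op Y)) :
    (tensorTwist T i φ hφ T' τ hτ).cross t (bandSec (heisInl A B) a) =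
      bandSec (toGrpMap (tensorMap i (𝟙 B))) a := by
  refine congrArg Multiplicative.ofAdd ?_
  refine (congrArg (_ + ·) (Heis.tmul_zero _)).trans ?_
  exact add_zero ((tensorMap i (𝟙 B)).hom.app (op Y) a)

theorem isQuotientTorsor_point (A : Sheaf J AddCommGrpCat.{max u v}) :
    IsQuotientTorsor (𝟙 (toGrp A)) (GSheaf.point J (toGrp A).obj) where
  injective _ := Function.injective_id
  locally_nonempty U := ⟨⊤, J.top_mem U, fun _ _ _ => ⟨⟨⟩⟩⟩
  locally_transitive {U} _ _ := ⟨⊤, J.top_mem U, fun _ _ _ => ⟨1, rfl⟩⟩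
  stabilizer _ g := ⟨fun _ => ⟨g, rfl⟩, fun _ => rfl⟩

/-- A trivial torsor has an equivariant map to the group, namely the inverse of its
trivialization. -/
theorem GSheaf.IsTrivial.exists_hom {P : GSheaf J (toGrp A).obj} (h : P.IsTrivial) :
    ∃ φ : P.carrier.obj ⟶ A.obj ⋙ forget AddCommGrpCat.{max u v},
      ∀ {U : Cᵒᵖ} (x : P.carrier.obj.obj U) (a : A.obj.obj U),
        (show A.obj.obj U from φ.app U (P.act x (Multiplicative.ofAdd a))) =
          (show A.obj.obj U from φ.app U x) + a := by
  obtain ⟨ψ, hψ⟩ := h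
  obtain ⟨χ, h₁, h₂⟩ := hψ.out
  have e₁ : ∀ {U : Cᵒᵖ} (x : P.carrier.obj.obj U), ψ.hom.app U (χ.app U x) = x :=
    fun {U} x => ConcreteCategory.congr_hom (congr_app h₂ U) x
  have e₂ : ∀ {U : Cᵒᵖ} (x : (toGrp A).obj.obj U), χ.app U (ψ.hom.app U x) = x :=
    fun {U} x => ConcreteCategory.congr_hom (congr_app h₁ U) x
  refine ⟨χ, fun {U} x a => ?_⟩
  have e := ψ.map_act (U := U) (χ.app U x) (Multiplicative.ofAdd a)
  rw [e₁] at e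
  exact (congrArg (χ.app U) e).symm.trans (e₂ _)

theorem GSheaf.isTorsor_prod {G₁ G₂ : Sheaf J GrpCat.{max u v}} {P : GSheaf J G₁.obj}
    {Q : GSheaf J G₂.obj} (hP : P.IsTorsor) (hQ : Q.IsTorsor) : (P.prod Q).IsTorsor where
  locally_nonempty U := by
    obtain ⟨S, hS, h⟩ := hP.locally_nonempty U
    obtain ⟨S', hS', h'⟩ := hQ.locally_nonempty U
    refine ⟨_, J.intersection_covering hS hS', fun V i hi => ?_⟩
    obtain ⟨x⟩ := h i hi.1
    obtain ⟨y⟩ := h' i hi.2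
    exact ⟨(x, y)⟩
  simply_transitive x y := by
    refine ⟨(diff hP x.1 y.1, diff hQ x.2 y.2), Prod.ext (act_diff hP _ _) (act_diff hQ _ _),
      fun g hg => ?_⟩
    exact Prod.ext (diff_eq hP (congrArg Prod.fst hg)).symm (diff_eq hQ (congrArg Prod.snd hg)).symm

variable {P : GSheaf J (toGrp A).obj} {Q : GSheaf J (toGrp B).obj}

/-- For trivial `P`, the equivariant map `φ : P ⟶ A` gives the crossed homomorphism `(a, b, t) ↦ t
+ φ ⊗ b`, which is the identity on `A ⊗ B`. -/
theorem nonempty_bandedEquiv_of_trivial_left (hP : P.IsTorsor) (hQ : Q.IsTorsor) (h : P.IsTrivial) :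
    Nonempty (BandedEquiv (heisenbergGerbe P Q) (torsorStack (tensor A B))) := by
  obtain ⟨φ, hφ⟩ := h.exists_hom
  let T : GSheaf J (heisSheaf A B).obj := (P.prod Q).res (heisenberg A B).π.hom
  let φ' : T.carrier.obj ⟶ A.obj ⋙ forget AddCommGrpCat.{max u v} :=
    { app := fun U => ↾fun t : P.carrier.obj.obj U × Q.carrier.obj.obj U => φ.app U t.1
      naturality := fun U V k => by
        refine ConcreteCategory.hom_ext _ _ fun t => ?_
        change P.carrier.obj.obj U × Q.carrier.obj.obj U at t
        have := NatTrans.naturality_apply φ k t.1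
        exact this }
  let τ : T.carrier.obj ⟶ (GSheaf.point J (toGrp (tensor A B)).obj).carrier.obj :=
    { app := fun U => ↾fun _ => PUnit.unit
      naturality := fun _ _ _ => rfl }
  refine Twist.nonempty_bandedEquiv_lifts (heisenberg A B) (GSheaf.isTorsor_prod hP hQ)
    (tensorTwist T (𝟙 A) φ' (fun {U} t h => hφ (U := U) t.1 h.a)
    (GSheaf.point J (toGrp (tensor A B)).obj) τ (fun _ _ => rfl))
    (isQuotientTorsor_point _) (fun t a => ?_)
  refine (tensorTwist_cross (T := T) (i := 𝟙 A) (φ := φ') (τ := τ) _ _ t a).trans ?_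
  exact congrArg (fun f : tensor A B ⟶ tensor A B => Multiplicative.ofAdd (f.hom.app _ a))
    (tensorMap_id A B)

/-- The twist from Heisenberg torsors to `A ⊗ B`-torsors given by an equivariant map `ψ` to `B`:
the crossed homomorphism is `(a, b, t) ↦ t - a ⊗ (ψ + b)`. It is not the mirror image of
`tensorTwist`, because the group law is not symmetric in `A` and `B`. -/
noncomputable def tensorTwistRight (T : GSheaf J (heisSheaf A B).obj)
    (ψ : T.carrier.obj ⟶ B.obj ⋙ forget AddCommGrpCat.{max u v})
    (hψ : ∀ {U : Cᵒᵖ} (t : T.carrier.obj.obj U) (h : Heis A B U),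
      (show B.obj.obj U from ψ.app U (T.act t h)) =
        (show B.obj.obj U from ψ.app U t) + h.b) :
    Twist (𝟭 C) T (GSheaf.point J (toGrp (tensor A B)).obj) where
  τ :=
    { app := fun U => ↾fun _ => PUnit.unit
      naturality := fun _ _ _ => rfl }
  θ {U} t (h : Heis A B (op U)) := Multiplicative.ofAdd
    (h.t - tmul h.a ((show B.obj.obj (op U) from ψ.app (op U) t) + h.b))
  map_θ {U V} k t h := by
    refine congrArg Multiplicative.ofAdd ((map_sub ((tensor A B).obj.map k.op).hom _ _).trans ?_)
    refine congrArg (_ - ·) ((map_tmul k.op _ _).trans ?_)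
    refine congrArg (tmul _) ((map_add (B.obj.map k.op).hom _ _).trans ?_)
    exact congrArg (fun m : B.obj.obj (op V) => m + _) (NatTrans.naturality_apply ψ k.op t).symm
  θ_mul {U} t g h := by
    change Heis A B (op U) at g h
    refine congrArg Multiplicative.ofAdd ?_
    change (g.t + h.t + tmul g.a h.b) -
      tmul (g.a + h.a) ((show B.obj.obj (op U) from ψ.app (op U) t) + (g.b + h.b)) =
      (g.t - tmul g.a ((show B.obj.obj (op U) from ψ.app (op U) t) + g.b)) +
      (h.t - tmul h.a ((show B.obj.obj (op U) from ψ.app (op U) (T.act t g)) + h.b))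
    rw [hψ]
    simp only [add_tmul, tmul_add]
    abel
  τ_act _ _ := rfl

theorem nonempty_bandedEquiv_of_trivial_right (hP : P.IsTorsor) (hQ : Q.IsTorsor)
    (h : Q.IsTrivial) :
    Nonempty (BandedEquiv (heisenbergGerbe P Q) (torsorStack (tensor A B))) := by
  obtain ⟨ψ, hψ⟩ := h.exists_hom
  let T : GSheaf J (heisSheaf A B).obj := (P.prod Q).res (heisenberg A B).π.hom
  let ψ' : T.carrier.obj ⟶ B.obj ⋙ forget AddCommGrpCat.{max u v} :=
    { app := fun U => ↾fun t : P.carrier.obj.obj U × Q.carrier.obj.obj U => ψ.app U t.2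
      naturality := fun U V k => by
        refine ConcreteCategory.hom_ext _ _ fun t => ?_
        change P.carrier.obj.obj U × Q.carrier.obj.obj U at t
        have := NatTrans.naturality_apply ψ k t.2
        exact this }
  refine Twist.nonempty_bandedEquiv_lifts (heisenberg A B) (GSheaf.isTorsor_prod hP hQ)
    (tensorTwistRight T ψ' (fun {U} t h => hψ (U := U) t.2 h.b))
    (isQuotientTorsor_point _)
    (fun t a => congrArg Multiplicative.ofAdd ?_)
  refine (congrArg (_ - ·) (Heis.zero_tmul _)).trans ?_
  exact sub_zero (show (tensor A B).obj.obj _ from a)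

end TensorTwist

/-! ### Cocycles and homomorphisms on the augmentation kernel -/

section ExtLift
universe w' v' u'
variable {𝒜 : Type u'} [Category.{v'} 𝒜] [Abelian 𝒜] [HasExt.{w'} 𝒜]

/-- A homomorphism `φ : A ⟶ A'` extends to a morphism of extensions of the same object as soon as
it carries the class of the first extension to the class of the second one. -/
theorem exists_hom_of_extClass {A A' E E' Z : 𝒜} {i : A ⟶ E} {p : E ⟶ Z} {i' : A' ⟶ E'}
    {p' : E' ⟶ Z} {h : i ≫ p = 0} {h' : i' ≫ p' = 0} (hS : (ShortComplex.mk i p h).ShortExact)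
    (hS' : (ShortComplex.mk i' p' h').ShortExact) (f : A ⟶ A')
    (hf : hS.extClass.comp (Abelian.Ext.mk₀ f) (add_zero 1) = hS'.extClass) :
    ∃ g : E ⟶ E', i ≫ g = f ≫ i' ∧ g ≫ p' = p := by
  obtain ⟨x, hx⟩ := Abelian.Ext.covariant_sequence_exact₃ E hS' (Abelian.Ext.mk₀ p) (zero_add 1) (by
    rw [← hf]
    exact hS.comp_extClass_assoc (Abelian.Ext.mk₀ f) (add_zero 1))
  obtain ⟨g, rfl⟩ := (Abelian.Ext.mk₀_bijective _ _).2 x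
  have hg : g ≫ p' = p := (Abelian.Ext.mk₀_bijective _ _).1 ((Abelian.Ext.mk₀_comp_mk₀ g p').symm.trans hx)
  have := hS'.mono_f
  obtain ⟨k, hk⟩ : ∃ k : A ⟶ A', k ≫ i' = i ≫ g :=
    ⟨hS'.exact.lift (i ≫ g) (by
      change (i ≫ g) ≫ p' = 0
      rw [Category.assoc, hg, h]), hS'.exact.lift_f _ _⟩
  have e := hS.extClass_naturality hS' (ShortComplex.homMk k g (𝟙 Z) hk (by
    change g ≫ p' = p ≫ 𝟙 Z
    rw [hg, Category.comp_id]))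
  have e' : hS.extClass.comp (Abelian.Ext.mk₀ (f - k)) (add_zero 1) = 0 := by
    have e₁ : hS.extClass.comp (Abelian.Ext.mk₀ k) (add_zero 1) = hS'.extClass :=
      e.trans (Abelian.Ext.mk₀_id_comp _)
    have e₂ : Abelian.Ext.mk₀ f = Abelian.Ext.mk₀ (f - k) + Abelian.Ext.mk₀ k := by
      rw [← Abelian.Ext.mk₀_add, sub_add_cancel]
    rw [e₂, Abelian.Ext.comp_add, e₁] at hf
    exact add_eq_right.1 hf
  obtain ⟨y, hy⟩ := Abelian.Ext.contravariant_sequence_exact₁ hS A' (Abelian.Ext.mk₀ (f - k))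
    (add_zero 1) e'
  obtain ⟨l, rfl⟩ := (Abelian.Ext.mk₀_bijective _ _).2 y
  have hl : i ≫ l = f - k :=
    (Abelian.Ext.mk₀_bijective _ _).1 ((Abelian.Ext.mk₀_comp_mk₀ i l).symm.trans hy)
  refine ⟨g + l ≫ i', ?_, ?_⟩
  · rw [Preadditive.comp_add, ← hk, ← Category.assoc, hl, Preadditive.sub_comp]
    abel
  · rw [Preadditive.add_comp, Category.assoc, h', Limits.comp_zero, add_zero, hg]

end ExtLift

section Sheafification
variable {C : Type u} [Category.{v} C] {J : GrothendieckTopology C}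

/-- The morphism from the sheaf associated with a presheaf deduced from a morphism to a sheaf. -/
noncomputable def sheafLift {M : Cᵒᵖ ⥤ AddCommGrpCat.{max u v}}
    {A : Sheaf J AddCommGrpCat.{max u v}} (f : M ⟶ A.obj) :
    (presheafToSheaf J AddCommGrpCat.{max u v}).obj M ⟶ A where
  hom := sheafifyLift J f A.property

theorem toSheafify_sheafLift {M : Cᵒᵖ ⥤ AddCommGrpCat.{max u v}}
    {A : Sheaf J AddCommGrpCat.{max u v}} (f : M ⟶ A.obj) :
    toSheafify J M ≫ (sheafLift f).hom = f := toSheafify_sheafifyLift J f A.property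

theorem sheafHom_ext {M : Cᵒᵖ ⥤ AddCommGrpCat.{max u v}} {A : Sheaf J AddCommGrpCat.{max u v}}
    {f g : (presheafToSheaf J AddCommGrpCat.{max u v}).obj M ⟶ A}
    (h : toSheafify J M ≫ f.hom = toSheafify J M ≫ g.hom) : f = g :=
  Sheaf.hom_ext (sheafify_hom_ext J f.hom g.hom A.property h)

theorem toSheafify_map {M N : Cᵒᵖ ⥤ AddCommGrpCat.{max u v}} (f : M ⟶ N) :
    toSheafify J M ≫ ((presheafToSheaf J AddCommGrpCat.{max u v}).map f).hom =
      f ≫ toSheafify J N := (toSheafify_naturality J f).symm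

/-- The kernel of a morphism of presheaves, on sections. -/
def kernelPresheaf {E Z : Cᵒᵖ ⥤ AddCommGrpCat.{max u v}} (p : E ⟶ Z) :
    Cᵒᵖ ⥤ AddCommGrpCat.{max u v} where
  obj U := AddCommGrpCat.of (p.app U).hom.ker
  map {U V} i := AddCommGrpCat.ofHom
    (((E.map i).hom.comp (p.app U).hom.ker.subtype).codRestrict (p.app V).hom.ker (by
      rintro ⟨e, he⟩
      refine (NatTrans.naturality_apply p i e).trans ?_
      exact (congrArg (Z.map i) he).trans (map_zero (Z.map i).hom)))
  map_id U := by ext x; exact ConcreteCategory.congr_hom (E.map_id U) x.1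
  map_comp i j := by ext x; exact ConcreteCategory.congr_hom (E.map_comp i j) x.1

/-- The inclusion of the kernel. -/
def kernelSubtype {E Z : Cᵒᵖ ⥤ AddCommGrpCat.{max u v}} (p : E ⟶ Z) : kernelPresheaf p ⟶ E where
  app U := AddCommGrpCat.ofHom (p.app U).hom.ker.subtype
  naturality _ _ _ := rfl

theorem kernelSubtype_comp {E Z : Cᵒᵖ ⥤ AddCommGrpCat.{max u v}} (p : E ⟶ Z) :
    kernelSubtype p ≫ p = 0 := by
  ext U x
  exact x.2

/-- The sequence of sheaves associated with a morphism of presheaves and its kernel. -/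
noncomputable def sheafifiedKernel (J : GrothendieckTopology C)
    {E Z : Cᵒᵖ ⥤ AddCommGrpCat.{max u v}} (p : E ⟶ Z) :
    ShortComplex (Sheaf J AddCommGrpCat.{max u v}) :=
  ShortComplex.mk ((presheafToSheaf J AddCommGrpCat.{max u v}).map (kernelSubtype p))
    ((presheafToSheaf J AddCommGrpCat.{max u v}).map p) (by
      rw [← Functor.map_comp, kernelSubtype_comp]
      exact (presheafToSheaf J AddCommGrpCat.{max u v}).map_zero _ _)

/-- The sheaves associated with the kernel of a locally surjective morphism form a short exact
sequence. -/
theorem sheafifiedKernel_shortExact {E Z : Cᵒᵖ ⥤ AddCommGrpCat.{max u v}} (p : E ⟶ Z)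
    [Presheaf.IsLocallySurjective J p] : (sheafifiedKernel J p).ShortExact := by
  have hz : kernelSubtype p ≫ toRange p = 0 := by
    ext U x
    exact Subtype.ext x.2
  let T : ShortComplex (Cᵒᵖ ⥤ AddCommGrpCat.{max u v}) :=
    ShortComplex.mk (kernelSubtype p) (toRange p) hz
  have hT : T.ShortExact := presheaf_shortExact T (fun U => Subtype.val_injective)
    (fun U => (p.app U).hom.rangeRestrict_surjective)
    (fun U x => Subtype.ext_iff.trans ⟨fun h => ⟨⟨x, h⟩, rfl⟩, fun ⟨y, hy⟩ => hy ▸ y.2⟩)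
  have hT' := hT.map_of_exact (presheafToSheaf J AddCommGrpCat.{max u v})
  have := Presheaf.isLocallyInjective_of_injective J (rangeSubtype p)
    (fun U => Subtype.val_injective)
  have hW := J.W_of_isLocallyBijective (rangeSubtype p)
  rw [J.W_iff] at hW
  let e := asIso ((presheafToSheaf J AddCommGrpCat.{max u v}).map (rangeSubtype p))
  refine ShortComplex.shortExact_of_iso (ShortComplex.isoMk
    (S₁ := T.map (presheafToSheaf J AddCommGrpCat.{max u v})) (S₂ := sheafifiedKernel J p)
    (Iso.refl _) (Iso.refl _) e ?_ ?_) hT'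
  · exact (Category.id_comp _).trans (Category.comp_id _).symm
  · refine (Category.id_comp _).trans ?_
    exact (presheafToSheaf J AddCommGrpCat.{max u v}).map_comp (toRange p) (rangeSubtype p)

end Sheafification

section CocycleClass
variable {C : Type u} [Category.{v} C] {J : GrothendieckTopology C}

/-- The presheaf `U ↦ ℤ[S(U)]`. -/
abbrev freePresheaf (S : Cᵒᵖ ⥤ Type (max u v)) : Cᵒᵖ ⥤ AddCommGrpCat.{max u v} :=
  S ⋙ AddCommGrpCat.free

/-- The morphism `ℤ[S] ⟶ M` deduced from a map `S ⟶ M`. -/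
def freeLift {S : Cᵒᵖ ⥤ Type (max u v)} {M : Cᵒᵖ ⥤ AddCommGrpCat.{max u v}}
    (φ : S ⟶ M ⋙ forget AddCommGrpCat.{max u v}) : freePresheaf S ⟶ M where
  app U := AddCommGrpCat.ofHom (FreeAbelianGroup.lift (β := M.obj U) (φ.app U))
  naturality U V i := by
    ext1
    refine FreeAbelianGroup.lift_ext _ _ fun x => ?_
    change FreeAbelianGroup.lift (β := M.obj V) (φ.app V) (FreeAbelianGroup.map (S.map i)
      (FreeAbelianGroup.of x)) = M.map i (FreeAbelianGroup.lift (β := M.obj U) (φ.app U) (FreeAbelianGroup.of x))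
    rw [FreeAbelianGroup.map_of_apply, FreeAbelianGroup.lift_apply_of,
      FreeAbelianGroup.lift_apply_of]
    exact NatTrans.naturality_apply φ i x

theorem freeLift_of {S : Cᵒᵖ ⥤ Type (max u v)} {M : Cᵒᵖ ⥤ AddCommGrpCat.{max u v}}
    (φ : S ⟶ M ⋙ forget AddCommGrpCat.{max u v}) {U : Cᵒᵖ} (x : S.obj U) :
    (freeLift φ).app U (FreeAbelianGroup.of x) = φ.app U x :=
  FreeAbelianGroup.lift_apply_of (β := M.obj U) _ _

theorem freeHom_ext {S : Cᵒᵖ ⥤ Type (max u v)} {M : Cᵒᵖ ⥤ AddCommGrpCat.{max u v}}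
    {f g : freePresheaf S ⟶ M}
    (h : ∀ (U : Cᵒᵖ) (x : S.obj U), f.app U (FreeAbelianGroup.of x) = g.app U (FreeAbelianGroup.of x)) :
    f = g := by
  ext1; funext U; ext1
  exact FreeAbelianGroup.lift_ext _ _ (h U)

/-- The augmentation `ℤ[S] ⟶ ℤ`. -/
def augmentation (S : Cᵒᵖ ⥤ Type (max u v)) :
    freePresheaf S ⟶ (Functor.const Cᵒᵖ).obj (AddCommGrpCat.of (ULift.{max u v} ℤ)) :=
  freeLift
    { app := fun _ => ↾fun _ => (ULift.up 1 : ULift.{max u v} ℤ)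
      naturality := fun _ _ _ => rfl }

theorem augmentation_of (S : Cᵒᵖ ⥤ Type (max u v)) {U : Cᵒᵖ} (x : S.obj U) :
    (augmentation S).app U (FreeAbelianGroup.of x) = (ULift.up 1 : ULift.{max u v} ℤ) :=
  freeLift_of _ _

/-- A presheaf of sets that locally has sections. -/
def LocallyNonempty (J : GrothendieckTopology C) (S : Cᵒᵖ ⥤ Type (max u v)) : Prop :=
  ∀ U : C, ∃ R ∈ J U, ∀ ⦃V : C⦄ (i : V ⟶ U), R i → Nonempty (S.obj (op V))

theorem LocallyNonempty.augmentation_surjective {S : Cᵒᵖ ⥤ Type (max u v)}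
    (hS : LocallyNonempty J S) : Presheaf.IsLocallySurjective J (augmentation S) where
  imageSieve_mem {U} s := by
    obtain ⟨R, hR, h⟩ := hS U
    refine J.superset_covering ?_ hR
    intro V i hi
    obtain ⟨x⟩ := h i hi
    refine ⟨(s : ULift.{max u v} ℤ).down • FreeAbelianGroup.of x, ?_⟩
    refine (map_zsmul ((augmentation S).app (op V)).hom _ _).trans ?_
    refine (congrArg _ (augmentation_of S x)).trans ?_
    refine ULift.ext _ _ ?_
    change (s : ULift.{max u v} ℤ).down • (1 : ℤ) = (s : ULift.{max u v} ℤ).down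
    simp

/-- A function `d` of two sections of a presheaf of sets `S`, with values in an abelian
presheaf, with `d x y + d y z = d x z`. -/
@[ext]
structure AbCocycle (S : Cᵒᵖ ⥤ Type (max u v)) (A : Cᵒᵖ ⥤ AddCommGrpCat.{max u v}) where
  d : ∀ {U : Cᵒᵖ}, S.obj U → S.obj U → A.obj U
  map_d : ∀ {U V : Cᵒᵖ} (i : U ⟶ V) (x y : S.obj U), A.map i (d x y) = d (S.map i x) (S.map i y)
  d_add : ∀ {U : Cᵒᵖ} (x y z : S.obj U), d x y + d y z = d x z

namespace AbCocycle
variable {S : Cᵒᵖ ⥤ Type (max u v)} {A : Cᵒᵖ ⥤ AddCommGrpCat.{max u v}}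

/-- The difference of two cocycles. -/
def sub (c c' : AbCocycle S A) : AbCocycle S A where
  d x y := c.d x y - c'.d x y
  map_d i x y := (map_sub (A.map i).hom _ _).trans (congrArg₂ (· - ·) (c.map_d i x y) (c'.map_d i x y))
  d_add x y z := by rw [← c.d_add x y z, ← c'.d_add x y z]; abel

/-- The image of a cocycle under a homomorphism. -/
def map {A' : Cᵒᵖ ⥤ AddCommGrpCat.{max u v}} (c : AbCocycle S A) (f : A ⟶ A') : AbCocycle S A' where
  d {U} x y := f.app U (c.d x y)
  map_d {_ V} i x y := (NatTrans.naturality_apply f i _).symm.trans (congrArg (f.app V) (c.map_d i x y))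
  d_add {U} x y z := (map_add (f.app U).hom _ _).symm.trans (congrArg (f.app U) (c.d_add x y z))

/-- The inverse image of a cocycle under a map of index presheaves. -/
def comap {S' : Cᵒᵖ ⥤ Type (max u v)} (c : AbCocycle S A) (k : S' ⟶ S) : AbCocycle S' A where
  d {U} x y := c.d (k.app U x) (k.app U y)
  map_d {U V} i x y := by rw [c.map_d, NatTrans.naturality_apply, NatTrans.naturality_apply]
  d_add _ _ _ := c.d_add _ _ _

variable (c : AbCocycle S A)

/-- The homomorphism `ℤ[S(U)] → A(U)`, `[y] ↦ d x y`. -/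
def linear {U : Cᵒᵖ} (x : S.obj U) : FreeAbelianGroup (S.obj U) →+ A.obj U :=
  FreeAbelianGroup.lift (c.d x)

theorem d_self {U : Cᵒᵖ} (x : S.obj U) : c.d x x = 0 := add_eq_left.1 (c.d_add x x x)

theorem linear_of {U : Cᵒᵖ} (x y : S.obj U) : c.linear x (FreeAbelianGroup.of y) = c.d x y :=
  FreeAbelianGroup.lift_apply_of _ _

/-- On elements of degree `n`, changing the base point changes `linear` by `n` times a value of
the cocycle. -/
theorem linear_change {U : Cᵒᵖ} (x x' : S.obj U) (n : FreeAbelianGroup (S.obj U)) :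
    c.linear x' n = c.linear x n + ((augmentation S).app U n : ULift.{max u v} ℤ).down • c.d x' x := by
  let k : FreeAbelianGroup (S.obj U) →+ A.obj U := (zmultiplesHom (A.obj U) (c.d x' x)).comp
    (AddEquiv.ulift.toAddMonoidHom.comp ((augmentation S).app U).hom)
  have h : c.linear x' = c.linear x + k := by
    refine FreeAbelianGroup.lift_ext _ _ fun y => ?_
    refine (c.linear_of x' y).trans ((c.d_add x' x y).symm.trans ?_)
    refine (add_comm _ _).trans (congrArg₂ (· + ·) (c.linear_of x y).symm ?_)
    change _ = ((augmentation S).app U (FreeAbelianGroup.of y) : ULift.{max u v} ℤ).down • c.d x' x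
    rw [augmentation_of]
    exact (one_zsmul _).symm
  exact DFunLike.congr_fun h n

/-- On the augmentation kernel, `linear` does not depend on the base point. -/
theorem linear_eq {U : Cᵒᵖ} (x x' : S.obj U) (n : (kernelPresheaf (augmentation S)).obj U) :
    c.linear x' n.1 = c.linear x n.1 := by
  have h : ((augmentation S).app U n.1 : ULift.{max u v} ℤ).down = 0 := congrArg ULift.down n.2
  refine (c.linear_change x x' n.1).trans ?_
  exact (congrArg (fun m : ℤ => c.linear x n.1 + m • c.d x' x) h).trans (by
    rw [zero_zsmul, add_zero])

theorem map_linear {U V : Cᵒᵖ} (i : U ⟶ V) (x : S.obj U) (n : FreeAbelianGroup (S.obj U)) :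
    A.map i (c.linear x n) = c.linear (S.map i x) (FreeAbelianGroup.map (S.map i) n) := by
  have h : (A.map i).hom.comp (c.linear x) =
      (c.linear (S.map i x)).comp (FreeAbelianGroup.map (S.map i)) := by
    refine FreeAbelianGroup.lift_ext _ _ fun y => ?_
    change A.map i (c.linear x (FreeAbelianGroup.of y)) = c.linear (S.map i x)
      (FreeAbelianGroup.map (S.map i) (FreeAbelianGroup.of y))
    rw [c.linear_of, FreeAbelianGroup.map_of_apply, c.linear_of, c.map_d]
  exact DFunLike.congr_fun h n

open Classical in
/-- The homomorphism from the augmentation kernel deduced from a cocycle: it sends `Σ nₓ [x]` to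
`Σ nₓ d(x₀, x)`, for an arbitrary `x₀`. -/
noncomputable def hom : kernelPresheaf (augmentation S) ⟶ A where
  app U := AddCommGrpCat.ofHom (if h : Nonempty (S.obj U) then
    (c.linear h.some).comp ((augmentation S).app U).hom.ker.subtype else 0)
  naturality U V i := by
    ext n
    by_cases h : Nonempty (S.obj U)
    · have h' : Nonempty (S.obj V) := h.map (S.map i)
      simp only [h, h', dif_pos]
      refine Eq.trans ?_ (c.map_linear i h.some n.1).symm
      exact c.linear_eq (S.map i h.some) h'.some ((kernelPresheaf (augmentation S)).map i n)
    · have e : n = 0 := by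
        refine Subtype.ext ?_
        have : IsEmpty (S.obj U) := not_nonempty_iff.1 h
        exact Subsingleton.elim (α := FreeAbelianGroup (S.obj U)) _ _
      rw [e]
      exact (map_zero (((kernelPresheaf (augmentation S)).map i) ≫ _).hom).trans (map_zero (_ ≫ A.map i).hom).symm

theorem hom_app {U : Cᵒᵖ} (x : S.obj U) (n : (kernelPresheaf (augmentation S)).obj U) :
    c.hom.app U n = c.linear x n.1 := by
  have h : Nonempty (S.obj U) := ⟨x⟩
  refine Eq.trans ?_ (c.linear_eq x h.some n)
  simp only [hom, h, dif_pos]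
  rfl

/-- A morphism out of the augmentation kernel is determined over the objects where `S` has a
section, as the kernel vanishes elsewhere. -/
theorem hom_ext {f g : kernelPresheaf (augmentation S) ⟶ A}
    (h : ∀ (U : Cᵒᵖ) (_ : S.obj U) (n : (kernelPresheaf (augmentation S)).obj U), f.app U n = g.app U n) :
    f = g := by
  ext U n
  by_cases hU : Nonempty (S.obj U)
  · exact h U hU.some n
  · have e : n = 0 := by
      refine Subtype.ext ?_
      have : IsEmpty (S.obj U) := not_nonempty_iff.1 hU
      exact Subsingleton.elim (α := FreeAbelianGroup (S.obj U)) _ _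
    rw [e]
    exact (map_zero (f.app U).hom).trans (map_zero (g.app U).hom).symm

theorem hom_sub (c c' : AbCocycle S A) : (c.sub c').hom = c.hom - c'.hom := by
  refine hom_ext fun U x n => ?_
  refine ((c.sub c').hom_app x n).trans (Eq.trans ?_
    (congrArg₂ (· - ·) (c.hom_app x n) (c'.hom_app x n)).symm)
  have h : (c.sub c').linear x = c.linear x - c'.linear x := by
    refine FreeAbelianGroup.lift_ext _ _ fun y => ?_
    refine ((c.sub c').linear_of x y).trans ?_
    exact (congrArg₂ (· - ·) (c.linear_of x y) (c'.linear_of x y)).symm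
  exact DFunLike.congr_fun h n.1

theorem hom_map {A' : Cᵒᵖ ⥤ AddCommGrpCat.{max u v}} (f : A ⟶ A') :
    (c.map f).hom = c.hom ≫ f := by
  refine hom_ext fun U x n => ?_
  refine ((c.map f).hom_app x n).trans (Eq.trans ?_ (congrArg (f.app U) (c.hom_app x n)).symm)
  have h : (c.map f).linear x = (f.app U).hom.comp (c.linear x) := by
    refine FreeAbelianGroup.lift_ext _ _ fun y => ?_
    refine ((c.map f).linear_of x y).trans ?_
    exact (congrArg (f.app U) (c.linear_of x y)).symm
  exact DFunLike.congr_fun h n.1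

end AbCocycle

end CocycleClass

/-! ### The class of a torsor -/

section CocycleClass
variable {C : Type u} [Category.{v} C] {J : GrothendieckTopology C}

namespace AbCocycle
variable {S : Cᵒᵖ ⥤ Type (max u v)} {A : Sheaf J AddCommGrpCat.{max u v}}

/-- The class in `H¹(A)` of an additive cocycle: the push-out of the sheaf extension of `ℤ` associated with
the augmentation `ℤ[S] ⟶ ℤ`. -/
noncomputable def cls (c : AbCocycle S A.obj) (hS : LocallyNonempty J S) : A.H 1 :=
  have := hS.augmentation_surjective
  (sheafifiedKernel_shortExact (J := J) (augmentation S)).extClass.comp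
    (Abelian.Ext.mk₀ (sheafLift c.hom)) (add_zero 1)

/-- The class is natural in the coefficients. -/
theorem cls_map (c : AbCocycle S A.obj) (hS : LocallyNonempty J S)
    {A' : Sheaf J AddCommGrpCat.{max u v}} (f : A ⟶ A') :
    (c.map f.hom).cls hS = (c.cls hS).comp (Abelian.Ext.mk₀ f) (add_zero 1) := by
  have h : sheafLift (c.map f.hom).hom = sheafLift c.hom ≫ f := by
    refine sheafHom_ext ?_
    rw [toSheafify_sheafLift, hom_map]
    exact (congrArg (fun k => k ≫ f.hom) (toSheafify_sheafLift c.hom)).symm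
  have := hS.augmentation_surjective
  refine (congrArg (fun k => (sheafifiedKernel_shortExact (J := J) (augmentation S)).extClass.comp
    (Abelian.Ext.mk₀ k) (add_zero 1)) h).trans ?_
  refine (congrArg (fun k => (sheafifiedKernel_shortExact (J := J) (augmentation S)).extClass.comp
    k (add_zero 1)) (Abelian.Ext.mk₀_comp_mk₀ (sheafLift c.hom) f)).symm.trans ?_
  exact (Abelian.Ext.comp_assoc_of_third_deg_zero _ _ _ _).symm

theorem cls_sub (c c' : AbCocycle S A.obj) (hS : LocallyNonempty J S) :
    (c.sub c').cls hS = c.cls hS - c'.cls hS := by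
  have h : sheafLift c.hom = sheafLift (c.sub c').hom + sheafLift c'.hom := by
    refine sheafHom_ext ?_
    refine (toSheafify_sheafLift c.hom).trans (Eq.symm ?_)
    refine (Preadditive.comp_add _ _ _ (toSheafify J _) (sheafLift (c.sub c').hom).hom
      (sheafLift c'.hom).hom).trans ?_
    rw [toSheafify_sheafLift, toSheafify_sheafLift, hom_sub, sub_add_cancel]
  have := hS.augmentation_surjective
  refine eq_sub_of_add_eq ?_
  refine (Abelian.Ext.comp_add _ _ _ _).symm.trans (congrArg (fun k =>
    (sheafifiedKernel_shortExact (J := J) (augmentation S)).extClass.comp k (add_zero 1)) ?_)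
  exact (Abelian.Ext.mk₀_add (sheafLift (c.sub c').hom) (sheafLift c'.hom)).symm.trans
    (congrArg Abelian.Ext.mk₀ h.symm)

/-- A cocycle which is trivialized by a map to the fibre over `1` of an extension of `ℤ`
has the class of that extension. -/
theorem cls_eq (c : AbCocycle S A.obj) (hS : LocallyNonempty J S) (X : ZExtension A)
    (φ : S ⟶ X.E.obj ⋙ forget AddCommGrpCat.{max u v})
    (h₁ : ∀ (U : Cᵒᵖ) (x y : S.obj U), (show X.E.obj.obj U from φ.app U y) =
      (show X.E.obj.obj U from φ.app U x) + X.i.hom.app U (c.d x y))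
    (h₂ : ∀ (U : Cᵒᵖ) (x : S.obj U),
      X.p.hom.app U (show X.E.obj.obj U from φ.app U x) = oneSection J U) :
    c.cls hS = X.cls := by
  have := hS.augmentation_surjective
  have e₁ : sheafLift c.hom ≫ X.i =
      (presheafToSheaf J AddCommGrpCat.{max u v}).map (kernelSubtype (augmentation S)) ≫
        sheafLift (freeLift φ) := by
    refine sheafHom_ext ?_
    refine (congrArg (fun k => k ≫ X.i.hom) (toSheafify_sheafLift c.hom)).trans (Eq.symm ?_)
    refine (congrArg (fun k => k ≫ (sheafLift (freeLift φ)).hom) (toSheafify_map _)).trans ?_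
    refine (Category.assoc _ _ _).trans ((congrArg (fun k => kernelSubtype (augmentation S) ≫ k)
      (toSheafify_sheafLift (freeLift φ))).trans ?_)
    refine hom_ext fun U x n => ?_
    let k : FreeAbelianGroup (S.obj U) →+ X.E.obj.obj U :=
      (zmultiplesHom (X.E.obj.obj U) (φ.app U x)).comp
        (AddEquiv.ulift.toAddMonoidHom.comp ((augmentation S).app U).hom)
    have h : ((freeLift φ).app U).hom = k + (X.i.hom.app U).hom.comp (c.linear x) := by
      refine FreeAbelianGroup.lift_ext _ _ fun y => ?_
      refine (freeLift_of φ y).trans ((h₁ U x y).trans (congrArg₂ (· + ·) ?_ ?_))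
      · change _ = ((augmentation S).app U (FreeAbelianGroup.of y) : ULift.{max u v} ℤ).down •
          (show X.E.obj.obj U from φ.app U x)
        rw [augmentation_of]
        exact (one_zsmul _).symm
      · exact congrArg (X.i.hom.app U) (c.linear_of x y).symm
    refine (DFunLike.congr_fun h n.1).trans ?_
    have hn : ((augmentation S).app U n.1 : ULift.{max u v} ℤ).down = 0 := congrArg ULift.down n.2
    refine Eq.trans (congrArg₂ (· + ·) ?_ (congrArg (X.i.hom.app U) (c.hom_app x n).symm))
      (zero_add _)
    exact (congrArg (fun m : ℤ => m • (show X.E.obj.obj U from φ.app U x)) hn).trans (zero_zsmul _)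
  have e₂ : sheafLift (freeLift φ) ≫ X.p =
      (presheafToSheaf J AddCommGrpCat.{max u v}).map (augmentation S) := by
    refine sheafHom_ext ?_
    refine (congrArg (fun k => k ≫ X.p.hom) (toSheafify_sheafLift (freeLift φ))).trans ?_
    refine Eq.trans ?_ (toSheafify_map (augmentation S)).symm
    refine freeHom_ext fun U x => ?_
    refine (congrArg (X.p.hom.app U) (freeLift_of φ x)).trans ((h₂ U x).trans ?_)
    exact congrArg ((toSheafify J ((Functor.const Cᵒᵖ).obj
      (AddCommGrpCat.of (ULift.{max u v} ℤ)))).app U).hom (augmentation_of S x).symm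
  have e := (sheafifiedKernel_shortExact (J := J) (augmentation S)).extClass_naturality X.shortExact
    (ShortComplex.homMk (S₁ := sheafifiedKernel J (augmentation S))
      (S₂ := ShortComplex.mk X.i X.p X.zero) (sheafLift c.hom) (sheafLift (freeLift φ)) (𝟙 _) e₁
      (e₂.trans (Category.comp_id _).symm))
  exact e.trans (Abelian.Ext.mk₀_id_comp _)

/-- A cocycle is trivialized by a map to the fibre over `1` of any extension of `ℤ` with the same
class. -/
theorem exists_of_cls_eq (c : AbCocycle S A.obj) (hS : LocallyNonempty J S) (X : ZExtension A)
    (h : c.cls hS = X.cls) : ∃ φ : S ⟶ X.E.obj ⋙ forget AddCommGrpCat.{max u v},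
      (∀ (U : Cᵒᵖ) (x y : S.obj U), (show X.E.obj.obj U from φ.app U y) =
        (show X.E.obj.obj U from φ.app U x) + X.i.hom.app U (c.d x y)) ∧
      ∀ (U : Cᵒᵖ) (x : S.obj U),
        X.p.hom.app U (show X.E.obj.obj U from φ.app U x) = oneSection J U := by
  have := hS.augmentation_surjective
  obtain ⟨g, hg₁, hg₂⟩ := exists_hom_of_extClass
    (sheafifiedKernel_shortExact (J := J) (augmentation S)) X.shortExact (sheafLift c.hom) h
  have e₁ : kernelSubtype (augmentation S) ≫ toSheafify J _ ≫ g.hom = c.hom ≫ X.i.hom := by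
    have e := congrArg (fun k : (sheafifiedKernel J (augmentation S)).X₁ ⟶ X.E =>
      toSheafify J _ ≫ k.hom) hg₁
    refine Eq.trans ?_ (e.trans ?_)
    · refine (Category.assoc _ _ _).symm.trans ?_
      exact congrArg (fun k => k ≫ g.hom) (toSheafify_map _).symm
    · exact congrArg (fun k => k ≫ X.i.hom) (toSheafify_sheafLift c.hom)
  have e₂ : (toSheafify J (freePresheaf S) ≫ g.hom) ≫ X.p.hom =
      augmentation S ≫ toSheafify J _ := by
    have e := congrArg (fun k : (sheafifiedKernel J (augmentation S)).X₂ ⟶ constZ J =>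
      toSheafify J (freePresheaf S) ≫ k.hom) hg₂
    exact e.trans (toSheafify_map _)
  let φ : S ⟶ X.E.obj ⋙ forget AddCommGrpCat.{max u v} :=
    { app := fun U => ↾fun x => (toSheafify J (freePresheaf S) ≫ g.hom).app U (FreeAbelianGroup.of x)
      naturality := fun U V i => by
        refine ConcreteCategory.hom_ext _ _ fun x => ?_
        refine Eq.trans ?_ (NatTrans.naturality_apply (toSheafify J (freePresheaf S) ≫ g.hom) i
          (FreeAbelianGroup.of x))
        exact congrArg ((toSheafify J (freePresheaf S) ≫ g.hom).app V)
          (FreeAbelianGroup.map_of_apply x).symm }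
  refine ⟨φ, fun U x y => ?_, fun U x => ?_⟩
  · let n : FreeAbelianGroup (S.obj U) := FreeAbelianGroup.of y - FreeAbelianGroup.of x
    have hn : (augmentation S).app U n = 0 := by
      refine (map_sub ((augmentation S).app U).hom _ _).trans ?_
      refine sub_eq_zero.2 ?_
      exact (augmentation_of S y).trans (augmentation_of S x).symm
    have e := ConcreteCategory.congr_hom (congr_app e₁ U)
      (⟨n, hn⟩ : (kernelPresheaf (augmentation S)).obj U)
    have e' : (show X.E.obj.obj U from φ.app U y) - (show X.E.obj.obj U from φ.app U x) =
        X.i.hom.app U (c.d x y) := by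
      refine (map_sub ((toSheafify J (freePresheaf S) ≫ g.hom).app U).hom _ _).symm.trans (e.trans ?_)
      refine congrArg (X.i.hom.app U) ((c.hom_app x _).trans ?_)
      refine (map_sub (c.linear x) _ _).trans ?_
      rw [c.linear_of, c.linear_of, c.d_self, sub_zero]
    rw [← e']
    abel
  · refine (ConcreteCategory.congr_hom (congr_app e₂ U) (FreeAbelianGroup.of x)).trans ?_
    exact congrArg ((toSheafify J ((Functor.const Cᵒᵖ).obj
      (AddCommGrpCat.of (ULift.{max u v} ℤ)))).app U).hom (augmentation_of S x)

end AbCocycle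

variable {A : Sheaf J AddCommGrpCat.{max u v}}

/-- The differences of sections of a torsor under an abelian sheaf. -/
noncomputable def GSheaf.cocycle {P : GSheaf J (toGrp A).obj} (hP : P.IsTorsor) :
    AbCocycle P.carrier.obj A.obj where
  d x y := Multiplicative.toAdd (GSheaf.diff hP x y)
  map_d i x y := GSheaf.map_diff hP i x y
  d_add x y z := GSheaf.diff_mul hP x y z

theorem GSheaf.cocycle_act {P : GSheaf J (toGrp A).obj} (hP : P.IsTorsor) {U : Cᵒᵖ}
    (x : P.carrier.obj.obj U) (a : A.obj.obj U) :
    (GSheaf.cocycle hP).d x (P.act x (Multiplicative.ofAdd a)) = a :=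
  GSheaf.diff_eq hP (g := Multiplicative.ofAdd a) rfl

theorem GSheaf.act_cocycle {P : GSheaf J (toGrp A).obj} (hP : P.IsTorsor) {U : Cᵒᵖ}
    (x y : P.carrier.obj.obj U) :
    P.act x (Multiplicative.ofAdd ((GSheaf.cocycle hP).d x y)) = y :=
  GSheaf.act_diff hP x y

/-- The class of a torsor is that of the cocycle of the differences of its sections. -/
theorem GSheaf.hasClass_iff {P : GSheaf J (toGrp A).obj} (hP : P.IsTorsor) (γ : A.H 1) :
    P.HasClass γ ↔ γ = (GSheaf.cocycle hP).cls hP.locally_nonempty := by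
  constructor
  · rintro ⟨X, φ, rfl, h₁, h₂⟩
    refine ((GSheaf.cocycle hP).cls_eq hP.locally_nonempty X φ (fun U x y => ?_) h₂).symm
    have h := h₁ U x ((GSheaf.cocycle hP).d x y)
    rw [GSheaf.act_cocycle] at h
    exact h
  · rintro rfl
    obtain ⟨X, hX⟩ := ZExtension.exists_cls_eq ((GSheaf.cocycle hP).cls hP.locally_nonempty)
    obtain ⟨φ, h₁, h₂⟩ := (GSheaf.cocycle hP).exists_of_cls_eq hP.locally_nonempty X hX.symm
    refine ⟨X, φ, hX, fun U x a => ?_, h₂⟩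
    have h := h₁ U x (P.act x (Multiplicative.ofAdd a))
    rw [GSheaf.cocycle_act] at h
    exact h

/-- The torsor of sections over `1` of an extension of `ℤ`. -/
noncomputable def ZExtension.fibre (X : ZExtension A) : GSheaf J (toGrp A).obj where
  carrier := ⟨fibreProduct (Functor.whiskerRight X.p.hom (forget AddCommGrpCat.{max u v}))
      (M := (Functor.const _).obj PUnit.{max u v + 1})
      { app := fun U => ↾fun _ => (oneSection J U : (constZ J).obj.obj U)
        naturality := fun _ _ i => ConcreteCategory.hom_ext _ _ fun _ => (map_oneSection i).symm },
    isSheaf_fibreProduct _ _ (isSheaf_underlying_ab X.E)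
      (GSheaf.point J (toGrp A).obj).carrier.property (isSheaf_underlying_ab (constZ J))⟩
  act {U} x a := ⟨((show X.E.obj.obj U from x.1.1) + X.i.hom.app U (Multiplicative.toAdd a), x.1.2), by
    refine (map_add (X.p.hom.app U).hom _ _).trans ?_
    refine (congrArg₂ (· + ·) x.2 (exact_of_shortExact X.shortExact U |>.apply_apply_eq_zero _)).trans ?_
    exact add_zero _⟩
  act_one {U} x := Subtype.ext (Prod.ext ((congrArg _ (map_zero (X.i.hom.app U).hom)).trans
    (add_zero _)) rfl)
  act_mul {U} x a b := Subtype.ext (Prod.ext ((congrArg _ (map_add (X.i.hom.app U).hom _ _)).trans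
    (add_assoc _ _ _).symm) rfl)
  map_act {U V} i x a := Subtype.ext (Prod.ext ((map_add (X.E.obj.map i).hom _ _).trans
    (congrArg _ (NatTrans.naturality_apply X.i.hom i _).symm)) rfl)

theorem ZExtension.isTorsor_fibre (X : ZExtension A) : X.fibre.IsTorsor where
  locally_nonempty U := by
    refine ⟨_, (locallySurjective_of_shortExact X.shortExact).imageSieve_mem
      (U := U) (oneSection J (op U)), ?_⟩
    rintro V i ⟨e, he⟩
    exact ⟨⟨(e, PUnit.unit), he.trans (map_oneSection i.op)⟩⟩
  simply_transitive {U} x y := by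
    have h : X.p.hom.app U ((show X.E.obj.obj U from y.1.1) - (show X.E.obj.obj U from x.1.1)) = 0 :=
      (map_sub (X.p.hom.app U).hom _ _).trans (sub_eq_zero.2 (y.2.trans x.2.symm))
    obtain ⟨a, ha⟩ := (exact_of_shortExact X.shortExact U _).1 h
    refine ⟨Multiplicative.ofAdd a, Subtype.ext (Prod.ext ?_ rfl), fun b hb => ?_⟩
    · refine (congrArg (fun k => (show X.E.obj.obj U from x.1.1) + k) ha).trans ?_
      exact add_sub_cancel _ _
    · refine injective_of_shortExact X.shortExact U ?_
      refine Eq.trans ?_ ha.symm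
      exact eq_sub_of_add_eq' (congrArg (fun p => p.1.1) hb)

theorem ZExtension.hasClass_fibre (X : ZExtension A) : X.fibre.HasClass X.cls :=
  ⟨X, { app := fun _ => ↾fun x => x.1.1
        naturality := fun _ _ _ => rfl }, rfl, fun _ _ _ => rfl, fun _ x => x.2⟩

/-- Every element of `H¹(A)` is the class of a torsor. -/
theorem GSheaf.exists_hasClass (γ : A.H 1) :
    ∃ P : GSheaf J (toGrp A).obj, P.IsTorsor ∧ P.HasClass γ := by
  obtain ⟨X, rfl⟩ := ZExtension.exists_cls_eq γ
  exact ⟨X.fibre, X.isTorsor_fibre, X.hasClass_fibre⟩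

/-- A cocycle with the class of an extension is trivialized by a map to its torsor of sections over `1`. -/
theorem ZExtension.exists_map_fibre (X : ZExtension A) {S : Cᵒᵖ ⥤ Type (max u v)} (c : AbCocycle S A.obj)
    (hS : LocallyNonempty J S) (h : c.cls hS = X.cls) :
    ∃ k : S ⟶ X.fibre.carrier.obj, ∀ {U : Cᵒᵖ} (x y : S.obj U),
      k.app U y = X.fibre.act (k.app U x) (Multiplicative.ofAdd (c.d x y)) := by
  obtain ⟨φ, h₁, h₂⟩ := c.exists_of_cls_eq hS X h
  refine ⟨{ app := fun U => ↾fun x => ⟨(φ.app U x, PUnit.unit), h₂ U x⟩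
            naturality := fun U V i => ConcreteCategory.hom_ext _ _ fun x => ?_ },
    fun {U} x y => Subtype.ext (Prod.ext (h₁ U x y) rfl)⟩
  have h := NatTrans.naturality_apply φ i x
  exact Subtype.ext (Prod.ext h rfl)

theorem ZExtension.nonempty_hom_fibre (X : ZExtension A) {P : GSheaf J (toGrp A).obj} (hP : P.IsTorsor)
    (h : P.HasClass X.cls) : Nonempty (GSheafHom P X.fibre) := by
  obtain ⟨k, hk⟩ := X.exists_map_fibre (GSheaf.cocycle hP) hP.locally_nonempty
    ((GSheaf.hasClass_iff hP _).1 h).symm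
  refine ⟨⟨k, fun {U} x a => (hk x (P.act x a)).trans ?_⟩⟩
  exact congrArg (fun b => X.fibre.act (k.app U x) (Multiplicative.ofAdd b))
    (GSheaf.cocycle_act hP x (Multiplicative.toAdd a))

theorem GSheaf.Isomorphic.symm {G : Cᵒᵖ ⥤ GrpCat.{max u v}} {P Q : GSheaf J G}
    (h : P.Isomorphic Q) : Q.Isomorphic P := by
  obtain ⟨φ, hφ⟩ := h
  obtain ⟨ψ, h₁, h₂⟩ := hφ.out
  refine ⟨⟨ψ, fun {U} x g => ?_⟩, ⟨φ.hom, h₂, h₁⟩⟩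
  have e₁ := fun y => ConcreteCategory.congr_hom (congr_app h₁ U) y
  have e₂ := fun y => ConcreteCategory.congr_hom (congr_app h₂ U) y
  have e := φ.map_act (ψ.app U x) g
  refine Eq.trans ?_ (e₁ (P.act (ψ.app U x) g))
  refine (congrArg (ψ.app U) ?_)
  exact (congrArg (fun y => Q.act y g) (e₂ x).symm).trans e.symm

theorem GSheaf.HasClass.of_hom {P P' : GSheaf J (toGrp A).obj} (φ : GSheafHom P P') {γ : A.H 1}
    (h : P'.HasClass γ) : P.HasClass γ := by
  obtain ⟨X, ψ, hX, h₁, h₂⟩ := h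
  refine ⟨X, φ.hom ≫ ψ, hX, fun U x a => ?_, fun U x => h₂ U _⟩
  exact (congrArg (ψ.app U) (φ.map_act x _)).trans (h₁ U _ a)

/-- Torsors are isomorphic exactly when their classes agree: both map to the torsor of sections
over `1` of one extension. -/
theorem GSheaf.isomorphic_iff {P P' : GSheaf J (toGrp A).obj} {γ γ' : A.H 1} (hP : P.IsTorsor)
    (hP' : P'.IsTorsor) (h : P.HasClass γ) (h' : P'.HasClass γ') : P.Isomorphic P' ↔ γ = γ' := by
  constructor
  · rintro ⟨φ, -⟩
    exact ((GSheaf.hasClass_iff hP γ).1 h).trans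
      ((GSheaf.hasClass_iff hP γ').1 (h'.of_hom φ)).symm
  · rintro rfl
    obtain ⟨X, rfl⟩ := ZExtension.exists_cls_eq γ
    obtain ⟨φ⟩ := X.nonempty_hom_fibre hP h
    obtain ⟨φ'⟩ := X.nonempty_hom_fibre hP' h'
    obtain ⟨ψ, -⟩ := GSheaf.Isomorphic.symm ⟨φ', GSheafHom.isIso hP' X.isTorsor_fibre φ'⟩
    exact ⟨φ.comp ψ, GSheafHom.isIso hP hP' _⟩

end CocycleClass

/-! ### The cup product is a class of the Heisenberg gerbe -/

section CupIsClass
variable {C : Type u} [Category.{v} C] {J : GrothendieckTopology C}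
  {A B : Sheaf J AddCommGrpCat.{max u v}}

theorem GSheaf.IsTorsor.of_isomorphic {G : Cᵒᵖ ⥤ GrpCat.{max u v}} {T T' : GSheaf J G}
    (hT' : T'.IsTorsor) (h : T.Isomorphic T') : T.IsTorsor := by
  obtain ⟨φ, hφ⟩ := h
  obtain ⟨ψ, h₁, -⟩ := hφ.out
  have e : ∀ {U : Cᵒᵖ} (x : T.carrier.obj.obj U), ψ.app U (φ.hom.app U x) = x := fun {U} x =>
    ConcreteCategory.congr_hom (congr_app h₁ U) x
  refine ⟨fun U => ?_, fun {U} x y => ?_⟩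
  · obtain ⟨S, hS, h⟩ := hT'.locally_nonempty U
    exact ⟨S, hS, fun V i hi => (h i hi).map (ψ.app (op V))⟩
  · obtain ⟨g, hg, hu⟩ := hT'.simply_transitive (φ.hom.app U x) (φ.hom.app U y)
    refine ⟨g, ?_, fun g' hg' => hu g' ?_⟩
    · have h := congrArg (ψ.app U) ((φ.map_act x g).trans hg)
      exact (e _).symm.trans (h.trans (e _))
    · exact (φ.map_act x g').symm.trans (congrArg (φ.hom.app U) hg')

/-- The cup product of the classes of `P` and `Q` is a class of the gerbe of lifts. Let `0 ⟶ A ⟶ E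
⟶ ℤ ⟶ 0` have the class of `P`, so that `P` maps to `E`. The crossed homomorphism `(a, b, t) ↦ t +
φ ⊗ b` to `E ⊗ B` of this map `φ` identifies the gerbe with the gerbe of lifts of `Q`, viewed as
a `ℤ ⊗ B`-torsor, along `0 ⟶ A ⊗ B ⟶ E ⊗ B ⟶ ℤ ⊗ B ⟶ 0`. The class of the latter gerbe is the
Yoneda product that defines the cup product. -/
theorem hasClass_lifts_cup {P : GSheaf J (toGrp A).obj} {Q : GSheaf J (toGrp B).obj}
    {T : GSheaf J (prodGrp (toGrp A) (toGrp B)).obj} (hP : P.IsTorsor) (hQ : Q.IsTorsor)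
    {γ : A.H 1} {δ : B.H 1} (hγ : P.HasClass γ) (hδ : Q.HasClass δ) (hT : T.IsTorsor)
    (ρ : GSheafHom T (P.prod Q)) : ((heisenberg A B).lifts T).HasClass (cup γ δ) := by
  -- `cup` is defined by this particular extension.
  obtain ⟨S, hS⟩ : ∃ S, S = (ZExtension.exists_cls_eq γ).choose := ⟨_, rfl⟩
  have hSγ : S.cls = γ := hS ▸ (ZExtension.exists_cls_eq γ).choose_spec
  obtain ⟨φ, hφ₁, hφ₂⟩ := (GSheaf.cocycle hP).exists_of_cls_eq hP.locally_nonempty S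
    (((GSheaf.hasClass_iff hP _).1 hγ).symm.trans hSγ.symm)
  obtain ⟨X, hX⟩ := ZExtension.exists_cls_eq
    (δ.comp (Abelian.Ext.mk₀ (oneTmul B)) (add_zero 1) : (tensor (constZ J) B).H 1)
  obtain ⟨k, hk⟩ := X.exists_map_fibre ((GSheaf.cocycle hQ).map (oneTmul B).hom) hQ.locally_nonempty
    (((GSheaf.cocycle hQ).cls_map hQ.locally_nonempty (oneTmul B)).trans (hX ▸ congrArg
      (fun d : B.H 1 => d.comp (Abelian.Ext.mk₀ (oneTmul B)) (add_zero 1))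
      ((GSheaf.hasClass_iff hQ _).1 hδ).symm))
  let 𝓔 := CentralExtension.ofShortExact _ (S.tensor_shortExact B)
  let T₁ : GSheaf J (heisSheaf A B).obj := T.res (heisenberg A B).π.hom
  let T₂ : GSheaf J (toGrp (tensor S.E B)).obj := X.fibre.res 𝓔.π.hom
  let φ' : T₁.carrier.obj ⟶ S.E.obj ⋙ forget AddCommGrpCat.{max u v} :=
    { app := fun U => ↾fun t => φ.app U (ρ.hom.app U t : P.carrier.obj.obj U × Q.carrier.obj.obj U).1
      naturality := fun U V i => by
        refine ConcreteCategory.hom_ext _ _ fun t => ?_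
        have h₁ := NatTrans.naturality_apply φ i
          (ρ.hom.app U t : P.carrier.obj.obj U × Q.carrier.obj.obj U).1
        have h₂ := congrArg (fun z : P.carrier.obj.obj V × Q.carrier.obj.obj V => φ.app V z.1)
          (NatTrans.naturality_apply ρ.hom i t)
        exact h₂.trans h₁ }
  let τ : T₁.carrier.obj ⟶ T₂.carrier.obj :=
    { app := fun U => ↾fun t => k.app U (ρ.hom.app U t : P.carrier.obj.obj U × Q.carrier.obj.obj U).2
      naturality := fun U V i => by
        refine ConcreteCategory.hom_ext _ _ fun t => ?_
        have h₁ := NatTrans.naturality_apply k i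
          (ρ.hom.app U t : P.carrier.obj.obj U × Q.carrier.obj.obj U).2
        have h₂ := congrArg (fun z : P.carrier.obj.obj V × Q.carrier.obj.obj V => k.app V z.2)
          (NatTrans.naturality_apply ρ.hom i t)
        exact h₂.trans h₁ }
  have hφ' : ∀ {U : Cᵒᵖ} (t : T₁.carrier.obj.obj U) (h : Heis A B U),
      (show S.E.obj.obj U from φ'.app U (T₁.act t h)) =
        (show S.E.obj.obj U from φ'.app U t) + S.i.hom.app U h.a := by
    intro U t h
    refine (congrArg (fun z : P.carrier.obj.obj U × Q.carrier.obj.obj U => φ.app U z.1)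
      (ρ.map_act t _)).trans ?_
    refine (hφ₁ U (ρ.hom.app U t : P.carrier.obj.obj U × Q.carrier.obj.obj U).1 _).trans ?_
    exact congrArg (fun a => (show S.E.obj.obj U from φ'.app U t) + S.i.hom.app U a)
      (GSheaf.cocycle_act hP _ h.a)
  -- The image of `t + φ ⊗ b` in `ℤ ⊗ B` is `1 ⊗ b`, because `φ` maps to `1` in `ℤ`.
  have hτ : ∀ {U : Cᵒᵖ} (t : T₁.carrier.obj.obj U) (h : Heis A B U),
      τ.app U (T₁.act t h) = T₂.act (τ.app U t) (Multiplicative.ofAdd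
        ((tensorMap S.i (𝟙 B)).hom.app U h.t + tmul (show S.E.obj.obj U from φ'.app U t) h.b)) := by
    intro U t h
    refine (congrArg (fun z : P.carrier.obj.obj U × Q.carrier.obj.obj U => k.app U z.2)
      (ρ.map_act t _)).trans ?_
    refine (hk (ρ.hom.app U t : P.carrier.obj.obj U × Q.carrier.obj.obj U).2 _).trans ?_
    refine congrArg (fun b => X.fibre.act (τ.app U t) (Multiplicative.ofAdd b)) ?_
    refine (congrArg ((oneTmul B).hom.app U) (GSheaf.cocycle_act hQ _ h.b)).trans (Eq.symm ?_)
    refine (map_add ((tensorMap S.p (𝟙 B)).hom.app U).hom _ _).trans ?_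
    have e : (tensorMap S.p (𝟙 B)).hom.app U ((tensorMap S.i (𝟙 B)).hom.app U h.t) = 0 :=
      (exact_of_shortExact (S.tensor_shortExact B) U).apply_apply_eq_zero h.t
    refine (congrArg₂ (· + ·) e (tensorMap_tmul S.p (𝟙 B) _ h.b)).trans ((zero_add _).trans ?_)
    exact congrArg (fun z => tmul z h.b) (hφ₂ U _)
  refine ⟨_, _, _, _, _, S.tensor_shortExact B, X.fibre, X.cls, X.isTorsor_fibre, X.hasClass_fibre,
    ?_, ?_⟩
  · exact Twist.nonempty_bandedEquiv_lifts (heisenberg A B) hT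
      (tensorTwist T₁ S.i φ' hφ' T₂ τ hτ) (𝓔.isQuotientTorsor X.isTorsor_fibre)
      (fun t a => tensorTwist_cross (T := T₁) (i := S.i) (φ := φ') (τ := τ) hφ' hτ t a)
  · rw [hX]
    subst hS
    exact (Abelian.Ext.comp_assoc_of_second_deg_zero _ _ _ _).symm

end CupIsClass

/-! ### Morphisms of stacks of lifts and sections -/

section LiftSections
variable {C : Type u} [Category.{v} C] {J : GrothendieckTopology C}
  {E E' : Sheaf J GrpCat.{max u v}} {T : GSheaf J E.obj} {T' : GSheaf J E'.obj}

namespace LiftObj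

/-- A morphism out of a lift with a section is determined by the image of this section. -/
theorem hom_ext_of_sec {U : C} {x y : LiftObj T U} (r : x.Sec (𝟙 U)) {φ ψ : x ⟶ y}
    (h : (Hom.ap φ r : y.Sec (𝟙 U)) = Hom.ap ψ r) : φ = ψ :=
  (existsUnique_hom_of_sec r (Hom.ap φ r) (slam_ap φ r).symm).unique rfl h.symm

variable (Φ : Pseudofunctor.StrongTrans (pseudofunctor T) (pseudofunctor T'))

/-- The functor on fibres of a morphism between stacks of lifts. -/
abbrev fibreFunctor (U : C) : LiftObj T U ⥤ LiftObj T' U := (Φ.app ⟨op U⟩).toFunctor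

/-- The compatibility with restriction of a morphism between stacks of lifts. -/
def compat {U V : C} (i : V ⟶ U) (x : LiftObj T U) :
    (pull i).obj ((fibreFunctor Φ U).obj x) ⟶ (fibreFunctor Φ V).obj ((pull i).obj x) :=
  (Φ.naturality i.op.toLoc).inv.toNatTrans.app x

theorem compat_naturality {U V : C} (i : V ⟶ U) {x y : LiftObj T U} (φ : x ⟶ y) :
    (pull i).map ((fibreFunctor Φ U).map φ) ≫ compat Φ i y =
      compat Φ i x ≫ (fibreFunctor Φ V).map ((pull i).map φ) :=
  (Φ.naturality i.op.toLoc).inv.toNatTrans.naturality φ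

/-- The inverse of `compat`. -/
def compatHom {U V : C} (i : V ⟶ U) (x : LiftObj T U) :
    (fibreFunctor Φ V).obj ((pull i).obj x) ⟶ (pull i).obj ((fibreFunctor Φ U).obj x) :=
  (Φ.naturality i.op.toLoc).hom.toNatTrans.app x

theorem compat_compatHom {U V : C} (i : V ⟶ U) (x : LiftObj T U) :
    compat Φ i x ≫ compatHom Φ i x = 𝟙 _ :=
  congrArg (fun k => (Cat.Hom₂.toNatTrans k).app x) (Φ.naturality i.op.toLoc).inv_hom_id

theorem compatHom_compat {U V : C} (i : V ⟶ U) (x : LiftObj T U) :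
    compatHom Φ i x ≫ compat Φ i x = 𝟙 _ :=
  congrArg (fun k => (Cat.Hom₂.toNatTrans k).app x) (Φ.naturality i.op.toLoc).hom_inv_id

theorem compat_id {U : C} (x : LiftObj T U) :
    compat Φ (𝟙 U) x ≫ (fibreFunctor Φ U).map ((pullId T U).hom.app x) =
      (pullId T' U).hom.app ((fibreFunctor Φ U).obj x) := by
  have h := congrArg (fun k => (Cat.Hom₂.toNatTrans k).app x) (Φ.naturality_id ⟨op U⟩)
  have h' : compatHom Φ (𝟙 U) x ≫ (pullId T' U).hom.app ((fibreFunctor Φ U).obj x) =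
      (fibreFunctor Φ U).map ((pullId T U).hom.app x) ≫ 𝟙 _ ≫ 𝟙 _ := h
  rw [Category.comp_id, Category.comp_id] at h'
  rw [← h', ← Category.assoc, compat_compatHom, Category.id_comp]

theorem compat_comp {U V W : C} (j : W ⟶ V) (i : V ⟶ U) (x : LiftObj T U) :
    compat Φ (j ≫ i) x ≫ (fibreFunctor Φ W).map ((pullComp T j i).hom.app x) =
      (pullComp T' j i).hom.app ((fibreFunctor Φ U).obj x) ≫ (pull j).map (compat Φ i x) ≫
        compat Φ j ((pull i).obj x) := by
  have h := congrArg (fun k => (Cat.Hom₂.toNatTrans k).app x)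
    (Φ.naturality_comp i.op.toLoc j.op.toLoc)
  have h' : compatHom Φ (j ≫ i) x ≫ (pullComp T' j i).hom.app ((fibreFunctor Φ U).obj x) =
      (fibreFunctor Φ W).map ((pullComp T j i).hom.app x) ≫ 𝟙 _ ≫
        compatHom Φ j ((pull i).obj x) ≫ 𝟙 _ ≫ (pull j).map (compatHom Φ i x) ≫ 𝟙 _ := h
  rw [Category.comp_id, Category.id_comp, Category.id_comp] at h'
  have e := congrArg (fun k => compat Φ (j ≫ i) x ≫ k ≫ (pull j).map (compat Φ i x) ≫
    compat Φ j ((pull i).obj x)) h'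
  refine Eq.trans ?_ (e.symm.trans ?_)
  · have e₁ : (pull j).map (compatHom Φ i x) ≫ (pull j).map (compat Φ i x) = 𝟙 _ := by
      rw [← CategoryTheory.Functor.map_comp, compatHom_compat]
      exact CategoryTheory.Functor.map_id _ _
    simp only [Category.assoc]
    rw [reassoc_of% e₁, compatHom_compat]
    exact congrArg _ (Category.comp_id _).symm
  · rw [Category.assoc, ← Category.assoc, compat_compatHom, Category.id_comp]

variable {Φ} in
/-- The section of the image of the restriction of `x` deduced from a section of the image of `x`. -/
def pullSec {U V : C} {x : LiftObj T U} (i : V ⟶ U) (r : ((fibreFunctor Φ U).obj x).Sec i) :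
    ((fibreFunctor Φ V).obj ((pull i).obj x)).Sec (𝟙 V) :=
  Hom.ap (compat Φ i x) (((fibreFunctor Φ U).obj x).res (b' := 𝟙 V ≫ i) (𝟙 V) rfl r)

/-- The morphism between trivial torsors given by `h`, when `t' · h = t`. -/
noncomputable def trivialHom {U : C} {t t' : T.carrier.obj.obj (op U)} (h : E.obj.obj (op U))
    (hh : T.act t' h = t) : trivial t ⟶ trivial t' :=
  (existsUnique_hom_of_sec (trivialSec t (𝟙 U)) ((trivial t').sact (trivialSec t' (𝟙 U)) h) (by
    rw [slam_sact, slam_trivialSec, slam_trivialSec, op_id, Functor.map_id_apply,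
      Functor.map_id_apply, hh])).choose

theorem ap_trivialHom {U : C} {t t' : T.carrier.obj.obj (op U)} (h : E.obj.obj (op U))
    (hh : T.act t' h = t) : (Hom.ap (trivialHom h hh) (trivialSec t (𝟙 U)) : (trivial t').Sec (𝟙 U)) =
      (trivial t').sact (trivialSec t' (𝟙 U)) h :=
  (existsUnique_hom_of_sec (trivialSec t (𝟙 U)) ((trivial t').sact (trivialSec t' (𝟙 U)) h) (by
    rw [slam_sact, slam_trivialSec, slam_trivialSec, op_id, Functor.map_id_apply,
      Functor.map_id_apply, hh])).choose_spec.1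

/-- The morphism from the restriction of a trivial torsor to the trivial torsor that maps `1` to `1`. -/
noncomputable def trivialRes {U V : C} (i : V ⟶ U) (t : T.carrier.obj.obj (op U)) :
    (pull i).obj (trivial t) ⟶ trivial (T.carrier.obj.map i.op t) :=
  (existsUnique_hom_of_sec (x := (pull i).obj (trivial t)) (trivialSec t (𝟙 V ≫ i))
    (trivialSec (T.carrier.obj.map i.op t) (𝟙 V)) (by
      refine (slam_trivialSec t (𝟙 V ≫ i)).trans (Eq.trans ?_ (slam_trivialSec _ _).symm)
      rw [op_id, Functor.map_id_apply, Category.id_comp])).choose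

theorem ap_trivialRes {U V : C} (i : V ⟶ U) (t : T.carrier.obj.obj (op U)) :
    (Hom.ap (trivialRes i t) (X := op (Over.mk (𝟙 V))) (trivialSec t (𝟙 V ≫ i)) :
      (trivial (T.carrier.obj.map i.op t)).Sec (𝟙 V)) = trivialSec _ (𝟙 V) :=
  (existsUnique_hom_of_sec (x := (pull i).obj (trivial t)) (trivialSec t (𝟙 V ≫ i))
    (trivialSec (T.carrier.obj.map i.op t) (𝟙 V)) (by
      refine (slam_trivialSec t (𝟙 V ≫ i)).trans (Eq.trans ?_ (slam_trivialSec _ _).symm)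
      rw [op_id, Functor.map_id_apply, Category.id_comp])).choose_spec.1

theorem ap_trivialRes_sec {U V Y : C} (i : V ⟶ U) (t : T.carrier.obj.obj (op U)) (b : Y ⟶ V) :
    (Hom.ap (trivialRes i t) (X := op (Over.mk b)) (trivialSec t (b ≫ i)) :
      (trivial (T.carrier.obj.map i.op t)).Sec b) = trivialSec _ b := by
  refine Eq.trans ?_ (res_trivialSec (T.carrier.obj.map i.op t) (𝟙 V) b (Category.comp_id b))
  rw [← ap_trivialRes]
  refine Eq.trans ?_ (ap_res (trivialRes i t) (b := 𝟙 V) (b' := b) b (Category.comp_id b) _)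
  exact congrArg (Hom.ap (trivialRes i t) (X := op (Over.mk b)))
    (res_trivialSec t (𝟙 V ≫ i) b (by simp)).symm

theorem ap_trivialHom_sec {U Y : C} {t t' : T.carrier.obj.obj (op U)} (h : E.obj.obj (op U))
    (hh : T.act t' h = t) (b : Y ⟶ U) :
    (Hom.ap (trivialHom h hh) (trivialSec t b) : (trivial t').Sec b) =
      (trivial t').sact (trivialSec t' b) (E.obj.map b.op h) := by
  rw [← res_trivialSec t (𝟙 U) b (b' := b) (Category.comp_id b)]
  refine (ap_res (trivialHom h hh) (b := 𝟙 U) (b' := b) b (Category.comp_id b) _).trans ?_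
  rw [ap_trivialHom, res_sact, res_trivialSec]

section
variable {Φ} {U V W : C} {x y : LiftObj T U}

theorem ap_map_comp {z : LiftObj T U} (φ : x ⟶ y) (ψ : y ⟶ z) {b : V ⟶ U}
    (r : ((fibreFunctor Φ U).obj x).Sec b) :
    Hom.ap ((fibreFunctor Φ U).map (φ ≫ ψ)) r =
      Hom.ap ((fibreFunctor Φ U).map ψ) (Hom.ap ((fibreFunctor Φ U).map φ) r) := by
  rw [CategoryTheory.Functor.map_comp]
  rfl

theorem pullSec_ap (φ : x ⟶ y) (i : V ⟶ U) (r : ((fibreFunctor Φ U).obj x).Sec i) :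
    pullSec (x := y) i (Hom.ap ((fibreFunctor Φ U).map φ) r) =
      Hom.ap ((fibreFunctor Φ V).map ((pull i).map φ)) (pullSec i r) := by
  refine (congrArg (Hom.ap (compat Φ i y)) (ap_res ((fibreFunctor Φ U).map φ) (b := i)
    (b' := 𝟙 V ≫ i) (𝟙 V) rfl r).symm).trans ?_
  exact congrArg (fun k : (pull i).obj ((fibreFunctor Φ U).obj x) ⟶
      (fibreFunctor Φ V).obj ((pull i).obj y) => Hom.ap k (X := op (Over.mk (𝟙 V)))
        (((fibreFunctor Φ U).obj x).res (b' := 𝟙 V ≫ i) (𝟙 V) rfl r))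
    (compat_naturality Φ i φ)

theorem pullSec_sact (i : V ⟶ U) (r : ((fibreFunctor Φ U).obj x).Sec i) (g : E'.obj.obj (op V)) :
    pullSec i (((fibreFunctor Φ U).obj x).sact r g) =
      ((fibreFunctor Φ V).obj ((pull i).obj x)).sact (pullSec i r) g := by
  refine Eq.trans ?_ (ap_sact (compat Φ i x) (b := 𝟙 V)
    (((fibreFunctor Φ U).obj x).res (b' := 𝟙 V ≫ i) (𝟙 V) rfl r) g)
  refine congrArg (Hom.ap (compat Φ i x)) ((res_sact _ _ _ _ _).trans ?_)
  rw [op_id, Functor.map_id_apply]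
  rfl

theorem slam_pullSec (i : V ⟶ U) (r : ((fibreFunctor Φ U).obj x).Sec i) :
    ((fibreFunctor Φ V).obj ((pull i).obj x)).slam (pullSec i r) =
      ((fibreFunctor Φ U).obj x).slam r := by
  refine (slam_ap (compat Φ i x) (b := 𝟙 V)
    (((fibreFunctor Φ U).obj x).res (b' := 𝟙 V ≫ i) (𝟙 V) rfl r)).trans ?_
  refine (slam_res _ (b := i) (b' := 𝟙 V ≫ i) (𝟙 V) rfl r).trans ?_
  rw [op_id, Functor.map_id_apply]

theorem pullSec_id (r : ((fibreFunctor Φ U).obj x).Sec (𝟙 U)) :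
    (Hom.ap ((fibreFunctor Φ U).map ((pullId T U).hom.app x)) (pullSec (𝟙 U) r) :
      ((fibreFunctor Φ U).obj x).Sec (𝟙 U)) = r := by
  refine (congrArg (fun k : (pull (𝟙 U)).obj ((fibreFunctor Φ U).obj x) ⟶
    (fibreFunctor Φ U).obj x => Hom.ap k (X := op (Over.mk (𝟙 U)))
      (((fibreFunctor Φ U).obj x).res (b := 𝟙 U) (b' := 𝟙 U ≫ 𝟙 U) (𝟙 U) rfl r))
    (compat_id Φ x)).trans ?_
  refine (map_map _ _ _ _).trans ((map_congr _ _ (𝟙 _) ?_ _).trans (Functor.map_id_apply _ _ _))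
  exact Category.id_comp _

theorem pullSec_comp (j : W ⟶ V) (i : V ⟶ U) (r : ((fibreFunctor Φ U).obj x).Sec (𝟙 U)) :
    (Hom.ap ((fibreFunctor Φ W).map ((pullComp T j i).hom.app x)) (pullSec (j ≫ i)
      (((fibreFunctor Φ U).obj x).res (j ≫ i) (Category.comp_id _) r)) :
      ((fibreFunctor Φ W).obj ((pull j).obj ((pull i).obj x))).Sec (𝟙 W)) =
    pullSec j (((fibreFunctor Φ V).obj ((pull i).obj x)).res j (Category.comp_id _) (pullSec i
      (((fibreFunctor Φ U).obj x).res i (Category.comp_id _) r))) := by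
  let x' := (fibreFunctor Φ U).obj x
  refine (congrArg (fun k : (pull (j ≫ i)).obj x' ⟶
    (fibreFunctor Φ W).obj ((pull j).obj ((pull i).obj x)) =>
      Hom.ap k (X := op (Over.mk (𝟙 W))) (x'.res (b := j ≫ i)
    (b' := 𝟙 W ≫ j ≫ i) (𝟙 W) rfl (x'.res (j ≫ i) (Category.comp_id _) r)))
    (compat_comp Φ j i x)).trans ?_
  have e₁ := ap_res (compat Φ i x) (b := 𝟙 V) (b' := j) j (Category.comp_id _)
    (x'.res (b' := 𝟙 V ≫ i) (𝟙 V) rfl (x'.res i (Category.comp_id _) r))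
  have e₂ := ap_res (compat Φ i x) (b := j) (b' := 𝟙 W ≫ j) (𝟙 W) rfl
    (((pull i).obj x').res (b := 𝟙 V) (b' := j) j (Category.comp_id _)
      (x'.res (b' := 𝟙 V ≫ i) (𝟙 V) rfl (x'.res i (Category.comp_id _) r)))
  refine Eq.symm ((congrArg (fun s => Hom.ap (compat Φ j ((pull i).obj x)) (X := op (Over.mk (𝟙 W)))
    (((fibreFunctor Φ V).obj ((pull i).obj x)).res (b := j) (b' := 𝟙 W ≫ j) (𝟙 W) rfl s)) e₁.symm).trans ?_)
  refine (congrArg (fun s => Hom.ap (compat Φ j ((pull i).obj x)) (X := op (Over.mk (𝟙 W))) s)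
    e₂.symm).trans ?_
  refine congrArg (fun s => Hom.ap (compat Φ j ((pull i).obj x)) (X := op (Over.mk (𝟙 W)))
    (Hom.ap (compat Φ i x) (X := op (Over.mk (𝟙 W ≫ j))) s)) ?_
  refine (map_map x' _ _ _).trans ((map_map x' _ _ _).trans ((map_map x' _ _ _).trans (Eq.symm
    ((map_map x' _ _ _).trans ((map_map x' _ _ _).trans (map_congr x' _ _ ?_ r))))))
  simp

end

end LiftObj
end LiftSections

/-! ### Sections of the images of trivial torsors -/

section TrivialSections
variable {C : Type u} [Category.{v} C] {J : GrothendieckTopology C}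
  {E E' : Sheaf J GrpCat.{max u v}} {T : GSheaf J E.obj} {T' : GSheaf J E'.obj}

namespace LiftObj
variable (Φ : Pseudofunctor.StrongTrans (pseudofunctor T) (pseudofunctor T'))

/-- A section `t` of `T` over `U` and a section over `U` of the image under `Φ` of the trivial
torsor with map to `T` given by `t`. -/
abbrev TrivialSection (U : C) : Type (max u v) :=
  Σ t : T.carrier.obj.obj (op U), ((fibreFunctor Φ U).obj (trivial t)).Sec (𝟙 U)

variable {Φ}

/-- Equality of two such pairs, stated along a morphism of trivial torsors that respects the
sections `1`, to avoid a cast along an equality of sections of `T`. -/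
theorem TrivialSection.ext {U : C} {s s' : TrivialSection Φ U} (q : trivial s.1 ⟶ trivial s'.1)
    (hq : (Hom.ap q (trivialSec s.1 (𝟙 U)) : (trivial s'.1).Sec (𝟙 U)) = trivialSec s'.1 (𝟙 U))
    (h : Hom.ap ((fibreFunctor Φ U).map q) s.2 = s'.2) : s = s' := by
  obtain ⟨t, r⟩ := s
  obtain ⟨t', r'⟩ := s'
  obtain rfl : t = t' := by
    have e := (slam_ap q (trivialSec t (𝟙 U))).symm.trans (congrArg (trivial t').slam hq)
    rw [slam_trivialSec, slam_trivialSec, op_id, Functor.map_id_apply, Functor.map_id_apply] at e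
    exact e
  obtain rfl : q = 𝟙 _ := hom_ext_of_sec _ hq
  refine congrArg (Sigma.mk t) (Eq.trans ?_ h)
  refine Eq.symm ((congrArg (fun k => Hom.ap k r) ((fibreFunctor Φ U).map_id (trivial t))).trans ?_)
  rfl

/-- The restriction of a pair of a section of `T` and of a section of the image of the corresponding
trivial torsor. -/
noncomputable def TrivialSection.map {U V : C} (i : V ⟶ U) (s : TrivialSection Φ U) :
    TrivialSection Φ V :=
  ⟨T.carrier.obj.map i.op s.1, Hom.ap ((fibreFunctor Φ V).map (trivialRes i s.1)) (pullSec i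
    (((fibreFunctor Φ U).obj (trivial s.1)).res i (Category.comp_id _) s.2))⟩

theorem TrivialSection.map_id {U : C} (s : TrivialSection Φ U) : s.map (𝟙 U) = s := by
  have hh : T.act s.1 1 = T.carrier.obj.map (𝟙 U).op s.1 := by
    rw [T.act_one, op_id, Functor.map_id_apply]
  have hq : (Hom.ap (trivialHom 1 hh) (trivialSec _ (𝟙 U)) : (trivial s.1).Sec (𝟙 U)) =
      trivialSec s.1 (𝟙 U) := (ap_trivialHom 1 hh).trans (sact_one _ _)
  refine TrivialSection.ext (trivialHom 1 hh) hq ?_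
  refine (ap_map_comp (trivialRes (𝟙 U) s.1) (trivialHom 1 hh) (pullSec (𝟙 U) _)).symm.trans ?_
  have e : trivialRes (𝟙 U) s.1 ≫ trivialHom 1 hh = (pullId T U).hom.app (trivial s.1) := by
    refine hom_ext_of_sec (x := (pull (𝟙 U)).obj (trivial s.1)) (trivialSec s.1 (𝟙 U ≫ 𝟙 U)) ?_
    refine ((ap_comp (trivialRes (𝟙 U) s.1) (trivialHom 1 hh) (X := op (Over.mk (𝟙 U))) _).trans
      (congrArg (Hom.ap (trivialHom 1 hh)) (ap_trivialRes (𝟙 U) s.1))).trans (hq.trans ?_)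
    exact (map_one (E.obj.map (𝟙 U).op).hom).symm
  rw [e]
  refine (congrArg (fun r => Hom.ap ((fibreFunctor Φ U).map ((pullId T U).hom.app (trivial s.1)))
    (pullSec (𝟙 U) r)) (res_id _ _ s.2)).trans (pullSec_id s.2)

theorem TrivialSection.map_comp {U V W : C} (j : W ⟶ V) (i : V ⟶ U) (s : TrivialSection Φ U) :
    s.map (j ≫ i) = (s.map i).map j := by
  have hh : T.act (T.carrier.obj.map j.op (T.carrier.obj.map i.op s.1)) 1 =
      T.carrier.obj.map (j ≫ i).op s.1 := by
    rw [T.act_one, op_comp, Functor.map_comp_apply]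
  have hq : (Hom.ap (trivialHom 1 hh) (trivialSec _ (𝟙 W)) :
      (trivial (T.carrier.obj.map j.op (T.carrier.obj.map i.op s.1))).Sec (𝟙 W)) =
      trivialSec _ (𝟙 W) := (ap_trivialHom 1 hh).trans (sact_one _ _)
  refine TrivialSection.ext (s' := (s.map i).map j) (trivialHom 1 hh) hq ?_
  refine (ap_map_comp (trivialRes (j ≫ i) s.1) (trivialHom 1 hh) (pullSec (j ≫ i) _)).symm.trans ?_
  have e : trivialRes (j ≫ i) s.1 ≫ trivialHom 1 hh = (pullComp T j i).hom.app (trivial s.1) ≫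
      (pull j).map (trivialRes i s.1) ≫ trivialRes j (T.carrier.obj.map i.op s.1) := by
    refine hom_ext_of_sec (x := (pull (j ≫ i)).obj (trivial s.1)) (trivialSec s.1 (𝟙 W ≫ j ≫ i)) ?_
    refine ((ap_comp (trivialRes (j ≫ i) s.1) (trivialHom 1 hh) (X := op (Over.mk (𝟙 W))) _).trans
      (congrArg (Hom.ap (trivialHom 1 hh)) (ap_trivialRes (j ≫ i) s.1))).trans (hq.trans ?_)
    refine (ap_trivialRes j (T.carrier.obj.map i.op s.1)).symm.trans ?_
    refine congrArg (Hom.ap (trivialRes j (T.carrier.obj.map i.op s.1)) (X := op (Over.mk (𝟙 W)))) ?_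
    refine (ap_trivialRes_sec i s.1 (𝟙 W ≫ j)).symm.trans ?_
    refine congrArg (Hom.ap (trivialRes i s.1) (X := op (Over.mk (𝟙 W ≫ j)))) ?_
    exact (map_one (E.obj.map (𝟙 W).op).hom).symm
  rw [e]
  refine (ap_map_comp ((pullComp T j i).hom.app (trivial s.1)) _ (pullSec (j ≫ i) _)).trans ?_
  refine (congrArg (Hom.ap _) (pullSec_comp j i s.2)).trans ?_
  refine (ap_map_comp ((pull j).map (trivialRes i s.1)) _ _).trans ?_
  refine congrArg (Hom.ap _) ((pullSec_ap (trivialRes i s.1) j _).symm.trans ?_)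
  exact congrArg (pullSec j) (ap_res _ _ _ _)

variable (Φ) in
/-- The presheaf of pairs of a section of `T` and of a section of the image of the corresponding
trivial torsor. -/
noncomputable def trivialSections : Cᵒᵖ ⥤ Type (max u v) where
  obj U := TrivialSection Φ U.unop
  map i := ↾fun s => TrivialSection.map i.unop s
  map_id U := ConcreteCategory.hom_ext _ _ fun s : TrivialSection Φ U.unop =>
    TrivialSection.map_id s
  map_comp i j := ConcreteCategory.hom_ext _ _ fun s => TrivialSection.map_comp j.unop i.unop s

/-- The difference of two sections of images of trivial torsors, along the morphism of trivial torsors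
given by `h`. -/
noncomputable def TrivialSection.diff {U : C} (s s' : TrivialSection Φ U) (h : E.obj.obj (op U))
    (hh : T.act s'.1 h = s.1) : E'.obj.obj (op U) :=
  ((fibreFunctor Φ U).obj (trivial s'.1)).sdiff
    (Hom.ap ((fibreFunctor Φ U).map (trivialHom h hh)) s.2) s'.2

namespace TrivialSection
variable {U V : C} {s s' s'' : TrivialSection Φ U} {h h' : E.obj.obj (op U)}

theorem sact_diff (hh : T.act s'.1 h = s.1) :
    ((fibreFunctor Φ U).obj (trivial s'.1)).sact
      (Hom.ap ((fibreFunctor Φ U).map (trivialHom h hh)) s.2) (s.diff s' h hh) = s'.2 :=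
  sact_sdiff _ _ _

theorem act_slam_diff (hh : T.act s'.1 h = s.1) :
    T'.act (((fibreFunctor Φ U).obj (trivial s.1)).slam s.2) (s.diff s' h hh) =
      ((fibreFunctor Φ U).obj (trivial s'.1)).slam s'.2 := by
  conv_rhs => rw [← sact_diff hh, slam_sact]
  exact congrArg (fun z => T'.act z _) (slam_ap _ _).symm

/-- The differences form a cocycle; the order of `h` and `h'` is reversed because morphisms of
trivial torsors compose in this way. -/
theorem diff_mul (hh : T.act s'.1 h = s.1) (hh' : T.act s''.1 h' = s'.1)
    (hh'' : T.act s''.1 (h' * h) = s.1) :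
    s.diff s' h hh * s'.diff s'' h' hh' = s.diff s'' (h' * h) hh'' := by
  have e : trivialHom h hh ≫ trivialHom h' hh' = trivialHom (h' * h) hh'' := by
    refine hom_ext_of_sec (trivialSec s.1 (𝟙 U)) ?_
    refine (congrArg (Hom.ap (trivialHom h' hh')) (ap_trivialHom h hh)).trans ?_
    refine (ap_sact (trivialHom h' hh') (b := 𝟙 U) _ _).trans ?_
    rw [ap_trivialHom, ap_trivialHom, sact_mul]
  refine (sdiff_eq _ ?_).symm
  rw [sact_mul, ← e]
  refine Eq.trans (congrArg (fun r => ((fibreFunctor Φ U).obj (trivial s''.1)).sact r _) ?_)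
    (sact_diff hh')
  refine (congrArg (fun r => ((fibreFunctor Φ U).obj (trivial s''.1)).sact r _)
    (ap_map_comp _ _ s.2)).trans ?_
  refine (ap_sact ((fibreFunctor Φ U).map (trivialHom h' hh')) (b := 𝟙 U) _ _).symm.trans ?_
  exact congrArg (Hom.ap _) (sact_diff hh)

theorem map_diff (i : V ⟶ U) (hh : T.act s'.1 h = s.1)
    (hh' : T.act (s'.map i).1 (E.obj.map i.op h) = (s.map i).1) :
    E'.obj.map i.op (s.diff s' h hh) = (s.map i).diff (s'.map i) (E.obj.map i.op h) hh' := by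
  have e : trivialRes i s.1 ≫ trivialHom (E.obj.map i.op h) hh' =
      (pull i).map (trivialHom h hh) ≫ trivialRes i s'.1 := by
    refine hom_ext_of_sec (x := (pull i).obj (trivial s.1)) (trivialSec s.1 (𝟙 V ≫ i)) ?_
    refine ((ap_comp (trivialRes i s.1) (trivialHom (E.obj.map i.op h) hh')
      (X := op (Over.mk (𝟙 V))) _).trans (congrArg (Hom.ap (trivialHom (E.obj.map i.op h) hh'))
        (ap_trivialRes i s.1))).trans ((ap_trivialHom _ hh').trans ?_)
    refine Eq.symm ((congrArg (Hom.ap (trivialRes i s'.1) (X := op (Over.mk (𝟙 V))))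
      (ap_trivialHom_sec h hh (𝟙 V ≫ i))).trans ?_)
    refine (ap_sact (trivialRes i s'.1) (b := 𝟙 V) _ _).trans ?_
    refine congrArg₂ (fun a b => (trivial (T.carrier.obj.map i.op s'.1)).sact (b := 𝟙 V) a b)
      (ap_trivialRes i s'.1) ?_
    rw [Category.id_comp]
  refine (sdiff_eq _ ?_).symm
  have e₁ : Hom.ap ((fibreFunctor Φ V).map (trivialHom (E.obj.map i.op h) hh')) (s.map i).2 =
      Hom.ap ((fibreFunctor Φ V).map (trivialRes i s'.1)) (pullSec i
        (((fibreFunctor Φ U).obj (trivial s'.1)).res i (Category.comp_id _)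
          (Hom.ap ((fibreFunctor Φ U).map (trivialHom h hh)) s.2))) := by
    refine (ap_map_comp (trivialRes i s.1) (trivialHom (E.obj.map i.op h) hh') _).symm.trans ?_
    refine (congrArg (fun k : (pull i).obj (trivial s.1) ⟶ trivial (s'.map i).1 =>
      Hom.ap ((fibreFunctor Φ V).map k) (pullSec i _)) e).trans ?_
    refine (ap_map_comp _ _ _).trans (congrArg (Hom.ap _) ((pullSec_ap _ i _).symm.trans ?_))
    exact congrArg (pullSec i) (ap_res _ _ _ _)
  refine (congrArg (fun r => ((fibreFunctor Φ V).obj (trivial _)).sact r _) e₁).trans ?_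
  refine (ap_sact ((fibreFunctor Φ V).map (trivialRes i s'.1)) (b := 𝟙 V) _ _).symm.trans ?_
  refine congrArg (Hom.ap _) ((pullSec_sact i _ _).symm.trans (congrArg (pullSec i) ?_))
  refine (res_sact _ _ _ _ _).symm.trans ?_
  exact congrArg _ (sact_diff hh)

end TrivialSection

/-- The inverse appears because `a` moves the first of the two sections. -/
theorem TrivialSection.diff_band {A : Sheaf J AddCommGrpCat.{max u v}} {ι : toGrp A ⟶ E}
    {ι' : toGrp A ⟶ E'}
    {central : ∀ (U : Cᵒᵖ) (a : (toGrp A).obj.obj U) (x : E.obj.obj U),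
      ι.hom.app U a * x = x * ι.hom.app U a}
    {triv : ∀ (U : Cᵒᵖ) (a : (toGrp A).obj.obj U) (t : T.carrier.obj.obj U),
      T.act t (ι.hom.app U a) = t}
    {central' : ∀ (U : Cᵒᵖ) (a : (toGrp A).obj.obj U) (x : E'.obj.obj U),
      ι'.hom.app U a * x = x * ι'.hom.app U a}
    {triv' : ∀ (U : Cᵒᵖ) (a : (toGrp A).obj.obj U) (t : T'.carrier.obj.obj U),
      T'.act t (ι'.hom.app U a) = t}
    (Ψ : BandedEquiv (bandedLifts T ι central triv) (bandedLifts T' ι' central' triv')) {U : C}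
    (s : TrivialSection Ψ.trans U) (a : A.obj.obj (op U)) (hh : T.act s.1 (bandSec ι a) = s.1) :
    s.diff s (bandSec ι a) hh = (bandSec ι' a)⁻¹ := by
  have e : trivialHom (bandSec ι a) hh = (bandedLifts T ι central triv).band (trivial s.1) a := by
    refine hom_ext_of_sec (trivialSec s.1 (𝟙 U)) ((ap_trivialHom _ hh).trans ?_)
    refine Eq.trans ?_ (ap_band (trivial s.1) a (𝟙 U) _).symm
    rw [op_id, Functor.map_id_apply]
  refine sdiff_eq _ ?_
  have e' : Hom.ap ((fibreFunctor Ψ.trans U).map (trivialHom (bandSec ι a) hh)) s.2 =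
      ((fibreFunctor Ψ.trans U).obj (trivial s.1)).sact s.2 (bandSec ι' a) := by
    rw [e]
    refine (congrArg (fun k => Hom.ap k s.2) (Ψ.map_band (trivial s.1) a)).trans ?_
    refine (ap_band _ a (𝟙 U) s.2).trans ?_
    rw [op_id, Functor.map_id_apply]
  rw [e', ← sact_mul, mul_inv_cancel, sact_one]

theorem slam_map {U V : C} (i : V ⟶ U) (s : TrivialSection Φ U) :
    ((fibreFunctor Φ V).obj (trivial (s.map i).1)).slam (s.map i).2 =
      T'.carrier.obj.map i.op (((fibreFunctor Φ U).obj (trivial s.1)).slam s.2) :=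
  (slam_ap _ _).trans ((slam_pullSec i _).trans (slam_res _ _ _ _))

/-- Every section of `T` locally underlies a section of the image of its trivial torsor. -/
theorem exists_trivialSection {U : C} (t : T.carrier.obj.obj (op U)) :
    ∃ S ∈ J U, ∀ ⦃V : C⦄ (i : V ⟶ U), S i →
      ∃ s : TrivialSection Φ V, s.1 = T.carrier.obj.map i.op t := by
  obtain ⟨S, hS, h⟩ := exists_sec ((fibreFunctor Φ U).obj (trivial t)) (𝟙 U)
  refine ⟨S, hS, fun V i hi => ?_⟩
  obtain ⟨r⟩ := h i hi
  exact ⟨⟨_, Hom.ap ((fibreFunctor Φ V).map (trivialRes i t)) (pullSec i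
    (((fibreFunctor Φ U).obj (trivial t)).res (𝟙 V) (by simp) r))⟩, rfl⟩

end LiftObj
end TrivialSections

/-! ### Uniqueness of the class of a gerbe of lifts -/

section LocalCocycle
variable {C : Type u} [Category.{v} C] {J : GrothendieckTopology C}

/-- A cocycle with values in a sheaf can be constructed locally: it is enough to give a relation
with at most one value, additive and stable under restriction, that has a value locally. -/
theorem AbCocycle.exists_of_local {S : Cᵒᵖ ⥤ Type (max u v)} (A : Sheaf J AddCommGrpCat.{max u v})
    (p : ∀ ⦃U : C⦄, S.obj (op U) → S.obj (op U) → A.obj.obj (op U) → Prop)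
    (res : ∀ ⦃U V : C⦄ (i : V ⟶ U) (x y : S.obj (op U)) (a : A.obj.obj (op U)), p x y a →
      p (S.map i.op x) (S.map i.op y) (A.obj.map i.op a))
    (uniq : ∀ ⦃U : C⦄ (x y : S.obj (op U)) (a a' : A.obj.obj (op U)), p x y a → p x y a' → a = a')
    (add : ∀ ⦃U : C⦄ (x y z : S.obj (op U)) (a b : A.obj.obj (op U)), p x y a → p y z b →
      p x z (a + b))
    (ex : ∀ ⦃U : C⦄ (x y : S.obj (op U)), ∃ R ∈ J U, ∀ ⦃V : C⦄ (i : V ⟶ U), R i →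
      ∃ a, p (S.map i.op x) (S.map i.op y) a) :
    ∃ c : AbCocycle S A.obj, ∀ ⦃U : C⦄ (x y : S.obj (op U)) (a : A.obj.obj (op U)), p x y a →
      c.d x y = a := by
  let M : Cᵒᵖ ⥤ Type (max u v) :=
    { obj := fun U => S.obj U × S.obj U
      map := fun i => ↾fun z => (S.map i z.1, S.map i z.2)
      map_id := fun U => ConcreteCategory.hom_ext _ _ fun z : S.obj U × S.obj U => by
        have h₁ := Functor.map_id_apply S U z.1
        have h₂ := Functor.map_id_apply S U z.2
        exact Prod.ext h₁ h₂
      map_comp := fun {U V W} i j => ConcreteCategory.hom_ext _ _ fun z : S.obj U × S.obj U => by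
        have h₁ := Functor.map_comp_apply S i j z.1
        have h₂ := Functor.map_comp_apply S i j z.2
        exact Prod.ext h₁ h₂ }
  obtain ⟨h, hh⟩ := exists_hom_of_local (M := M) (isSheaf_underlying_ab A)
    (fun X z a => p z.1 z.2 a) (fun X Y f z a => res f z.1 z.2 a)
    (fun X z a a' => uniq z.1 z.2 a a') (fun X z => ex z.1 z.2)
  let pair {U : Cᵒᵖ} (x y : S.obj U) : M.obj U := Prod.mk x y
  let d {U : Cᵒᵖ} (x y : S.obj U) : A.obj.obj U := h.app U (pair x y)
  have map_d {U V : Cᵒᵖ} (i : U ⟶ V) (x y : S.obj U) :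
      A.obj.map i (d x y) = d (S.map i x) (S.map i y) :=
    (NatTrans.naturality_apply h i (pair x y)).symm
  have hd {U : C} (x y : S.obj (op U)) (a : A.obj.obj (op U)) (ha : p x y a) : d x y = a :=
    hh (X := U) (pair x y) a ha
  refine ⟨⟨d, map_d, fun {U} x y z => ?_⟩, fun U => hd⟩
  obtain ⟨R, hR, h₁⟩ := ex (U := U.unop) x y
  obtain ⟨R', hR', h₂⟩ := ex (U := U.unop) y z
  refine sections_ext (isSheaf_underlying_ab A) (J.intersection_covering hR hR') fun V i hi => ?_
  obtain ⟨a, ha⟩ := h₁ i hi.1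
  obtain ⟨b, hb⟩ := h₂ i hi.2
  refine (map_add (A.obj.map i.op).hom _ _).trans (Eq.trans ?_ (map_d i.op x z).symm)
  refine (congrArg₂ (· + ·) ((map_d i.op x y).trans (hd _ _ a ha))
    ((map_d i.op y z).trans (hd _ _ b hb))).trans ?_
  exact (hd _ _ (a + b) (add _ _ _ _ _ ha hb)).symm

/-- Refining the index presheaf does not change the class. -/
theorem AbCocycle.cls_comap {S S' : Cᵒᵖ ⥤ Type (max u v)} {A : Sheaf J AddCommGrpCat.{max u v}}
    (c : AbCocycle S A.obj) (hS : LocallyNonempty J S) (hS' : LocallyNonempty J S') (k : S' ⟶ S) :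
    (c.comap k).cls hS' = c.cls hS := by
  obtain ⟨X, hX⟩ := ZExtension.exists_cls_eq (c.cls hS)
  obtain ⟨φ, h₁, h₂⟩ := c.exists_of_cls_eq hS X hX.symm
  exact ((c.comap k).cls_eq hS' X (k ≫ φ) (fun U x y => h₁ U _ _) (fun U x => h₂ U _)).trans hX

end LocalCocycle

section Uniqueness
variable {C : Type u} [Category.{v} C] {J : GrothendieckTopology C}
  {E : Sheaf J GrpCat.{max u v}} {T : GSheaf J E.obj} {N : Sheaf J AddCommGrpCat.{max u v}}
  {ι : toGrp N ⟶ E}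
  {central : ∀ (U : Cᵒᵖ) (a : (toGrp N).obj.obj U) (x : E.obj.obj U),
    ι.hom.app U a * x = x * ι.hom.app U a}
  {triv : ∀ (U : Cᵒᵖ) (a : (toGrp N).obj.obj U) (t : T.carrier.obj.obj U),
    T.act t (ι.hom.app U a) = t}
  {I Q : Sheaf J AddCommGrpCat.{max u v}} {f : N ⟶ I} {g : I ⟶ Q} {zero : f ≫ g = 0}
  {hS : (ShortComplex.mk f g zero).ShortExact} {R : GSheaf J (toGrp Q).obj}

namespace LiftObj

/-- The map to `T` that forgets the section of the image of the trivial torsor. -/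
def trivialSectionsBase {E' : Sheaf J GrpCat.{max u v}} {T' : GSheaf J E'.obj}
    (Φ : Pseudofunctor.StrongTrans (pseudofunctor T) (pseudofunctor T')) :
    trivialSections Φ ⟶ T.carrier.obj where
  app U := ↾fun s : TrivialSection Φ U.unop => s.1
  naturality _ _ _ := rfl

/-- The map to `T'` that sends a section of the image of a trivial torsor to its image in `T'`. -/
def trivialSectionsSlam {E' : Sheaf J GrpCat.{max u v}} {T' : GSheaf J E'.obj}
    (Φ : Pseudofunctor.StrongTrans (pseudofunctor T) (pseudofunctor T')) :
    trivialSections Φ ⟶ T'.carrier.obj where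
  app U := ↾fun s : TrivialSection Φ U.unop => ((fibreFunctor Φ U.unop).obj (trivial s.1)).slam s.2
  naturality _ _ i := ConcreteCategory.hom_ext _ _ fun s => slam_map i.unop s

end LiftObj

open LiftObj

/-- The difference, in the abelian sheaf `I`, of two sections of images of trivial torsors under
an equivalence with the gerbe of lifts along `0 ⟶ N ⟶ I ⟶ Q ⟶ 0`. -/
noncomputable def bandedDiff (Ψ : BandedEquiv (bandedLifts T ι central triv)
      ((CentralExtension.ofShortExact _ hS).lifts R)) {U : C} (s s' : TrivialSection Ψ.trans U)
    (h : E.obj.obj (op U)) (hh : T.act s'.1 h = s.1) : I.obj.obj (op U) :=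
  Multiplicative.toAdd (show Multiplicative (I.obj.obj (op U)) from s.diff s' h hh)

variable {Ψ : BandedEquiv (bandedLifts T ι central triv)
      ((CentralExtension.ofShortExact _ hS).lifts R)} {U : C} {s s' s'' : TrivialSection Ψ.trans U}
  {h h' : E.obj.obj (op U)}

theorem bandedDiff_add (hh : T.act s'.1 h = s.1) (hh' : T.act s''.1 h' = s'.1)
    (hh'' : T.act s''.1 (h' * h) = s.1) :
    bandedDiff Ψ s s' h hh + bandedDiff Ψ s' s'' h' hh' = bandedDiff Ψ s s'' (h' * h) hh'' :=
  TrivialSection.diff_mul hh hh' hh''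

theorem map_bandedDiff {V : C} (i : V ⟶ U) (hh : T.act s'.1 h = s.1)
    (hh' : T.act (s'.map i).1 (E.obj.map i.op h) = (s.map i).1) :
    I.obj.map i.op (bandedDiff Ψ s s' h hh) =
      bandedDiff Ψ (s.map i) (s'.map i) (E.obj.map i.op h) hh' :=
  TrivialSection.map_diff i hh hh'

/-- Changing `h` by a section of `N` changes the difference by this section, whatever the
equivalence is. Thus the differences of two equivalences, pushed into one sheaf that contains `N`,
do not depend on `h` after subtraction. -/
theorem bandedDiff_band (a : N.obj.obj (op U)) (hh : T.act s'.1 h = s.1)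
    (hh' : T.act s'.1 (h * bandSec ι a) = s.1) :
    bandedDiff Ψ s s' (h * bandSec ι a) hh' =
      bandedDiff Ψ s s' h hh - f.hom.app (op U) a := by
  have e : bandedDiff Ψ s s (bandSec ι a) (triv _ _ _) = -f.hom.app (op U) a :=
    TrivialSection.diff_band Ψ s a _
  refine (bandedDiff_add (s' := s) (triv _ _ _) hh hh').symm.trans ?_
  rw [e]
  abel

/-- The image in `Q` of the differences is the cocycle of the torsor `R`. -/
theorem cocycle_slam (hR : R.IsTorsor) (hh : T.act s'.1 h = s.1) :
    (GSheaf.cocycle hR).d (((fibreFunctor Ψ.trans U).obj (trivial s.1)).slam s.2)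
      (((fibreFunctor Ψ.trans U).obj (trivial s'.1)).slam s'.2) =
        g.hom.app (op U) (bandedDiff Ψ s s' h hh) :=
  GSheaf.diff_eq hR (TrivialSection.act_slam_diff hh)

variable {I' Q' : Sheaf J AddCommGrpCat.{max u v}} {f' : N ⟶ I'} {g' : I' ⟶ Q'}
  {zero' : f' ≫ g' = 0} {hS' : (ShortComplex.mk f' g' zero').ShortExact} {R' : GSheaf J (toGrp Q').obj}

/-- The class of a gerbe of lifts is unique. For two equivalences with gerbes of lifts along
extensions `I` and `I'` of `Q` and `Q'` by `N`, map `I` and `I'` to an injective sheaf `M`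
containing `N`, with induced maps `ρ`, `ρ'` of `Q`, `Q'` to `M / N`. The differences of the two
equivalences in `M`, subtracted, form a cocycle in `M`, whose class vanishes as `M` is injective.
Its image in `M / N` is the difference of the cocycles of the torsors, so `ρ` and `ρ'` map their
classes to the same element of `H¹(M / N)`, and both connecting maps factor through that of `0 ⟶ N
⟶ M ⟶ M / N ⟶ 0`. -/
theorem comp_extClass_eq (hT : IsQuotientTorsor ι T) (Ψ : BandedEquiv (bandedLifts T ι central triv)
      ((CentralExtension.ofShortExact _ hS).lifts R)) (hR : R.IsTorsor)
    (Ψ' : BandedEquiv (bandedLifts T ι central triv)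
      ((CentralExtension.ofShortExact _ hS').lifts R')) (hR' : R'.IsTorsor) {t : Q.H 1} {t' : Q'.H 1}
    (ht : R.HasClass t) (ht' : R'.HasClass t') :
    Abelian.Ext.comp t hS.extClass rfl = Abelian.Ext.comp t' hS'.extClass rfl := by
  have := hS.mono_f
  have := hS'.mono_f
  have := hS.epi_g
  have := hS'.epi_g
  let ι₀ := Injective.ι N
  let q := Limits.cokernel.π ι₀
  have hq : ι₀ ≫ q = 0 := Limits.cokernel.condition ι₀
  let σ : I ⟶ Injective.under N := Injective.factorThru ι₀ f
  let σ' : I' ⟶ Injective.under N := Injective.factorThru ι₀ f'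
  have hσ : f ≫ σ = ι₀ := Injective.comp_factorThru ι₀ f
  have hσ' : f' ≫ σ' = ι₀ := Injective.comp_factorThru ι₀ f'
  obtain ⟨ρ, hρ⟩ : ∃ ρ : Q ⟶ Limits.cokernel ι₀, g ≫ ρ = σ ≫ q :=
    ⟨hS.exact.desc (σ ≫ q) (by
      change f ≫ σ ≫ q = 0
      rw [← Category.assoc, hσ, hq]), hS.exact.g_desc _ _⟩
  obtain ⟨ρ', hρ'⟩ : ∃ ρ' : Q' ⟶ Limits.cokernel ι₀, g' ≫ ρ' = σ' ≫ q :=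
    ⟨hS'.exact.desc (σ' ≫ q) (by
      change f' ≫ σ' ≫ q = 0
      rw [← Category.assoc, hσ', hq]), hS'.exact.g_desc _ _⟩
  -- Sections of both images of the same trivial torsor.
  let X := fibreProduct (trivialSectionsBase Ψ.trans) (trivialSectionsBase Ψ'.trans)
  have hX : LocallyNonempty J X := fun U => by
    obtain ⟨S, hS₁, hS₂⟩ := hT.locally_nonempty U
    refine exists_cover_trans hS₁ _ fun V i hi => ?_
    obtain ⟨t₀⟩ := hS₂ i hi
    obtain ⟨S₁, hS₁, h₁⟩ := exists_trivialSection (Φ := Ψ.trans) t₀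
    obtain ⟨S₂, hS₂, h₂⟩ := exists_trivialSection (Φ := Ψ'.trans) t₀
    refine ⟨_, J.intersection_covering hS₁ hS₂, fun W j hj => ?_⟩
    obtain ⟨s, hs⟩ := h₁ j hj.1
    obtain ⟨s', hs'⟩ := h₂ j hj.2
    exact ⟨⟨(s, s'), hs.trans hs'.symm⟩⟩
  let s₁ {U : C} (x : X.obj (op U)) : TrivialSection Ψ.trans U := x.1.1
  let s₂ {U : C} (x : X.obj (op U)) : TrivialSection Ψ'.trans U := x.1.2
  have hs {U : C} (x : X.obj (op U)) : (s₁ x).1 = (s₂ x).1 := x.2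
  obtain ⟨c, hc⟩ := AbCocycle.exists_of_local (S := X) (Injective.under N)
    (fun U x y e => ∃ (h : E.obj.obj (op U)) (h₁ : T.act (s₁ y).1 h = (s₁ x).1)
      (h₂ : T.act (s₂ y).1 h = (s₂ x).1),
      σ.hom.app (op U) (bandedDiff Ψ (s₁ x) (s₁ y) h h₁) -
        σ'.hom.app (op U) (bandedDiff Ψ' (s₂ x) (s₂ y) h h₂) = e)
    (by
      rintro U V i x y _ ⟨h, h₁, h₂, rfl⟩
      refine ⟨E.obj.map i.op h, (T.map_act i.op (s₁ y).1 h).symm.trans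
        (congrArg (T.carrier.obj.map i.op) h₁), (T.map_act i.op (s₂ y).1 h).symm.trans
        (congrArg (T.carrier.obj.map i.op) h₂), ?_⟩
      refine Eq.symm ((map_sub ((Injective.under N).obj.map i.op).hom _ _).trans (congrArg₂ (· - ·)
        ((NatTrans.naturality_apply σ.hom i.op _).symm.trans (congrArg (σ.hom.app (op V)) ?_))
        ((NatTrans.naturality_apply σ'.hom i.op _).symm.trans (congrArg (σ'.hom.app (op V)) ?_))))
      · exact map_bandedDiff i h₁ _
      · exact map_bandedDiff i h₂ _)
    (by
      rintro U x y _ _ ⟨h, h₁, h₂, rfl⟩ ⟨h', h₁', h₂', rfl⟩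
      -- Two choices of `h` differ by a section of `N`, with the same image under `f ≫ σ` and `f' ≫ σ'`.
      obtain ⟨a, rfl⟩ : ∃ a : N.obj.obj (op U), h * bandSec ι a = h' := by
        obtain ⟨a, ha⟩ := (hT.stabilizer (s₁ x).1 (h⁻¹ * h')).1 (by
          rw [T.act_mul, ← h₁, T.act_act_inv, h₁', h₁])
        exact ⟨a, (congrArg (h * ·) ha).trans (mul_inv_cancel_left h h')⟩
      rw [bandedDiff_band a h₁ h₁', bandedDiff_band a h₂ h₂', map_sub, map_sub]
      have e₁ : σ.hom.app (op U) (f.hom.app (op U) a) = ι₀.hom.app (op U) a :=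
        congrArg (fun k : N ⟶ Injective.under N => k.hom.app (op U) a) hσ
      have e₂ : σ'.hom.app (op U) (f'.hom.app (op U) a) = ι₀.hom.app (op U) a :=
        congrArg (fun k : N ⟶ Injective.under N => k.hom.app (op U) a) hσ'
      rw [e₁, e₂]
      abel)
    (by
      rintro U x y z _ _ ⟨h, h₁, h₂, rfl⟩ ⟨h', h₁', h₂', rfl⟩
      refine ⟨h' * h, by rw [T.act_mul, h₁', h₁], by rw [T.act_mul, h₂', h₂], ?_⟩
      rw [← bandedDiff_add h₁ h₁', ← bandedDiff_add h₂ h₂', map_add, map_add]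
      abel)
    (fun U x y => by
      obtain ⟨S, hS₁, hS₂⟩ := hT.locally_transitive (s₁ y).1 (s₁ x).1
      refine ⟨S, hS₁, fun V i hi => ?_⟩
      obtain ⟨h, h₁⟩ := hS₂ i hi
      refine ⟨_, h, h₁, ?_, rfl⟩
      exact (congrArg (fun t => T.act t h) (hs (X.map i.op y))).symm.trans (h₁.trans (hs (X.map i.op x))))
  let k₁ : X ⟶ R.carrier.obj :=
    { app := fun U => ↾fun x => x.1.1
      naturality := fun _ _ _ => rfl : X ⟶ trivialSections Ψ.trans } ≫ trivialSectionsSlam Ψ.trans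
  let k₂ : X ⟶ R'.carrier.obj :=
    { app := fun U => ↾fun x => x.1.2
      naturality := fun _ _ _ => rfl : X ⟶ trivialSections Ψ'.trans } ≫ trivialSectionsSlam Ψ'.trans
  -- The ambiguity of `h` dies in the quotient, where both sides can be compared locally.
  have hc' : c.map q.hom = (((GSheaf.cocycle hR).comap k₁).map ρ.hom).sub
      (((GSheaf.cocycle hR').comap k₂).map ρ'.hom) := by
    refine AbCocycle.ext (funext fun U => funext fun x => funext fun y => ?_)
    obtain ⟨S, hS₁, hS₂⟩ := hT.locally_transitive (s₁ y).1 (s₁ x).1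
    refine sections_ext (isSheaf_underlying_ab (Limits.cokernel ι₀)) hS₁ fun V i hi => ?_
    refine ((c.map q.hom).map_d i.op x y).trans (Eq.trans ?_ (AbCocycle.map_d _ i.op x y).symm)
    obtain ⟨h, h₁⟩ := hS₂ i hi
    have h₂ : T.act (s₂ (X.map i.op y)).1 h = (s₂ (X.map i.op x)).1 :=
      (congrArg (fun t => T.act t h) (hs (X.map i.op y))).symm.trans (h₁.trans (hs (X.map i.op x)))
    refine (congrArg (q.hom.app (op V)) (hc (X.map i.op x) (X.map i.op y) _
      ⟨h, h₁, h₂, rfl⟩)).trans ((map_sub (q.hom.app (op V)).hom _ _).trans ?_)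
    refine congrArg₂ (· - ·) ?_ ?_
    · refine (congrArg (fun k : I ⟶ Limits.cokernel ι₀ => k.hom.app (op V)
        (bandedDiff Ψ (s₁ (X.map i.op x)) (s₁ (X.map i.op y)) h h₁)) hρ).symm.trans ?_
      exact congrArg (ρ.hom.app (op V)) (cocycle_slam hR h₁).symm
    · refine (congrArg (fun k : I' ⟶ Limits.cokernel ι₀ => k.hom.app (op V)
        (bandedDiff Ψ' (s₂ (X.map i.op x)) (s₂ (X.map i.op y)) h h₂)) hρ').symm.trans ?_
      exact congrArg (ρ'.hom.app (op V)) (cocycle_slam hR' h₂).symm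
  have key : t.comp (Abelian.Ext.mk₀ ρ) (add_zero 1) = t'.comp (Abelian.Ext.mk₀ ρ') (add_zero 1) := by
    have e₀ : (c.map q.hom).cls hX = 0 := by
      rw [AbCocycle.cls_map, Abelian.Ext.eq_zero_of_injective (c.cls hX), Abelian.Ext.zero_comp]
    rw [hc', AbCocycle.cls_sub, AbCocycle.cls_map, AbCocycle.cls_map,
      AbCocycle.cls_comap _ hR.locally_nonempty, AbCocycle.cls_comap _ hR'.locally_nonempty,
      ← (GSheaf.hasClass_iff hR t).1 ht, ← (GSheaf.hasClass_iff hR' t').1 ht'] at e₀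
    exact sub_eq_zero.1 e₀
  have e₁ : hS.extClass = (Abelian.Ext.mk₀ ρ).comp (ZExtension.injShortExact N).extClass
      (zero_add 1) :=
    (Abelian.Ext.comp_mk₀_id _).symm.trans (hS.extClass_naturality (ZExtension.injShortExact N)
      (ShortComplex.homMk (𝟙 N) σ ρ ((Category.id_comp _).trans hσ.symm) hρ.symm))
  have e₂ : hS'.extClass = (Abelian.Ext.mk₀ ρ').comp (ZExtension.injShortExact N).extClass
      (zero_add 1) :=
    (Abelian.Ext.comp_mk₀_id _).symm.trans (hS'.extClass_naturality (ZExtension.injShortExact N)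
      (ShortComplex.homMk (𝟙 N) σ' ρ' ((Category.id_comp _).trans hσ'.symm) hρ'.symm))
  rw [e₁, e₂]
  exact (Abelian.Ext.comp_assoc_of_second_deg_zero _ _ _ _).symm.trans
    ((congrArg (fun k => Abelian.Ext.comp k (ZExtension.injShortExact N).extClass rfl) key).trans
      (Abelian.Ext.comp_assoc_of_second_deg_zero _ _ _ _))

end Uniqueness

/-! ### The class of the Heisenberg gerbe and the boundary map -/

section Boundary
variable {C : Type u} [Category.{v} C] {J : GrothendieckTopology C}
  {A B : Sheaf J AddCommGrpCat.{max u v}}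

/-- The gerbe of lifts of `P × Q` to the Heisenberg group has exactly one class, the cup product.
-/
theorem hasClass_lifts_iff {P : GSheaf J (toGrp A).obj} {Q : GSheaf J (toGrp B).obj}
    {T : GSheaf J (prodGrp (toGrp A) (toGrp B)).obj} (hP : P.IsTorsor) (hQ : Q.IsTorsor)
    {γ : A.H 1} {δ : B.H 1} (hγ : P.HasClass γ) (hδ : Q.HasClass δ) (hT : T.Isomorphic (P.prod Q))
    (x : (tensor A B).H 2) : ((heisenberg A B).lifts T).HasClass x ↔ x = cup γ δ := by
  have hT' : T.IsTorsor := (GSheaf.isTorsor_prod hP hQ).of_isomorphic hT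
  obtain ⟨ρ, -⟩ := hT
  have h := hasClass_lifts_cup hP hQ hγ hδ hT' ρ
  refine ⟨fun hx => ?_, fun hx => hx ▸ h⟩
  obtain ⟨I, I₁, f, g, zero, hS, R, t, hR, ht, ⟨Ψ⟩, rfl⟩ := hx
  obtain ⟨I', I₁', f', g', zero', hS', R', t', hR', ht', ⟨Ψ'⟩, h'⟩ := h
  rw [h']
  exact comp_extClass_eq ((heisenberg A B).isQuotientTorsor hT') Ψ hR Ψ' hR' ht ht'

/-- The boundary map of the Heisenberg extension is well defined and equal to the cup product. -/
theorem isHeisenbergBoundary_iff (γ : A.H 1) (δ : B.H 1) (x : (tensor A B).H 2) :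
    IsHeisenbergBoundary γ δ x ↔ x = cup γ δ := by
  constructor
  · rintro ⟨T, P, Q, hP, hγ, hQ, hδ, hT, hx⟩
    exact (hasClass_lifts_iff hP hQ hγ hδ hT x).1 hx
  · intro hx
    obtain ⟨P, hP, hγ⟩ := GSheaf.exists_hasClass γ
    obtain ⟨Q, hQ, hδ⟩ := GSheaf.exists_hasClass δ
    have hT : (P.prod Q).Isomorphic (P.prod Q) :=
      ⟨GSheafHom.id _, inferInstanceAs (IsIso (𝟙 (P.prod Q).carrier.obj))⟩
    exact ⟨P.prod Q, P, Q, hP, hγ, hQ, hδ, hT, (hasClass_lifts_iff hP hQ hγ hδ hT x).2 hx⟩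

end Boundary

end HeisenbergGerbe

open HeisenbergGerbe in
/-- The Heisenberg extension of a pair of abelian sheaves on a site and the cup product. -/
theorem theorem1 {C : Type u} [Category.{v} C] (J : GrothendieckTopology C) :
    -- the Heisenberg sheaf is a central extension of `A × B` by `A ⊗ B`, with the stated group law
    (∀ A B : Sheaf J AddCommGrpCat.{max u v},
      (∀ (U : Cᵒᵖ) (a a' : A.obj.obj U) (b b' : B.obj.obj U) (t t' : (tensor A B).obj.obj U),
        (⟨a, b, t⟩ * ⟨a', b', t'⟩ : Heis A B U) =
          ⟨a + a', b + b', t + t' + tmul a b'⟩) ∧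
      (∀ U : Cᵒᵖ, Function.Injective ((heisInl A B).hom.app U)) ∧
      (∀ (U : Cᵒᵖ) (x : (heisSheaf A B).obj.obj U),
        (heisProj A B).hom.app U x = 1 ↔ ∃ t, (heisInl A B).hom.app U t = x) ∧
      Presheaf.IsLocallySurjective J (heisProj A B).hom ∧
      (∀ (U : Cᵒᵖ) (t : (toGrp (tensor A B)).obj.obj U) (x : (heisSheaf A B).obj.obj U),
        (heisInl A B).hom.app U t * x = x * (heisInl A B).hom.app U t)) ∧
    -- it is functorial in `A` and `B`, and so is the extension
    (∀ A B : Sheaf J AddCommGrpCat.{max u v}, heisMap (𝟙 A) (𝟙 B) = 𝟙 (heisSheaf A B)) ∧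
    (∀ (A A' A'' B B' B'' : Sheaf J AddCommGrpCat.{max u v}) (f : A ⟶ A') (f' : A' ⟶ A'')
      (g : B ⟶ B') (g' : B' ⟶ B''),
      heisMap (f ≫ f') (g ≫ g') = heisMap f g ≫ heisMap f' g') ∧
    (∀ (A A' B B' : Sheaf J AddCommGrpCat.{max u v}) (f : A ⟶ A') (g : B ⟶ B'),
      heisInl A B ≫ heisMap f g = toGrpMap (tensorMap f g) ≫ heisInl A' B' ∧
      heisMap f g ≫ heisProj A' B' = heisProj A B ≫ prodGrpMap (toGrpMap f) (toGrpMap g)) ∧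
    -- `H¹` classifies torsors
    (∀ A : Sheaf J AddCommGrpCat.{max u v},
      (∀ P : GSheaf J (toGrp A).obj, P.IsTorsor → ∃! γ : A.H 1, P.HasClass γ) ∧
      (∀ γ : A.H 1, ∃ P : GSheaf J (toGrp A).obj, P.IsTorsor ∧ P.HasClass γ) ∧
      (∀ (P P' : GSheaf J (toGrp A).obj) (γ γ' : A.H 1), P.IsTorsor → P'.IsTorsor →
        P.HasClass γ → P'.HasClass γ' → (P.Isomorphic P' ↔ γ = γ'))) ∧
    -- the boundary map of the Heisenberg extension is the cup product
    (∀ (A B : Sheaf J AddCommGrpCat.{max u v}) (γ : A.H 1) (δ : B.H 1) (x : (tensor A B).H 2),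
      IsHeisenbergBoundary γ δ x ↔ x = cup γ δ) ∧
    -- the gerbe of local lifts has band `A ⊗ B` and its class is the cup product
    (∀ (A B : Sheaf J AddCommGrpCat.{max u v}) (P : GSheaf J (toGrp A).obj)
      (Q : GSheaf J (toGrp B).obj), P.IsTorsor → Q.IsTorsor →
      (heisenbergGerbe P Q).IsGerbe ∧
      ∀ (γ : A.H 1) (δ : B.H 1), P.HasClass γ → Q.HasClass δ →
        ∀ x : (tensor A B).H 2, (heisenbergGerbe P Q).HasClass x ↔ x = cup γ δ) ∧
    -- functoriality: existence of the morphism of gerbes, and its universal property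
    (∀ (D : Type u) [Category.{v} D] (K : GrothendieckTopology D) (F : C ⥤ D)
      [F.IsContinuous J K], (∀ U : C, RepresentablyFlat (Over.post (X := U) F)) →
      ∀ (X : TorsorPair J) (Y : TorsorPair K) (f : TorsorPairHom F X Y),
        Nonempty (GerbeHom f) ∧
        ∀ (U : C) (x : X.Lift U) (y y' : Y.Lift (F.obj U)) (c : LiftMap f x y)
          (c' : LiftMap f x y'), ∃! φ : y ⟶ y', c.post φ = c') ∧
    -- compatibility with identities
    (∀ (X : TorsorPair J) (Φ : GerbeHom (F := 𝟭 C) (K := J) (TorsorPairHom.id X)) (U : C),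
      ∃! e : 𝟭 (X.Lift U) ≅ Φ.functor U,
        ∀ x : X.Lift U, (LiftMap.id x).post (e.hom.app x) = Φ.unit x) ∧
    -- compatibility with composition
    (∀ (D D' : Type u) [Category.{v} D] [Category.{v} D'] (K : GrothendieckTopology D)
      (K' : GrothendieckTopology D') (F : C ⥤ D) (G : D ⥤ D') [F.IsContinuous J K]
      [G.IsContinuous K K'] [(F ⋙ G).IsContinuous J K'],
      (∀ U : C, RepresentablyFlat (Over.post (X := U) F)) →
      (∀ U : D, RepresentablyFlat (Over.post (X := U) G)) →
      ∀ (X : TorsorPair J) (Y : TorsorPair K) (Z : TorsorPair K') (f : TorsorPairHom F X Y)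
        (g : TorsorPairHom G Y Z) (Φ : GerbeHom f) (Ψ : GerbeHom g) (Ξ : GerbeHom (f.comp g))
        (U : C), ∃! e : Φ.functor U ⋙ Ψ.functor (F.obj U) ≅ Ξ.functor U,
          ∀ x : X.Lift U, ((Φ.unit x).comp (Ψ.unit ((Φ.functor U).obj x))).post (e.hom.app x) =
            Ξ.unit x) ∧
    -- triviality
    (∀ (A B : Sheaf J AddCommGrpCat.{max u v}) (P : GSheaf J (toGrp A).obj)
      (Q : GSheaf J (toGrp B).obj), P.IsTorsor → Q.IsTorsor → P.IsTrivial ∨ Q.IsTrivial →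
      Nonempty (BandedEquiv (heisenbergGerbe P Q) (torsorStack (tensor A B)))) := by
  refine ⟨fun A B => ⟨fun _ _ _ _ _ _ _ => rfl, (heisenberg A B).injective, (heisenberg A B).exact,
      (heisenberg A B).surjective, (heisenberg A B).central⟩, heisMap_id,
    fun _ _ _ _ _ _ f f' g g' => heisMap_comp f f' g g', fun A A' B B' f g => ⟨?_, rfl⟩,
    fun A => ⟨fun P hP => ⟨_, (GSheaf.hasClass_iff hP _).2 rfl,
        fun γ => (GSheaf.hasClass_iff hP γ).1⟩, GSheaf.exists_hasClass,
      fun P P' γ γ' hP hP' => GSheaf.isomorphic_iff hP hP'⟩,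
    fun A B => isHeisenbergBoundary_iff,
    fun A B P Q hP hQ => ⟨(heisenberg A B).isGerbe_lifts (GSheaf.isTorsor_prod hP hQ),
      fun γ δ hγ hδ => hasClass_lifts_iff hP hQ hγ hδ
        ⟨GSheafHom.id _, inferInstanceAs (IsIso (𝟙 (P.prod Q).carrier.obj))⟩⟩,
    fun D _ K F _ hF X Y f => ⟨⟨f.gerbeHom hF⟩, fun U x y y' c c' => ?_⟩,
    fun X Φ U => Φ.existsUnique_iso_id U,
    fun D D' _ _ K K' F G _ _ _ hF hG X Y Z f g Φ Ψ Ξ U =>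
      GerbeHom.existsUnique_iso_comp hF hG Φ Ψ Ξ U,
    fun A B P Q hP hQ h => ?_⟩
  · ext U t
    exact Heis.ext (map_zero (f.hom.app U).hom) (map_zero (g.hom.app U).hom) rfl
  · have := hF U
    exact LiftMap.existsUnique c c'
  · exact h.elim (nonempty_bandedEquiv_of_trivial_left hP hQ)
      (nonempty_bandedEquiv_of_trivial_right hP hQ)
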